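/- **Setting.** Let $G=(A\cup B,E)$ be a finite bipartite graph with $n=|A|+|B|$ vertices and $m=|E|$ edges, $E\subseteq A\times B$, and let every edge $(a,b)\in E$ have a weight $c(a,b)\in\{0,1\}$. The *pieces* of $G$ are the connected components of the subgraph induced by the edges of weight $0$ (that is, the components of the weight-$0$ subgraph that contain an edge; edges of weight $1$ belong to no piece). **The algorithm.** It maintains a matching $M$ and integer dual weights $y$ on $A\cup B$. An edge $(a,b)\in E$ is directed from $a$ to $b$ and has slack $0$ if $(a,b)\in M$; otherwise it is directed from $b$ to $a$ and has slack $c(a,b)+y(a)-y(b)$. Edges of slack $0$ are *admissible*. Vertices not covered by $M$ are *free*. *Preprocessing.* $M$ is a union of maximum matchings of the pieces, and $y=0$. Then the following phases are repeated. *First stage.* Let $\ell_v\in[0,\infty]$ be the shortest-path distance, with the slacks as lengths, from the set of free vertices of $B$ to $v$, and let $\ell$ be the minimum of $\ell_a$ over the free vertices $a\in A$ ($\infty$ if there are none). If $\ell=\infty$, return $M$. Otherwise add $\ell-\ell_v$ to $y(v)$ for every $v$ with $\ell_v<\ell$. *Second stage.* From each vertex $b\in B$ that is free at the beginning of the stage,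 one after the other, run a depth-first search in the graph of the admissible edges that have not been deleted during this stage. The search keeps a simple path starting at $b$. It repeatedly takes an edge not yet visited by this search that leaves the last vertex of the path, marks it visited, and appends its head unless the head is on the path already; if there is no such edge, it removes the last vertex (and ends without success if the path consists of $b$ only). It ends with success as soon as a free vertex of $A$ is appended. After a search without success all edges it visited are deleted. After a success with path $P$, for each edge $(a,b')\in P\setminus M$ the dual weight $y(b')$ is decreased by $2c(a,b')$, then $M$ is replaced by $M\oplus P$, and all edges visited by the search are deleted except those that lie in a piece containing an edge of $P$. **Model.** Time is measured on a random access machine with logarithmic cost: every operation is charged the total bit length of the numbers involved. The input consists of $|A|,|B|,m$ and a list of the edges with their weights, in any order. **Theorem.** 1. Whatever choices are made, every matching returned by the above algorithm is a maximum cardinality matching of $G$. 2. There are a single random access machine program and a constant $k$ such that the following holds. On every input the program halts, and its output is a maximum cardinality matching of $G$ that is the result of an execution of the above algorithm. Moreover, for every constant $\kappa$ there is a constant $C$, depending only on $\kappa$, such that, whenever $m\ge 1$, $w$ is an upper bound on the weight of every matching of $G$, and $r\ge 0$ is a real number such that every piece has at most $\kappa r$ vertices and at most $\kappa\, mr/n$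 edges, its running time is at most $$C\cdot m\Bigl(\sqrt w+\sqrt r+\frac{wr}{n}\Bigr)(\log n)^k=\tilde{\mathcal O}\Bigl(m\bigl(\sqrt w+\sqrt r+\tfrac{wr}{n}\bigr)\Bigr).$$ (The numbers $w$, $r$, $\kappa$ are not given to the program.) -/

import Mathlib

/-! ## Bipartite graphs with `0/1` weights, matchings, pieces -/

/-- A finite bipartite graph with sides `A`, `B` whose edges have weight `0` or `1`. -/
structure WGraph (A B : Type) where
  /-- the edge set -/
  E : Finset (A × B)
  /-- the weights (only the values on `E` matter) -/
  c : A × B → ℕ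
  c_zero_or_one : ∀ e ∈ E, c e = 0 ∨ c e = 1

namespace WGraph

variable {A B : Type} (G : WGraph A B)

/-- A matching: a set of pairwise vertex-disjoint edges. -/
def IsMatching (M : Finset (A × B)) : Prop :=
  M ⊆ G.E ∧ ∀ e ∈ M, ∀ f ∈ M, (e.1 = f.1 ∨ e.2 = f.2) → e = f

/-- A matching of largest cardinality. -/
def IsMaximumMatching (M : Finset (A × B)) : Prop :=
  G.IsMatching M ∧ ∀ N, G.IsMatching N → N.card ≤ M.card

/-- The weight of a set of edges. -/
def weight (M : Finset (A × B)) : ℕ := ∑ e ∈ M, G.c e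

/-- The subgraph formed by the edges of weight `0`. -/
def zeroGraph : SimpleGraph (A ⊕ B) where
  Adj u v := ∃ e ∈ G.E, G.c e = 0 ∧
    ((u = Sum.inl e.1 ∧ v = Sum.inr e.2) ∨ (u = Sum.inr e.2 ∧ v = Sum.inl e.1))
  symm := ⟨by
    rintro u v ⟨e, he, h0, h | h⟩
    · exact ⟨e, he, h0, Or.inr ⟨h.2, h.1⟩⟩
    · exact ⟨e, he, h0, Or.inl ⟨h.2, h.1⟩⟩⟩
  loopless := ⟨by
    rintro u ⟨e, -, -, ⟨h1, h2⟩ | ⟨h1, h2⟩⟩ <;> simp [h1] at h2⟩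

open Classical in
/-- The edges (of weight `0`) of the connected component `K` of the weight-`0` subgraph.
The pieces are the components for which this set is non-empty: the subgraph induced by the edges
of weight `0` has no isolated vertices. -/
noncomputable def pieceEdges (K : G.zeroGraph.ConnectedComponent) : Finset (A × B) :=
  G.E.filter fun e => G.c e = 0 ∧ G.zeroGraph.connectedComponentMk (Sum.inl e.1) = K

/-! ## The residual network and slacks -/

/-- `a ∈ A` is free, i.e. not covered by `M`. -/
def FreeA (M : Finset (A × B)) (a : A) : Prop := ∀ e ∈ M, e.1 ≠ a

/-- `b ∈ B` is free, i.e. not covered by `M`. -/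
def FreeB (M : Finset (A × B)) (b : B) : Prop := ∀ e ∈ M, e.2 ≠ b

/-- `Arc M u e v`: in the residual network of `M` the edge `e` is directed from `u` to `v`.
Edges outside `M` go from `B` to `A`, edges of `M` go from `A` to `B`. -/
inductive Arc (M : Finset (A × B)) : A ⊕ B → A × B → A ⊕ B → Prop
  | unmatched (a : A) (b : B) : (a, b) ∈ G.E → (a, b) ∉ M → Arc M (Sum.inr b) (a, b) (Sum.inl a)
  | matched (a : A) (b : B) : (a, b) ∈ M → Arc M (Sum.inl a) (a, b) (Sum.inr b)

open Classical in
/-- The slack of an edge with respect to a matching `M` and dual weights `y`. -/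
noncomputable def slack (M : Finset (A × B)) (y : A ⊕ B → ℤ) (e : A × B) : ℤ :=
  if e ∈ M then 0 else (G.c e : ℤ) + y (Sum.inl e.1) - y (Sum.inr e.2)

/-! ## First stage: Hungarian search -/

/-- `SlackWalk M y v d`: in the augmented residual network (a source joined by arcs of length `0`
to all free vertices of `B`, every other arc having its slack as length) there is a walk of
length `d` from the source to `v`. -/
inductive SlackWalk (M : Finset (A × B)) (y : A ⊕ B → ℤ) : A ⊕ B → ℕ → Prop
  | source (b : B) : FreeB M b → SlackWalk M y (Sum.inr b) 0
  | step (u v : A ⊕ B) (e : A × B) (d k : ℕ) : SlackWalk M y u d → G.Arc M u e v →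
      G.slack M y e = (k : ℤ) → SlackWalk M y v (d + k)

/-- The distance `ℓ_v` from the source to `v`; it is `⊤` if `v` cannot be reached. -/
noncomputable def dist (M : Finset (A × B)) (y : A ⊕ B → ℤ) (v : A ⊕ B) : ℕ∞ :=
  ⨅ (d : ℕ) (_ : G.SlackWalk M y v d), (d : ℕ∞)

/-- `ℓ`, the least distance from the source to a free vertex of `A`; it is `⊤` if there is none. -/
noncomputable def minDist (M : Finset (A × B)) (y : A ⊕ B → ℤ) : ℕ∞ :=
  ⨅ (a : A) (_ : FreeA M a), G.dist M y (Sum.inl a)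

open Classical in
/-- The dual weights after the first stage: `y(v) + ℓ - ℓ_v` if `ℓ_v < ℓ`, otherwise `y(v)`. -/
noncomputable def updateDuals (M : Finset (A × B)) (y : A ⊕ B → ℤ) (v : A ⊕ B) : ℤ :=
  if G.dist M y v < G.minDist M y then
    y v + ((G.minDist M y).toNat : ℤ) - ((G.dist M y v).toNat : ℤ)
  else y v

/-! ## Second stage: depth-first searches in the admissible graph -/

/-- State of the second stage of a phase: the matching, the dual weights, and the set of edges that
have been deleted during this stage. -/
structure StageState (A B : Type) where
  M : Finset (A × B)
  y : A ⊕ B → ℤ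
  deleted : Finset (A × B)

/-- The arcs of the graph `G'` that is searched: the admissible arcs (arcs of the residual network
of slack `0`) whose edges have not been deleted. -/
def SearchArc (S : StageState A B) (u : A ⊕ B) (e : A × B) (v : A ⊕ B) : Prop :=
  G.Arc S.M u e v ∧ G.slack S.M S.y e = 0 ∧ e ∉ S.deleted

/-- `v` is a free vertex of `A`. -/
def IsFreeA (M : Finset (A × B)) (v : A ⊕ B) : Prop := ∃ a, v = Sum.inl a ∧ FreeA M a

/-- `DFS S b P vis`: the depth-first search started at `b` can reach a configuration in which the
current path is `P` (last vertex first) and `vis` is the set of visited edges. -/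
inductive DFS [DecidableEq A] [DecidableEq B] (S : StageState A B) (b : B) :
    List (A ⊕ B) → Finset (A × B) → Prop
  | start : DFS S b [Sum.inr b] ∅
  | onPath (u v : A ⊕ B) (e : A × B) (P : List (A ⊕ B)) (vis : Finset (A × B)) :
      DFS S b (u :: P) vis → G.SearchArc S u e v → e ∉ vis → v ∈ u :: P →
      DFS S b (u :: P) (insert e vis)
  | push (u v : A ⊕ B) (e : A × B) (P : List (A ⊕ B)) (vis : Finset (A × B)) :
      DFS S b (u :: P) vis → G.SearchArc S u e v → e ∉ vis → v ∉ u :: P → ¬ IsFreeA S.M v →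
      DFS S b (v :: u :: P) (insert e vis)
  | pop (u v : A ⊕ B) (P : List (A ⊕ B)) (vis : Finset (A × B)) :
      DFS S b (u :: v :: P) vis → (∀ e x, G.SearchArc S u e x → e ∈ vis) →
      DFS S b (v :: P) vis

/-- The search from `b` ends without an augmenting path, having visited the edges `vis`. -/
def DFSFails [DecidableEq A] [DecidableEq B] (S : StageState A B) (b : B)
    (vis : Finset (A × B)) : Prop :=
  G.DFS S b [Sum.inr b] vis ∧ ∀ e x, G.SearchArc S (Sum.inr b) e x → e ∈ vis

/-- The search from `b` ends with the augmenting path `P` (last vertex first), having visited the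
edges `vis`. -/
def DFSFinds [DecidableEq A] [DecidableEq B] (S : StageState A B) (b : B)
    (P : List (A ⊕ B)) (vis : Finset (A × B)) : Prop :=
  ∃ u v e Q vis', G.DFS S b (u :: Q) vis' ∧ G.SearchArc S u e v ∧ e ∉ vis' ∧ v ∉ u :: Q ∧
    IsFreeA S.M v ∧ P = v :: u :: Q ∧ vis = insert e vis'

/-- The edge joining two vertices of opposite sides, as a set. -/
def edgeBetween : A ⊕ B → A ⊕ B → Finset (A × B)
  | Sum.inl a, Sum.inr b => {(a, b)}
  | Sum.inr b, Sum.inl a => {(a, b)}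
  | _, _ => ∅

/-- The edges of a path given by its list of vertices. -/
def pathEdges [DecidableEq A] [DecidableEq B] : List (A ⊕ B) → Finset (A × B)
  | [] => ∅
  | [_] => ∅
  | u :: v :: P => edgeBetween u v ∪ pathEdges (v :: P)

/-- The edge `e` lies in a piece that is affected by `P`, i.e. a piece containing an edge of `P`. -/
def InAffectedPiece [DecidableEq A] [DecidableEq B] (P : List (A ⊕ B)) (e : A × B) : Prop :=
  ∃ K, e ∈ G.pieceEdges K ∧ ∃ f ∈ pathEdges P, f ∈ G.pieceEdges K

/-- The dual weights after augmenting along `P`: `y(b)` decreases by `2 c(a, b)` for each edge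
`(a, b)` of `P` outside `M` (each `b` has at most one such edge). -/
def augmentDuals [DecidableEq A] [DecidableEq B] (M : Finset (A × B)) (y : A ⊕ B → ℤ)
    (P : List (A ⊕ B)) : A ⊕ B → ℤ
  | Sum.inl a => y (Sum.inl a)
  | Sum.inr b => y (Sum.inr b) - 2 * ∑ e ∈ (pathEdges P \ M).filter (fun e => e.2 = b), (G.c e : ℤ)

open Classical in
/-- The effect of a search that found the augmenting path `P`: augment along `P` and delete every
visited edge that lies in no affected piece of `P`. -/
noncomputable def afterAugment [DecidableEq A] [DecidableEq B] (S : StageState A B)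
    (P : List (A ⊕ B)) (vis : Finset (A × B)) : StageState A B where
  M := symmDiff S.M (pathEdges P)
  y := G.augmentDuals S.M S.y P
  deleted := S.deleted ∪ vis.filter fun e => ¬ G.InAffectedPiece P e

/-- `SecondStage bs S S'`: performing one search from each vertex of the list `bs`, in this order,
can lead from `S` to `S'`. -/
inductive SecondStage [DecidableEq A] [DecidableEq B] :
    List B → StageState A B → StageState A B → Prop
  | done (S : StageState A B) : SecondStage [] S S
  | fails (b : B) (bs : List B) (S S' : StageState A B) (vis : Finset (A × B)) :
      G.DFSFails S b vis → SecondStage bs { S with deleted := S.deleted ∪ vis } S' →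
      SecondStage (b :: bs) S S'
  | finds (b : B) (bs : List B) (S S' : StageState A B) (P : List (A ⊕ B))
      (vis : Finset (A × B)) :
      G.DFSFinds S b P vis → SecondStage bs (G.afterAugment S P vis) S' →
      SecondStage (b :: bs) S S'

/-! ## The whole algorithm -/

/-- `Phases M y N`: the phases, started with matching `M` and dual weights `y`, can stop with `N`.
If no free vertex of `A` is reachable, stop; otherwise update the dual weights, search from all
vertices of `B` that are free (in some order), and continue. -/
inductive Phases [DecidableEq A] [DecidableEq B] :
    Finset (A × B) → (A ⊕ B → ℤ) → Finset (A × B) → Prop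
  | halt (M : Finset (A × B)) (y : A ⊕ B → ℤ) : G.minDist M y = ⊤ → Phases M y M
  | phase (M : Finset (A × B)) (y : A ⊕ B → ℤ) (bs : List B) (S' : StageState A B)
      (N : Finset (A × B)) :
      G.minDist M y ≠ ⊤ → bs.Nodup → (∀ b, b ∈ bs ↔ FreeB M b) →
      G.SecondStage bs ⟨M, G.updateDuals M y, ∅⟩ S' → Phases S'.M S'.y N → Phases M y N

/-- The matching after the preprocessing step: a union of maximum matchings of the pieces. -/
def IsPreprocessed [DecidableEq A] [DecidableEq B] (M : Finset (A × B)) : Prop :=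
  G.IsMatching M ∧ (∀ e ∈ M, G.c e = 0) ∧
    ∀ (K : G.zeroGraph.ConnectedComponent) (N : Finset (A × B)),
      G.IsMatching N → N ⊆ G.pieceEdges K → N.card ≤ (M ∩ G.pieceEdges K).card

/-- `M` is a possible result of the two-stage algorithm. -/
def TwoStageResult [DecidableEq A] [DecidableEq B] (M : Finset (A × B)) : Prop :=
  ∃ M₀, G.IsPreprocessed M₀ ∧ G.Phases M₀ (fun _ => 0) M

end WGraph

/-! ## Random access machines with logarithmic cost

Programs are structured programs over integer variables and finitely many integer arrays (those
named in the program text). Every operation is charged the bit lengths of all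
the numbers involved, so huge numbers are not free. -/

namespace RAM

/-- The binary operations. -/
inductive Op
  | add | sub | mul | div | eq | lt

/-- Value of a binary operation; a comparison yields `1` if it is true and `0` otherwise. -/
def Op.val : Op → ℤ → ℤ → ℤ
  | .add, x, y => x + y
  | .sub, x, y => x - y
  | .mul, x, y => x * y
  | .div, x, y => x / y
  | .eq, x, y => if x = y then 1 else 0
  | .lt, x, y => if x < y then 1 else 0

/-- Expressions: constants, variables, array cells, binary operations. -/
inductive Expr
  | const (z : ℤ)
  | var (x : ℕ)
  | read (a : ℕ) (i : Expr)
  | op (o : Op) (e f : Expr)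

/-- Programs. -/
inductive Cmd
  | skip
  | assign (x : ℕ) (e : Expr)
  | write (a : ℕ) (i e : Expr)
  | seq (p q : Cmd)
  | ite (e : Expr) (p q : Cmd)
  | while (e : Expr) (p : Cmd)

/-- Memory contents: the variables and the arrays. -/
structure State where
  var : ℕ → ℤ
  arr : ℕ → ℤ → ℤ

/-- Value of an expression. -/
def Expr.val (s : State) : Expr → ℤ
  | .const z => z
  | .var x => s.var x
  | .read a i => s.arr a (i.val s)
  | .op o e f => o.val (e.val s) (f.val s)

/-- The cost of handling the number `z`: one plus the length of its binary representation. -/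
def bits (z : ℤ) : ℕ := 1 + Nat.size z.natAbs

/-- Logarithmic cost of evaluating an expression: the sum of `bits` over the values of all its
subexpressions (in particular over all array indices). -/
def Expr.cost (s : State) : Expr → ℕ
  | .const z => bits z
  | .var x => bits (s.var x)
  | .read a i => i.cost s + bits (s.arr a (i.val s))
  | .op o e f => e.cost s + f.cost s + bits (o.val (e.val s) (f.val s))

/-- `Exec p s t s'`: the program `p` started in `s` halts in `s'`, at total cost `t`. -/
inductive Exec : Cmd → State → ℕ → State → Prop
  | skip (s : State) : Exec .skip s 1 s
  | assign (x : ℕ) (e : Expr) (s : State) :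
      Exec (.assign x e) s (1 + e.cost s) { s with var := Function.update s.var x (e.val s) }
  | write (a : ℕ) (i e : Expr) (s : State) :
      Exec (.write a i e) s (1 + i.cost s + e.cost s)
        { s with arr := Function.update s.arr a
                          (Function.update (s.arr a) (i.val s) (e.val s)) }
  | seq (p q : Cmd) (s s' s'' : State) (t t' : ℕ) :
      Exec p s t s' → Exec q s' t' s'' → Exec (.seq p q) s (t + t') s''
  | iteTrue (e : Expr) (p q : Cmd) (s s' : State) (t : ℕ) :
      e.val s ≠ 0 → Exec p s t s' → Exec (.ite e p q) s (1 + e.cost s + t) s'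
  | iteFalse (e : Expr) (p q : Cmd) (s s' : State) (t : ℕ) :
      e.val s = 0 → Exec q s t s' → Exec (.ite e p q) s (1 + e.cost s + t) s'
  | whileTrue (e : Expr) (p : Cmd) (s s' s'' : State) (t t' : ℕ) :
      e.val s ≠ 0 → Exec p s t s' → Exec (.while e p) s' t' s'' →
      Exec (.while e p) s (1 + e.cost s + t + t') s''
  | whileFalse (e : Expr) (p : Cmd) (s : State) :
      e.val s = 0 → Exec (.while e p) s (1 + e.cost s) s

/-- The input: the numbers of vertices `p` and `q` of the two sides and the number of edges are in
variables `0`, `1`, `2`; the ends and the weight of the `i`-th edge of the list are in cell `i` of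
the arrays `0`, `1`, `2`; everything else is `0`. -/
def inputState {p q : ℕ} (G : WGraph (Fin p) (Fin q)) (L : List (Fin p × Fin q)) : State where
  var x := if x = 0 then (p : ℤ) else if x = 1 then (q : ℤ) else if x = 2 then (L.length : ℤ) else 0
  arr a i :=
    if 0 ≤ i then
      match L[i.toNat]? with
      | none => 0
      | some e => if a = 0 then ((e.1 : ℕ) : ℤ) else if a = 1 then ((e.2 : ℕ) : ℤ)
          else if a = 2 then (G.c e : ℤ) else 0
    else 0

/-- The output: the set of those edges of the list that are marked by `1` in array `3`. -/
def outputEdges {p q : ℕ} (L : List (Fin p × Fin q)) (s : State) : Finset (Fin p × Fin q) :=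
  (Finset.univ.filter fun i : Fin L.length => s.arr 3 ((i : ℕ) : ℤ) = 1).image fun i => L[i]

end RAM

/-! Correctness is linear programming duality. `Feasible` says that every residual arc from u to v
of an edge e has slack c(e)+y(v)-y(u) ≥ 0, with equality on matched edges, that y vanishes at the
free vertices of A, and that y has one common value Y, which is also its maximum, at the free
vertices of B. The first stage preserves this with Y+ℓ in place of Y (`Feasible.updateDuals`), and
so does an augmentation (`FindsInv.feasible`). When no free vertex of A is reachable, the reachable
vertices of A and the unreachable vertices of B form a König cover, and the matching is maximum
(`isMaximum_of_minDist`).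

Phases are counted by weak duality: if k augmentations are missing, then kY ≤ 2w
(`Feasible.card_sub_mul_le`). A second stage leaves no admissible augmenting path, so from the
second phase on ℓ ≥ 1; hence Y grows while k shrinks, and since they cannot both exceed √(2w) there
are O(√w) phases (`phasePotential_lt`).

That the second stage leaves no admissible augmenting path is the delicate point, because most edges
visited by a successful search are deleted. Each visited edge lies on the path found, or on a closed
admissible walk through a vertex of the path, or leads to a vertex from which everything has been
searched in vain (field `back` of `DFSInv`). Along admissible arcs y drops by the weight, so a
closed admissible walk has weight 0 throughout; it lies in one piece, and the path contains an edge
of that piece (`FindsInv.affected`), so the edge is retained. A new matching edge of weight 1 on the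
path has its dual weight in B lowered by 2, so no admissible arc leaves that end. Together these
facts maintain a `Barrier`, a closed set without free vertices of A that absorbs all deleted
admissible arcs (`Barrier.finds`, `StageResult.one_le_minDist`).

Retained edges may be visited again. Along the path y falls from Y to 0, one unit per edge of weight
1, so the path meets at most Y+1 components (`card_components_le`). With Y ≤ 2w/k the total over all
augmentations is a harmonic sum (`revisitPotential_le`), that is O(w log n) pieces with O(mr/n)
edges each. There are at most w augmentations, since a matching exceeds the preprocessed one by no
more than its weight (`IsPreprocessed.card_le`).

On the machine, `Run` and `wp` count steps under a bound on all stored numbers, and `Run.exec` turns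
steps into bit cost. Distances are found with buckets; linearly many suffice because distance minus
dual weight grows by at most 2 per matched vertex of B (`Dial.bucket_le`). Edges live in linked
lists, and all linear bounds are potential arguments on the sizes of these lists. The preprocessing
runs the very same phases on each piece with all weights set to 1: then there are no pieces, the
weight of a matching is its cardinality, and the phase bound becomes O(√r) (`solvePieces_spec`). -/

namespace WGraph

variable {A B : Type} {G : WGraph A B}

/-! ## Feasible dual weights -/

/-- The invariants of the dual weights; `Y` is the common dual weight of the free vertices of `B`. -/
structure Feasible (G : WGraph A B) (M : Finset (A × B)) (y : A ⊕ B → ℤ) (Y : ℤ) : Prop where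
  matching : G.IsMatching M
  nonneg : ∀ e ∈ G.E, e ∉ M → 0 ≤ (G.c e : ℤ) + y (Sum.inl e.1) - y (Sum.inr e.2)
  tight : ∀ e ∈ M, y (Sum.inl e.1) - y (Sum.inr e.2) = G.c e
  left_nonneg : ∀ a, 0 ≤ y (Sum.inl a)
  left_le : ∀ a, y (Sum.inl a) ≤ Y
  left_free : ∀ a, FreeA M a → y (Sum.inl a) = 0
  right_le : ∀ b, y (Sum.inr b) ≤ Y
  right_free : ∀ b, FreeB M b → y (Sum.inr b) = Y

theorem Arc.inj {M : Finset (A × B)} {u v u' v' : A ⊕ B} {e : A × B}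
    (h : G.Arc M u e v) (h' : G.Arc M u' e v') : u = u' ∧ v = v' := by
  cases h <;> cases h' <;> simp_all

theorem Arc.mem {M : Finset (A × B)} (hM : M ⊆ G.E) {u v : A ⊕ B} {e : A × B}
    (h : G.Arc M u e v) : e ∈ G.E := by
  cases h with
  | unmatched a b h _ => exact h
  | matched a b h => exact hM h

theorem Arc.in_unique {M : Finset (A × B)} (hM : G.IsMatching M) {u v : A ⊕ B} {b : B}
    {e f : A × B} (h : G.Arc M u e (Sum.inr b)) (h' : G.Arc M v f (Sum.inr b)) : u = v ∧ e = f := by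
  cases h with | matched a _ h => ?_
  cases h' with | matched a' _ h' => ?_
  have := hM.2 _ h _ h' (Or.inr rfl)
  simp_all

theorem Arc.out_unique {M : Finset (A × B)} (hM : G.IsMatching M) {u v : A ⊕ B} {a : A}
    {e f : A × B} (h : G.Arc M (Sum.inl a) e u) (h' : G.Arc M (Sum.inl a) f v) : u = v ∧ e = f := by
  cases h with | matched _ b h => ?_
  cases h' with | matched _ b' h' => ?_
  have := hM.2 _ h _ h' (Or.inl rfl)
  simp_all

theorem Arc.not_freeB {M : Finset (A × B)} {u : A ⊕ B} {b : B} {e : A × B}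
    (h : G.Arc M u e (Sum.inr b)) : ¬ FreeB M b := by
  cases h with | matched a _ h => exact fun hf => hf _ h rfl

namespace Feasible

variable {M : Finset (A × B)} {y : A ⊕ B → ℤ} {Y : ℤ}

/-- Tightness of matched edges is what makes the formula independent of the direction of the arc;
slacks are reduced costs of the potential y, so they telescope along walks. -/
theorem slack_eq (hF : G.Feasible M y Y) {u v : A ⊕ B} {e : A × B} (h : G.Arc M u e v) :
    G.slack M y e = G.c e + y v - y u := by
  cases h with
  | unmatched a b h h' => simp [slack, h']
  | matched a b h => have := hF.tight _ h; simp only [slack, h, if_true] at *; linarith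

theorem slack_nonneg (hF : G.Feasible M y Y) {u v : A ⊕ B} {e : A × B} (h : G.Arc M u e v) :
    0 ≤ G.slack M y e := by
  cases h with
  | unmatched a b h h' => simpa [slack, h'] using hF.nonneg _ h h'
  | matched a b h => simp [slack, h]

/-- A matched vertex of B has the dual weight of its partner minus a weight 0 or 1. The bound is
needed to keep the numbers in the memory small. -/
theorem right_ge (hF : G.Feasible M y Y) (hY : 0 ≤ Y) (b : B) : -1 ≤ y (Sum.inr b) := by
  by_cases hb : FreeB M b
  · rw [hF.right_free b hb]; omega
  · simp only [FreeB, not_forall, not_not] at hb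
    obtain ⟨e, he, rfl⟩ := hb
    have h1 := hF.tight e he
    have h2 := hF.left_nonneg e.1
    have h3 := G.c_zero_or_one e (hF.matching.1 he)
    omega

end Feasible

theorem feasible_zero {M : Finset (A × B)} (hM : G.IsMatching M) (h0 : ∀ e ∈ M, G.c e = 0) :
    G.Feasible M (fun _ => 0) 0 where
  matching := hM
  nonneg := by intro e _ _; simp
  tight := by intro e he; simp [h0 e he]
  left_nonneg := by simp
  left_le := by simp
  left_free := by simp
  right_le := by simp
  right_free := by simp

/-! ## Distances -/

section Dist

variable {M : Finset (A × B)} {y : A ⊕ B → ℤ}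

theorem dist_le {v : A ⊕ B} {d : ℕ} (h : G.SlackWalk M y v d) : G.dist M y v ≤ d :=
  iInf₂_le d h

theorem le_dist {v : A ⊕ B} {x : ℕ∞} (h : ∀ d, G.SlackWalk M y v d → x ≤ d) :
    x ≤ G.dist M y v := le_iInf₂ h

theorem exists_dist_eq {v : A ⊕ B} (h : G.dist M y v ≠ ⊤) :
    ∃ d : ℕ, G.SlackWalk M y v d ∧ G.dist M y v = d := by
  classical
  have h1 : ∃ d, G.SlackWalk M y v d := by
    by_contra hc
    push Not at hc
    exact h (top_le_iff.1 (le_dist fun d hd => absurd hd (hc d)))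
  refine ⟨Nat.find h1, Nat.find_spec h1, le_antisymm (dist_le (Nat.find_spec h1)) ?_⟩
  exact le_dist fun d hd => by exact_mod_cast Nat.find_min' h1 hd

theorem minDist_le {a : A} (ha : FreeA M a) : G.minDist M y ≤ G.dist M y (Sum.inl a) :=
  iInf₂_le a ha

theorem le_minDist {x : ℕ∞} (h : ∀ a, FreeA M a → ∀ d, G.SlackWalk M y (Sum.inl a) d → x ≤ d) :
    x ≤ G.minDist M y := le_iInf₂ fun a ha => le_dist (h a ha)

theorem exists_minDist_eq (h : G.minDist M y ≠ ⊤) :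
    ∃ (d : ℕ) (a : A), FreeA M a ∧ G.SlackWalk M y (Sum.inl a) d ∧ G.minDist M y = d := by
  classical
  have h1 : ∃ d, ∃ a, FreeA M a ∧ G.SlackWalk M y (Sum.inl a) d := by
    by_contra hc
    push Not at hc
    exact h (top_le_iff.1 (le_minDist fun a ha d hd => absurd hd (hc d a ha)))
  obtain ⟨a, ha, hw⟩ := Nat.find_spec h1
  refine ⟨_, a, ha, hw, le_antisymm ((minDist_le ha).trans (dist_le hw)) ?_⟩
  exact le_minDist fun a' ha' d hd => by exact_mod_cast Nat.find_min' h1 ⟨a', ha', hd⟩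

theorem updateDuals_of_walk {L : ℕ} (hL : G.minDist M y = L) {v : A ⊕ B} {d : ℕ}
    (hd : G.SlackWalk M y v d) (hdL : d ≤ L) (hmin : ∀ k, G.SlackWalk M y v k → d ≤ k) :
    G.updateDuals M y v = y v + L - d := by
  have h : G.dist M y v = d := le_antisymm (dist_le hd) (le_dist fun k hk => by
    exact_mod_cast hmin k hk)
  unfold updateDuals
  rw [h, hL]
  -- At d = L both branches give the same value, so vertices at distance exactly L may be treated as
  -- reached.
  split_ifs with h1
  · simp
  · have : ¬ d < L := by exact_mod_cast h1
    have : d = L := by omega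
    subst this; simp

theorem updateDuals_of_le {L : ℕ} (hL : G.minDist M y = L) {v : A ⊕ B}
    (hmin : ∀ k, G.SlackWalk M y v k → L ≤ k) : G.updateDuals M y v = y v := by
  unfold updateDuals
  rw [if_neg, ]
  rw [hL, not_lt]
  exact le_dist fun k hk => by exact_mod_cast hmin k hk

/-- Distances from L on play no role: a vertex has an attained distance below L, or all its walks
are at least L long. Later arguments split along this line. -/
theorem updateDuals_cases {L : ℕ} (hL : G.minDist M y = L) (v : A ⊕ B) :
    (∃ d, G.SlackWalk M y v d ∧ d < L ∧ (∀ k, G.SlackWalk M y v k → d ≤ k) ∧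
      G.updateDuals M y v = y v + L - d) ∨
    ((∀ k, G.SlackWalk M y v k → L ≤ k) ∧ G.updateDuals M y v = y v) := by
  by_cases h : G.dist M y v < L
  · obtain ⟨d, hd, he⟩ := exists_dist_eq (ne_top_of_lt h)
    have hdL : d < L := by rw [he] at h; exact_mod_cast h
    have hm : ∀ k, G.SlackWalk M y v k → d ≤ k := fun k hk => by
      have := dist_le hk; rw [he] at this; exact_mod_cast this
    exact Or.inl ⟨d, hd, hdL, hm, updateDuals_of_walk hL hd hdL.le hm⟩
  · have hm : ∀ k, G.SlackWalk M y v k → L ≤ k := fun k hk => by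
      exact_mod_cast (not_lt.1 h).trans (dist_le hk)
    exact Or.inr ⟨hm, updateDuals_of_le hL hm⟩

theorem le_updateDuals {L : ℕ} (hL : G.minDist M y = L) (v : A ⊕ B) :
    y v ≤ G.updateDuals M y v := by
  rcases updateDuals_cases hL v with ⟨d, -, h, -, h'⟩ | ⟨-, h⟩ <;> omega

theorem updateDuals_le {L : ℕ} (hL : G.minDist M y = L) (v : A ⊕ B) :
    G.updateDuals M y v ≤ y v + L := by
  rcases updateDuals_cases hL v with ⟨d, -, h, -, h'⟩ | ⟨-, h⟩ <;> omega

theorem updateDuals_walk {L : ℕ} (hL : G.minDist M y = L) {v : A ⊕ B} {d : ℕ}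
    (hd : G.SlackWalk M y v d) : y v + L - d ≤ G.updateDuals M y v := by
  rcases updateDuals_cases hL v with ⟨d', -, h, hm, h'⟩ | ⟨hm, h⟩
  · have := hm d hd; omega
  · have := hm d hd; omega

variable {Y : ℤ}

/-- This is the triangle inequality: an optimal walk to u extends to v by the slack of the arc. If u
is not raised, it suffices that v does not fall. -/
theorem updateDuals_arc (hF : G.Feasible M y Y) {L : ℕ} (hL : G.minDist M y = L) {u v : A ⊕ B}
    {e : A × B} (h : G.Arc M u e v) :
    0 ≤ G.c e + G.updateDuals M y v - G.updateDuals M y u := by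
  have h1 := hF.slack_nonneg h
  have h2 := hF.slack_eq h
  obtain ⟨k, hk⟩ := Int.eq_ofNat_of_zero_le h1
  rcases updateDuals_cases hL u with ⟨d', hw, _, -, h'⟩ | ⟨-, h'⟩
  · have := updateDuals_walk hL (SlackWalk.step u v e d' k hw h hk)
    push_cast at this
    omega
  · have := le_updateDuals hL v
    omega

/-- A matched vertex of B is entered only from its partner, by an arc of slack 0. Hence both ends
have the same distance and move together. -/
theorem updateDuals_matched (hF : G.Feasible M y Y) {L : ℕ} (hL : G.minDist M y = L) {e : A × B}
    (he : e ∈ M) :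
    G.updateDuals M y (Sum.inl e.1) - G.updateDuals M y (Sum.inr e.2) = G.c e := by
  have harc : G.Arc M (Sum.inl e.1) e (Sum.inr e.2) := .matched e.1 e.2 he
  have h1 := updateDuals_arc hF hL harc
  have h2 := hF.tight e he
  rcases updateDuals_cases hL (Sum.inr e.2) with ⟨d, hw, _, -, h'⟩ | ⟨-, h'⟩
  · cases hw with
    | source b hb => exact absurd rfl (hb e he)
    | step u _ f d k hw hf hs =>
      obtain ⟨rfl, rfl⟩ := Arc.in_unique hF.matching harc hf
      have h3 := updateDuals_walk hL hw
      push_cast at h'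
      omega
  · have := le_updateDuals hL (Sum.inl e.1)
    omega

/-- Free vertices of B have distance 0 and rise by L; free vertices of A have distance at least L
and stay at 0; nothing rises by more than L. -/
theorem Feasible.updateDuals (hF : G.Feasible M y Y) {L : ℕ} (hL : G.minDist M y = L) :
    G.Feasible M (G.updateDuals M y) (Y + L) where
  matching := hF.matching
  nonneg := fun e he heM => updateDuals_arc hF hL (.unmatched e.1 e.2 he heM)
  tight := fun e he => updateDuals_matched hF hL he
  left_nonneg := fun a => (hF.left_nonneg a).trans (le_updateDuals hL _)
  left_le := fun a => (updateDuals_le hL _).trans (by have := hF.left_le a; omega)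
  left_free := fun a ha => by
    rw [updateDuals_of_le hL, hF.left_free a ha]
    intro k hk
    have := (minDist_le (y := y) ha).trans (dist_le hk)
    rw [hL] at this; exact_mod_cast this
  right_le := fun b => (updateDuals_le hL _).trans (by have := hF.right_le b; omega)
  right_free := fun b hb => by
    refine le_antisymm ((updateDuals_le hL _).trans (by have := hF.right_le b; omega)) ?_
    have := updateDuals_walk hL (SlackWalk.source (G := G) (y := y) b hb)
    rw [hF.right_free b hb] at this
    simpa using this

/-- Reduced costs telescope, so the new length of a walk to v is the old one, plus the change of
y(v), minus the change L at the source. For a walk attaining the minimum this is 0. -/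
theorem updateDuals_minDist (hF : G.Feasible M y Y) {L : ℕ} (hL : G.minDist M y = L) :
    G.minDist M (G.updateDuals M y) = 0 := by
  have hF' := hF.updateDuals hL
  have key : ∀ v d, G.SlackWalk M y v d →
      ∃ d' : ℕ, G.SlackWalk M (G.updateDuals M y) v d' ∧
        (d' : ℤ) = d + (G.updateDuals M y v - y v) - L := by
    intro v d h
    induction h with
    | source b hb =>
      refine ⟨0, .source b hb, ?_⟩
      rw [hF.right_free b hb, hF'.right_free b hb]; simp
    | step u v e d k hw ha hs ih =>
      obtain ⟨d', hd', he⟩ := ih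
      obtain ⟨k', hk'⟩ := Int.eq_ofNat_of_zero_le (hF'.slack_nonneg ha)
      refine ⟨_, .step u v e d' k' hd' ha hk', ?_⟩
      have h1 := hF.slack_eq ha
      have h2 := hF'.slack_eq ha
      push_cast
      omega
  obtain ⟨d, a, ha, hw, hd⟩ := exists_minDist_eq (G := G) (M := M) (y := y) (by rw [hL]; simp)
  obtain ⟨d', hd', he⟩ := key _ _ hw
  rw [hF.left_free a ha, hF'.left_free a ha] at he
  have hdL : d = L := by rw [hL] at hd; exact_mod_cast hd.symm
  have : d' = 0 := by omega
  subst this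
  exact le_antisymm ((minDist_le ha).trans (dist_le hd')) (by simp)

/-- König: the algorithm stops only at maximum matchings. -/
theorem isMaximum_of_minDist (hF : G.Feasible M y Y) (h : G.minDist M y = ⊤) :
    G.IsMaximumMatching M := by
  classical
  refine ⟨hF.matching, fun N hN => ?_⟩
  -- Reachable vertices of A and unreachable vertices of B cover all edges of N. All of them are
  -- covered by M, and an edge of M has only one end among them, so N injects into M.
  let R : A ⊕ B → Prop := fun v => ∃ d, G.SlackWalk M y v d
  have hstep : ∀ u e v, R u → G.Arc M u e v → R v := by
    rintro u e v ⟨d, hd⟩ ha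
    obtain ⟨k, hk⟩ := Int.eq_ofNat_of_zero_le (hF.slack_nonneg ha)
    exact ⟨_, .step u v e d k hd ha hk⟩
  have hnf : ∀ a, R (Sum.inl a) → ∃ e ∈ M, e.1 = a := by
    rintro a ⟨d, hd⟩
    by_contra hc
    push Not at hc
    have := (minDist_le (y := y) (G := G) hc).trans (dist_le hd)
    rw [h] at this
    simp at this
  have hcov : ∀ f ∈ N, ∃ e ∈ M, (R (Sum.inl f.1) ∧ e.1 = f.1) ∨ (¬ R (Sum.inl f.1) ∧ e.2 = f.2) := by
    intro f hf
    by_cases h1 : R (Sum.inl f.1)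
    · obtain ⟨e, he, h2⟩ := hnf _ h1
      exact ⟨e, he, Or.inl ⟨h1, h2⟩⟩
    · by_cases hfM : f ∈ M
      · exact ⟨f, hfM, Or.inr ⟨h1, rfl⟩⟩
      have h2 : ¬ R (Sum.inr f.2) := fun h2 =>
        h1 (hstep _ _ _ h2 (.unmatched f.1 f.2 (hN.1 hf) hfM))
      by_contra hc
      push Not at hc
      exact h2 ⟨0, .source _ fun e he h3 => (hc e he).2 h1 h3⟩
  choose! g hg hg' using hcov
  refine Finset.card_le_card_of_injOn g hg ?_
  have hmat : ∀ e ∈ M, ¬ R (Sum.inl e.1) → ¬ R (Sum.inr e.2) := by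
    rintro e he hc ⟨d, hd⟩
    cases hd with
    | source b hb => exact hb e he rfl
    | step u _ f d k hw hf hs =>
      obtain ⟨rfl, rfl⟩ := Arc.in_unique hF.matching hf (.matched e.1 e.2 he)
      exact hc ⟨_, hw⟩
  have hN1 : ∀ f ∈ N, ¬ R (Sum.inl f.1) → ¬ R (Sum.inr f.2) := by
    intro f hf h1
    by_cases hfM : f ∈ M
    · exact hmat f hfM h1
    · exact fun h2 => h1 (hstep _ _ _ h2 (.unmatched f.1 f.2 (hN.1 hf) hfM))
  intro f hf f' hf' hff
  -- An edge of M chosen for the end in A of `f` and for the end in B of `f'` would lead from a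
  -- reachable vertex to an unreachable one.
  have key : ∀ f ∈ N, ∀ f' ∈ N, g f = g f' → R (Sum.inl f.1) → R (Sum.inl f'.1) := by
    intro f hf f' hf' h0 h1
    by_contra h2
    have e1 : (g f).1 = f.1 := by
      rcases hg' f hf with h | h
      · exact h.2
      · exact absurd h1 h.1
    have e2 : (g f').2 = f'.2 := by
      rcases hg' f' hf' with h | h
      · exact absurd h.1 h2
      · exact h.2
    have h3 := hN1 f' hf' h2
    rw [← e2, ← h0] at h3
    rw [← e1] at h1
    exact h3 (hstep _ _ _ h1 (.matched _ _ (hg f hf)))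
  rcases hg' f hf with ⟨h1, h2⟩ | ⟨h1, h2⟩
  · rcases hg' f' hf' with ⟨h3, h4⟩ | ⟨h3, h4⟩
    · exact hN.2 _ hf _ hf' (Or.inl (by rw [← h2, ← h4, hff]))
    · exact absurd (key f hf f' hf' hff h1) h3
  · rcases hg' f' hf' with ⟨h3, h4⟩ | ⟨h3, h4⟩
    · exact absurd (key f' hf' f hf hff.symm h3) h1
    · exact hN.2 _ hf _ hf' (Or.inr (by rw [← h2, ← h4, hff]))

/-- Weak duality: the dual weight of the free vertices bounds the number of augmentations left. -/
theorem Feasible.card_sub_mul_le [DecidableEq A] [DecidableEq B] (hF : G.Feasible M y Y)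
    {N : Finset (A × B)} (hN : G.IsMatching N) :
    ((N.card : ℤ) - M.card) * Y ≤ G.weight M + G.weight N := by
  have inj1 : ∀ N, G.IsMatching N → Set.InjOn Prod.fst (N : Set (A × B)) :=
    fun N hN e he f hf h => hN.2 _ he _ hf (Or.inl h)
  have inj2 : ∀ N, G.IsMatching N → Set.InjOn Prod.snd (N : Set (A × B)) :=
    fun N hN e he f hf h => hN.2 _ he _ hf (Or.inr h)
  have hA : ∀ N, G.IsMatching N → ∑ e ∈ N, y (Sum.inl e.1) = ∑ a ∈ N.image Prod.fst, y (Sum.inl a) :=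
    fun N hN => (Finset.sum_image (f := fun a => y (Sum.inl a)) (inj1 N hN)).symm
  have hB : ∀ N, G.IsMatching N →
      ∑ e ∈ N, (Y - y (Sum.inr e.2)) = ∑ b ∈ N.image Prod.snd, (Y - y (Sum.inr b)) :=
    fun N hN => (Finset.sum_image (f := fun b => Y - y (Sum.inr b)) (inj2 N hN)).symm
  -- Enlarging the sum to all vertices covered by N or M adds nonnegative terms; those not covered
  -- by M are free and contribute 0.
  have h1 : ∑ e ∈ N, y (Sum.inl e.1) ≤ ∑ e ∈ M, y (Sum.inl e.1) := by
    rw [hA N hN, hA M hF.matching]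
    calc ∑ a ∈ N.image Prod.fst, y (Sum.inl a)
        ≤ ∑ a ∈ N.image Prod.fst ∪ M.image Prod.fst, y (Sum.inl a) :=
          Finset.sum_le_sum_of_subset_of_nonneg Finset.subset_union_left
            fun a _ _ => hF.left_nonneg a
      _ = ∑ a ∈ M.image Prod.fst, y (Sum.inl a) := by
          symm
          refine Finset.sum_subset Finset.subset_union_right fun a _ ha => hF.left_free a ?_
          intro e he h
          exact ha (Finset.mem_image.2 ⟨e, he, h⟩)
  -- The same argument on the other side, where Y - y(b) is nonnegative and vanishes at free
  -- vertices.
  have h2 : ∑ e ∈ N, (Y - y (Sum.inr e.2)) ≤ ∑ e ∈ M, (Y - y (Sum.inr e.2)) := by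
    rw [hB N hN, hB M hF.matching]
    calc ∑ b ∈ N.image Prod.snd, (Y - y (Sum.inr b))
        ≤ ∑ b ∈ N.image Prod.snd ∪ M.image Prod.snd, (Y - y (Sum.inr b)) :=
          Finset.sum_le_sum_of_subset_of_nonneg Finset.subset_union_left
            fun b _ _ => by have := hF.right_le b; omega
      _ = ∑ b ∈ M.image Prod.snd, (Y - y (Sum.inr b)) := by
          symm
          refine Finset.sum_subset Finset.subset_union_right fun b _ hb => ?_
          rw [hF.right_free b, sub_self]
          intro e he h
          exact hb (Finset.mem_image.2 ⟨e, he, h⟩)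
  have h3 : ∑ e ∈ M, (y (Sum.inl e.1) - y (Sum.inr e.2)) = ∑ e ∈ M, (G.c e : ℤ) :=
    Finset.sum_congr rfl fun e he => hF.tight e he
  have h4 : 0 ≤ ∑ e ∈ N, ((G.c e : ℤ) + y (Sum.inl e.1) - y (Sum.inr e.2)) := by
    refine Finset.sum_nonneg fun e he => ?_
    by_cases heM : e ∈ M
    · have := hF.tight e heM; omega
    · exact hF.nonneg e (hN.1 he) heM
  simp only [Finset.sum_sub_distrib, Finset.sum_add_distrib, Finset.sum_const, nsmul_eq_mul]
    at h1 h2 h3 h4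
  simp only [weight]
  push_cast
  linarith

end Dist

end WGraph

namespace WGraph

set_option linter.unusedSectionVars false

variable {A B : Type} [DecidableEq A] [DecidableEq B] {G : WGraph A B}

/-! ## Augmenting along a path -/

theorem Arc.edgeBetween_eq {M : Finset (A × B)} {u v : A ⊕ B} {e : A × B} (h : G.Arc M u e v) :
    edgeBetween v u = {e} := by
  cases h <;> rfl

theorem mem_of_mem_edgeBetween {u v : A ⊕ B} {e : A × B} (h : e ∈ edgeBetween u v) :
    (Sum.inl e.1 = u ∨ Sum.inl e.1 = v) ∧ (Sum.inr e.2 = u ∨ Sum.inr e.2 = v) := by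
  rcases u with a | b <;> rcases v with a' | b' <;> simp_all [edgeBetween]

theorem mem_of_mem_pathEdges {P : List (A ⊕ B)} {e : A × B} (h : e ∈ pathEdges P) :
    Sum.inl e.1 ∈ P ∧ Sum.inr e.2 ∈ P := by
  induction P with
  | nil => simp [pathEdges] at h
  | cons u P ih =>
    cases P with
    | nil => simp [pathEdges] at h
    | cons v P =>
      rw [pathEdges, Finset.mem_union] at h
      rcases h with h | h
      · obtain ⟨h1, h2⟩ := mem_of_mem_edgeBetween h
        constructor
        · rcases h1 with h1 | h1 <;> simp [h1]
        · rcases h2 with h1 | h1 <;> simp [h1]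
      · exact ⟨List.mem_cons_of_mem _ (ih h).1, List.mem_cons_of_mem _ (ih h).2⟩

/-- The path is shortened at its end in A: exchanging its last matched edge for its last edge keeps
the cardinality, covers `a`, frees the previous vertex of A, and leaves an augmenting path to that
vertex. Two vertices vanish at a time, so the induction runs over a bound for the length. -/
theorem augment_aux (b : B) : ∀ (n : ℕ) (M : Finset (A × B)) (P : List (A ⊕ B)) (a : A),
    P.length ≤ n → G.IsMatching M → (Sum.inl a :: P).Nodup →
    (Sum.inl a :: P).IsChain (fun v u => ∃ e, G.Arc M u e v) →
    (Sum.inl a :: P).getLast? = some (Sum.inr b) → FreeB M b → FreeA M a →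
    let M' := symmDiff M (pathEdges (Sum.inl a :: P))
    G.IsMatching M' ∧ M'.card = M.card + 1 ∧ (∀ x, FreeA M' x ↔ FreeA M x ∧ x ≠ a) ∧
      (∀ x, FreeB M' x ↔ FreeB M x ∧ x ≠ b) := by
  intro n
  induction n with
  | zero =>
    intro M P a hl _ _ _ hlast
    have : P = [] := List.length_eq_zero_iff.1 (by omega)
    subst this; simp at hlast
  | succ n ih =>
    intro M P a hl hM hnd hch hlast hb ha
    rcases P with _ | ⟨u, P⟩
    · simp at hlast
    rw [List.isChain_cons_cons] at hch
    obtain ⟨⟨e, he⟩, hch⟩ := hch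
    cases he with | unmatched _ b1 heE heM => ?_
    rcases P with _ | ⟨u2, Q⟩
    · simp only [List.getLast?_cons_cons, List.getLast?_singleton, Option.some.injEq,
        Sum.inr.injEq] at hlast
      subst hlast
      have hpe : pathEdges [Sum.inl a, Sum.inr b1] = {(a, b1)} := by
        simp [pathEdges, edgeBetween]
      have hM' : symmDiff M (pathEdges [Sum.inl a, Sum.inr b1]) = insert (a, b1) M := by
        rw [hpe]; ext f; simp only [Finset.mem_symmDiff, Finset.mem_singleton, Finset.mem_insert]
        constructor
        · rintro (h | h) <;> tauto
        · rintro (h | h)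
          · subst h; exact Or.inr ⟨rfl, heM⟩
          · exact Or.inl ⟨h, by rintro rfl; exact heM h⟩
      simp only [hM']
      refine ⟨⟨?_, ?_⟩, ?_, ?_, ?_⟩
      · exact Finset.insert_subset heE hM.1
      · intro f hf g hg hfg
        rcases Finset.mem_insert.1 hf with rfl | hf <;> rcases Finset.mem_insert.1 hg with rfl | hg
        · rfl
        · rcases hfg with h | h
          · exact absurd h.symm (ha _ hg)
          · exact absurd h.symm (hb _ hg)
        · rcases hfg with h | h
          · exact absurd h (ha _ hf)
          · exact absurd h (hb _ hf)
        · exact hM.2 _ hf _ hg hfg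
      · exact Finset.card_insert_of_notMem heM
      · intro x; simp only [FreeA, Finset.forall_mem_insert]; tauto
      · intro x; simp only [FreeB, Finset.forall_mem_insert]; tauto
    · rw [List.isChain_cons_cons] at hch
      obtain ⟨⟨e2, he2⟩, hch⟩ := hch
      cases he2 with | matched a2 _ he2 => ?_
      simp only [List.nodup_cons, List.mem_cons, not_or] at hnd
      obtain ⟨⟨-, h_a2, haQ⟩, ⟨-, hbQ⟩, ha2Q, hQ⟩ := hnd
      have haa : a ≠ a2 := fun h => h_a2 (by rw [h])
      let M1 := insert (a, b1) (M.erase (a2, b1))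
      have hbM : ∀ f ∈ M, f.2 = b1 → f = (a2, b1) := fun f hf h => hM.2 _ hf _ he2 (Or.inr h)
      have hbM' : ∀ f ∈ M, f.1 = a2 → f = (a2, b1) := fun f hf h => hM.2 _ hf _ he2 (Or.inl h)
      have hmem : ∀ f : A × B, f.1 ≠ a → f.2 ≠ b1 → (f ∈ M1 ↔ f ∈ M) := by
        intro f h1 h2
        simp only [M1, Finset.mem_insert, Finset.mem_erase]
        constructor
        · rintro (rfl | h)
          · exact absurd rfl h1
          · exact h.2
        · intro h; exact Or.inr ⟨by rintro rfl; exact h2 rfl, h⟩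
      have hM1 : G.IsMatching M1 := by
        refine ⟨Finset.insert_subset heE ((Finset.erase_subset _ _).trans hM.1), ?_⟩
        intro f hf g hg hfg
        rcases Finset.mem_insert.1 hf with rfl | hf <;> rcases Finset.mem_insert.1 hg with rfl | hg
        · rfl
        · obtain ⟨g1, g2⟩ := Finset.mem_erase.1 hg
          rcases hfg with h | h
          · exact absurd h.symm (ha _ g2)
          · exact absurd (hbM _ g2 h.symm) g1
        · obtain ⟨g1, g2⟩ := Finset.mem_erase.1 hf
          rcases hfg with h | h
          · exact absurd h (ha _ g2)
          · exact absurd (hbM _ g2 h) g1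
        · exact hM.2 _ (Finset.mem_of_mem_erase hf) _ (Finset.mem_of_mem_erase hg) hfg
      have hcard : M1.card = M.card := by
        rw [Finset.card_insert_of_notMem (by simp [heM]), Finset.card_erase_add_one he2]
      have hfa : ∀ x, FreeA M1 x ↔ (FreeA M x ∨ x = a2) ∧ x ≠ a := by
        intro x
        simp only [FreeA, M1, Finset.forall_mem_insert, Finset.mem_erase]
        constructor
        · rintro ⟨h1, h2⟩
          refine ⟨?_, fun h => h1 h.symm⟩
          by_cases hx : x = a2
          · exact Or.inr hx
          · exact Or.inl fun f hf h => h2 f ⟨by rintro rfl; exact hx h.symm, hf⟩ h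
        · rintro ⟨h1, h2⟩
          refine ⟨fun h => h2 h.symm, fun f hf => ?_⟩
          rcases h1 with h1 | rfl
          · exact h1 f hf.2
          · exact fun h => hf.1 (hbM' f hf.2 h)
      have hfb : ∀ x, FreeB M1 x ↔ FreeB M x := by
        intro x
        simp only [FreeB, M1, Finset.forall_mem_insert, Finset.mem_erase]
        constructor
        · rintro ⟨h1, h2⟩ f hf h
          exact h2 f ⟨by rintro rfl; exact h1 h, hf⟩ h
        · intro h1
          exact ⟨fun h => h1 _ he2 h, fun f hf => h1 f hf.2⟩
      have hbb : b ≠ b1 := by rintro rfl; exact hb _ he2 rfl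
      -- The exchange concerns only edges at `a` or `b1`, and neither vertex occurs on the remaining
      -- path.
      have hch1 : (Sum.inl a2 :: Q).IsChain (fun v u => ∃ e, G.Arc M1 u e v) := by
        refine hch.imp_of_mem_imp ?_
        rintro v u hv hu ⟨f, hf⟩
        have ham : Sum.inl a ∉ (Sum.inl a2 :: Q : List (A ⊕ B)) := by
          simp only [List.mem_cons, not_or]; exact ⟨h_a2, haQ⟩
        have hbm : Sum.inr b1 ∉ (Sum.inl a2 :: Q : List (A ⊕ B)) := by
          simp only [List.mem_cons, not_or]; exact ⟨by simp, hbQ⟩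
        cases hf with
        | unmatched a' b' h1 h2 =>
          refine ⟨_, .unmatched a' b' h1 ?_⟩
          rwa [hmem _ (by rintro rfl; exact ham hv) (by rintro rfl; exact hbm hu)]
        | matched a' b' h1 =>
          refine ⟨_, .matched a' b' ?_⟩
          rwa [hmem _ (by rintro rfl; exact ham hu) (by rintro rfl; exact hbm hv)]
      have := ih M1 Q a2 (by simp only [List.length_cons] at hl; omega) hM1
        (List.nodup_cons.2 ⟨ha2Q, hQ⟩) hch1
        (by simpa [List.getLast?_cons_cons] using hlast) ((hfb b).2 hb)
        ((hfa a2).2 ⟨Or.inr rfl, Ne.symm haa⟩)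
      have heq : symmDiff M (pathEdges (Sum.inl a :: Sum.inr b1 :: Sum.inl a2 :: Q)) =
          symmDiff M1 (pathEdges (Sum.inl a2 :: Q)) := by
        have n1 : (a, b1) ∉ pathEdges (Sum.inl a2 :: Q) := fun h => by
          have := (mem_of_mem_pathEdges h).2
          simp [hbQ] at this
        have n2 : (a2, b1) ∉ pathEdges (Sum.inl a2 :: Q) := fun h => by
          have := (mem_of_mem_pathEdges h).2
          simp [hbQ] at this
        rw [pathEdges, pathEdges]
        ext f
        simp only [edgeBetween, Finset.mem_symmDiff, Finset.mem_union, Finset.mem_singleton, M1,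
          Finset.mem_insert, Finset.mem_erase]
        by_cases f1 : f = (a, b1)
        · subst f1; simp [heM, n1]
        · by_cases f2 : f = (a2, b1)
          · subst f2; simp [he2, n2, f1]
          · simp [f1, f2]
      simp only [heq]
      obtain ⟨r1, r2, r3, r4⟩ := this
      refine ⟨r1, by rw [r2, hcard], fun x => ?_, fun x => ?_⟩
      · rw [r3, hfa]
        have : FreeA M x → x ≠ a2 := fun h h' => h _ he2 h'.symm
        tauto
      · rw [r4, hfb]

/-! ## Invariants of a depth-first search -/

/-- One step in the searched graph. -/
def Step (G : WGraph A B) (S : StageState A B) (u v : A ⊕ B) : Prop := ∃ e, G.SearchArc S u e v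

/-- Reachability in the searched graph. -/
abbrev Reach (G : WGraph A B) (S : StageState A B) : A ⊕ B → A ⊕ B → Prop :=
  Relation.ReflTransGen (G.Step S)

/-- All arcs leaving `v` have been visited. -/
def Done (G : WGraph A B) (S : StageState A B) (vis : Finset (A × B)) (v : A ⊕ B) : Prop :=
  ∀ e x, G.SearchArc S v e x → e ∈ vis

/-- Everything that can be reached from `z` has been searched in vain. -/
def Dead (G : WGraph A B) (S : StageState A B) (vis : Finset (A × B)) (z : A ⊕ B) : Prop :=
  ∀ z', G.Reach S z z' → G.Done S vis z' ∧ ¬ IsFreeA S.M z'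

theorem Done.mono {S : StageState A B} {vis vis' : Finset (A × B)} {v : A ⊕ B} (h : vis ⊆ vis')
    (hv : G.Done S vis v) : G.Done S vis' v := fun e x he => h (hv e x he)

theorem Dead.mono {S : StageState A B} {vis vis' : Finset (A × B)} {v : A ⊕ B} (h : vis ⊆ vis')
    (hv : G.Dead S vis v) : G.Dead S vis' v := fun z hz => ⟨(hv z hz).1.mono h, (hv z hz).2⟩

/-- Paths are listed with the last vertex first, so every entry reaches the head of the list. -/
theorem chain_reach {S : StageState A B} {vis : Finset (A × B)} {P : List (A ⊕ B)} {v : A ⊕ B}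
    (h : (v :: P).IsChain (fun v u => ∃ e ∈ vis, G.SearchArc S u e v)) :
    ∀ x ∈ v :: P, G.Reach S x v := by
  induction P generalizing v with
  | nil => intro x hx; simp only [List.mem_singleton] at hx; subst hx; exact .refl
  | cons u P ih =>
    rw [List.isChain_cons_cons] at h
    intro x hx
    rcases List.mem_cons.1 hx with rfl | hx
    · exact .refl
    · obtain ⟨e, -, he⟩ := h.1
      exact (ih h.2 x hx).tail ⟨e, he⟩

/-- Invariants of a search from `b` whose current path is `P` and that has visited `vis`. -/
structure DFSInv (G : WGraph A B) (S : StageState A B) (b : B) (P : List (A ⊕ B))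
    (vis : Finset (A × B)) : Prop where
  last : P.getLast? = some (Sum.inr b)
  nodup : P.Nodup
  chain : P.IsChain (fun v u => ∃ e ∈ vis, G.SearchArc S u e v)
  not_free : ∀ x ∈ P, ¬ IsFreeA S.M x
  reach : ∀ x ∈ P, G.Reach S (Sum.inr b) x
  arc : ∀ e ∈ vis, ∃ u v, G.SearchArc S u e v ∧ G.Reach S (Sum.inr b) u
  head : ∀ e ∈ vis, ∀ u v, G.SearchArc S u e v → v ∈ P ∨ (G.Done S vis v ∧ ¬ IsFreeA S.M v)
  -- The trichotomy on which the deletion rule rests: a visited edge is on the path, lies on a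
  -- closed walk through a path vertex, or has a head from which nothing is left to be searched.
  back : ∀ e ∈ vis, ∀ u v, G.SearchArc S u e v → e ∈ pathEdges P ∨
    (∃ x ∈ P, G.Reach S v x ∧ G.Reach S x u) ∨ G.Dead S vis v

/-- Follow arcs from v: each vertex met is finished, so its arcs are visited and their heads are on
the path or finished; the former is excluded by assumption. -/
theorem dead_of_not_reach {S : StageState A B} {vis : Finset (A × B)} {v : A ⊕ B}
    {P : List (A ⊕ B)}
    (hh : ∀ e ∈ vis, ∀ u v, G.SearchArc S u e v → v ∈ P ∨ (G.Done S vis v ∧ ¬ IsFreeA S.M v))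
    (hv : v ∈ P ∨ (G.Done S vis v ∧ ¬ IsFreeA S.M v)) (hn : ∀ x ∈ P, ¬ G.Reach S v x) :
    G.Dead S vis v := by
  intro z hz
  induction hz with
  | refl => exact hv.resolve_left fun h => hn v h .refl
  | tail h1 h2 ih =>
    obtain ⟨e, he⟩ := h2
    exact (hh e (ih.1 e _ he) _ _ he).resolve_left fun h => hn _ h (h1.tail ⟨e, he⟩)

/-- Only the removal of a path vertex can endanger the trichotomy for visited edges. Then a closed
walk through the removed vertex is rerouted through the remaining path, or the head of the edge has
become dead. -/
theorem DFS.inv {S : StageState A B} {b : B} {P : List (A ⊕ B)} {vis : Finset (A × B)}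
    (h : G.DFS S b P vis) : G.DFSInv S b P vis := by
  induction h with
  | start =>
    exact ⟨by simp, by simp, by simp, by simp [IsFreeA], by simp [Relation.ReflTransGen.refl],
      by simp, by simp, by simp⟩
  | onPath u v e P vis _ he hev hvP ih =>
    have hsub := Finset.subset_insert e vis
    have hu := chain_reach ih.chain
    have hsame : ∀ u' v', G.SearchArc S u' e v' → u' = u ∧ v' = v := fun u' v' h =>
      h.1.inj he.1
    refine ⟨ih.last, ih.nodup, ?_, ih.not_free, ih.reach, ?_, ?_, ?_⟩
    · exact ih.chain.imp fun _ _ ⟨f, hf, h⟩ => ⟨f, hsub hf, h⟩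
    · intro f hf
      rcases Finset.mem_insert.1 hf with rfl | hf
      · exact ⟨u, v, he, ih.reach u (by simp)⟩
      · exact ih.arc f hf
    · intro f hf u' v' h
      rcases Finset.mem_insert.1 hf with rfl | hf
      · obtain ⟨rfl, rfl⟩ := hsame _ _ h
        exact Or.inl hvP
      · rcases ih.head f hf u' v' h with h | h
        · exact Or.inl h
        · exact Or.inr ⟨h.1.mono hsub, h.2⟩
    · intro f hf u' v' h
      rcases Finset.mem_insert.1 hf with rfl | hf
      · obtain ⟨rfl, rfl⟩ := hsame _ _ h
        exact Or.inr (Or.inl ⟨_, hvP, .refl, hu _ hvP⟩)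
      · rcases ih.back f hf u' v' h with h | h | h
        · exact Or.inl h
        · exact Or.inr (Or.inl h)
        · exact Or.inr (Or.inr (h.mono hsub))
  | push u v e P vis _ he hev hvP hvf ih =>
    have hsub := Finset.subset_insert e vis
    have hsame : ∀ u' v', G.SearchArc S u' e v' → u' = u ∧ v' = v := fun u' v' h =>
      h.1.inj he.1
    refine ⟨?_, ?_, ?_, ?_, ?_, ?_, ?_, ?_⟩
    · rw [List.getLast?_cons_cons]; exact ih.last
    · exact List.nodup_cons.2 ⟨hvP, ih.nodup⟩
    · rw [List.isChain_cons_cons]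
      exact ⟨⟨e, by simp, he⟩, ih.chain.imp fun _ _ ⟨f, hf, h⟩ => ⟨f, hsub hf, h⟩⟩
    · intro x hx
      rcases List.mem_cons.1 hx with rfl | hx
      · exact hvf
      · exact ih.not_free x hx
    · intro x hx
      rcases List.mem_cons.1 hx with rfl | hx
      · exact (ih.reach u (by simp)).tail ⟨e, he⟩
      · exact ih.reach x hx
    · intro f hf
      rcases Finset.mem_insert.1 hf with rfl | hf
      · exact ⟨u, v, he, ih.reach u (by simp)⟩
      · exact ih.arc f hf
    · intro f hf u' v' h
      rcases Finset.mem_insert.1 hf with rfl | hf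
      · obtain ⟨rfl, rfl⟩ := hsame _ _ h
        exact Or.inl (by simp)
      · rcases ih.head f hf u' v' h with h | h
        · exact Or.inl (List.mem_cons_of_mem _ h)
        · exact Or.inr ⟨h.1.mono hsub, h.2⟩
    · intro f hf u' v' h
      rcases Finset.mem_insert.1 hf with rfl | hf
      · refine Or.inl ?_
        rw [pathEdges, he.1.edgeBetween_eq]; simp
      · rcases ih.back f hf u' v' h with h | ⟨x, hx, h⟩ | h
        · refine Or.inl ?_
          rw [pathEdges]; exact Finset.mem_union_right _ h
        · exact Or.inr (Or.inl ⟨x, List.mem_cons_of_mem _ hx, h⟩)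
        · exact Or.inr (Or.inr (h.mono hsub))
  | pop u p P vis _ hdone ih =>
    have hch := ih.chain
    rw [List.isChain_cons_cons] at hch
    obtain ⟨⟨e0, he0, harc0⟩, hch⟩ := hch
    have hp := chain_reach hch
    have hhead : ∀ e ∈ vis, ∀ u v, G.SearchArc S u e v →
        v ∈ p :: P ∨ (G.Done S vis v ∧ ¬ IsFreeA S.M v) := by
      intro f hf u' v' h
      rcases ih.head f hf u' v' h with h | h
      · rcases List.mem_cons.1 h with rfl | h
        · exact Or.inr ⟨hdone, ih.not_free _ (by simp)⟩
        · exact Or.inl h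
      · exact Or.inr h
    refine ⟨?_, (List.nodup_cons.1 ih.nodup).2, hch,
      fun x hx => ih.not_free x (List.mem_cons_of_mem _ hx),
      fun x hx => ih.reach x (List.mem_cons_of_mem _ hx), ih.arc, hhead, ?_⟩
    · have := ih.last; rwa [List.getLast?_cons_cons] at this
    · intro f hf u' v' h
      -- If the head still reaches a remaining vertex x, then x leads up the path to `p` and on
      -- through the removed arc, which closes the walk. Otherwise everything reachable from the
      -- head is finished.
      by_cases hn : ∃ x ∈ p :: P, G.Reach S v' x
      · obtain ⟨x, hx, hvx⟩ := hn
        rcases ih.back f hf u' v' h with h1 | ⟨z, hz, hvz, hzu⟩ | h1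
        · rw [pathEdges, harc0.1.edgeBetween_eq, Finset.mem_union, Finset.mem_singleton] at h1
          rcases h1 with rfl | h1
          · obtain ⟨rfl, rfl⟩ := h.1.inj harc0.1
            exact Or.inr (Or.inl ⟨x, hx, hvx, hp x hx⟩)
          · exact Or.inl h1
        · rcases List.mem_cons.1 hz with rfl | hz
          · exact Or.inr (Or.inl ⟨x, hx, hvx,
              ((hp x hx).tail ⟨e0, harc0⟩).trans hzu⟩)
          · exact Or.inr (Or.inl ⟨z, hz, hvz, hzu⟩)
        · exact Or.inr (Or.inr h1)
      · push Not at hn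
        exact Or.inr (Or.inr (dead_of_not_reach hhead (hhead f hf u' v' h) hn))

/-- What a successful search provides. -/
structure FindsInv (G : WGraph A B) (S : StageState A B) (b : B) (P : List (A ⊕ B))
    (vis : Finset (A × B)) (a : A) (X : Set (A ⊕ B)) : Prop where
  head_eq : P.head? = some (Sum.inl a)
  last : P.getLast? = some (Sum.inr b)
  nodup : P.Nodup
  free : FreeA S.M a
  chain : P.IsChain (fun v u => ∃ e ∈ vis, G.SearchArc S u e v)
  arc : ∀ e ∈ vis, ∃ u v, G.SearchArc S u e v
  notMem : ∀ x ∈ X, x ∉ P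
  closed : ∀ u ∈ X, ∀ e v, G.SearchArc S u e v → v ∈ X
  not_free : ∀ x ∈ X, ¬ IsFreeA S.M x
  back : ∀ e ∈ vis, ∀ u v, G.SearchArc S u e v → e ∈ pathEdges P ∨
    (∃ x ∈ P, ¬ IsFreeA S.M x ∧ G.Reach S v x ∧ G.Reach S x u) ∨ v ∈ X

/-- Just before the free vertex is appended, the invariants of the running search hold. The set X
collects the dead vertices of that moment; the last edge is on the path. -/
theorem DFSFinds.inv {S : StageState A B} {b : B} {P : List (A ⊕ B)} {vis : Finset (A × B)}
    (h : G.DFSFinds S b P vis) : ∃ a X, G.FindsInv S b P vis a X := by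
  obtain ⟨u, v, e, Q, vis', hd, he, hev, hv, ⟨a, rfl, ha⟩, rfl, rfl⟩ := h
  have hi := hd.inv
  have hsub := Finset.subset_insert e vis'
  have hu := chain_reach hi.chain
  refine ⟨a, {z | G.Dead S vis' z}, rfl, ?_, List.nodup_cons.2 ⟨hv, hi.nodup⟩, ha, ?_, ?_, ?_, ?_,
    ?_, ?_⟩
  · rw [List.getLast?_cons_cons]; exact hi.last
  · rw [List.isChain_cons_cons]
    exact ⟨⟨e, by simp, he⟩, hi.chain.imp fun _ _ ⟨f, hf, h⟩ => ⟨f, hsub hf, h⟩⟩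
  · intro f hf
    rcases Finset.mem_insert.1 hf with rfl | hf
    · exact ⟨u, _, he⟩
    · obtain ⟨x, y, h, -⟩ := hi.arc f hf
      exact ⟨x, y, h⟩
  · intro x hx hxP
    rcases List.mem_cons.1 hxP with rfl | hxP
    · exact (hx _ .refl).2 ⟨a, rfl, ha⟩
    -- A dead path vertex would reach `u`, although the arc `e` leaving `u` had not been visited.
    · exact hev ((hx u (hu x hxP)).1 e _ he)
  · intro x hx f y hy z hz
    exact hx z (.head ⟨f, hy⟩ hz)
  · intro x hx; exact (hx _ .refl).2
  · intro f hf x y hxy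
    rcases Finset.mem_insert.1 hf with rfl | hf
    · refine Or.inl ?_
      rw [pathEdges, he.1.edgeBetween_eq]; simp
    · rcases hi.back f hf x y hxy with h | ⟨z, hz, h⟩ | h
      · refine Or.inl ?_
        rw [pathEdges]; exact Finset.mem_union_right _ h
      · exact Or.inr (Or.inl ⟨z, List.mem_cons_of_mem _ hz, hi.not_free z hz, h⟩)
      · exact Or.inr (Or.inr h)

theorem pathEdges_subset {S : StageState A B} {vis : Finset (A × B)} {P : List (A ⊕ B)}
    (h : P.IsChain (fun v u => ∃ e ∈ vis, G.SearchArc S u e v)) :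
    ∀ e ∈ pathEdges P, e ∈ vis ∧ ∃ u v, G.SearchArc S u e v := by
  induction P with
  | nil => simp [pathEdges]
  | cons u P ih =>
    cases P with
    | nil => simp [pathEdges]
    | cons v P =>
      rw [List.isChain_cons_cons] at h
      obtain ⟨⟨f, hf, hfa⟩, h⟩ := h
      intro e he
      rw [pathEdges, hfa.1.edgeBetween_eq, Finset.mem_union, Finset.mem_singleton] at he
      rcases he with rfl | he
      · exact ⟨hf, _, _, hfa⟩
      · exact ih h e he

/-- The effect of a successful search on the matching. -/
theorem FindsInv.augment {S : StageState A B} {b : B} {P : List (A ⊕ B)} {vis : Finset (A × B)}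
    {a : A} {X : Set (A ⊕ B)} (h : G.FindsInv S b P vis a X) (hM : G.IsMatching S.M)
    (hb : FreeB S.M b) :
    let M' := symmDiff S.M (pathEdges P)
    G.IsMatching M' ∧ M'.card = S.M.card + 1 ∧ (∀ x, FreeA M' x ↔ FreeA S.M x ∧ x ≠ a) ∧
      (∀ x, FreeB M' x ↔ FreeB S.M x ∧ x ≠ b) := by
  obtain ⟨v, Q, rfl⟩ : ∃ v Q, P = v :: Q := by
    cases P with
    | nil => have := h.last; simp at this
    | cons v Q => exact ⟨v, Q, rfl⟩
  obtain rfl : v = Sum.inl a := by simpa using h.head_eq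
  exact augment_aux b _ S.M Q a le_rfl hM h.nodup
    (h.chain.imp fun _ _ ⟨e, _, he⟩ => ⟨e, he.1⟩) h.last hb h.free

section Augment

variable {S : StageState A B} {b : B} {P : List (A ⊕ B)} {vis : Finset (A × B)}
    {a : A} {X : Set (A ⊕ B)} {Y : ℤ}

theorem augmentDuals_le (M : Finset (A × B)) (y : A ⊕ B → ℤ) (P : List (A ⊕ B)) (v : A ⊕ B) :
    G.augmentDuals M y P v ≤ y v := by
  cases v with
  | inl a => simp [augmentDuals]
  | inr b =>
    simp only [augmentDuals]
    have : 0 ≤ ∑ e ∈ (pathEdges P \ M).filter (fun e => e.2 = b), (G.c e : ℤ) :=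
      Finset.sum_nonneg fun _ _ => by positivity
    omega

/-- The new edges of the path belong to the new matching, so the sum in the definition has a single
term. -/
theorem augmentDuals_eq {M : Finset (A × B)} (y : A ⊕ B → ℤ)
    (hM' : G.IsMatching (symmDiff M (pathEdges P))) {e : A × B} (he : e ∈ pathEdges P \ M) :
    G.augmentDuals M y P (Sum.inr e.2) = y (Sum.inr e.2) - 2 * G.c e := by
  have : (pathEdges P \ M).filter (fun f => f.2 = e.2) = {e} := by
    ext f
    simp only [Finset.mem_filter, Finset.mem_singleton]
    constructor
    · rintro ⟨hf, h⟩
      refine hM'.2 _ ?_ _ ?_ (Or.inr h)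
      · rw [Finset.mem_symmDiff]; rw [Finset.mem_sdiff] at hf; exact Or.inr hf
      · rw [Finset.mem_symmDiff]; rw [Finset.mem_sdiff] at he; exact Or.inr he
    · rintro rfl; exact ⟨he, rfl⟩
  simp [augmentDuals, this]

theorem augmentDuals_eq_self {M : Finset (A × B)} (y : A ⊕ B → ℤ) {x : B}
    (h : ∀ e ∈ pathEdges P \ M, e.2 ≠ x) :
    G.augmentDuals M y P (Sum.inr x) = y (Sum.inr x) := by
  have : (pathEdges P \ M).filter (fun f => f.2 = x) = ∅ := by
    rw [Finset.filter_eq_empty_iff]; exact fun e he => h e he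
  simp [augmentDuals, this]

/-- A path edge outside M has slack 0, that is y(b) = y(a)+c, while as a matched edge it needs y(b)
= y(a)-c; this explains the decrease by 2c. Lower values on B can only increase the slacks of the
other unmatched edges, and a former matching edge had c+y(a)-y(b) = 2c ≥ 0. -/
theorem FindsInv.feasible (h : G.FindsInv S b P vis a X) (hF : G.Feasible S.M S.y Y)
    (hb : FreeB S.M b) :
    G.Feasible (G.afterAugment S P vis).M (G.afterAugment S P vis).y Y := by
  obtain ⟨hM', -, hfa, hfb⟩ := h.augment hF.matching hb
  have hpe := pathEdges_subset h.chain
  refine ⟨hM', ?_, ?_, hF.left_nonneg, hF.left_le, ?_, ?_, ?_⟩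
  · intro e he heM
    have h1 := augmentDuals_le (G := G) S.M S.y P (Sum.inr e.2)
    simp only [afterAugment] at *
    have : 0 ≤ (G.c e : ℤ) + S.y (Sum.inl e.1) - S.y (Sum.inr e.2) := by
      by_cases h2 : e ∈ S.M
      · have := hF.tight e h2; omega
      · exact hF.nonneg e he h2
    simp only [augmentDuals] at h1 ⊢
    omega
  · intro e he
    simp only [afterAugment] at *
    by_cases h2 : e ∈ S.M
    · have h3 := augmentDuals_eq_self (G := G) (P := P) (M := S.M) S.y (x := e.2) (by
        intro f hf hfe
        rw [Finset.mem_sdiff] at hf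
        have := hM'.2 f (by rw [Finset.mem_symmDiff]; exact Or.inr hf) e he (Or.inr hfe)
        subst this; exact hf.2 h2)
      have := hF.tight e h2
      rw [h3]; exact this
    · have hePM : e ∈ pathEdges P \ S.M := by
        rw [Finset.mem_symmDiff] at he; rw [Finset.mem_sdiff]; tauto
      rw [augmentDuals_eq S.y hM' hePM]
      obtain ⟨u, v, harc, hs, -⟩ := (hpe e (Finset.mem_sdiff.1 hePM).1).2
      simp only [slack, h2, if_false] at hs
      simp only [augmentDuals]
      omega
  · intro x hx
    exact hF.left_free x ((hfa x).1 hx).1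
  · intro x
    exact (augmentDuals_le _ _ _ _).trans (hF.right_le x)
  · intro x hx
    refine (augmentDuals_eq_self (G := G) (P := P) (M := S.M) S.y (x := x) ?_).trans
      (hF.right_free x ((hfb x).1 hx).1)
    intro f hf
    rw [Finset.mem_sdiff] at hf
    exact hx f (by simp only [afterAugment, Finset.mem_symmDiff]; exact Or.inr hf)

/-- An admissible arc lowers y by exactly the weight of its edge. -/
theorem reach_le (hF : G.Feasible S.M S.y Y) {u v : A ⊕ B} (h : G.Reach S u v) :
    S.y v ≤ S.y u := by
  induction h with
  | refl => exact le_rfl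
  | tail _ h2 ih =>
    obtain ⟨e, he⟩ := h2
    have h1 := hF.slack_eq he.1
    rw [he.2.1] at h1
    omega

theorem zeroGraph_adj {e : A × B} (he : e ∈ G.E) (h0 : G.c e = 0) :
    G.zeroGraph.Adj (Sum.inl e.1) (Sum.inr e.2) := ⟨e, he, h0, Or.inl ⟨rfl, rfl⟩⟩

theorem arc_adj (hM : S.M ⊆ G.E) {u v : A ⊕ B} {e : A × B} (h : G.Arc S.M u e v)
    (h0 : G.c e = 0) :
    G.zeroGraph.Adj u v ∧ ∀ K, e ∈ G.pieceEdges K ↔ G.zeroGraph.connectedComponentMk u = K := by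
  have hE := h.mem hM
  have hadj := zeroGraph_adj hE h0
  have hcc := SimpleGraph.ConnectedComponent.sound hadj.reachable
  cases h with
  | unmatched a b h1 h2 => exact ⟨hadj.symm, fun K => by simp [pieceEdges, hE, h0, ← hcc]⟩
  | matched a b h1 => exact ⟨hadj, fun K => by simp [pieceEdges, hE, h0]⟩

/-- Without any drop of y all arcs of the walk have weight 0, so the walk stays in one component. -/
theorem reach_zero (hF : G.Feasible S.M S.y Y) {u v : A ⊕ B} (h : G.Reach S u v)
    (huv : S.y u ≤ S.y v) : G.zeroGraph.Reachable u v := by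
  induction h with
  | refl => exact .refl _
  | tail h1 h2 ih =>
    have h3 := reach_le hF h1
    obtain ⟨e, he⟩ := h2
    have h4 := hF.slack_eq he.1
    rw [he.2.1] at h4
    have h0 : G.c e = 0 := by omega
    exact (ih (by omega)).trans (arc_adj hF.matching.1 he.1 h0).1.reachable

/-- A visited edge on a closed walk through `P` lies in an affected piece. -/
theorem FindsInv.affected (h : G.FindsInv S b P vis a X) (hF : G.Feasible S.M S.y Y)
    (hb : FreeB S.M b) {u v x : A ⊕ B} {e : A × B} (he : G.SearchArc S u e v) (hx : x ∈ P)
    (hxf : ¬ IsFreeA S.M x) (hvx : G.Reach S v x) (hxu : G.Reach S x u) :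
    G.InAffectedPiece P e := by
  have h1 := reach_le hF hvx
  have h2 := reach_le hF hxu
  have h3 := hF.slack_eq he.1
  rw [he.2.1] at h3
  have hc : G.c e = 0 := by omega
  have hmk : G.zeroGraph.connectedComponentMk u = G.zeroGraph.connectedComponentMk x :=
    (SimpleGraph.ConnectedComponent.sound (reach_zero hF hxu (by omega))).symm
  have hmk' : G.zeroGraph.connectedComponentMk v = G.zeroGraph.connectedComponentMk x :=
    (SimpleGraph.ConnectedComponent.sound (reach_zero hF hvx (by omega)))
  refine ⟨G.zeroGraph.connectedComponentMk x, ((arc_adj hF.matching.1 he.1 hc).2 _).2 hmk, ?_⟩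
  -- An arc at x along which y does not drop has weight 0 and hence lies in the piece of x.
  have key : ∀ w f z, G.SearchArc S w f z → (w = x ∨ z = x) → S.y w ≤ S.y z →
      f ∈ G.pieceEdges (G.zeroGraph.connectedComponentMk x) := by
    intro w f z hf hwz hy
    have h4 := hF.slack_eq hf.1
    rw [hf.2.1] at h4
    have hc' : G.c f = 0 := by omega
    have h5 := arc_adj hF.matching.1 hf.1 hc'
    rw [h5.2]
    rcases hwz with rfl | rfl
    · rfl
    · exact SimpleGraph.ConnectedComponent.sound h5.1.reachable
  obtain ⟨L, R, rfl⟩ := List.append_of_mem hx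
  have hmemPE : ∀ (w z : A ⊕ B) (L R : List (A ⊕ B)) (f : A × B), f ∈ edgeBetween z w →
      f ∈ pathEdges (L ++ z :: w :: R) := by
    intro w z L R f hf
    induction L with
    | nil => simp only [List.nil_append, pathEdges]; exact Finset.mem_union_left _ hf
    | cons l L ih =>
      cases L with
      | nil => simp only [List.cons_append, List.nil_append, pathEdges] at ih ⊢
               exact Finset.mem_union_right _ ih
      | cons l' L => simp only [List.cons_append, pathEdges] at ih ⊢
                     exact Finset.mem_union_right _ ih
  -- It remains to see that the path shares with the closed walk an arc at x. A vertex of A has only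
  -- one outgoing arc, and x is not the end of the path because it is not free. A vertex of B has
  -- only one incoming arc, and x is not the root because a free vertex has none.
  rcases x with xa | xb
  · rcases List.eq_nil_or_concat L with rfl | ⟨L, z, rfl⟩
    · exfalso
      have := h.head_eq
      simp only [List.nil_append, List.head?_cons, Option.some.injEq, Sum.inl.injEq] at this
      exact hxf ⟨xa, rfl, this ▸ h.free⟩
    · have hch := h.chain
      simp only [List.append_assoc, List.singleton_append, List.concat_eq_append] at hch
      have := (List.isChain_append.1 hch).2.1
      rw [List.isChain_cons_cons] at this
      obtain ⟨⟨f, -, hf⟩, -⟩ := this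
      refine ⟨f, ?_, ?_⟩
      · simp only [List.append_assoc, List.singleton_append, List.concat_eq_append]
        apply hmemPE; rw [hf.1.edgeBetween_eq]; simp
      · refine key _ _ _ hf (Or.inl rfl) ?_
        rcases hxu.cases_head with rfl | ⟨w, ⟨g, hg⟩, hwu⟩
        · obtain ⟨rfl, rfl⟩ := Arc.out_unique hF.matching he.1 hf.1
          omega
        · obtain ⟨rfl, rfl⟩ := Arc.out_unique hF.matching hg.1 hf.1
          have := reach_le hF hwu
          omega
  · rcases R with _ | ⟨z, R⟩
    · exfalso
      have := h.last
      simp only [List.getLast?_append_cons, List.getLast?_singleton, Option.some.injEq,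
        Sum.inr.injEq] at this
      subst this
      rcases hvx.cases_tail with rfl | ⟨w, -, ⟨g, hg⟩⟩
      · exact he.1.not_freeB hb
      · exact hg.1.not_freeB hb
    · have := (List.isChain_append.1 h.chain).2.1
      rw [List.isChain_cons_cons] at this
      obtain ⟨⟨f, -, hf⟩, -⟩ := this
      refine ⟨f, ?_, ?_⟩
      · apply hmemPE; rw [hf.1.edgeBetween_eq]; simp
      · refine key _ _ _ hf (Or.inr rfl) ?_
        rcases hvx.cases_tail with rfl | ⟨w, hvw, ⟨g, hg⟩⟩
        · obtain ⟨rfl, rfl⟩ := Arc.in_unique hF.matching he.1 hf.1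
          omega
        · obtain ⟨rfl, rfl⟩ := Arc.in_unique hF.matching hg.1 hf.1
          have := reach_le hF hvw
          omega

end Augment

end WGraph

namespace WGraph

set_option linter.unusedSectionVars false

variable {A B : Type} [DecidableEq A] [DecidableEq B] {G : WGraph A B}

/-! ## The second stage leaves no admissible augmenting path -/

/-- `Z` is closed under admissible arcs, contains no free vertex of `A`, and contains the heads of
all admissible deleted arcs. -/
structure Barrier (G : WGraph A B) (S : StageState A B) (Z : Set (A ⊕ B)) : Prop where
  closed : ∀ u ∈ Z, ∀ e v, G.Arc S.M u e v → G.slack S.M S.y e = 0 → v ∈ Z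
  not_free : ∀ x ∈ Z, ¬ IsFreeA S.M x
  deleted : ∀ e ∈ S.deleted, ∀ u v, G.Arc S.M u e v → G.slack S.M S.y e = 0 → v ∈ Z

/-- After a failure the path consists of the finished root, so heads of visited arcs are all
finished and the property spreads along arcs. -/
theorem DFSFails.dead {S : StageState A B} {b : B} {vis : Finset (A × B)}
    (h : G.DFSFails S b vis) : G.Dead S vis (Sum.inr b) := by
  have hi := h.1.inv
  intro z hz
  induction hz with
  | refl => exact ⟨h.2, by simp [IsFreeA]⟩
  | tail h1 h2 ih =>
    obtain ⟨e, he⟩ := h2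
    rcases hi.head e (ih.1 e _ he) _ _ he with h3 | h3
    · simp only [List.mem_singleton] at h3
      subst h3
      exact ⟨h.2, by simp [IsFreeA]⟩
    · exact h3

/-- What the search can reach joins the barrier. An admissible arc leaving this set is undeleted,
and leads to a reachable vertex, or was deleted before, and leads into Z. -/
theorem Barrier.fails {S : StageState A B} {b : B} {vis : Finset (A × B)} {Z : Set (A ⊕ B)}
    (hZ : G.Barrier S Z) (h : G.DFSFails S b vis) :
    G.Barrier { S with deleted := S.deleted ∪ vis } (Z ∪ {v | G.Reach S (Sum.inr b) v}) where
  closed := by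
    rintro u (hu | hu) e v hev hs
    · exact Or.inl (hZ.closed u hu e v hev hs)
    · by_cases hd : e ∈ S.deleted
      · exact Or.inl (hZ.deleted e hd u v hev hs)
      · exact Or.inr (Relation.ReflTransGen.tail hu ⟨e, hev, hs, hd⟩)
  not_free := by
    rintro x (hx | hx)
    · exact hZ.not_free x hx
    · exact (h.dead x hx).2
  deleted := by
    intro e he u v hev hs
    by_cases hd : e ∈ S.deleted
    · exact Or.inl (hZ.deleted e hd u v hev hs)
    · have hv : e ∈ vis := by
        simp only [Finset.mem_union] at he; exact he.resolve_left hd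
      obtain ⟨u', v', harc, hr⟩ := h.1.inv.arc e hv
      obtain ⟨rfl, rfl⟩ := harc.1.inj hev
      exact Or.inr (hr.tail ⟨e, harc⟩)

section Finds

variable {S : StageState A B} {b : B} {P : List (A ⊕ B)} {vis : Finset (A × B)}
    {a : A} {X : Set (A ⊕ B)} {Y : ℤ}

/-- The admissible arcs that leave a vertex outside the path are not changed. -/
theorem afterAugment_arc {x v : A ⊕ B} {e : A × B} (hx : x ∉ P)
    (h : G.Arc (G.afterAugment S P vis).M x e v)
    (hs : G.slack (G.afterAugment S P vis).M (G.afterAugment S P vis).y e = 0) :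
    G.Arc S.M x e v ∧ G.slack S.M S.y e = 0 := by
  have hmem : e ∉ pathEdges P → (e ∈ symmDiff S.M (pathEdges P) ↔ e ∈ S.M) := by
    intro h; rw [Finset.mem_symmDiff]; tauto
  simp only [afterAugment] at h hs
  cases h with
  | unmatched a' b' h1 h2 =>
    have hpe : (a', b') ∉ pathEdges P := fun h => hx (mem_of_mem_pathEdges h).2
    have hyb : G.augmentDuals S.M S.y P (Sum.inr b') = S.y (Sum.inr b') :=
      augmentDuals_eq_self _ fun f hf hfb => hx (hfb ▸
        (mem_of_mem_pathEdges (Finset.mem_sdiff.1 hf).1).2)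
    rw [hmem hpe] at h2
    refine ⟨.unmatched a' b' h1 h2, ?_⟩
    simp only [slack, hmem hpe, h2, if_false] at hs ⊢
    rw [hyb] at hs
    simp only [augmentDuals] at hs
    exact hs
  | matched a' b' h1 =>
    have hpe : (a', b') ∉ pathEdges P := fun h => hx (mem_of_mem_pathEdges h).1
    rw [hmem hpe] at h1
    exact ⟨.matched a' b' h1, by simp [slack, h1]⟩

/-- The new barrier consists of Z, the dead vertices X of the search, and the set W of ends in B of
new matching edges of weight 1. Z and X avoid the path, so their outgoing admissible arcs are old
ones; W has no outgoing admissible arcs. The vertices of the path outside W need no protection,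
because the deleted edges leading to them are no longer admissible or have been kept. -/
theorem Barrier.finds {Z : Set (A ⊕ B)} (hZ : G.Barrier S Z) (hF : G.Feasible S.M S.y Y)
    (hb : FreeB S.M b) (h : G.FindsInv S b P vis a X) :
    ∃ Z', Z ⊆ Z' ∧ G.Barrier (G.afterAugment S P vis) Z' := by
  obtain ⟨hM', -, hfa, hfb⟩ := h.augment hF.matching hb
  have hF' := h.feasible hF hb
  have hpe := pathEdges_subset h.chain
  obtain ⟨w, Q, rfl⟩ : ∃ v Q, P = v :: Q := by
    cases P with
    | nil => have := h.last; simp at this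
    | cons v Q => exact ⟨v, Q, rfl⟩
  obtain rfl : w = Sum.inl a := by simpa using h.head_eq
  -- A path vertex in Z would lead, inside the closed set Z, to the free end of the path.
  have hZP : ∀ x ∈ Z, x ∉ Sum.inl a :: Q := by
    intro x hx hxP
    have hr := chain_reach h.chain x hxP
    have : ∀ z, G.Reach S x z → z ∈ Z := by
      intro z hz
      induction hz with
      | refl => exact hx
      | tail _ h2 ih =>
        obtain ⟨e, he⟩ := h2
        exact hZ.closed _ ih e _ he.1 he.2.1
    exact hZ.not_free _ (this _ hr) ⟨a, rfl, h.free⟩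
  set P := Sum.inl a :: Q with hP
  let W : Set (A ⊕ B) := {v | ∃ e ∈ pathEdges P \ S.M, G.c e = 1 ∧ v = Sum.inr e.2}
  -- The dual weight was lowered by 2. Every other edge there had c+y(a)-y(b) ≥ 0, also if it was
  -- the old matching edge, and therefore has slack at least 2 now.
  have hW : ∀ u ∈ W, ∀ e v, G.Arc (G.afterAugment S P vis).M u e v →
      G.slack (G.afterAugment S P vis).M (G.afterAugment S P vis).y e ≠ 0 := by
    rintro _ ⟨f, hf, hf1, rfl⟩ e v hev hs
    cases hev with | unmatched a' b' h1 h2 => ?_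
    simp only [afterAugment] at h2 hs
    have hy := augmentDuals_eq (G := G) S.y hM' hf
    simp only [slack, h2, if_false] at hs
    rw [hy] at hs
    simp only [augmentDuals, hf1] at hs
    by_cases h3 : (a', f.2) ∈ S.M
    · have := hF.tight _ h3
      simp only at this
      push_cast at hs
      omega
    · have := hF.nonneg _ h1 h3
      simp only at this
      push_cast at hs
      omega
  have hfree : ∀ x, IsFreeA (G.afterAugment S P vis).M x → IsFreeA S.M x := by
    rintro x ⟨a', rfl, h'⟩
    exact ⟨a', rfl, ((hfa a').1 h').1⟩
  have hXcl : ∀ u ∈ X, ∀ e v, G.Arc S.M u e v → G.slack S.M S.y e = 0 → v ∈ Z ∪ X := by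
    intro u hu e v h1 h2
    by_cases hd : e ∈ S.deleted
    · exact Or.inl (hZ.deleted e hd u v h1 h2)
    · exact Or.inr (h.closed u hu e v ⟨h1, h2, hd⟩)
  -- A deleted edge of the path has weight 1, since otherwise its own piece is affected: if it was
  -- matched its slack is now positive, and if it was unmatched its head is now in W. An edge off
  -- the path keeps its direction and its slack does not decrease, so either it was a deleted
  -- admissible arc before, with head in Z, or it was visited by this search and the trichotomy
  -- leaves only a head in X.
  have hlast : ∀ e, (e ∈ S.deleted ∨ (e ∈ vis ∧ ¬ G.InAffectedPiece P e)) → ∀ u v,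
      G.Arc (G.afterAugment S P vis).M u e v →
      G.slack (G.afterAugment S P vis).M (G.afterAugment S P vis).y e = 0 → v ∈ Z ∪ X ∪ W := by
    intro e he u v hev hs
    have hmem : e ∈ symmDiff S.M (pathEdges P) ↔ _ := Finset.mem_symmDiff
    by_cases hep : e ∈ pathEdges P
    · obtain ⟨hv, x, z, hxz⟩ := hpe e hep
      have hna : ¬ G.InAffectedPiece P e := by
        rcases he with he | he
        · exact absurd he hxz.2.2
        · exact he.2
      have hc : G.c e = 1 := by
        rcases G.c_zero_or_one e (hxz.1.mem hF.matching.1) with h0 | h1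
        · refine absurd ?_ hna
          have := ((arc_adj hF.matching.1 hxz.1 h0).2 _).2 rfl
          exact ⟨_, this, e, hep, this⟩
        · exact h1
      by_cases heM : e ∈ S.M
      · exfalso
        have h2 : e ∉ (G.afterAugment S P vis).M := by
          simp only [afterAugment]; rw [hmem]; tauto
        simp only [slack, h2, if_false] at hs
        have h3 := hF.tight e heM
        have h4 := augmentDuals_le (G := G) S.M S.y P (Sum.inr e.2)
        simp only [afterAugment] at hs
        simp only [augmentDuals] at hs h4
        omega
      · have h2 : e ∈ (G.afterAugment S P vis).M := by
          simp only [afterAugment]; rw [hmem]; tauto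
        obtain ⟨rfl, rfl⟩ := hev.inj (.matched e.1 e.2 h2)
        exact Or.inr ⟨e, Finset.mem_sdiff.2 ⟨hep, heM⟩, hc, rfl⟩
    · have hmem' : e ∈ (G.afterAugment S P vis).M ↔ e ∈ S.M := by
        simp only [afterAugment]; rw [hmem]; tauto
      have harc : G.Arc S.M u e v := by
        cases hev with
        | unmatched a' b' h1 h2 => rw [hmem'] at h2; exact .unmatched a' b' h1 h2
        | matched a' b' h1 => rw [hmem'] at h1; exact .matched a' b' h1
      rcases he with he | ⟨he, hna⟩
      · by_cases h0 : G.slack S.M S.y e = 0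
        · exact Or.inl (Or.inl (hZ.deleted e he u v harc h0))
        · exfalso
          have h1 := hF.slack_nonneg harc
          have h2 := hF.slack_eq harc
          have h3 := hF'.slack_eq hev
          cases harc with
          | unmatched a' b' _ _ =>
            have h4 := augmentDuals_le (G := G) S.M S.y P (Sum.inr b')
            simp only [afterAugment] at h3 hs
            simp only [augmentDuals] at h3 h4
            omega
          | matched a' b' h5 => exact h0 (by simp [slack, h5])
      · obtain ⟨u', v', hsa⟩ := h.arc e he
        obtain ⟨rfl, rfl⟩ := hsa.1.inj harc
        rcases h.back e he _ _ hsa with h1 | ⟨x, hx, hxf, h1, h2⟩ | h1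
        · exact absurd h1 hep
        · exact absurd (h.affected hF hb hsa hx hxf h1 h2) hna
        · exact Or.inl (Or.inr h1)
  refine ⟨Z ∪ X ∪ W, fun x hx => Or.inl (Or.inl hx), ?_, ?_, ?_⟩
  · rintro u ((hu | hu) | hu) e v hev hs
    · obtain ⟨h1, h2⟩ := afterAugment_arc (hZP u hu) hev hs
      exact Or.inl (Or.inl (hZ.closed u hu e v h1 h2))
    · obtain ⟨h1, h2⟩ := afterAugment_arc (h.notMem u hu) hev hs
      exact Or.inl (hXcl u hu e v h1 h2)
    · exact absurd hs (hW u hu e v hev)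
  · rintro x ((hx | hx) | ⟨e, -, -, rfl⟩) hf
    · exact hZ.not_free x hx (hfree x hf)
    · exact h.not_free x hx (hfree x hf)
    · simp [IsFreeA] at hf
  · intro e he
    apply hlast
    simpa [afterAugment] using he

theorem FindsInv.dual_eq (h : G.FindsInv S b P vis a X) (hF : G.Feasible S.M S.y Y)
    (hb : FreeB S.M b) : S.y (Sum.inr b) = Y ∧ S.y (Sum.inl a) = 0 :=
  ⟨hF.right_free b hb, hF.left_free a h.free⟩

/-- A path meets at most one component more than the decrease of the dual weights along it. -/
theorem card_components_le [DecidableEq G.zeroGraph.ConnectedComponent]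
    (hF : G.Feasible S.M S.y Y) {v : A ⊕ B}
    (h : (v :: P).IsChain (fun v u => ∃ e ∈ vis, G.SearchArc S u e v)) {u : A ⊕ B}
    (hl : (v :: P).getLast? = some u) :
    (((v :: P).map G.zeroGraph.connectedComponentMk).toFinset.card : ℤ) ≤ S.y u - S.y v + 1 := by
  induction P generalizing v with
  | nil =>
    simp only [List.getLast?_singleton, Option.some.injEq] at hl
    subst hl; simp
  | cons w P ih =>
    rw [List.isChain_cons_cons] at h
    obtain ⟨⟨e, -, he⟩, h⟩ := h
    have := ih h (by rwa [List.getLast?_cons_cons] at hl)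
    have h3 := hF.slack_eq he.1
    rw [he.2.1] at h3
    rw [List.map_cons, List.toFinset_cons]
    rcases G.c_zero_or_one e (he.1.mem hF.matching.1) with h0 | h1
    · have h4 := SimpleGraph.ConnectedComponent.sound (arc_adj hF.matching.1 he.1 h0).1.reachable
      rw [Finset.insert_eq_of_mem]
      · omega
      · simp [← h4]
    · have := Finset.card_insert_le (G.zeroGraph.connectedComponentMk v)
        ((w :: P).map G.zeroGraph.connectedComponentMk).toFinset
      omega

-- The path starts at dual weight Y and ends at 0, so it meets at most Y+1 components, and each
-- affected piece belongs to one of them.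
open Classical in
theorem FindsInv.card_affected_le (h : G.FindsInv S b P vis a X) (hF : G.Feasible S.M S.y Y)
    (hb : FreeB S.M b) {m : ℕ} (hm : ∀ K, (G.pieceEdges K).card ≤ m) :
    ((G.E.filter (G.InAffectedPiece P)).card : ℤ) ≤ (Y + 1) * m := by
  obtain ⟨w, Q, rfl⟩ : ∃ v Q, P = v :: Q := by
    cases P with
    | nil => have := h.last; simp at this
    | cons v Q => exact ⟨v, Q, rfl⟩
  obtain rfl : w = Sum.inl a := by simpa using h.head_eq
  obtain ⟨h1, h2⟩ := h.dual_eq hF hb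
  have h3 := card_components_le hF h.chain h.last
  have hsub : G.E.filter (G.InAffectedPiece (Sum.inl a :: Q)) ⊆
      ((Sum.inl a :: Q).map G.zeroGraph.connectedComponentMk).toFinset.biUnion G.pieceEdges := by
    intro e he
    obtain ⟨-, K, hK, f, hf, hfK⟩ := Finset.mem_filter.1 he
    refine Finset.mem_biUnion.2 ⟨K, ?_, hK⟩
    simp only [pieceEdges, Finset.mem_filter] at hfK
    rw [List.mem_toFinset, List.mem_map]
    exact ⟨_, (mem_of_mem_pathEdges hf).1, hfK.2.2⟩
  have h4 := (Finset.card_le_card hsub).trans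
    (Finset.card_biUnion_le_card_mul _ _ m fun K _ => hm K)
  have h5 : ((G.E.filter (G.InAffectedPiece (Sum.inl a :: Q))).card : ℤ) ≤
      (((Sum.inl a :: Q).map G.zeroGraph.connectedComponentMk).toFinset.card : ℤ) * m := by
    exact_mod_cast h4
  refine h5.trans (mul_le_mul_of_nonneg_right ?_ (by positivity))
  omega

end Finds

/-! ## A whole second stage -/

theorem SecondStage.append {l l' : List B} {S S' S'' : StageState A B}
    (h : G.SecondStage l S S') (h' : G.SecondStage l' S' S'') : G.SecondStage (l ++ l') S S'' := by
  induction h with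
  | done S => exact h'
  | fails b bs S S' vis hd _ ih => exact .fails b _ S S'' vis hd (ih h')
  | finds b bs S S' P vis hd _ ih => exact .finds b _ S S'' P vis hd (ih h')

/-- What holds after a second stage. -/
structure StageResult (G : WGraph A B) (bs : List B) (S S' : StageState A B) (Y : ℤ) : Prop where
  feasible : G.Feasible S'.M S'.y Y
  card_le : S.M.card ≤ S'.M.card
  freeB : ∀ x, FreeB S'.M x → FreeB S.M x
  freeB' : ∀ x, x ∉ bs → FreeB S.M x → FreeB S'.M x
  eq_of_card : S'.M.card = S.M.card → S'.M = S.M ∧ S'.y = S.y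
  barrier : ∀ Z, G.Barrier S Z →
    ∃ Z', Z ⊆ Z' ∧ G.Barrier S' Z' ∧ ∀ x ∈ bs, FreeB S'.M x → Sum.inr x ∈ Z'

/-- Feasibility and a growing barrier are carried from search to search. A vertex of `bs` that is
still free at the end is one whose search failed, and a failed search puts its root into the
barrier. -/
theorem SecondStage.result {bs : List B} {S S' : StageState A B} (h : G.SecondStage bs S S')
    {Y : ℤ} (hF : G.Feasible S.M S.y Y) (hnd : bs.Nodup) (hfree : ∀ x ∈ bs, FreeB S.M x) :
    G.StageResult bs S S' Y := by
  induction h with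
  | done S =>
    exact ⟨hF, le_rfl, fun _ h => h, fun _ _ h => h, fun _ => ⟨rfl, rfl⟩,
      fun Z hZ => ⟨Z, le_rfl, hZ, by simp⟩⟩
  | fails b bs S S' vis hd _ ih =>
    obtain ⟨hb, hnd⟩ := List.nodup_cons.1 hnd
    obtain ⟨r1, r2, r3, r4, r5, r6⟩ := ih hF hnd fun x hx => hfree x (List.mem_cons_of_mem _ hx)
    refine ⟨r1, r2, r3, fun x hx => r4 x fun h => hx (List.mem_cons_of_mem _ h), r5, ?_⟩
    intro Z hZ
    obtain ⟨Z', h1, h2, h3⟩ := r6 _ (hZ.fails hd)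
    refine ⟨Z', fun x hx => h1 (Or.inl hx), h2, fun x hx hf => ?_⟩
    rcases List.mem_cons.1 hx with rfl | hx
    · exact h1 (Or.inr .refl)
    · exact h3 x hx hf
  | finds b bs S S' P vis hd _ ih =>
    obtain ⟨hb, hnd⟩ := List.nodup_cons.1 hnd
    obtain ⟨a, X, hi⟩ := hd.inv
    have hbf := hfree b (by simp)
    obtain ⟨-, hc, -, hfb⟩ := hi.augment hF.matching hbf
    obtain ⟨r1, r2, r3, r4, r5, r6⟩ := ih (hi.feasible hF hbf) hnd fun x hx =>
      (hfb x).2 ⟨hfree x (List.mem_cons_of_mem _ hx), by rintro rfl; exact hb hx⟩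
    have hc' : (G.afterAugment S P vis).M.card = S.M.card + 1 := hc
    refine ⟨r1, by omega, fun x hx => ((hfb x).1 (r3 x hx)).1, ?_, fun h => by omega, ?_⟩
    · intro x hx hxf
      simp only [List.mem_cons, not_or] at hx
      exact r4 x hx.2 ((hfb x).2 ⟨hxf, hx.1⟩)
    · intro Z hZ
      obtain ⟨Z1, h1, h2⟩ := hZ.finds hF hbf hi
      obtain ⟨Z', h3, h4, h5⟩ := r6 _ h2
      refine ⟨Z', h1.trans h3, h4, fun x hx hf => ?_⟩
      rcases List.mem_cons.1 hx with rfl | hx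
      · exact absurd rfl ((hfb x).1 (r3 x hf)).2
      · exact h5 x hx hf

/-- After a second stage there is no admissible augmenting path. -/
theorem StageResult.one_le_minDist {bs : List B} {M : Finset (A × B)} {y : A ⊕ B → ℤ}
    {S' : StageState A B} {Y : ℤ} (h : G.StageResult bs ⟨M, y, ∅⟩ S' Y)
    (hbs : ∀ b, FreeB M b → b ∈ bs) : 1 ≤ G.minDist S'.M S'.y := by
  -- Nothing is deleted at the beginning of a stage, so the empty set is a barrier there.
  obtain ⟨Z, -, hZ, hbZ⟩ := h.barrier ∅ ⟨by simp, by simp, by simp⟩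
  refine le_minDist fun a ha d hd => ?_
  by_contra hc
  have h0 : d = 0 := by
    have : ¬ 1 ≤ d := fun h => hc (by exact_mod_cast h)
    omega
  -- A walk of length 0 begins at a free vertex of B, which lies in Z, and uses only admissible
  -- arcs, under which Z is closed.
  have key : ∀ v k, G.SlackWalk S'.M S'.y v k → k = 0 → v ∈ Z := by
    intro v k hk
    induction hk with
    | source b hb => exact fun _ => hbZ b (hbs b (h.freeB b hb)) hb
    | step u v e d k _ ha hs ih =>
      intro h0
      obtain ⟨h1, rfl⟩ : d = 0 ∧ k = 0 := by omega
      exact hZ.closed u (ih h1) e v ha (by simpa using hs)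
  exact hZ.not_free _ (key _ _ hd h0) ⟨a, rfl, ha⟩

/-- A second stage that starts with an admissible augmenting path augments the matching. -/
theorem StageResult.card_lt {bs : List B} {M : Finset (A × B)} {y : A ⊕ B → ℤ}
    {S' : StageState A B} {Y : ℤ} (h : G.StageResult bs ⟨M, y, ∅⟩ S' Y)
    (hbs : ∀ b, FreeB M b → b ∈ bs) (h0 : G.minDist M y = 0) : M.card < S'.M.card := by
  refine lt_of_le_of_ne h.card_le fun hc => ?_
  obtain ⟨h1, h2⟩ := h.eq_of_card hc.symm
  have := h.one_le_minDist hbs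
  rw [h1, h2, h0] at this
  simp at this

/-- Only the invariants matter here; that the phases come to an end is not needed, because the
execution is given. -/
theorem Phases.isMaximum {M N : Finset (A × B)} {y : A ⊕ B → ℤ} (h : G.Phases M y N) {Y : ℤ}
    (hF : G.Feasible M y Y) : G.IsMaximumMatching N := by
  induction h generalizing Y with
  | halt M y h => exact isMaximum_of_minDist hF h
  | phase M y bs S' N hne hnd hbs hst _ ih =>
    obtain ⟨L, -, -, -, hL⟩ := exists_minDist_eq hne
    exact ih (hst.result (hF.updateDuals hL) hnd fun x hx => (hbs x).1 hx).feasible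

theorem TwoStageResult.isMaximum {M : Finset (A × B)} (h : G.TwoStageResult M) :
    G.IsMaximumMatching M := by
  obtain ⟨M₀, h0, h1⟩ := h
  exact h1.isMaximum (feasible_zero h0.1 h0.2.1)

/-! ## The number of phases -/

/-- A bound for the number of phases when `k` augmentations are left and the free vertices of `B`
have dual weight `Y`. -/
def phasePotential (R k : ℕ) (Y : ℤ) : ℕ := min k R + (R - Y).toNat

/-- If Y' < R, the term R-Y drops. Otherwise kR ≤ kY' ≤ 2w < R² forces k < R, and the term min(k,R)
drops. -/
theorem phasePotential_lt {R k k' w : ℕ} {Y Y' : ℤ} (hR : 2 * w < R * R) (hk : k' < k)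
    (hY : Y < Y') (hw : k * Y' ≤ 2 * w) : phasePotential R k' Y' < phasePotential R k Y := by
  unfold phasePotential
  by_cases h : Y' < R
  · omega
  · have hkR : k < R := by
      by_contra hc
      have h1 : (R : ℤ) * R ≤ k * Y' := mul_le_mul (by exact_mod_cast not_lt.1 hc) (by omega)
        (by positivity) (by positivity)
      have h2 : (2 * w : ℤ) < R * R := by exact_mod_cast hR
      omega
    omega

theorem phasePotential_le {R k : ℕ} : phasePotential R k 0 ≤ 2 * R := by
  unfold phasePotential; omega

theorem phasePotential_mono {R k k' : ℕ} {Y Y' : ℤ} (hk : k' ≤ k) (hY : Y ≤ Y') :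
    phasePotential R k' Y' ≤ phasePotential R k Y := by
  unfold phasePotential; omega

/-- A bound for the number of pieces visited again when `k` augmentations are left. -/
def revisitPotential (w k : ℕ) : ℕ := ∑ j ∈ Finset.Icc 1 k, (1 + 2 * w / j)

/-- The augmentations of one phase are charged to the indices j with k' < j ≤ k, and for these Y ≤
2w/k ≤ 2w/j. -/
theorem revisitPotential_le {w k k' : ℕ} {Y : ℤ} (hk : k' ≤ k) (hY : k * Y ≤ 2 * w) :
    revisitPotential w k' + ((k - k' : ℕ) : ℤ) * (Y + 1) ≤ revisitPotential w k := by
  have : revisitPotential w k = revisitPotential w k' +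
      ∑ j ∈ Finset.Ioc k' k, (1 + 2 * w / j) := by
    unfold revisitPotential
    rw [← Finset.sum_union]
    · congr 1; ext j; simp only [Finset.mem_Icc, Finset.mem_union, Finset.mem_Ioc]; omega
    · rw [Finset.disjoint_left]; intro j; simp only [Finset.mem_Icc, Finset.mem_Ioc]; omega
  rw [this]
  push_cast
  have h2 : ∑ j ∈ Finset.Ioc k' k, (Y + 1) ≤ ∑ j ∈ Finset.Ioc k' k, (1 + 2 * (w : ℤ) / j) := by
    refine Finset.sum_le_sum fun j hj => ?_
    rw [Finset.mem_Ioc] at hj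
    have hj0 : (0 : ℤ) < j := by exact_mod_cast (by omega : 0 < j)
    rcases le_or_gt 0 Y with hY0 | hY0
    · have : Y ≤ 2 * (w : ℤ) / j := by
        rw [Int.le_ediv_iff_mul_le hj0]
        refine le_trans ?_ hY
        rw [mul_comm]
        exact mul_le_mul_of_nonneg_right (by exact_mod_cast hj.2) hY0
      omega
    · have : 0 ≤ 2 * (w : ℤ) / j := Int.ediv_nonneg (by positivity) hj0.le
      omega
  rw [Finset.sum_const, Nat.card_Ioc, nsmul_eq_mul] at h2
  linarith

end WGraph

namespace RAM

/-! ## Reasoning about programs -/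

/-- All numbers in the memory are at most `N` in absolute value. -/
def Bdd (N : ℤ) (s : State) : Prop := (∀ x, |s.var x| ≤ N) ∧ ∀ a i, |s.arr a i| ≤ N

/-- `Run N p s k s'`: the program `p` started in `s` halts in `s'` after `k` steps, and all numbers
written to the memory are at most `N` in absolute value. -/
inductive Run (N : ℤ) : Cmd → State → ℕ → State → Prop
  | skip (s : State) : Run N .skip s 1 s
  | assign (x : ℕ) (e : Expr) (s : State) : |e.val s| ≤ N →
      Run N (.assign x e) s 1 { s with var := Function.update s.var x (e.val s) }
  | write (a : ℕ) (i e : Expr) (s : State) : |e.val s| ≤ N →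
      Run N (.write a i e) s 1
        { s with arr := Function.update s.arr a
                          (Function.update (s.arr a) (i.val s) (e.val s)) }
  | seq (p q : Cmd) (s s' s'' : State) (t t' : ℕ) :
      Run N p s t s' → Run N q s' t' s'' → Run N (.seq p q) s (t + t') s''
  | iteTrue (e : Expr) (p q : Cmd) (s s' : State) (t : ℕ) :
      e.val s ≠ 0 → Run N p s t s' → Run N (.ite e p q) s (1 + t) s'
  | iteFalse (e : Expr) (p q : Cmd) (s s' : State) (t : ℕ) :
      e.val s = 0 → Run N q s t s' → Run N (.ite e p q) s (1 + t) s'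
  | whileTrue (e : Expr) (p : Cmd) (s s' s'' : State) (t t' : ℕ) :
      e.val s ≠ 0 → Run N p s t s' → Run N (.while e p) s' t' s'' →
      Run N (.while e p) s (1 + t + t') s''
  | whileFalse (e : Expr) (p : Cmd) (s : State) :
      e.val s = 0 → Run N (.while e p) s 1 s

/-- The number of nodes of an expression. -/
def Expr.size : Expr → ℕ
  | .const _ => 1
  | .var _ => 1
  | .read _ i => i.size + 1
  | .op _ e f => e.size + f.size + 1

/-- The expression contains no products and quotients, and only constants up to `K`. -/
def Expr.good (K : ℕ) : Expr → Bool
  | .const z => decide (z.natAbs ≤ K)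
  | .var _ => true
  | .read _ i => i.good K
  | .op .mul _ _ => false
  | .op .div _ _ => false
  | .op _ e f => e.good K && f.good K

/-- All expressions of the program are good and of size at most `K`. -/
def Cmd.good (K : ℕ) : Cmd → Bool
  | .skip => true
  | .assign _ e => e.good K && decide (e.size ≤ K)
  | .write _ i e => e.good K && decide (e.size ≤ K) && (i.good K && decide (i.size ≤ K))
  | .seq p q => p.good K && q.good K
  | .ite e p q => e.good K && decide (e.size ≤ K) && (p.good K && q.good K)
  | .while e p => e.good K && decide (e.size ≤ K) && p.good K

/-- Without products and quotients, an operation at most adds the bounds of its arguments, so every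
node costs at most a factor 2. A read needs no such factor, since it returns a stored number. -/
theorem Expr.abs_val_le {N : ℤ} {K : ℕ} {s : State} (hN : 1 ≤ N) (hK : (K : ℤ) ≤ N)
    (hs : Bdd N s) {e : Expr} (he : e.good K) : |e.val s| ≤ 2 ^ e.size * N := by
  induction e with
  | const z =>
    simp only [Expr.good, decide_eq_true_eq] at he
    simp only [Expr.val, Expr.size]
    have : |z| = (z.natAbs : ℤ) := Int.abs_eq_natAbs z
    omega
  | var x => have := hs.1 x; simp only [Expr.val, Expr.size]; omega
  | read a i _ =>
    simp only [Expr.val, Expr.size]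
    refine (hs.2 a _).trans (le_mul_of_one_le_left (by omega) ?_)
    exact one_le_pow₀ (by norm_num)
  | op o e f he1 hf1 =>
    have hone : (1 : ℤ) ≤ 2 ^ (e.size + f.size + 1) * N :=
      hN.trans (le_mul_of_one_le_left (by omega) (one_le_pow₀ (by norm_num)))
    have key : e.good K → f.good K → |e.val s| + |f.val s| ≤ 2 ^ (e.size + f.size + 1) * N := by
      intro h1 h2
      have h3 := he1 h1
      have h4 := hf1 h2
      have h5 : (2 : ℤ) ^ e.size ≤ 2 ^ (e.size + f.size) :=
        pow_le_pow_right₀ (by norm_num) (by omega)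
      have h6 : (2 : ℤ) ^ f.size ≤ 2 ^ (e.size + f.size) :=
        pow_le_pow_right₀ (by norm_num) (by omega)
      rw [pow_succ]
      nlinarith
    cases o <;> simp only [Expr.good, Bool.and_eq_true, Bool.false_eq_true] at he <;>
      simp only [Expr.val, Op.val, Expr.size]
    · exact (abs_add_le _ _).trans (key he.1 he.2)
    · exact (abs_sub _ _).trans (key he.1 he.2)
    · split_ifs <;> simp <;> omega
    · split_ifs <;> simp <;> omega

theorem bits_le {z : ℤ} {n k : ℕ} (h : |z| ≤ 2 ^ k * n) : bits z ≤ 1 + k + Nat.size n := by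
  unfold bits
  have h1 : z.natAbs ≤ n * 2 ^ k := by
    have : ((z.natAbs : ℕ) : ℤ) ≤ ((n * 2 ^ k : ℕ) : ℤ) := by
      push_cast; rw [mul_comm]; exact h
    exact_mod_cast this
  have h2 : Nat.size z.natAbs ≤ Nat.size n + k := by
    rw [Nat.size_le, pow_add]
    exact h1.trans_lt (mul_lt_mul_of_pos_right (Nat.lt_size_self n) (by positivity))
  omega

/-- Each subexpression has a value of at most about size + log n bits, and there are `size` many of
them. -/
theorem Expr.cost_le {n K : ℕ} {s : State} (hN : 1 ≤ n) (hK : K ≤ n)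
    (hs : Bdd n s) {e : Expr} (he : e.good K) :
    e.cost s ≤ e.size * (1 + e.size + Nat.size n) := by
  have hv : ∀ {e : Expr}, e.good K → bits (e.val s) ≤ 1 + e.size + Nat.size n := fun he =>
    bits_le (Expr.abs_val_le (by exact_mod_cast hN) (by exact_mod_cast hK) hs he)
  induction e with
  | const z => simpa [Expr.cost, Expr.size, Expr.val] using hv he
  | var x => simpa [Expr.cost, Expr.size, Expr.val] using hv (e := .var x) he
  | read a i ih =>
    have h1 := ih he
    have h2 := hv (e := .read a i) he
    simp only [Expr.cost, Expr.size, Expr.val] at *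
    nlinarith
  | op o e f he1 hf1 =>
    have h2 := hv he
    have key : e.good K → f.good K →
        e.cost s + f.cost s + bits ((Expr.op o e f).val s) ≤
          (e.size + f.size + 1) * (1 + (e.size + f.size + 1) + Nat.size n) := by
      intro h3 h4
      have h5 := he1 h3
      have h6 := hf1 h4
      simp only [Expr.size] at h2
      nlinarith
    cases o <;> simp only [Expr.good, Bool.and_eq_true, Bool.false_eq_true] at he <;>
      simpa only [Expr.cost, Expr.size, Expr.val] using key he.1 he.2

/-- The cost of a single step. -/
def stepCost (K n : ℕ) : ℕ := 1 + 2 * (K * (1 + K + Nat.size n))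

theorem Expr.cost_le' {n K : ℕ} {s : State} (hN : 1 ≤ n) (hK : K ≤ n)
    (hs : Bdd n s) {e : Expr} (he : e.good K) (hsz : e.size ≤ K) :
    e.cost s ≤ K * (1 + K + Nat.size n) :=
  (Expr.cost_le hN hK hs he).trans (Nat.mul_le_mul hsz (by omega))

theorem Run.bdd {N : ℤ} {p : Cmd} {s s' : State} {k : ℕ} (h : Run N p s k s') (hs : Bdd N s) :
    Bdd N s' := by
  induction h with
  | skip => exact hs
  | assign x e s he =>
    refine ⟨fun y => ?_, hs.2⟩
    simp only [Function.update_apply]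
    split_ifs
    · exact he
    · exact hs.1 y
  | write a i e s he =>
    refine ⟨hs.1, fun b j => ?_⟩
    simp only [Function.update_apply]
    split_ifs with h1
    · simp only [Function.update_apply]
      split_ifs
      · exact he
      · exact hs.2 _ _
    · exact hs.2 _ _
  | seq _ _ _ _ _ _ _ _ _ ih1 ih2 => exact ih2 (ih1 hs)
  | iteTrue _ _ _ _ _ _ _ _ ih => exact ih hs
  | iteFalse _ _ _ _ _ _ _ _ ih => exact ih hs
  | whileTrue _ _ _ _ _ _ _ _ _ _ ih1 ih2 => exact ih2 (ih1 hs)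
  | whileFalse => exact hs

/-- Separates the analysis of programs from bit lengths: it is enough to count steps and to bound
the stored numbers, and each step then has cost at most `stepCost K n`. -/
theorem Run.exec {n K : ℕ} {p : Cmd} {s s' : State} {k : ℕ} (h : Run n p s k s')
    (hN : 1 ≤ n) (hK : K ≤ n) (hp : p.good K) (hs : Bdd n s) :
    ∃ t, Exec p s t s' ∧ t ≤ k * stepCost K n := by
  have hc : ∀ {s : State} {e : Expr}, Bdd n s → e.good K → e.size ≤ K →
      1 + e.cost s ≤ stepCost K n := fun hs he hz => by
    have := Expr.cost_le' hN hK hs he hz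
    unfold stepCost; omega
  induction h with
  | skip s => exact ⟨1, .skip s, by unfold stepCost; omega⟩
  | assign x e s he =>
    simp only [Cmd.good, Bool.and_eq_true, decide_eq_true_eq] at hp
    exact ⟨_, .assign x e s, by have := hc hs hp.1 hp.2; omega⟩
  | write a i e s he =>
    simp only [Cmd.good, Bool.and_eq_true, decide_eq_true_eq] at hp
    refine ⟨_, .write a i e s, ?_⟩
    have h1 := Expr.cost_le' hN hK hs hp.1.1 hp.1.2
    have h2 := Expr.cost_le' hN hK hs hp.2.1 hp.2.2
    unfold stepCost; omega
  | seq p q s s' s'' t t' h1 h2 ih1 ih2 =>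
    simp only [Cmd.good, Bool.and_eq_true] at hp
    obtain ⟨t1, e1, c1⟩ := ih1 hp.1 hs
    obtain ⟨t2, e2, c2⟩ := ih2 hp.2 (h1.bdd hs)
    exact ⟨_, .seq _ _ _ _ _ _ _ e1 e2, by rw [add_mul]; omega⟩
  | iteTrue e p q s s' t h0 h1 ih =>
    simp only [Cmd.good, Bool.and_eq_true, decide_eq_true_eq] at hp
    obtain ⟨t1, e1, c1⟩ := ih hp.2.1 hs
    have := hc hs hp.1.1 hp.1.2
    exact ⟨_, .iteTrue _ _ _ _ _ _ h0 e1, by rw [add_mul]; omega⟩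
  | iteFalse e p q s s' t h0 h1 ih =>
    simp only [Cmd.good, Bool.and_eq_true, decide_eq_true_eq] at hp
    obtain ⟨t1, e1, c1⟩ := ih hp.2.2 hs
    have := hc hs hp.1.1 hp.1.2
    exact ⟨_, .iteFalse _ _ _ _ _ _ h0 e1, by rw [add_mul]; omega⟩
  | whileTrue e p s s' s'' t t' h0 h1 h2 ih1 ih2 =>
    have hp' := hp
    simp only [Cmd.good, Bool.and_eq_true, decide_eq_true_eq] at hp
    obtain ⟨t1, e1, c1⟩ := ih1 hp.2 hs
    obtain ⟨t2, e2, c2⟩ := ih2 hp' (h1.bdd hs)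
    have := hc hs hp.1.1 hp.1.2
    exact ⟨_, .whileTrue _ _ _ _ _ _ _ h0 e1 e2, by rw [add_mul, add_mul]; omega⟩
  | whileFalse e p s h0 =>
    simp only [Cmd.good, Bool.and_eq_true, decide_eq_true_eq] at hp
    exact ⟨_, .whileFalse _ _ _ h0, by have := hc hs hp.1.1 hp.1.2; omega⟩

/-- The variables that a program may change. -/
def Cmd.vars : Cmd → List ℕ
  | .skip => []
  | .assign x _ => [x]
  | .write _ _ _ => []
  | .seq p q => p.vars ++ q.vars
  | .ite _ p q => p.vars ++ q.vars
  | .while _ p => p.vars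

/-- The arrays that a program may change. -/
def Cmd.arrs : Cmd → List ℕ
  | .skip => []
  | .assign _ _ => []
  | .write a _ _ => [a]
  | .seq p q => p.arrs ++ q.arrs
  | .ite _ p q => p.arrs ++ q.arrs
  | .while _ p => p.arrs

/-- The states agree outside the variables and arrays that `p` may change. -/
def Frame (p : Cmd) (s s' : State) : Prop :=
  (∀ x, x ∉ p.vars → s'.var x = s.var x) ∧ ∀ a, a ∉ p.arrs → s'.arr a = s.arr a

theorem Run.frame {N : ℤ} {p : Cmd} {s s' : State} {k : ℕ} (h : Run N p s k s') :
    Frame p s s' := by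
  induction h with
  | skip => exact ⟨fun _ _ => rfl, fun _ _ => rfl⟩
  | assign x e s he =>
    refine ⟨fun y hy => ?_, fun _ _ => rfl⟩
    simp only [Cmd.vars, List.mem_singleton] at hy
    simp [hy]
  | write a i e s he =>
    refine ⟨fun _ _ => rfl, fun b hb => ?_⟩
    simp only [Cmd.arrs, List.mem_singleton] at hb
    simp [hb]
  | seq _ _ _ _ _ _ _ _ _ ih1 ih2 =>
    refine ⟨fun x hx => ?_, fun x hx => ?_⟩ <;>
      simp only [Cmd.vars, Cmd.arrs, List.mem_append, not_or] at hx
    · rw [ih2.1 x hx.2, ih1.1 x hx.1]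
    · rw [ih2.2 x hx.2, ih1.2 x hx.1]
  | iteTrue _ _ _ _ _ _ _ _ ih =>
    refine ⟨fun x hx => ?_, fun x hx => ?_⟩ <;>
      simp only [Cmd.vars, Cmd.arrs, List.mem_append, not_or] at hx
    · exact ih.1 x hx.1
    · exact ih.2 x hx.1
  | iteFalse _ _ _ _ _ _ _ _ ih =>
    refine ⟨fun x hx => ?_, fun x hx => ?_⟩ <;>
      simp only [Cmd.vars, Cmd.arrs, List.mem_append, not_or] at hx
    · exact ih.1 x hx.2
    · exact ih.2 x hx.2
  | whileTrue _ _ _ _ _ _ _ _ _ _ ih1 ih2 =>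
    exact ⟨fun x hx => by rw [ih2.1 x hx, ih1.1 x hx], fun x hx => by rw [ih2.2 x hx, ih1.2 x hx]⟩
  | whileFalse => exact ⟨fun _ _ => rfl, fun _ _ => rfl⟩

/-- Weakest precondition; the last argument of the assertions counts the steps. -/
def wp (N : ℤ) (p : Cmd) (Q : State → ℕ → Prop) (s : State) (t : ℕ) : Prop :=
  ∃ k s', Run N p s k s' ∧ Q s' (t + k)

variable {N : ℤ} {p q : Cmd} {e i : Expr} {Q Q' I : State → ℕ → Prop} {s : State} {t T x a : ℕ}

theorem wp_skip : wp N .skip Q s t ↔ Q s (t + 1) := by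
  constructor
  · rintro ⟨k, s', h, hQ⟩; cases h; exact hQ
  · exact fun h => ⟨_, _, .skip s, h⟩

theorem wp_assign : wp N (.assign x e) Q s t ↔
    |e.val s| ≤ N ∧ Q { s with var := Function.update s.var x (e.val s) } (t + 1) := by
  constructor
  · rintro ⟨k, s', h, hQ⟩; cases h with | assign _ _ _ h => exact ⟨h, hQ⟩
  · exact fun h => ⟨_, _, .assign _ _ s h.1, h.2⟩

theorem wp_write : wp N (.write a i e) Q s t ↔
    |e.val s| ≤ N ∧ Q { s with
      arr := Function.update s.arr a (Function.update (s.arr a) (i.val s) (e.val s)) } (t + 1) := by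
  constructor
  · rintro ⟨k, s', h, hQ⟩; cases h with | write _ _ _ _ h => exact ⟨h, hQ⟩
  · exact fun h => ⟨_, _, .write _ _ _ s h.1, h.2⟩

theorem wp_seq : wp N (.seq p q) Q s t ↔ wp N p (wp N q Q) s t := by
  constructor
  · rintro ⟨k, s', h, hQ⟩
    cases h with
    | seq _ _ _ s1 _ k1 k2 h1 h2 => exact ⟨k1, s1, h1, k2, s', h2, by rwa [add_assoc]⟩
  · rintro ⟨k1, s1, h1, k2, s', h2, h⟩
    exact ⟨_, _, .seq _ _ _ _ _ _ _ h1 h2, by rwa [← add_assoc]⟩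

theorem wp_ite : wp N (.ite e p q) Q s t ↔
    (e.val s ≠ 0 → wp N p Q s (t + 1)) ∧ (e.val s = 0 → wp N q Q s (t + 1)) := by
  constructor
  · rintro ⟨k, s', h, hQ⟩
    cases h with
    | iteTrue _ _ _ _ _ k h0 h1 =>
      exact ⟨fun _ => ⟨k, s', h1, by rwa [add_assoc]⟩, fun h => absurd h h0⟩
    | iteFalse _ _ _ _ _ k h0 h1 =>
      exact ⟨fun h => absurd h0 h, fun _ => ⟨k, s', h1, by rwa [add_assoc]⟩⟩
  · rintro ⟨h1, h2⟩
    by_cases h0 : e.val s = 0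
    · obtain ⟨k, s', h, hQ⟩ := h2 h0
      exact ⟨_, _, .iteFalse _ _ _ _ _ _ h0 h, by rwa [← add_assoc]⟩
    · obtain ⟨k, s', h, hQ⟩ := h1 h0
      exact ⟨_, _, .iteTrue _ _ _ _ _ _ h0 h, by rwa [← add_assoc]⟩

theorem wp_conseq (hb : Bdd N s) (h : wp N p Q s t)
    (hQ : ∀ s' t', Bdd N s' → Frame p s s' → Q s' t' → Q' s' t') : wp N p Q' s t := by
  obtain ⟨k, s', hr, h⟩ := h
  exact ⟨k, s', hr, hQ _ _ (hr.bdd hb) hr.frame h⟩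

theorem Frame.refl (p : Cmd) (s : State) : Frame p s s := ⟨fun _ _ => rfl, fun _ _ => rfl⟩

theorem Frame.trans {s' s'' : State} (h : Frame p s s') (h' : Frame p s' s'') : Frame p s s'' :=
  ⟨fun x hx => by rw [h'.1 x hx, h.1 x hx], fun x hx => by rw [h'.2 x hx, h.2 x hx]⟩

/-- The step counter doubles as termination measure: it increases in every round and the invariant
keeps it below T. The invariant may use that the frame of the body is unchanged since the loop was
entered. -/
theorem wp_while (hb : Bdd N s) (T : ℕ) (I : State → ℕ → Prop) (h0 : I s t)
    (h : ∀ s' t', Bdd N s' → Frame p s s' → I s' t' → t' ≤ T ∧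
      (e.val s' ≠ 0 → wp N p I s' (t' + 1)) ∧ (e.val s' = 0 → Q s' (t' + 1))) :
    wp N (.while e p) Q s t := by
  have key : ∀ n s' t', T < t' + n → Bdd N s' → Frame p s s' → I s' t' →
      wp N (.while e p) Q s' t' := by
    intro n
    induction n with
    | zero => intro s' t' hn hb' hf hI; have := (h s' t' hb' hf hI).1; omega
    | succ n ih =>
      intro s' t' hn hb' hf hI
      obtain ⟨-, h1, h2⟩ := h s' t' hb' hf hI
      by_cases hz : e.val s' = 0
      · exact ⟨_, _, .whileFalse _ _ _ hz, h2 hz⟩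
      · obtain ⟨k, s1, hr, hI1⟩ := h1 hz
        obtain ⟨k2, s2, hr2, hQ⟩ := ih s1 (t' + 1 + k) (by omega) (hr.bdd hb')
          (hf.trans hr.frame) hI1
        exact ⟨_, _, .whileTrue _ _ _ _ _ _ _ hz hr hr2, by
          rwa [show t' + (1 + k + k2) = t' + 1 + k + k2 by omega]⟩
  exact key (T + 1) s t (by omega) hb (Frame.refl _ _) h0

/-! ## Linked lists -/

/-- Following the pointers `n` from `h` one meets the elements of the list; `0` ends the list. -/
def Linked (n : ℤ → ℤ) : ℤ → List ℤ → Prop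
  | h, [] => h = 0
  | h, e :: l => h = e ∧ e ≠ 0 ∧ Linked n (n e) l

theorem Linked.update {n : ℤ → ℤ} {e v : ℤ} : ∀ {l : List ℤ} {h : ℤ}, e ∉ l → Linked n h l →
    Linked (Function.update n e v) h l
  | [], _, _, hl => hl
  | f :: l, h, he, hl => by
    simp only [List.mem_cons, not_or] at he
    refine ⟨hl.1, hl.2.1, ?_⟩
    rw [Function.update_of_ne (Ne.symm he.1)]
    exact Linked.update he.2 hl.2.2

/-- For every `j ∈ D` the linked list with head `h j` consists of the elements `e` of `R` with
`key e = j`. -/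
def Lists (D : Set ℤ) (h n key : ℤ → ℤ) (R : Finset ℤ) : Prop :=
  ∀ j ∈ D, ∃ l, Linked n (h j) l ∧ l.Nodup ∧ ∀ e, e ∈ l ↔ e ∈ R ∧ key e = j

namespace Lists

variable {D : Set ℤ} {h n key key' : ℤ → ℤ} {R : Finset ℤ} {j e : ℤ}

theorem empty (h0 : ∀ j ∈ D, h j = 0) : Lists D h n key ∅ := fun j hj =>
  ⟨[], h0 j hj, by simp, by simp⟩

/-- The keys of edges outside the lists may change freely. This is used for the buckets, whose keys
depend on distances that are found later. -/
theorem congr_key (hl : Lists D h n key R) (hk : ∀ e ∈ R, key e = key' e) :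
    Lists D h n key' R := fun j hj => by
  obtain ⟨l, h1, h2, h3⟩ := hl j hj
  refine ⟨l, h1, h2, fun e => (h3 e).trans ?_⟩
  constructor
  · rintro ⟨h4, h5⟩; exact ⟨h4, by rw [← hk e h4]; exact h5⟩
  · rintro ⟨h4, h5⟩; exact ⟨h4, by rw [hk e h4]; exact h5⟩

theorem ne_of_head (hl : Lists D h n key R) (hj : j ∈ D) (h0 : h j = 0) : ∀ e ∈ R, key e ≠ j := by
  intro e he hk
  obtain ⟨l, h1, h2, h3⟩ := hl j hj
  have := (h3 e).2 ⟨he, hk⟩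
  cases l with
  | nil => simp at this
  | cons f l => exact h1.2.1 (h1.1 ▸ h0)

theorem pop (hl : Lists D h n key R) (hj : j ∈ D) (h0 : h j ≠ 0) :
    h j ∈ R ∧ key (h j) = j ∧ Lists D (Function.update h j (n (h j))) n key (R.erase (h j)) := by
  obtain ⟨l, h1, h2, h3⟩ := hl j hj
  cases l with
  | nil => exact absurd h1 h0
  | cons f l =>
    obtain ⟨rfl, hf0, h4⟩ := h1
    have hf := (h3 (h j)).1 (by simp)
    refine ⟨hf.1, hf.2, fun j' hj' => ?_⟩
    rw [List.nodup_cons] at h2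
    by_cases hjj : j' = j
    · subst hjj
      rw [Function.update_self]
      refine ⟨l, h4, h2.2, fun e => ?_⟩
      have := h3 e
      rw [List.mem_cons] at this
      rw [Finset.mem_erase]
      constructor
      · intro he
        exact ⟨⟨fun h => h2.1 (h ▸ he), (this.1 (Or.inr he)).1⟩, (this.1 (Or.inr he)).2⟩
      · rintro ⟨⟨h5, h6⟩, h7⟩
        exact (this.2 ⟨h6, h7⟩).resolve_left h5
    · rw [Function.update_of_ne hjj]
      obtain ⟨l', k1, k2, k3⟩ := hl j' hj'
      refine ⟨l', k1, k2, fun e => (k3 e).trans ?_⟩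
      rw [Finset.mem_erase]
      constructor
      · rintro ⟨h5, h6⟩
        exact ⟨⟨fun h => hjj (by rw [← h6, h, hf.2]), h5⟩, h6⟩
      · rintro ⟨⟨_, h5⟩, h6⟩; exact ⟨h5, h6⟩

theorem push (hl : Lists D h n key R) (he : e ∉ R) (he0 : e ≠ 0) :
    Lists D (Function.update h (key e) e) (Function.update n e (h (key e))) key (insert e R) := by
  intro j hj
  obtain ⟨l, h1, h2, h3⟩ := hl j hj
  have hel : e ∉ l := fun h => he ((h3 e).1 h).1
  by_cases hjj : j = key e
  · subst hjj
    rw [Function.update_self]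
    refine ⟨e :: l, ⟨rfl, he0, ?_⟩, List.nodup_cons.2 ⟨hel, h2⟩, fun f => ?_⟩
    · rw [Function.update_self]
      exact h1.update hel
    · rw [List.mem_cons, Finset.mem_insert, h3 f]
      constructor
      · rintro (rfl | ⟨h4, h5⟩)
        · exact ⟨Or.inl rfl, rfl⟩
        · exact ⟨Or.inr h4, h5⟩
      · rintro ⟨rfl | h4, h5⟩
        · exact Or.inl rfl
        · exact Or.inr ⟨h4, h5⟩
  · rw [Function.update_of_ne hjj]
    refine ⟨l, h1.update hel, h2, fun f => ?_⟩
    rw [Finset.mem_insert, h3 f]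
    constructor
    · rintro ⟨h4, h5⟩; exact ⟨Or.inr h4, h5⟩
    · rintro ⟨rfl | h4, h5⟩
      · exact absurd h5.symm hjj
      · exact ⟨h4, h5⟩

end Lists

end RAM

namespace RAM

set_option linter.unusedSectionVars false

/-! ## The memory layout -/

notation "aEA" => (4 : ℕ)
notation "aEB" => (5 : ℕ)
notation "aWt" => (6 : ℕ)
notation "aPc" => (7 : ℕ)
notation "aOr" => (8 : ℕ)
notation "aMA" => (9 : ℕ)
notation "aMB" => (10 : ℕ)
notation "aYA" => (11 : ℕ)
notation "aYB" => (12 : ℕ)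
notation "aLH" => (13 : ℕ)
notation "aLN" => (14 : ℕ)
notation "aDA" => (15 : ℕ)
notation "aDB" => (16 : ℕ)
notation "aBK" => (17 : ℕ)
notation "aNX" => (18 : ℕ)
notation "aFl" => (19 : ℕ)
notation "aRt" => (20 : ℕ)
notation "aVs" => (21 : ℕ)
notation "aSt" => (22 : ℕ)
notation "aAf" => (23 : ℕ)
notation "xLo" => (3 : ℕ)
notation "xHi" => (4 : ℕ)
notation "xE" => (5 : ℕ)
notation "xD" => (6 : ℕ)
notation "xFd" => (7 : ℕ)
notation "xF" => (8 : ℕ)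
notation "xG" => (9 : ℕ)
notation "xB" => (10 : ℕ)
notation "xK" => (11 : ℕ)
notation "xSp" => (12 : ℕ)
notation "xNv" => (13 : ℕ)
notation "xRes" => (14 : ℕ)
notation "xI" => (15 : ℕ)
notation "xA" => (16 : ℕ)

/-- Sequential composition. -/
infixr:60 " ;; " => Cmd.seq

/-- Addition of expressions. -/
abbrev Expr.plus (e f : Expr) : Expr := .op .add e f
/-- Subtraction of expressions. -/
abbrev Expr.minus (e f : Expr) : Expr := .op .sub e f
/-- Comparison of expressions. -/
abbrev Expr.less (e f : Expr) : Expr := .op .lt e f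
/-- Equality test of expressions. -/
abbrev Expr.equal (e f : Expr) : Expr := .op .eq e f

/-- Run `body` for all `xE` from `xLo` to `xHi`. -/
def forEdges (body : Cmd) : Cmd :=
  .assign xE (.var xLo) ;;
  .while (.less (.var xE) (.plus (.var xHi) (.const 1)))
    (body ;; .assign xE (.plus (.var xE) (.const 1)))

/-- A loop rule with an invariant indexed by the current edge number; it speaks of the state after
the increment, so that initial and final values are `lo` and `hi + 1`. -/
theorem wp_forEdges {N : ℤ} {body : Cmd} {Q : State → ℕ → Prop} {s : State} {t : ℕ} {lo hi : ℤ}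
    (hb : Bdd N s) (T : ℕ) (I : ℤ → State → ℕ → Prop) (hlo : s.var xLo = lo)
    (hhi : s.var xHi = hi) (hle : lo ≤ hi + 1) (hlo0 : 0 ≤ lo) (hN : hi + 1 ≤ N)
    (h4 : xHi ∉ body.vars) (h5 : xE ∉ body.vars)
    (h0 : I lo { s with var := Function.update s.var xE lo } (t + 1))
    (hT : ∀ i s' t', i ≤ hi + 1 → I i s' t' → t' ≤ T)
    (hstep : ∀ i s' t', lo ≤ i → i ≤ hi → Bdd N s' → Frame (forEdges body) s s' →
      s'.var xE = i → I i s' t' →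
      wp N body (fun s'' t'' => I (i + 1) { s'' with var := Function.update s''.var xE (i + 1) }
        (t'' + 1)) s' (t' + 1))
    (hQ : ∀ s' t', Bdd N s' → Frame (forEdges body) s s' → I (hi + 1) s' t' → Q s' (t' + 1)) :
    wp N (forEdges body) Q s t := by
  have hfr : ∀ s', Frame (.while (.less (.var xE) (.plus (.var xHi) (.const 1)))
      (body ;; .assign xE (.plus (.var xE) (.const 1))))
      { s with var := Function.update s.var xE lo } s' → Frame (forEdges body) s s' := by
    intro s' h
    refine ⟨fun x hx => ?_, fun x hx => ?_⟩
    · simp only [forEdges, Cmd.vars, List.mem_append, List.mem_singleton, not_or] at hx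
      rw [h.1 x (by simp [Cmd.vars, hx])]
      simp [hx]
    · simp only [forEdges, Cmd.arrs, List.mem_append, not_or] at hx
      rw [h.2 x (by simp [Cmd.arrs, hx])]
  unfold forEdges
  rw [wp_seq, wp_assign]
  simp only [Expr.val, hlo]
  have hloN : |lo| ≤ N := by rw [abs_of_nonneg hlo0]; omega
  refine ⟨hloN, ?_⟩
  have hb1 : Bdd N { s with var := Function.update s.var xE lo } := by
    refine ⟨fun x => ?_, hb.2⟩
    simp only [Function.update_apply]; split_ifs
    · exact hloN
    · exact hb.1 x
  refine wp_while hb1 T (fun s' t' => ∃ i, s'.var xE = i ∧ lo ≤ i ∧ i ≤ hi + 1 ∧ I i s' t')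
    ⟨lo, by simp, le_rfl, hle, h0⟩ ?_
  rintro s' t' hb' hf ⟨i, hi1, hi2, hi3, hI⟩
  have hf' := hfr s' hf
  have e4 : s'.var xHi = hi := by
    rw [hf'.1 xHi (by simp [forEdges, Cmd.vars, h4]), hhi]
  refine ⟨hT i s' t' hi3 hI, ?_, ?_⟩
  · intro hc
    simp only [Expr.val, Op.val, hi1, e4, ne_eq, ite_eq_right_iff, one_ne_zero, imp_false,
      not_not] at hc
    rw [wp_seq]
    refine wp_conseq hb' (hstep i s' t' hi2 (by omega) hb' hf' hi1 hI) ?_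
    intro s'' t'' hb'' hf'' hI''
    have e5 : s''.var xE = i := by rw [hf''.1 xE h5, hi1]
    rw [wp_assign]
    simp only [Expr.val, Op.val, e5]
    exact ⟨by rw [abs_le]; omega, i + 1, by simp, by omega, by omega, hI''⟩
  · intro hc
    simp only [Expr.val, Op.val, hi1, e4, ite_eq_right_iff, one_ne_zero, imp_false] at hc
    have : i = hi + 1 := by omega
    subst this
    exact hQ s' t' hb' hf' hI

/-- The data on which the program for the phases works: the edges with numbers from `lo` to `hi`
form a graph; `oa` and `ob` are the contents of the arrays for the matching at places that do not
belong to the graph. -/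
structure Layout (A B : Type) where
  G : WGraph A B
  ia : A → ℤ
  ib : B → ℤ
  ed : ℤ → A × B
  lo : ℤ
  hi : ℤ
  w : ℤ → ℤ
  pc : ℤ → ℤ
  oa : ℤ → ℤ
  ob : ℤ → ℤ
  ia_inj : Function.Injective ia
  ib_inj : Function.Injective ib
  one_le : 1 ≤ lo
  lo_le : lo ≤ hi
  ed_inj : ∀ e f, lo ≤ e → e ≤ hi → lo ≤ f → f ≤ hi → ed e = ed f → e = f
  ed_mem : ∀ e, lo ≤ e → e ≤ hi → ed e ∈ G.E
  ed_surj : ∀ x ∈ G.E, ∃ e, lo ≤ e ∧ e ≤ hi ∧ ed e = x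
  weight : ∀ e, lo ≤ e → e ≤ hi → (G.c (ed e) : ℤ) = w e
  piece : ∀ e f, lo ≤ e → e ≤ hi → lo ≤ f → f ≤ hi → w e = 0 → w f = 0 →
    (pc e = pc f ↔ G.zeroGraph.connectedComponentMk (Sum.inl (ed e).1) =
      G.zeroGraph.connectedComponentMk (Sum.inl (ed f).1))

namespace Layout

variable {A B : Type} [DecidableEq A] [DecidableEq B] (X : Layout A B)

/-- The vertices of `A` on edges. -/
def IA (a : A) : Prop := ∃ e, X.lo ≤ e ∧ e ≤ X.hi ∧ (X.ed e).1 = a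

/-- The vertices of `B` on edges. -/
def IB (b : B) : Prop := ∃ e, X.lo ≤ e ∧ e ≤ X.hi ∧ (X.ed e).2 = b

/-- The numbers of the vertices of `B` on edges. -/
def dom : Set ℤ := {j | ∃ b, X.IB b ∧ X.ib b = j}

/-- The end of an edge in `B`. -/
def keyB (e : ℤ) : ℤ := X.ib (X.ed e).2

/-- The memory cells that the program for the phases does not change. -/
structure Static (s : State) : Prop where
  ea : ∀ e, X.lo ≤ e → e ≤ X.hi → s.arr aEA e = X.ia (X.ed e).1
  eb : ∀ e, X.lo ≤ e → e ≤ X.hi → s.arr aEB e = X.ib (X.ed e).2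
  wt : ∀ e, X.lo ≤ e → e ≤ X.hi → s.arr aWt e = X.w e
  pc : ∀ e, X.lo ≤ e → e ≤ X.hi → s.arr aPc e = X.pc e
  lo : s.var xLo = X.lo
  hi : s.var xHi = X.hi

/-- The arrays for the matching represent `M`. -/
structure Mates (M : Finset (A × B)) (ma mb : ℤ → ℤ) : Prop where
  left : ∀ a, X.IA a → (WGraph.FreeA M a ∧ ma (X.ia a) = 0) ∨
    ∃ g, X.lo ≤ g ∧ g ≤ X.hi ∧ X.ed g ∈ M ∧ (X.ed g).1 = a ∧ ma (X.ia a) = g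
  right : ∀ b, X.IB b → (WGraph.FreeB M b ↔ mb (X.ib b) = 0)
  left_out : ∀ i, (∀ a, X.IA a → X.ia a ≠ i) → ma i = X.oa i
  right_out : ∀ i, (∀ b, X.IB b → X.ib b ≠ i) → mb i = X.ob i

/-- The arrays for the dual weights represent `y`. -/
structure Duals (y : A ⊕ B → ℤ) (ya yb : ℤ → ℤ) : Prop where
  left : ∀ a, X.IA a → ya (X.ia a) = y (Sum.inl a)
  right : ∀ b, X.IB b → yb (X.ib b) = y (Sum.inr b)

/-- The unmatched edges. -/
noncomputable def unmatched (M : Finset (A × B)) : Finset ℤ :=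
  (Finset.Icc X.lo X.hi).filter fun e => X.ed e ∉ M

variable {X}

theorem ia_mem {e : ℤ} (h1 : X.lo ≤ e) (h2 : e ≤ X.hi) : X.IA (X.ed e).1 := ⟨e, h1, h2, rfl⟩

theorem ib_mem {e : ℤ} (h1 : X.lo ≤ e) (h2 : e ≤ X.hi) : X.IB (X.ed e).2 := ⟨e, h1, h2, rfl⟩

theorem keyB_mem {e : ℤ} (h1 : X.lo ≤ e) (h2 : e ≤ X.hi) : X.keyB e ∈ X.dom :=
  ⟨_, ib_mem h1 h2, rfl⟩

theorem Static.of_frame {s s' : State} {p : Cmd} (h : X.Static s) (hf : Frame p s s')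
    (h4 : aEA ∉ p.arrs) (h5 : aEB ∉ p.arrs) (h6 : aWt ∉ p.arrs) (h7 : aPc ∉ p.arrs)
    (k3 : xLo ∉ p.vars) (k4 : xHi ∉ p.vars) : X.Static s' :=
  ⟨by rw [hf.2 _ h4]; exact h.ea, by rw [hf.2 _ h5]; exact h.eb, by rw [hf.2 _ h6]; exact h.wt,
    by rw [hf.2 _ h7]; exact h.pc, by rw [hf.1 _ k3]; exact h.lo, by rw [hf.1 _ k4]; exact h.hi⟩

theorem Mates.mem_iff {M : Finset (A × B)} {ma mb : ℤ → ℤ} (h : X.Mates M ma mb)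
    (hM : X.G.IsMatching M) {e : ℤ} (h1 : X.lo ≤ e) (h2 : e ≤ X.hi) :
    X.ed e ∈ M ↔ ma (X.ia (X.ed e).1) = e := by
  have hl := X.one_le
  rcases h.left _ (ia_mem h1 h2) with ⟨h3, h4⟩ | ⟨g, g1, g2, g3, g4, g5⟩
  · constructor
    · intro h5; exact absurd rfl (h3 _ h5)
    · intro h5; omega
  · rw [g5]
    constructor
    · intro h5
      exact X.ed_inj _ _ g1 g2 h1 h2 (hM.2 _ g3 _ h5 (Or.inl g4))
    · rintro rfl; exact g3

end Layout

/-! ## Preparing a phase -/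

/-- Clear the arrays of a phase and build the lists of unmatched edges. -/
def buildLists : Cmd :=
  forEdges (
    .write aLH (.read aEB (.var xE)) (.const 0) ;;
    .write aDA (.read aEA (.var xE)) (.const 0) ;;
    .write aDB (.read aEB (.var xE)) (.const 0) ;;
    .write aFl (.read aEA (.var xE)) (.const 0) ;;
    .write aRt (.read aEB (.var xE)) (.const 0)) ;;
  forEdges (
    .ite (.equal (.read aMA (.read aEA (.var xE))) (.var xE)) .skip (
      .write aLN (.var xE) (.read aLH (.read aEB (.var xE))) ;;
      .write aLH (.read aEB (.var xE)) (.var xE)))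

section

variable {A B : Type} [DecidableEq A] [DecidableEq B] {X : Layout A B} {N : ℤ} {s : State} {t : ℕ}
  {M : Finset (A × B)} {y : A ⊕ B → ℤ}

/-- Cells are cleared through the edges that refer to them. Thus the cost depends only on the edges
of the layout, which matters when the layout is a single small piece of a large graph. -/
theorem buildLists_spec (hN : X.hi + 1 ≤ N) (hb : Bdd N s) (hs : X.Static s)
    (hM : X.G.IsMatching M) (hm : X.Mates M (s.arr aMA) (s.arr aMB)) :
    wp N buildLists (fun s' t' => (t' : ℤ) ≤ t + 12 * (X.hi + 1 - X.lo) + 4 ∧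
      Lists X.dom (s'.arr aLH) (s'.arr aLN) X.keyB (X.unmatched M) ∧
      (∀ a, X.IA a → s'.arr aDA (X.ia a) = 0 ∧ s'.arr aFl (X.ia a) = 0) ∧
      ∀ b, X.IB b → s'.arr aDB (X.ib b) = 0 ∧ s'.arr aRt (X.ib b) = 0) s t := by
  have hl := X.one_le
  have hle := X.lo_le
  unfold buildLists
  rw [wp_seq]
  refine wp_forEdges (lo := X.lo) (hi := X.hi) hb (t + 7 * (X.hi + 1 - X.lo) + 1).toNat
    (fun i s' t' => (t' : ℤ) ≤ t + 7 * (i - X.lo) + 1 ∧ ∀ e, X.lo ≤ e → e < i →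
      s'.arr aLH (X.ib (X.ed e).2) = 0 ∧ s'.arr aDA (X.ia (X.ed e).1) = 0 ∧
      s'.arr aDB (X.ib (X.ed e).2) = 0 ∧ s'.arr aFl (X.ia (X.ed e).1) = 0 ∧
      s'.arr aRt (X.ib (X.ed e).2) = 0) hs.lo hs.hi (by omega) (by omega) hN (by decide)
    (by decide) ?_ ?_ ?_ ?_
  · refine ⟨by push_cast; omega, fun e h1 h2 => by omega⟩
  · rintro i s' t' hi ⟨h, -⟩; omega
  · rintro i s' t' hi1 hi2 hb' hf he ⟨ht, hI⟩
    have hs' := hs.of_frame hf (by decide) (by decide) (by decide) (by decide) (by decide)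
      (by decide)
    simp only [wp_seq, wp_write, Expr.val, he, abs_zero]
    refine ⟨by omega, by omega, by omega, by omega, by omega, by push_cast; omega, ?_⟩
    simp [Function.update_apply, hs'.ea i hi1 hi2, hs'.eb i hi1 hi2]
    intro e h1 h2
    rcases eq_or_ne e i with rfl | hne
    · simp
    · obtain ⟨k1, k2, k3, k4, k5⟩ := hI e h1 (by omega)
      simp [k1, k2, k3, k4, k5]
  intro s1 t1 hb1 hf1 ⟨ht1, hI1⟩
  have hs1 := hs.of_frame hf1 (by decide) (by decide) (by decide) (by decide) (by decide)
      (by decide)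
  have hm1 : X.Mates M (s1.arr aMA) (s1.arr aMB) := by
    rw [hf1.2 aMA (by decide), hf1.2 aMB (by decide)]; exact hm
  refine wp_forEdges (lo := X.lo) (hi := X.hi) hb1 (t + 12 * (X.hi + 1 - X.lo) + 4).toNat
    (fun i s' t' => (t' : ℤ) ≤ t + 7 * (X.hi + 1 - X.lo) + 5 * (i - X.lo) + 3 ∧
      Lists X.dom (s'.arr aLH) (s'.arr aLN) X.keyB ((X.unmatched M).filter (· < i)))
    hs1.lo hs1.hi (by omega) (by omega) hN (by decide)
    (by decide) ?_ ?_ ?_ ?_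
  · refine ⟨by push_cast; omega, ?_⟩
    have : (X.unmatched M).filter (· < X.lo) = ∅ := by
      ext e; simp [Layout.unmatched]; omega
    rw [this]
    apply Lists.empty
    rintro j ⟨b, ⟨e, h1, h2, rfl⟩, rfl⟩
    exact (hI1 e h1 (by omega)).1
  · rintro i s' t' hi ⟨h, -⟩; omega
  · rintro i s' t' hi1 hi2 hb' hf he ⟨ht, hI⟩
    have hs' := hs1.of_frame hf (by decide) (by decide) (by decide) (by decide) (by decide)
      (by decide)
    have hm' : X.Mates M (s'.arr aMA) (s'.arr aMB) := by
      rw [hf.2 aMA (by decide), hf.2 aMB (by decide)]; exact hm1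
    have hmem := hm'.mem_iff hM hi1 hi2
    simp only [wp_ite, wp_skip, wp_seq, wp_write, Expr.val, Op.val, he, hs'.ea i hi1 hi2,
      hs'.eb i hi1 hi2, ← hmem]
    refine ⟨fun h => ?_, fun h => ?_⟩
    · have h' : X.ed i ∈ M := by by_contra hc; simp [hc] at h
      refine ⟨by push_cast; omega, ?_⟩
      have : (X.unmatched M).filter (· < i + 1) = (X.unmatched M).filter (· < i) := by
        ext e; simp only [Layout.unmatched, Finset.mem_filter, Finset.mem_Icc]
        constructor
        · rintro ⟨⟨h1, h2⟩, h3⟩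
          refine ⟨⟨h1, h2⟩, lt_of_le_of_ne (by omega) ?_⟩
          rintro rfl; exact h2 h'
        · rintro ⟨h1, h2⟩; exact ⟨h1, by omega⟩
      rw [this]; exact hI
    · have h' : X.ed i ∉ M := by intro hc; simp [hc] at h
      have hnot : i ∉ (X.unmatched M).filter (· < i) := by simp
      have hp := hI.push hnot (by omega)
      have : (X.unmatched M).filter (· < i + 1) = insert i ((X.unmatched M).filter (· < i)) := by
        ext e; simp only [Layout.unmatched, Finset.mem_filter, Finset.mem_Icc, Finset.mem_insert]
        constructor
        · rintro ⟨⟨h1, h2⟩, h3⟩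
          rcases eq_or_ne e i with rfl | hne
          · exact Or.inl rfl
          · exact Or.inr ⟨⟨h1, h2⟩, by omega⟩
        · rintro (rfl | ⟨h1, h2⟩)
          · exact ⟨⟨⟨hi1, hi2⟩, h'⟩, by omega⟩
          · exact ⟨h1, by omega⟩
      rw [this]
      refine ⟨hb'.2 _ _, ?_, by push_cast; omega, ?_⟩
      · rw [abs_le]; omega
      · simpa [Function.update_apply, he, hs'.eb i hi1 hi2, Layout.keyB] using hp
  · rintro s2 t2 hb2 hf2 ⟨ht2, hl2⟩
    refine ⟨by push_cast; omega, ?_, ?_, ?_⟩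
    · have : (X.unmatched M).filter (· < X.hi + 1) = X.unmatched M := by
        rw [Finset.filter_true_of_mem]
        intro e he
        simp only [Layout.unmatched, Finset.mem_filter, Finset.mem_Icc] at he
        omega
      rwa [this] at hl2
    · rintro a ⟨e, h1, h2, rfl⟩
      rw [hf2.2 aDA (by decide), hf2.2 aFl (by decide)]
      have := hI1 e h1 (by omega)
      exact ⟨this.2.1, this.2.2.2.1⟩
    · rintro b ⟨e, h1, h2, rfl⟩
      rw [hf2.2 aDB (by decide), hf2.2 aRt (by decide)]
      have := hI1 e h1 (by omega)
      exact ⟨this.2.2.1, this.2.2.2.2⟩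

end

end RAM

/-! ### Invariants of the bucket search for distances -/

namespace RAM

set_option linter.unusedSectionVars false

open WGraph

namespace Layout

variable {A B : Type} [DecidableEq A] [DecidableEq B] (X : Layout A B)

/-- The slack of an unmatched edge. -/
def sl (y : A ⊕ B → ℤ) (e : ℤ) : ℤ := X.w e + y (Sum.inl (X.ed e).1) - y (Sum.inr (X.ed e).2)

/-- The bucket of an edge. -/
def bucket (y : A ⊕ B → ℤ) (db : ℤ → ℤ) (e : ℤ) : ℤ := db (X.keyB e) - 1 + X.sl y e

/-- Invariants of the search for distances: `da` and `db` contain the distances found so far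
(plus one; `0` means that there is none yet), `R` is the set of edges in the buckets, `S` the set of
edges that have been put into buckets, `F` a set of edges with different ends in `A` that have been
used, and the edges of `pend` are still to be put into buckets. -/
structure Dial (M : Finset (A × B)) (y : A ⊕ B → ℤ) (Y : ℤ) (da db : ℤ → ℤ) (d : ℤ)
    (R S F : Finset ℤ) (pend : List ℤ) : Prop where
  R_sub : ∀ e ∈ R, e ∈ S
  S_sub : ∀ e ∈ S, e ∈ X.unmatched M ∧ db (X.keyB e) ≠ 0
  pend_nodup : pend.Nodup
  pend_sub : ∀ e ∈ pend, e ∉ S ∧ e ∈ X.unmatched M ∧ db (X.keyB e) = d + 1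
  key_ge : ∀ e ∈ R, d ≤ X.bucket y db e
  d_nonneg : 0 ≤ d
  finB : ∀ b, X.IB b → db (X.ib b) ≠ 0 → db (X.ib b) - 1 ≤ d ∧
    -- Distance minus dual weight grows by the weight of the edge along unmatched and along matched
    -- arcs alike. So each new vertex of B adds at most 2, which is paid by an edge added to F; a
    -- free vertex starts with 0 - Y.
    db (X.ib b) - 1 ≤ 2 * F.card + y (Sum.inr b) - Y ∧
    ∃ k : ℕ, X.G.SlackWalk M y (Sum.inr b) k ∧ (k : ℤ) = db (X.ib b) - 1
  finA : ∀ a, X.IA a → da (X.ia a) ≠ 0 → da (X.ia a) - 1 ≤ d ∧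
    ∃ k : ℕ, X.G.SlackWalk M y (Sum.inl a) k ∧ (k : ℤ) = da (X.ia a) - 1
  source : ∀ b, X.IB b → FreeB M b → db (X.ib b) = 1
  relax : ∀ e, X.lo ≤ e → e ≤ X.hi → X.ed e ∉ M → db (X.keyB e) ≠ 0 →
    e ∈ R ∨ e ∈ pend ∨ (da (X.ia (X.ed e).1) ≠ 0 ∧ da (X.ia (X.ed e).1) ≤ db (X.keyB e) + X.sl y e)
  matched : ∀ e, X.lo ≤ e → e ≤ X.hi → X.ed e ∈ M → da (X.ia (X.ed e).1) = db (X.keyB e)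
  F_sub : ∀ e ∈ F, X.lo ≤ e ∧ e ≤ X.hi ∧ da (X.ia (X.ed e).1) ≠ 0

variable {X} {M : Finset (A × B)} {y : A ⊕ B → ℤ} {Y : ℤ}

theorem mem_unmatched {e : ℤ} : e ∈ X.unmatched M ↔ (X.lo ≤ e ∧ e ≤ X.hi) ∧ X.ed e ∉ M := by
  simp [unmatched]

theorem slack_eq {e : ℤ} (h : e ∈ X.unmatched M) : X.G.slack M y (X.ed e) = X.sl y e := by
  rw [mem_unmatched] at h
  rw [slack, if_neg h.2, X.weight e h.1.1 h.1.2]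
  rfl

theorem arc_of {e : ℤ} (h : e ∈ X.unmatched M) :
    X.G.Arc M (Sum.inr (X.ed e).2) (X.ed e) (Sum.inl (X.ed e).1) := by
  rw [mem_unmatched] at h
  exact .unmatched _ _ (X.ed_mem e h.1.1 h.1.2) h.2

theorem sl_nonneg (hF : X.G.Feasible M y Y) {e : ℤ} (h : e ∈ X.unmatched M) : 0 ≤ X.sl y e := by
  rw [← slack_eq (y := y) h]
  exact hF.slack_nonneg (arc_of h)

theorem w_cases {e : ℤ} (h1 : X.lo ≤ e) (h2 : e ≤ X.hi) : X.w e = 0 ∨ X.w e = 1 := by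
  rw [← X.weight e h1 h2]
  have := X.G.c_zero_or_one _ (X.ed_mem e h1 h2)
  omega

theorem card_le (F : Finset ℤ) (hF : ∀ e ∈ F, X.lo ≤ e ∧ e ≤ X.hi) :
    (F.card : ℤ) ≤ X.hi + 1 - X.lo := by
  have h : F ⊆ Finset.Icc X.lo X.hi := fun e he => Finset.mem_Icc.2 (hF e he)
  have h1 := Finset.card_le_card h
  have := X.lo_le
  rw [Int.card_Icc] at h1
  omega

namespace Dial

variable {da db : ℤ → ℤ} {d : ℤ} {R S F : Finset ℤ} {pend : List ℤ}

theorem card_F_le (h : X.Dial M y Y da db d R S F pend) : (F.card : ℤ) ≤ X.hi + 1 - X.lo :=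
  card_le F fun e he => ⟨(h.F_sub e he).1, (h.F_sub e he).2.1⟩

theorem card_S_le (h : X.Dial M y Y da db d R S F pend) : (S.card : ℤ) ≤ X.hi + 1 - X.lo :=
  card_le S fun e he => (mem_unmatched.1 (h.S_sub e he).1).1

/-- One more unmatched arc adds at most 1 to the difference of distance and dual weight. -/
theorem bucket_le (h : X.Dial M y Y da db d R S F pend) {e : ℤ}
    (he : e ∈ X.unmatched M) (hd : db (X.keyB e) ≠ 0) :
    X.bucket y db e ≤ 2 * F.card + 1 + y (Sum.inl (X.ed e).1) - Y := by
  have h1 := (mem_unmatched.1 he).1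
  have h2 := (h.finB _ (ib_mem h1.1 h1.2) hd).2.1
  have h3 := w_cases h1.1 h1.2
  unfold bucket keyB sl
  omega

/-- Since y(a) ≤ Y and F is a set of edges, the number of buckets needed is linear in the number of
edges, however large Y is. -/
theorem bucket_lt (h : X.Dial M y Y da db d R S F pend) (hF : X.G.Feasible M y Y) {e : ℤ}
    (he : e ∈ X.unmatched M) (hd : db (X.keyB e) ≠ 0) :
    X.bucket y db e < 2 * (X.hi - X.lo) + 4 := by
  have h1 := h.bucket_le he hd
  have h2 := h.card_F_le
  have h3 := hF.left_le (X.ed e).1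
  omega

/-- Slacks are nonnegative, so a new edge never falls into a bucket that has been passed. -/
theorem push {f : ℤ} (h : X.Dial M y Y da db d R S F (f :: pend)) (hF : X.G.Feasible M y Y) :
    X.Dial M y Y da db d (insert f R) (insert f S) F pend ∧ f ∉ R ∧ f ∉ S := by
  have hf := h.pend_sub f (by simp)
  have hnd := List.nodup_cons.1 h.pend_nodup
  refine ⟨⟨?_, ?_, hnd.2, ?_, ?_, h.d_nonneg, h.finB, h.finA, h.source, ?_, h.matched, h.F_sub⟩,
    fun hc => hf.1 (h.R_sub f hc), hf.1⟩
  · exact fun e he => Finset.insert_subset_insert f h.R_sub he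
  · intro e he
    rcases Finset.mem_insert.1 he with rfl | he
    · exact ⟨hf.2.1, by have := h.d_nonneg; omega⟩
    · exact h.S_sub e he
  · intro e he
    have := h.pend_sub e (by simp [he])
    refine ⟨?_, this.2⟩
    rw [Finset.mem_insert, not_or]
    exact ⟨by rintro rfl; exact hnd.1 he, this.1⟩
  · intro e he
    rcases Finset.mem_insert.1 he with rfl | he
    · have := sl_nonneg hF hf.2.1
      unfold bucket; omega
    · exact h.key_ge e he
  · intro e h1 h2 h3 h4
    rcases h.relax e h1 h2 h3 h4 with h5 | h5 | h5
    · exact Or.inl (Finset.mem_insert_of_mem h5)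
    · rcases List.mem_cons.1 h5 with rfl | h5
      · exact Or.inl (Finset.mem_insert_self _ _)
      · exact Or.inr (Or.inl h5)
    · exact Or.inr (Or.inr h5)

theorem succ (h : X.Dial M y Y da db d R S F []) (h0 : ∀ e ∈ R, X.bucket y db e ≠ d) :
    X.Dial M y Y da db (d + 1) R S F [] where
  R_sub := h.R_sub
  S_sub := h.S_sub
  pend_nodup := by simp
  pend_sub := by simp
  key_ge := fun e he => by have := h.key_ge e he; have := h0 e he; omega
  d_nonneg := by have := h.d_nonneg; omega
  finB := fun b hb hd => by
    obtain ⟨h1, h2⟩ := h.finB b hb hd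
    exact ⟨by omega, h2⟩
  finA := fun a ha hd => by
    obtain ⟨h1, h2⟩ := h.finA a ha hd
    exact ⟨by omega, h2⟩
  source := h.source
  relax := h.relax
  matched := h.matched
  F_sub := h.F_sub

/-- The end in A was reached at distance at most d, the bucket of e; so e is relaxed already and may
be dropped. -/
theorem pop (h : X.Dial M y Y da db d R S F []) {e : ℤ} (he : e ∈ R)
    (hk : X.bucket y db e = d) (ha : da (X.ia (X.ed e).1) ≠ 0) :
    X.Dial M y Y da db d (R.erase e) S F [] where
  R_sub := fun f hf => h.R_sub f (Finset.mem_of_mem_erase hf)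
  S_sub := h.S_sub
  pend_nodup := by simp
  pend_sub := by simp
  key_ge := fun f hf => h.key_ge f (Finset.mem_of_mem_erase hf)
  d_nonneg := h.d_nonneg
  finB := h.finB
  finA := h.finA
  source := h.source
  relax := fun f h1 h2 h3 h4 => by
    by_cases hfe : f = e
    · subst hfe
      refine Or.inr (Or.inr ⟨ha, ?_⟩)
      have := (h.finA _ (ia_mem h1 h2) ha).1
      unfold bucket at hk
      omega
    · rcases h.relax f h1 h2 h3 h4 with h5 | h5
      · exact Or.inl (Finset.mem_erase.2 ⟨hfe, h5⟩)
      · exact Or.inr h5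
  matched := h.matched
  F_sub := h.F_sub

theorem walk (h : X.Dial M y Y da db d R S F []) (hF : X.G.Feasible M y Y) {e : ℤ} (he : e ∈ R)
    (hk : X.bucket y db e = d) :
    ∃ k : ℕ, X.G.SlackWalk M y (Sum.inl (X.ed e).1) k ∧ (k : ℤ) = d := by
  obtain ⟨h1, h2⟩ := h.S_sub e (h.R_sub e he)
  have h3 := (mem_unmatched.1 h1).1
  obtain ⟨-, -, k, hk1, hk2⟩ := h.finB _ (ib_mem h3.1 h3.2) h2
  obtain ⟨k', hk'⟩ := Int.eq_ofNat_of_zero_le (sl_nonneg hF h1)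
  refine ⟨k + k', .step _ _ _ k k' hk1 (arc_of h1) (by rw [slack_eq h1, hk']), ?_⟩
  unfold bucket keyB at hk
  push_cast
  omega

/-- A new vertex of `A` is reached. -/
theorem newA (h : X.Dial M y Y da db d R S F []) (hF : X.G.Feasible M y Y) {e : ℤ} (he : e ∈ R)
    (hk : X.bucket y db e = d) (ha : da (X.ia (X.ed e).1) = 0) (hfree : FreeA M (X.ed e).1) :
    X.Dial M y Y (Function.update da (X.ia (X.ed e).1) (d + 1)) db d (R.erase e) S F [] := by
  have h0 := h.d_nonneg
  have hsub : ∀ j, da j ≠ 0 → Function.update da (X.ia (X.ed e).1) (d + 1) j = da j := by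
    intro j hj
    rw [Function.update_of_ne]; rintro rfl; exact hj ha
  refine ⟨fun f hf => h.R_sub f (Finset.mem_of_mem_erase hf), h.S_sub, by simp, by simp,
    fun f hf => h.key_ge f (Finset.mem_of_mem_erase hf), h.d_nonneg, h.finB, ?_, h.source, ?_, ?_,
    ?_⟩
  · intro a ha' hne
    by_cases haa : a = (X.ed e).1
    · subst haa
      rw [Function.update_self]
      obtain ⟨k, hk1, hk2⟩ := h.walk hF he hk
      exact ⟨by omega, k, hk1, by omega⟩
    · rw [Function.update_of_ne fun hc => haa (X.ia_inj hc)] at hne ⊢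
      exact h.finA a ha' hne
  · intro f h1 h2 h3 h4
    by_cases hfe : f = e
    · subst hfe
      refine Or.inr (Or.inr ?_)
      rw [Function.update_self]
      unfold bucket at hk
      omega
    · rcases h.relax f h1 h2 h3 h4 with h5 | h5 | h5
      · exact Or.inl (Finset.mem_erase.2 ⟨hfe, h5⟩)
      · simp at h5
      · refine Or.inr (Or.inr ?_)
        rwa [hsub _ h5.1]
  · intro f h1 h2 h3
    rw [Function.update_of_ne fun hc => hfree _ h3 (X.ia_inj hc)]
    exact h.matched f h1 h2 h3
  · intro f hf
    obtain ⟨h1, h2, h3⟩ := h.F_sub f hf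
    exact ⟨h1, h2, by rwa [hsub _ h3]⟩

/-- A new vertex of `A` and its partner are reached. -/
theorem newAB (h : X.Dial M y Y da db d R S F []) (hF : X.G.Feasible M y Y) {e g : ℤ} (he : e ∈ R)
    (hk : X.bucket y db e = d) (ha : da (X.ia (X.ed e).1) = 0) (g1 : X.lo ≤ g) (g2 : g ≤ X.hi)
    (hg : X.ed g ∈ M) (hge : (X.ed g).1 = (X.ed e).1) {l : List ℤ} (hl : l.Nodup)
    (hlm : ∀ f, f ∈ l ↔ f ∈ X.unmatched M ∧ X.keyB f = X.keyB g) :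
    db (X.keyB g) = 0 ∧ X.Dial M y Y (Function.update da (X.ia (X.ed e).1) (d + 1))
      (Function.update db (X.keyB g) (d + 1)) d (R.erase e) S (insert e F) l ∧ e ∉ F := by
  have h0 := h.d_nonneg
  have hdb : db (X.keyB g) = 0 := by rw [← h.matched g g1 g2 hg, hge, ha]
  have hsub : ∀ j, da j ≠ 0 → Function.update da (X.ia (X.ed e).1) (d + 1) j = da j := by
    intro j hj
    rw [Function.update_of_ne]; rintro rfl; exact hj ha
  have hsubB : ∀ j, db j ≠ 0 → Function.update db (X.keyB g) (d + 1) j = db j := by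
    intro j hj
    rw [Function.update_of_ne]; rintro rfl; exact hj hdb
  have heF : e ∉ F := fun hc => (h.F_sub e hc).2.2 ha
  have hcard : ((insert e F).card : ℤ) = F.card + 1 := by
    rw [Finset.card_insert_of_notMem heF]; push_cast; rfl
  obtain ⟨e1, e2⟩ := h.S_sub e (h.R_sub e he)
  obtain ⟨⟨e3, e4⟩, e5⟩ := mem_unmatched.1 e1
  refine ⟨hdb, ⟨fun f hf => h.R_sub f (Finset.mem_of_mem_erase hf), ?_, hl, ?_, ?_, h.d_nonneg, ?_,
    ?_, ?_, ?_, ?_, ?_⟩, heF⟩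
  · intro f hf
    obtain ⟨f1, f2⟩ := h.S_sub f hf
    exact ⟨f1, by rwa [hsubB _ f2]⟩
  · intro f hf
    obtain ⟨f1, f2⟩ := (hlm f).1 hf
    refine ⟨fun hc => (h.S_sub f hc).2 (f2 ▸ hdb), f1, ?_⟩
    rw [f2, Function.update_self]
  · intro f hf
    have hfR := Finset.mem_of_mem_erase hf
    have := h.key_ge f hfR
    unfold bucket at this ⊢
    rwa [hsubB _ (h.S_sub f (h.R_sub f hfR)).2]
  · intro b hb hne
    rw [hcard]
    by_cases hbb : X.ib b = X.keyB g
    · have hbg : b = (X.ed g).2 := X.ib_inj hbb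
      subst hbg
      rw [hbb, Function.update_self]
      obtain ⟨k, hk1, hk2⟩ := h.walk hF he hk
      -- This gives d ≤ 2|F| + 1 + y(a) - Y, and y(a) ≤ y(b) + 1 on the matching edge; the insertion
      -- of `e` into F absorbs the surplus of 2.
      have hb1 := h.bucket_le e1 e2
      have ht := hF.tight _ hg
      have hc := X.G.c_zero_or_one _ (X.ed_mem g g1 g2)
      rw [hge] at ht
      have harc : X.G.Arc M (Sum.inl (X.ed e).1) (X.ed g) (Sum.inr (X.ed g).2) := by
        rw [← hge]; exact .matched _ _ hg
      refine ⟨by omega, by omega, k + 0, .step _ _ _ k 0 hk1 harc ?_, by push_cast; omega⟩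
      simp [slack, hg]
    · rw [Function.update_of_ne hbb] at hne ⊢
      obtain ⟨r1, r2, r3⟩ := h.finB b hb hne
      exact ⟨r1, by omega, r3⟩
  · intro a ha' hne
    by_cases haa : a = (X.ed e).1
    · subst haa
      rw [Function.update_self]
      obtain ⟨k, hk1, hk2⟩ := h.walk hF he hk
      exact ⟨by omega, k, hk1, by omega⟩
    · rw [Function.update_of_ne fun hc => haa (X.ia_inj hc)] at hne ⊢
      exact h.finA a ha' hne
  · intro b hb hbf
    rw [hsubB _ (by rw [h.source b hb hbf]; simp)]
    exact h.source b hb hbf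
  · intro f h1 h2 h3 h4
    by_cases hfg : X.keyB f = X.keyB g
    · exact Or.inr (Or.inl ((hlm f).2 ⟨mem_unmatched.2 ⟨⟨h1, h2⟩, h3⟩, hfg⟩))
    rw [Function.update_of_ne hfg] at h4 ⊢
    by_cases hfe : f = e
    · subst hfe
      refine Or.inr (Or.inr ?_)
      rw [Function.update_self]
      unfold bucket at hk
      omega
    · rcases h.relax f h1 h2 h3 h4 with h5 | h5 | h5
      · exact Or.inl (Finset.mem_erase.2 ⟨hfe, h5⟩)
      · simp at h5
      · refine Or.inr (Or.inr ?_)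
        rwa [hsub _ h5.1]
  · intro f h1 h2 h3
    by_cases hfg : f = g
    · subst hfg
      rw [hge, Function.update_self, Function.update_self]
    · rw [Function.update_of_ne, Function.update_of_ne]
      · exact h.matched f h1 h2 h3
      · intro hc
        have := hF.matching.2 _ h3 _ hg (Or.inr (X.ib_inj hc))
        exact hfg (X.ed_inj _ _ h1 h2 g1 g2 this)
      · intro hc
        have := hF.matching.2 _ h3 _ hg (Or.inl (by rw [hge]; exact X.ia_inj hc))
        exact hfg (X.ed_inj _ _ h1 h2 g1 g2 this)
  · intro f hf
    rcases Finset.mem_insert.1 hf with rfl | hf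
    · exact ⟨e3, e4, by rw [Function.update_self]; omega⟩
    · obtain ⟨h1, h2, h3⟩ := h.F_sub f hf
      exact ⟨h1, h2, by rwa [hsub _ h3]⟩

/-- Every walk leads to a vertex that has been reached, or is at least as long as some edge in the
buckets indicates. -/
theorem lower (h : X.Dial M y Y da db d R S F []) (hF : X.G.Feasible M y Y) {v : A ⊕ B} {k : ℕ}
    (hw : X.G.SlackWalk M y v k) : (∃ e ∈ R, X.bucket y db e ≤ k) ∨
      ((∀ a, v = Sum.inl a → X.IA a ∧ da (X.ia a) ≠ 0 ∧ da (X.ia a) - 1 ≤ k) ∧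
        ∀ b, v = Sum.inr b → X.IB b → db (X.ib b) ≠ 0 ∧ db (X.ib b) - 1 ≤ k) := by
  induction hw with
  | source b hb =>
    refine Or.inr ⟨by simp, fun b' hbb hb' => ?_⟩
    obtain rfl : b = b' := by simpa using hbb
    rw [h.source b hb' hb]; simp
  | step u v f k k' _ ha hs ih =>
    rcases ih with ⟨e, he, hk⟩ | ⟨ih1, ih2⟩
    · exact Or.inl ⟨e, he, by push_cast; omega⟩
    · obtain ⟨e, e1, e2, rfl⟩ := X.ed_surj f (ha.mem hF.matching.1)
      generalize hfe : X.ed e = f at *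
      cases ha with
      | unmatched a b h1 h2 =>
        have hu : e ∈ X.unmatched M := mem_unmatched.2 ⟨⟨e1, e2⟩, by rwa [hfe]⟩
        have hb : X.keyB e = X.ib b := by simp [keyB, hfe]
        have hib : X.IB b := ⟨e, e1, e2, by rw [hfe]⟩
        have hia : X.IA a := ⟨e, e1, e2, by rw [hfe]⟩
        obtain ⟨i1, i2⟩ := ih2 b rfl hib
        rw [← hfe, slack_eq hu] at hs
        rcases h.relax e e1 e2 (by rwa [hfe]) (by rwa [hb]) with h5 | h5 | ⟨h5, h6⟩
        · refine Or.inl ⟨e, h5, ?_⟩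
          unfold bucket; rw [hb]; push_cast; omega
        · simp at h5
        · refine Or.inr ⟨?_, by simp⟩
          intro a' ha'
          obtain rfl : a = a' := by simpa using ha'
          simp only [hfe, hb] at h5 h6
          exact ⟨hia, h5, by push_cast; omega⟩
      | matched a b h1 =>
        refine Or.inr ⟨by simp, fun b' hbb hb' => ?_⟩
        obtain rfl : b = b' := by simpa using hbb
        obtain ⟨-, i1, i2⟩ := ih1 a rfl
        have := h.matched e e1 e2 (by rwa [hfe])
        simp only [keyB, hfe] at this
        rw [← this]
        exact ⟨i1, by push_cast; omega⟩

/-- With empty buckets, `lower` shows that every reachable vertex of A has received an entry. -/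
theorem minDist_eq_top (h : X.Dial M y Y da db d ∅ S F []) (hF : X.G.Feasible M y Y)
    (h0 : ∀ a, X.IA a → FreeA M a → da (X.ia a) = 0) : X.G.minDist M y = ⊤ := by
  rw [← top_le_iff]
  refine le_minDist fun a ha k hk => ?_
  rcases h.lower hF hk with ⟨e, he, -⟩ | ⟨h1, -⟩
  · simp at he
  · obtain ⟨h2, h3, -⟩ := h1 a rfl
    exact absurd (h0 a h2 ha) h3

/-- The remaining edges lie in buckets from d on, so by `lower` a walk shorter than d ends at a
vertex whose entry is no larger than the walk. Entries are also lengths of walks, hence exact;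
vertices without entry have distance at least d and are not moved. -/
theorem minDist_eq (h : X.Dial M y Y da db d R S F []) (hF : X.G.Feasible M y Y) {L : ℕ}
    (hd : d = L) {a : A} (ha : X.IA a) (haf : FreeA M a) (had : da (X.ia a) = d + 1)
    (h0 : ∀ a, X.IA a → FreeA M a → da (X.ia a) ≠ 0 → da (X.ia a) = d + 1) :
    X.G.minDist M y = L ∧
    (∀ a, X.IA a → X.G.updateDuals M y (Sum.inl a) =
      if da (X.ia a) = 0 then y (Sum.inl a) else y (Sum.inl a) + (d + 1 - da (X.ia a))) ∧
    ∀ b, X.IB b → X.G.updateDuals M y (Sum.inr b) =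
      if db (X.ib b) = 0 then y (Sum.inr b) else y (Sum.inr b) + (d + 1 - db (X.ib b)) := by
  have hlow : ∀ {v k}, X.G.SlackWalk M y v k → (d ≤ k) ∨
      ((∀ a, v = Sum.inl a → X.IA a ∧ da (X.ia a) ≠ 0 ∧ da (X.ia a) - 1 ≤ k) ∧
        ∀ b, v = Sum.inr b → X.IB b → db (X.ib b) ≠ 0 ∧ db (X.ib b) - 1 ≤ k) := by
    intro v k hw
    rcases h.lower hF hw with ⟨e, he, h1⟩ | h1
    · exact Or.inl ((h.key_ge e he).trans h1)
    · exact Or.inr h1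
  have hmd : X.G.minDist M y = L := by
    apply le_antisymm
    · have h1 := h.d_nonneg
      obtain ⟨-, k, hk1, hk2⟩ := h.finA a ha (by omega)
      have : k = L := by omega
      subst this
      exact (minDist_le haf).trans (dist_le hk1)
    · refine le_minDist fun a' ha' k hk => ?_
      have : (L : ℤ) ≤ k := by
        rcases hlow hk with h1 | ⟨h1, -⟩
        · omega
        · obtain ⟨h2, h3, h4⟩ := h1 a' rfl
          have := h0 a' h2 ha' h3
          omega
      exact_mod_cast this
  refine ⟨hmd, fun a ha => ?_, fun b hb => ?_⟩
  · split_ifs with hz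
    · refine updateDuals_of_le hmd fun k hk => ?_
      rcases hlow hk with h1 | ⟨h1, -⟩
      · omega
      · exact absurd hz (h1 a rfl).2.1
    · obtain ⟨h1, k, hk1, hk2⟩ := h.finA a ha hz
      rw [updateDuals_of_walk hmd hk1 (by omega)]
      · omega
      · intro k' hk'
        rcases hlow hk' with h1 | ⟨h1, -⟩
        · omega
        · have := (h1 a rfl).2.2; omega
  · split_ifs with hz
    · refine updateDuals_of_le hmd fun k hk => ?_
      rcases hlow hk with h1 | ⟨-, h1⟩
      · omega
      · exact absurd hz (h1 b rfl hb).1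
    · obtain ⟨h1, -, k, hk1, hk2⟩ := h.finB b hb hz
      rw [updateDuals_of_walk hmd hk1 (by omega)]
      · omega
      · intro k' hk'
        rcases hlow hk' with h1 | ⟨-, h1⟩
        · omega
        · have := (h1 b rfl hb).2; omega

end Dial

end Layout

end RAM

namespace RAM

set_option linter.unusedSectionVars false

open WGraph

theorem wp_while_true {N : ℤ} {e : Expr} {p : Cmd} {Q : State → ℕ → Prop} {s : State} {t : ℕ}
    (h0 : e.val s ≠ 0) (h : wp N p (wp N (.while e p) Q) s (t + 1)) :
    wp N (.while e p) Q s t := by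
  obtain ⟨k, s', h1, k', s'', h2, h3⟩ := h
  exact ⟨_, _, .whileTrue _ _ _ _ _ _ _ h0 h1 h2, by rwa [← add_assoc, ← add_assoc]⟩

theorem wp_while_false {N : ℤ} {e : Expr} {p : Cmd} {Q : State → ℕ → Prop} {s : State} {t : ℕ}
    (h0 : e.val s = 0) (h : Q s (t + 1)) : wp N (.while e p) Q s t :=
  ⟨_, _, .whileFalse _ _ _ h0, h⟩

theorem Bdd.assign {N : ℤ} {s : State} (hb : Bdd N s) {x : ℕ} {v : ℤ} (hv : |v| ≤ N) :
    Bdd N { s with var := Function.update s.var x v } := by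
  refine ⟨fun z => ?_, hb.2⟩
  simp only [Function.update_apply]
  split_ifs
  · exact hv
  · exact hb.1 z

theorem Bdd.write {N : ℤ} {s : State} (hb : Bdd N s) {a : ℕ} {i v : ℤ} (hv : |v| ≤ N) :
    Bdd N { s with arr := Function.update s.arr a (Function.update (s.arr a) i v) } := by
  refine ⟨hb.1, fun b j => ?_⟩
  simp only [Function.update_apply]
  split_ifs
  · simp only [Function.update_apply]
    split_ifs
    · exact hv
    · exact hb.2 _ _
  · exact hb.2 _ _

/-! ## First stage: distances by buckets -/

/-- Empty the buckets. -/
def clearBuckets : Cmd :=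
  .assign xD (.const 0) ;;
  .assign xK (.plus (.minus (.plus (.var xHi) (.var xHi)) (.plus (.var xLo) (.var xLo)))
    (.const 4)) ;;
  .while (.less (.var xD) (.var xK))
    (.write aBK (.var xD) (.const 0) ;; .assign xD (.plus (.var xD) (.const 1)))

/-- Put the edges at free vertices of `B` into buckets. -/
def initBuckets : Cmd :=
  forEdges (.ite (.read aMB (.read aEB (.var xE))) .skip (
    .write aDB (.read aEB (.var xE)) (.const 1) ;;
    .assign xI (.minus (.plus (.read aWt (.var xE)) (.read aYA (.read aEA (.var xE))))
      (.read aYB (.read aEB (.var xE)))) ;;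
    .write aNX (.var xE) (.read aBK (.var xI)) ;;
    .write aBK (.var xI) (.var xE)))

/-- Put the unmatched edges at the vertex `xB` into buckets. -/
def scan : Cmd :=
  .while (.var xF) (
    .assign xI (.minus (.plus (.plus (.var xD) (.read aWt (.var xF)))
      (.read aYA (.read aEA (.var xF)))) (.read aYB (.var xB))) ;;
    .write aNX (.var xF) (.read aBK (.var xI)) ;;
    .write aBK (.var xI) (.var xF) ;;
    .assign xF (.read aLN (.var xF)))

/-- Take an edge from the current bucket, or go to the next bucket. -/
def dialStep : Cmd :=
  .assign xE (.read aBK (.var xD)) ;;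
  .ite (.var xE) (
    .write aBK (.var xD) (.read aNX (.var xE)) ;;
    .assign xA (.read aEA (.var xE)) ;;
    .ite (.read aDA (.var xA)) .skip (
      .write aDA (.var xA) (.plus (.var xD) (.const 1)) ;;
      .assign xG (.read aMA (.var xA)) ;;
      .ite (.var xG) (
        .assign xB (.read aEB (.var xG)) ;;
        .write aDB (.var xB) (.plus (.var xD) (.const 1)) ;;
        .assign xF (.read aLH (.var xB)) ;;
        scan)
      (.assign xFd (.const 1))))
  (.assign xD (.plus (.var xD) (.const 1)))

/-- Compute the distances; `xFd` tells whether a free vertex of `A` is reached, and `xD` is its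
distance. -/
def stageOne : Cmd :=
  clearBuckets ;; initBuckets ;; .assign xFd (.const 0) ;; .assign xD (.const 0) ;;
  .while (.less (.var xFd) (.less (.var xD) (.var xK))) dialStep

section

variable {A B : Type} [DecidableEq A] [DecidableEq B] {X : Layout A B} {N : ℤ} {s : State} {t : ℕ}
  {M : Finset (A × B)} {y : A ⊕ B → ℤ} {Y : ℤ}

theorem clearBuckets_spec (hN : 2 * X.hi + 4 ≤ N) (hb : Bdd N s) (hs : X.Static s) :
    wp N clearBuckets (fun s' t' => (t' : ℤ) ≤ t + 6 * (X.hi + 1 - X.lo) + 20 ∧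
      s'.var xK = 2 * (X.hi - X.lo) + 4 ∧
      ∀ j, 0 ≤ j → j < 2 * (X.hi - X.lo) + 4 → s'.arr aBK j = 0) s t := by
  have hl := X.one_le
  have hle := X.lo_le
  simp only [clearBuckets, wp_seq, wp_assign, Expr.val, Op.val]
  simp only [ne_eq, Nat.reduceEqDiff, not_false_eq_true,
    Function.update_of_ne, hs.lo, hs.hi]
  refine ⟨by rw [abs_le]; omega, by rw [abs_le]; omega, ?_⟩
  refine wp_while ((hb.assign (by rw [abs_le]; omega)).assign (by rw [abs_le]; omega)) (t + 6 * (X.hi + 1 - X.lo) + 20).toNat (fun s' t' => ∃ i : ℤ, 0 ≤ i ∧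
    i ≤ 2 * (X.hi - X.lo) + 4 ∧ s'.var xD = i ∧ (t' : ℤ) ≤ t + 2 + 3 * i ∧
    ∀ j, 0 ≤ j → j < i → s'.arr aBK j = 0)
    ⟨0, le_rfl, by omega, by simp, by push_cast; omega, fun j h1 h2 => by omega⟩ ?_
  rintro s' t' hb' hf ⟨i, h1, h2, h3, h4, h5⟩
  have hK : s'.var xK = 2 * (X.hi - X.lo) + 4 := by
    rw [hf.1 xK (by decide)]; simp; ring
  refine ⟨by omega, ?_, ?_⟩
  · intro hc
    simp only [Expr.val, Op.val, h3, hK, ne_eq, ite_eq_right_iff, one_ne_zero, imp_false,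
      not_not] at hc
    simp only [wp_seq, wp_write, wp_assign, Expr.val, Op.val, h3]
    refine ⟨by simp; omega, by rw [abs_le]; omega, i + 1, by omega, by omega, by simp,
      by push_cast; omega, fun j h6 h7 => ?_⟩
    simp only [Function.update_apply, if_true]
    split_ifs
    · rfl
    · exact h5 j h6 (by omega)
  · intro hc
    simp only [Expr.val, Op.val, h3, hK, ite_eq_right_iff, one_ne_zero, imp_false] at hc
    exact ⟨by push_cast; omega, hK, fun j h6 h7 => h5 j h6 (by omega)⟩

/-- The edges below `i` at free vertices of `B`. -/
noncomputable def freeEdges (X : Layout A B) (M : Finset (A × B)) (i : ℤ) : Finset ℤ :=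
  open Classical in (Finset.Icc X.lo X.hi).filter fun e => e < i ∧ FreeB M (X.ed e).2

theorem mem_freeEdges {i e : ℤ} : e ∈ freeEdges X M i ↔
    (X.lo ≤ e ∧ e ≤ X.hi) ∧ e < i ∧ FreeB M (X.ed e).2 := by simp [freeEdges]

/-- Distances are stored increased by 1, so that 0 can mean that there is none. A free vertex gets
the entry 1 once for each of its edges, which does no harm, and an edge there has its slack as
bucket. -/
theorem initBuckets_spec (hN : 2 * X.hi + 4 ≤ N) (hb : Bdd N s) (hs : X.Static s)
    (hm : X.Mates M (s.arr aMA) (s.arr aMB)) (hd : X.Duals y (s.arr aYA) (s.arr aYB))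
    (hF : X.G.Feasible M y Y)
    (hA : ∀ a, X.IA a → s.arr aDA (X.ia a) = 0)
    (hB : ∀ b, X.IB b → s.arr aDB (X.ib b) = 0)
    (hbk : ∀ j, 0 ≤ j → j < 2 * (X.hi - X.lo) + 4 → s.arr aBK j = 0) :
    wp N initBuckets (fun s' t' => (t' : ℤ) ≤ t + 7 * (X.hi + 1 - X.lo) + 3 ∧
      ∃ S, X.Dial M y Y (s'.arr aDA) (s'.arr aDB) 0 S S ∅ [] ∧
      Lists (Set.Ico 0 (2 * (X.hi - X.lo) + 4)) (s'.arr aBK) (s'.arr aNX)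
        (X.bucket y (s'.arr aDB)) S) s t := by
  have hl := X.one_le
  have hle := X.lo_le
  unfold initBuckets
  refine wp_forEdges (lo := X.lo) (hi := X.hi) hb (t + 7 * (X.hi + 1 - X.lo) + 1).toNat
    (fun i s' t' => (t' : ℤ) ≤ t + 7 * (i - X.lo) + 1 ∧
      Lists (Set.Ico 0 (2 * (X.hi - X.lo) + 4)) (s'.arr aBK) (s'.arr aNX) (X.sl y)
        (freeEdges X M i) ∧
      (∀ e, X.lo ≤ e → e ≤ X.hi → e < i → FreeB M (X.ed e).2 → s'.arr aDB (X.keyB e) = 1) ∧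
      ∀ b, X.IB b → ¬ FreeB M b → s'.arr aDB (X.ib b) = 0) hs.lo hs.hi (by omega) (by omega)
    (by omega) (by decide) (by decide) ?_ ?_ ?_ ?_
  · refine ⟨by push_cast; omega, ?_, fun e h1 h2 h3 => by omega, fun b hb _ => hB b hb⟩
    have : freeEdges X M X.lo = ∅ := by
      ext e; rw [mem_freeEdges]; simp; omega
    rw [this]
    exact Lists.empty fun j hj => hbk j hj.1 hj.2
  · rintro i s' t' hi ⟨h, -⟩; omega
  · rintro i s' t' hi1 hi2 hb' hf he ⟨ht, hI, hdb, hdb'⟩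
    have hs' := hs.of_frame hf (by decide) (by decide) (by decide) (by decide) (by decide)
      (by decide)
    have hm' : X.Mates M (s'.arr aMA) (s'.arr aMB) := by
      rw [hf.2 aMA (by decide), hf.2 aMB (by decide)]; exact hm
    have hd' : X.Duals y (s'.arr aYA) (s'.arr aYB) := by
      rw [hf.2 aYA (by decide), hf.2 aYB (by decide)]; exact hd
    have hfree := hm'.right _ (Layout.ib_mem hi1 hi2)
    simp only [wp_ite, wp_skip, wp_seq, wp_write, wp_assign, Expr.val, Op.val, he, hs'.ea i hi1 hi2,
      hs'.eb i hi1 hi2, ne_eq, ← hfree, Function.update_self, Function.update_of_ne,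
      Nat.reduceEqDiff, not_false_eq_true, hs'.wt i hi1 hi2,
      hd'.left _ (Layout.ia_mem hi1 hi2), hd'.right _ (Layout.ib_mem hi1 hi2)]
    refine ⟨fun h => ?_, fun h => ?_⟩
    · refine ⟨by push_cast; omega, ?_, ?_, hdb'⟩
      · have : freeEdges X M (i + 1) = freeEdges X M i := by
          ext e; rw [mem_freeEdges, mem_freeEdges]
          refine and_congr_right fun _ => and_congr_left fun h' => ?_
          have : e ≠ i := by rintro rfl; exact h h'
          omega
        rw [this]; exact hI
      · intro e h1 h2 h3 h4
        have : e ≠ i := by rintro rfl; exact h h4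
        exact hdb e h1 h2 (by omega) h4
    · have hu : i ∈ X.unmatched M := Layout.mem_unmatched.2 ⟨⟨hi1, hi2⟩, fun hc => h _ hc rfl⟩
      have hsl := Layout.sl_nonneg hF hu
      have hyb := hF.right_free _ h
      have hya := hF.left_le (X.ed i).1
      have hw := Layout.w_cases hi1 hi2
      have hp := hI.push (e := i) (by rw [mem_freeEdges]; omega) (by omega)
      have : freeEdges X M (i + 1) = insert i (freeEdges X M i) := by
        ext e; rw [Finset.mem_insert, mem_freeEdges, mem_freeEdges]
        constructor
        · rintro ⟨h1, h2, h3⟩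
          by_cases hei : e = i
          · exact Or.inl hei
          · exact Or.inr ⟨h1, by omega, h3⟩
        · rintro (rfl | ⟨h1, h2, h3⟩)
          · exact ⟨⟨hi1, hi2⟩, by omega, h⟩
          · exact ⟨h1, by omega, h3⟩
      unfold Layout.sl at hsl hp
      refine ⟨by rw [abs_le]; omega, by rw [abs_le]; omega, hb'.2 _ _, by rw [abs_le]; omega,
        by push_cast; omega, ?_, ?_, ?_⟩
      · rw [this]; exact hp
      · intro e h1 h2 h3 h4
        simp only [Layout.keyB, Function.update_apply]
        split_ifs with h5
        · rfl
        · exact hdb e h1 h2 (lt_of_le_of_ne (by omega) (by rintro rfl; exact h5 rfl)) h4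
      · intro b hb1 hb2
        rw [Function.update_of_ne fun hc => hb2 (by rw [X.ib_inj hc]; exact h)]
        exact hdb' b hb1 hb2
  · rintro s' t' hb' hf ⟨ht, hI, hdb, hdb'⟩
    have hda : s'.arr aDA = s.arr aDA := hf.2 _ (by decide)
    have hkey : ∀ e, X.lo ≤ e → e ≤ X.hi → s'.arr aDB (X.keyB e) ≠ 0 →
        FreeB M (X.ed e).2 := by
      intro e h1 h2 h3
      by_contra hc
      exact h3 (hdb' _ (Layout.ib_mem h1 h2) hc)
    have hfm : ∀ e, X.lo ≤ e → e ≤ X.hi → FreeB M (X.ed e).2 → e ∈ freeEdges X M (X.hi + 1) :=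
      fun e h1 h2 h3 => mem_freeEdges.2 ⟨⟨h1, h2⟩, by omega, h3⟩
    have hub : ∀ e ∈ freeEdges X M (X.hi + 1), e ∈ X.unmatched M ∧ s'.arr aDB (X.keyB e) = 1 := by
      intro e he
      obtain ⟨⟨h1, h2⟩, h3, h4⟩ := mem_freeEdges.1 he
      exact ⟨Layout.mem_unmatched.2 ⟨⟨h1, h2⟩, fun hc => h4 _ hc rfl⟩, hdb e h1 h2 h3 h4⟩
    refine ⟨by push_cast; omega, freeEdges X M (X.hi + 1), ⟨fun _ h => h, ?_, by simp, by simp, ?_,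
      le_rfl, ?_, ?_, ?_, ?_, ?_, by simp⟩, ?_⟩
    · intro e he
      have := hub e he
      exact ⟨this.1, by omega⟩
    · intro e he
      have h1 := hub e he
      have h2 := Layout.sl_nonneg hF h1.1
      unfold Layout.bucket; omega
    · rintro b ⟨e, h1, h2, rfl⟩ h3
      have h4 := hkey e h1 h2 h3
      have h5 : s'.arr aDB (X.ib (X.ed e).2) = 1 := hdb e h1 h2 (by omega) h4
      rw [h5, hF.right_free _ h4]
      exact ⟨by norm_num, by simp, 0, .source _ h4, by norm_num⟩
    · intro a ha h1
      rw [hda] at h1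
      exact absurd (hA a ha) h1
    · rintro b ⟨e, h1, h2, rfl⟩ h3
      exact hdb e h1 h2 (by omega) h3
    · intro e h1 h2 h3 h4
      exact Or.inl (hfm e h1 h2 (hkey e h1 h2 h4))
    · intro e h1 h2 h3
      rw [hda, hA _ (Layout.ia_mem h1 h2)]
      exact (hdb' _ (Layout.ib_mem h1 h2) fun hc => hc _ h3 rfl).symm
    · refine hI.congr_key fun e he => ?_
      unfold Layout.bucket
      rw [(hub e he).2]; ring

/-- Induction on the list of edges still to be put into buckets; all of them start at the vertex
just reached at distance d, so their buckets are d plus slack. -/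
theorem scan_spec (hN : 2 * X.hi + 4 ≤ N) (hF : X.G.Feasible M y Y) {F : Finset ℤ}
    (l : List ℤ) : ∀ (s : State) (t : ℕ) (R S : Finset ℤ), Bdd N s → X.Static s →
    X.Duals y (s.arr aYA) (s.arr aYB) →
    X.Dial M y Y (s.arr aDA) (s.arr aDB) (s.var xD) R S F l →
    Lists (Set.Ico 0 (2 * (X.hi - X.lo) + 4)) (s.arr aBK) (s.arr aNX)
      (X.bucket y (s.arr aDB)) R →
    Linked (s.arr aLN) (s.var xF) l → (∀ f ∈ l, X.keyB f = s.var xB) →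
    wp N scan (fun s' t' => (t' : ℤ) ≤ t + 5 * l.length + 1 ∧ ∃ R' S',
      X.Dial M y Y (s'.arr aDA) (s'.arr aDB) (s'.var xD) R' S' F [] ∧
      Lists (Set.Ico 0 (2 * (X.hi - X.lo) + 4)) (s'.arr aBK) (s'.arr aNX)
        (X.bucket y (s'.arr aDB)) R' ∧
      R'.card = R.card + l.length ∧ S'.card = S.card + l.length) s t := by
  have hl := X.one_le
  have hle := X.lo_le
  induction l with
  | nil =>
    intro s t R S hb hs hd hD hL hk _
    refine wp_while_false hk ⟨by simp, R, S, hD, hL, rfl, rfl⟩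
  | cons f l ih =>
    intro s t R S hb hs hd hD hL hk hB
    obtain ⟨h1, h2, h3⟩ := hk
    obtain ⟨hD', hfR, hfS⟩ := hD.push hF
    obtain ⟨-, hu, hdb⟩ := hD.pend_sub f (by simp)
    obtain ⟨⟨f1, f2⟩, f3⟩ := Layout.mem_unmatched.1 hu
    have hge := hD'.key_ge f (by simp)
    have hlt := hD.bucket_lt hF hu (by have := hD.d_nonneg; omega)
    have h0 := hD.d_nonneg
    have hp := hL.push hfR h2
    have hyb : s.arr aYB (s.var xB) = y (Sum.inr (X.ed f).2) := by
      rw [← hB f (by simp)]; exact hd.right _ (Layout.ib_mem f1 f2)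
    have hkey : s.var xD + X.w f + y (Sum.inl (X.ed f).1) - y (Sum.inr (X.ed f).2) =
        X.bucket y (s.arr aDB) f := by
      unfold Layout.bucket Layout.sl; omega
    refine wp_while_true (by simpa [Expr.val, h1] using h2) ?_
    simp only [wp_seq, wp_write, wp_assign, Expr.val, Op.val, ne_eq, Function.update_self,
      Function.update_of_ne, Nat.reduceEqDiff, not_false_eq_true, h1,
      hs.wt f f1 f2, hs.ea f f1 f2, hd.left _ (Layout.ia_mem f1 f2), hyb, hkey]
    refine ⟨by rw [abs_le]; omega, hb.2 _ _, by rw [abs_le]; omega, hb.2 _ _, ?_⟩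
    have hb' := (((hb.assign (x := xI) (v := X.bucket y (s.arr aDB) f) (by rw [abs_le]; omega)).write
      (a := aNX) (i := f) (hb.2 aBK (X.bucket y (s.arr aDB) f))).write
      (a := aBK) (i := X.bucket y (s.arr aDB) f) (v := f) (by rw [abs_le]; omega)).assign (x := xF)
      (hb.2 aLN f)
    refine wp_conseq hb' (ih _ _ (insert f R) (insert f S) hb' ?_ ?_ ?_ ?_ ?_ ?_) ?_
    · exact ⟨hs.ea, hs.eb, hs.wt, hs.pc, hs.lo, hs.hi⟩
    · exact hd
    · exact hD'
    · exact hp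
    · exact h3
    · exact fun g hg => hB g (by simp [hg])
    · rintro s' t' hb' hf ⟨ht, R', S', r1, r2, r3, r4⟩
      refine ⟨by simp only [List.length_cons]; push_cast at ht ⊢; omega, R', S', r1, r2, ?_, ?_⟩
      · rw [r3, Finset.card_insert_of_notMem hfR, List.length_cons]; omega
      · rw [r4, Finset.card_insert_of_notMem hfS, List.length_cons]; omega

end

end RAM

/-! ### The main loop of the search for distances, and the change of the dual weights -/

namespace RAM

set_option linter.unusedSectionVars false

open WGraph

/-- Add the dual adjustments. -/
def adjustDuals : Cmd :=
  forEdges (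
    .ite (.read aDA (.read aEA (.var xE))) (
      .write aYA (.read aEA (.var xE)) (.plus (.read aYA (.read aEA (.var xE)))
        (.minus (.plus (.var xD) (.const 1)) (.read aDA (.read aEA (.var xE))))) ;;
      .write aDA (.read aEA (.var xE)) (.const 0)) .skip ;;
    .ite (.read aDB (.read aEB (.var xE))) (
      .write aYB (.read aEB (.var xE)) (.plus (.read aYB (.read aEB (.var xE)))
        (.minus (.plus (.var xD) (.const 1)) (.read aDB (.read aEB (.var xE))))) ;;
      .write aDB (.read aEB (.var xE)) (.const 0)) .skip)

section

variable {A B : Type} [DecidableEq A] [DecidableEq B] {X : Layout A B} {N : ℤ} {s : State} {t : ℕ}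
  {M : Finset (A × B)} {y : A ⊕ B → ℤ} {Y : ℤ}

/-- Invariants of the main loop of the search for distances. -/
structure DialState (X : Layout A B) (M : Finset (A × B)) (y : A ⊕ B → ℤ) (Y : ℤ) (s : State)
    (R S F : Finset ℤ) : Prop where
  dial : X.Dial M y Y (s.arr aDA) (s.arr aDB) (s.var xD) R S F []
  lists : Lists (Set.Ico 0 (2 * (X.hi - X.lo) + 4)) (s.arr aBK) (s.arr aNX)
    (X.bucket y (s.arr aDB)) R
  le : s.var xD ≤ 2 * (X.hi - X.lo) + 4
  found : (s.var xFd = 0 ∧ ∀ a, X.IA a → FreeA M a → s.arr aDA (X.ia a) = 0) ∨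
    (s.var xFd = 1 ∧ Y + s.var xD ≤ 2 * (X.hi + 1 - X.lo) + 1 ∧
      (∃ a, X.IA a ∧ FreeA M a ∧ s.arr aDA (X.ia a) = s.var xD + 1) ∧
      ∀ a, X.IA a → FreeA M a → s.arr aDA (X.ia a) ≠ 0 → s.arr aDA (X.ia a) = s.var xD + 1)

/-- Potential argument: an edge in a bucket holds 20 units. They and the cost of its insertion come
from the 40 units for the growth of S, which never shrinks. Advancing d and finding a free vertex
pay for themselves. -/
theorem dialStep_spec (hN : 2 * X.hi + 10 ≤ N) (hb : Bdd N s) (hs : X.Static s)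
    (hm : X.Mates M (s.arr aMA) (s.arr aMB)) (hd : X.Duals y (s.arr aYA) (s.arr aYB))
    (hF : X.G.Feasible M y Y)
    (hL : Lists X.dom (s.arr aLH) (s.arr aLN) X.keyB (X.unmatched M))
    {R S F : Finset ℤ} (hD : DialState X M y Y s R S F) (h0 : s.var xFd = 0)
    (h1 : s.var xD < 2 * (X.hi - X.lo) + 4) :
    wp N dialStep (fun s' t' => ∃ R' S' F', DialState X M y Y s' R' S' F' ∧
      (t' : ℤ) + 1 + 20 * R'.card ≤
        t + 20 * R.card + 40 * (S'.card - S.card : ℤ) + 20 * (s'.var xD - s.var xD) +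
        20 * s'.var xFd) s t := by
  have hl := X.one_le
  have hle := X.lo_le
  obtain ⟨hD, hK, hDle, hfound⟩ := hD
  have hfound : ∀ a, X.IA a → FreeA M a → s.arr aDA (X.ia a) = 0 := by
    rcases hfound with h | h
    · exact h.2
    · omega
  have hd0 := hD.d_nonneg
  have hdD : s.var xD ∈ Set.Ico (0 : ℤ) (2 * (X.hi - X.lo) + 4) := ⟨hd0, h1⟩
  simp only [dialStep, wp_seq, wp_assign, wp_ite, wp_write, wp_skip, Expr.val, Op.val, ne_eq,
    Function.update_self, Function.update_of_ne, Nat.reduceEqDiff, not_false_eq_true]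
  refine ⟨hb.2 _ _, fun he0 => ?_, fun he0 => ?_⟩
  swap
  · have hne := hK.ne_of_head hdD he0
    refine ⟨by rw [abs_le]; omega, R, S, F, ⟨hD.succ hne, hK, ?_, Or.inl ⟨?_, hfound⟩⟩, ?_⟩
    · simp; omega
    · simpa using h0
    · simp [h0]; omega
  obtain ⟨heR, hek, hK'⟩ := hK.pop hdD he0
  set e := s.arr aBK (s.var xD) with he
  obtain ⟨hu, hdb⟩ := hD.S_sub e (hD.R_sub e heR)
  obtain ⟨⟨e1, e2⟩, e3⟩ := Layout.mem_unmatched.1 hu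
  have hcard : ((R.erase e).card : ℤ) = R.card - 1 := by
    have := Finset.card_erase_add_one heR; omega
  refine ⟨hb.2 _ _, hb.2 _ _, ?_⟩
  rw [hs.ea e e1 e2]
  refine ⟨fun ha => ?_, fun ha => ?_⟩
  · refine ⟨R.erase e, S, F, ⟨hD.pop heR hek ha, hK', by simpa using hDle, ?_⟩, ?_⟩
    · exact Or.inl ⟨by simpa using h0, hfound⟩
    · simp [h0, hcard]; omega
  refine ⟨by rw [abs_le]; omega, hb.2 _ _, ?_⟩
  rcases hm.left _ (Layout.ia_mem e1 e2) with ⟨hfree, hma⟩ | ⟨g, g1, g2, hg, hge, hma⟩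
  · rw [hma]
    refine ⟨fun h => absurd rfl h, fun _ => ⟨by rw [abs_le]; omega, R.erase e, S, F,
      ⟨?_, hK', by simpa using hDle, Or.inr ⟨by simp, ?_, ?_, ?_⟩⟩, ?_⟩⟩
    · simpa using hD.newA hF heR hek ha hfree
    -- At a free vertex of A the dual weight is 0, so the bound reads Y + d ≤ 2|F| + 1. Hence the
    -- dual weights stay linear in the number of edges.
    · have k1 := hD.bucket_le hu hdb
      have k2 := hD.card_F_le
      rw [hF.left_free _ hfree] at k1
      simp
      omega
    · exact ⟨_, Layout.ia_mem e1 e2, hfree, by simp⟩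
    · intro a ha1 ha2 ha3
      by_cases haa : a = (X.ed e).1
      · subst haa; simp
      · simp [X.ia_inj.eq_iff, haa, hfound a ha1 ha2] at ha3
    · simp [hcard]; omega
  · rw [hma]
    refine ⟨fun _ => ?_, fun h => by omega⟩
    rw [hs.eb g g1 g2]
    obtain ⟨l, hl1, hl2, hl3⟩ := hL (X.keyB g) (Layout.keyB_mem g1 g2)
    obtain ⟨hdb0, hD', heF⟩ := hD.newAB hF heR hek ha g1 g2 hg hge hl2 hl3
    refine ⟨hb.2 aEB g |> fun h => by rwa [hs.eb g g1 g2] at h, by rw [abs_le]; omega,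
      hb.2 _ _, ?_⟩
    have hb' := ((((((((hb.assign (x := xE) (hb.2 aBK (s.var xD))).write (a := aBK)
      (i := s.var xD) (hb.2 aNX e)).assign (x := xA) (v := X.ia (X.ed e).1)
      (by rw [← hs.ea e e1 e2]; exact hb.2 _ _)).write
      (a := aDA) (i := X.ia (X.ed e).1) (v := s.var xD + 1) (by rw [abs_le]; omega)).assign
      (x := xG) (v := g) (by rw [abs_le]; omega)).assign (x := xB) (v := X.ib (X.ed g).2)
      (by rw [← hs.eb g g1 g2]; exact hb.2 _ _)).write
      (a := aDB) (i := X.ib (X.ed g).2) (v := s.var xD + 1) (by rw [abs_le]; omega)).assign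
      (x := xF) (hb.2 aLH (X.ib (X.ed g).2)))
    refine wp_conseq hb' (scan_spec (F := insert e F) (by omega) hF l _ _ (R.erase e) S hb'
      ⟨hs.ea, hs.eb, hs.wt, hs.pc, hs.lo, hs.hi⟩ hd ?_ ?_ ?_ ?_) ?_
    · simpa [Layout.keyB] using hD'
    · simp only [Function.update_of_ne, Function.update_self, ne_eq, Nat.reduceEqDiff,
        not_false_eq_true]
      refine hK'.congr_key fun f hf => ?_
      have := (hD.S_sub f (hD.R_sub f (Finset.mem_of_mem_erase hf))).2
      unfold Layout.bucket
      rw [Function.update_of_ne]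
      intro hc
      exact this (by rw [hc]; exact hdb0)
    · simpa [Layout.keyB] using hl1
    · intro f hf
      simpa [Layout.keyB] using ((hl3 f).1 hf).2
    · rintro s' t' hb2 hf2 ⟨ht, R', S', r1, r2, r3, r4⟩
      have hxD : s'.var xD = s.var xD := by rw [hf2.1 xD (by decide)]; simp
      have hFd : s'.var xFd = 0 := by rw [hf2.1 xFd (by decide)]; simpa using h0
      refine ⟨R', S', insert e F, ⟨r1, r2, by omega, Or.inl ⟨hFd, fun a ha1 ha2 => ?_⟩⟩, ?_⟩
      · rw [hf2.2 aDA (by decide)]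
        have haa : a ≠ (X.ed e).1 := by
          rintro rfl; exact ha2 _ hg hge
        simp [X.ia_inj.eq_iff, haa, hfound a ha1 ha2]
      · rw [hxD, hFd, r3, r4]
        push_cast at ht ⊢
        omega

/-- Every edge enters a bucket at most once and the number of buckets is linear, so the potential of
a single step adds up to linear time. Running out of buckets means that no free vertex is reachable.
-/
theorem stageOne_spec (hN : 2 * X.hi + 10 ≤ N) (hb : Bdd N s) (hs : X.Static s)
    (hm : X.Mates M (s.arr aMA) (s.arr aMB)) (hd : X.Duals y (s.arr aYA) (s.arr aYB))
    (hF : X.G.Feasible M y Y)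
    (hL : Lists X.dom (s.arr aLH) (s.arr aLN) X.keyB (X.unmatched M))
    (hA : ∀ a, X.IA a → s.arr aDA (X.ia a) = 0)
    (hB : ∀ b, X.IB b → s.arr aDB (X.ib b) = 0) :
    wp N stageOne (fun s' t' => (t' : ℤ) ≤ t + 150 * (X.hi + 1 - X.lo) + 150 ∧
      ((s'.var xFd = 0 ∧ X.G.minDist M y = ⊤) ∨ (s'.var xFd = 1 ∧ ∃ L : ℕ, s'.var xD = L ∧
        X.G.minDist M y = L ∧ Y + L ≤ 2 * (X.hi + 1 - X.lo) + 1 ∧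
        (∀ a, X.IA a → X.G.updateDuals M y (Sum.inl a) = if s'.arr aDA (X.ia a) = 0 then
          y (Sum.inl a) else y (Sum.inl a) + (s'.var xD + 1 - s'.arr aDA (X.ia a))) ∧
        ∀ b, X.IB b → X.G.updateDuals M y (Sum.inr b) = if s'.arr aDB (X.ib b) = 0 then
          y (Sum.inr b) else y (Sum.inr b) + (s'.var xD + 1 - s'.arr aDB (X.ib b))))) s t := by
  have hl := X.one_le
  have hle := X.lo_le
  unfold stageOne
  rw [wp_seq]
  refine wp_conseq hb (clearBuckets_spec (by omega) hb hs) ?_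
  rintro s1 t1 hb1 hf1 ⟨ht1, hK1, hbk1⟩
  have hs1 := hs.of_frame hf1 (by decide) (by decide) (by decide) (by decide) (by decide)
    (by decide)
  rw [wp_seq]
  refine wp_conseq hb1 (initBuckets_spec (M := M) (y := y) (Y := Y) (by omega) hb1 hs1 ?_ ?_ hF ?_ ?_
    hbk1) ?_
  · rw [hf1.2 aMA (by decide), hf1.2 aMB (by decide)]; exact hm
  · rw [hf1.2 aYA (by decide), hf1.2 aYB (by decide)]; exact hd
  · rw [hf1.2 aDA (by decide)]; exact hA
  · rw [hf1.2 aDB (by decide)]; exact hB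
  rintro s2 t2 hb2 hf2 ⟨ht2, S, hD2, hl2⟩
  have hs2 := hs1.of_frame hf2 (by decide) (by decide) (by decide) (by decide) (by decide)
    (by decide)
  have hda2 : s2.arr aDA = s.arr aDA := by rw [hf2.2 aDA (by decide), hf1.2 aDA (by decide)]
  simp only [wp_seq, wp_assign, Expr.val, abs_zero]
  refine ⟨by omega, by omega, ?_⟩
  have hb3 := (hb2.assign (x := xFd) (v := 0) (by rw [abs_zero]; omega)).assign (x := xD) (v := 0)
    (by rw [abs_zero]; omega)
  have hS := hD2.card_S_le
  refine wp_while hb3 (t + 150 * (X.hi + 1 - X.lo) + 140).toNat (fun s' t' => ∃ R' S' F',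
    DialState X M y Y s' R' S' F' ∧ (s'.var xFd = 0 ∨ s'.var xFd = 1) ∧
    (t' : ℤ) + 20 * R'.card ≤ t2 + 2 + 40 * S'.card + 20 * s'.var xD + 20 * s'.var xFd) ?_ ?_
  · refine ⟨S, S, ∅, ⟨by simpa using hD2, hl2, by simp; omega, Or.inl ⟨by simp, ?_⟩⟩,
      Or.inl (by simp), ?_⟩
    · intro a ha _
      simp only [hda2]; exact hA a ha
    · simp; omega
  rintro s' t' hb' hf' ⟨R, S', F, hD, hfd, ht⟩
  have hS' := hD.dial.card_S_le
  have hDle := hD.le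
  have hxK : s'.var xK = 2 * (X.hi - X.lo) + 4 := by
    rw [hf'.1 xK (by decide)]; simp; rw [hf2.1 xK (by decide)]; exact hK1
  refine ⟨by omega, fun hc => ?_, fun hc => ?_⟩
  -- The guard compares two truth values: it holds exactly if nothing has been found and there are
  -- buckets left.
  · simp only [Expr.val, Op.val, hxK] at hc
    have h0 : s'.var xFd = 0 := by
      rcases hfd with h | h
      · exact h
      · rw [h] at hc; split_ifs at hc <;> simp_all
    rw [h0] at hc
    have h1 : s'.var xD < 2 * (X.hi - X.lo) + 4 := by
      by_contra h; simp [h] at hc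
    have e1 : ∀ a, a ∉ [aDA, aDB, aBK, aNX] → s'.arr a = s.arr a := by
      intro a ha
      rw [hf'.2 a, hf2.2 a, hf1.2 a]
      · intro h; apply ha; revert h; simp [clearBuckets, Cmd.arrs]; tauto
      · intro h; apply ha; revert h; simp [initBuckets, forEdges, Cmd.arrs]; tauto
      · intro h; apply ha; revert h; simp [dialStep, scan, Cmd.arrs]; tauto
    have hs3 : X.Static s' := by
      exact Layout.Static.of_frame (p := dialStep)
        (s := { s2 with var := Function.update (Function.update s2.var xFd 0) xD 0 })
        ⟨hs2.ea, hs2.eb, hs2.wt, hs2.pc, by simpa using hs2.lo, by simpa using hs2.hi⟩ hf'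
        (by decide) (by decide) (by decide) (by decide) (by decide) (by decide)
    refine wp_conseq hb' (dialStep_spec hN hb' hs3 ?_ ?_ hF ?_ hD h0 h1) ?_
    · rw [e1 aMA (by decide), e1 aMB (by decide)]; exact hm
    · rw [e1 aYA (by decide), e1 aYB (by decide)]; exact hd
    · rw [e1 aLH (by decide), e1 aLN (by decide)]; exact hL
    · rintro s3 t3 _ _ ⟨R3, S3, F3, hD3, ht3⟩
      refine ⟨R3, S3, F3, hD3, ?_, ?_⟩
      · rcases hD3.found with h | h
        · exact Or.inl h.1
        · exact Or.inr h.1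
      · push_cast at ht3; omega
  · refine ⟨by push_cast; omega, ?_⟩
    simp only [Expr.val, Op.val, hxK] at hc
    rcases hD.found with ⟨h0, h1⟩ | ⟨h0, h1, ⟨a, ha1, ha2, ha3⟩, h3⟩
    · refine Or.inl ⟨h0, ?_⟩
      have hd' : s'.var xD = 2 * (X.hi - X.lo) + 4 := by
        by_contra h
        have : s'.var xD < 2 * (X.hi - X.lo) + 4 := by omega
        simp [h0, this] at hc
      -- All buckets have been passed, while `bucket_lt` keeps every edge below the last one.
      have hR : R = ∅ := by
        rw [Finset.eq_empty_iff_forall_notMem]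
        intro e he
        have k1 := hD.dial.key_ge e he
        have k2 := hD.dial.S_sub e (hD.dial.R_sub e he)
        have k3 := hD.dial.bucket_lt hF k2.1 k2.2
        omega
      subst hR
      exact hD.dial.minDist_eq_top hF h1
    · obtain ⟨L, hL'⟩ := Int.eq_ofNat_of_zero_le hD.dial.d_nonneg
      obtain ⟨k1, k2, k3⟩ := hD.dial.minDist_eq hF hL' ha1 ha2 ha3 h3
      exact Or.inr ⟨h0, L, hL', k1, by omega, k2, k3⟩

/-- A vertex is met once for each of its edges. Resetting its distance to 0 after the correction
prevents a second one; the invariant says that the new dual weight is the stored value plus the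
correction still pending. -/
theorem adjustDuals_spec (hN : 2 * X.hi + 10 ≤ N) (hb : Bdd N s) (hs : X.Static s)
    {y' : A ⊕ B → ℤ} {Y' : ℤ} (hF' : X.G.Feasible M y' Y') (hY' : 0 ≤ Y') (hYN : Y' ≤ N)
    (hA : ∀ a, X.IA a → y' (Sum.inl a) = if s.arr aDA (X.ia a) = 0 then s.arr aYA (X.ia a)
      else s.arr aYA (X.ia a) + (s.var xD + 1 - s.arr aDA (X.ia a)))
    (hB : ∀ b, X.IB b → y' (Sum.inr b) = if s.arr aDB (X.ib b) = 0 then s.arr aYB (X.ib b)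
      else s.arr aYB (X.ib b) + (s.var xD + 1 - s.arr aDB (X.ib b))) :
    wp N adjustDuals (fun s' t' => (t' : ℤ) ≤ t + 20 * (X.hi + 1 - X.lo) + 3 ∧
      X.Duals y' (s'.arr aYA) (s'.arr aYB)) s t := by
  have hl := X.one_le
  have hle := X.lo_le
  have hya : ∀ a, |y' (Sum.inl a)| ≤ N := fun a => by
    have h1 := hF'.left_nonneg a
    have h2 := hF'.left_le a
    rw [abs_le]; omega
  have hyb : ∀ b, |y' (Sum.inr b)| ≤ N := fun b => by
    have h1 := hF'.right_ge hY' b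
    have h2 := hF'.right_le b
    rw [abs_le]; omega
  unfold adjustDuals
  refine wp_forEdges (lo := X.lo) (hi := X.hi) hb (t + 20 * (X.hi + 1 - X.lo) + 1).toNat
    (fun i s' t' => (t' : ℤ) ≤ t + 20 * (i - X.lo) + 1 ∧
      (∀ a, X.IA a → y' (Sum.inl a) = if s'.arr aDA (X.ia a) = 0 then s'.arr aYA (X.ia a)
        else s'.arr aYA (X.ia a) + (s.var xD + 1 - s'.arr aDA (X.ia a))) ∧
      (∀ b, X.IB b → y' (Sum.inr b) = if s'.arr aDB (X.ib b) = 0 then s'.arr aYB (X.ib b)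
        else s'.arr aYB (X.ib b) + (s.var xD + 1 - s'.arr aDB (X.ib b))) ∧
      ∀ e, X.lo ≤ e → e < i → s'.arr aDA (X.ia (X.ed e).1) = 0 ∧
        s'.arr aDB (X.ib (X.ed e).2) = 0) hs.lo hs.hi (by omega) (by omega)
    (by omega) (by decide) (by decide) ?_ ?_ ?_ ?_
  · exact ⟨by push_cast; omega, hA, hB, fun e h1 h2 => by omega⟩
  · rintro i s' t' hi ⟨h, -⟩; omega
  · rintro i s' t' hi1 hi2 hb' hf he ⟨ht, hA', hB', hz⟩
    have hs' := hs.of_frame hf (by decide) (by decide) (by decide) (by decide) (by decide)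
      (by decide)
    have hD : s'.var xD = s.var xD := hf.1 _ (by decide)
    have ha := hA' _ (Layout.ia_mem hi1 hi2)
    have hbb := hB' _ (Layout.ib_mem hi1 hi2)
    have hna := hya (X.ed i).1
    have hnb := hyb (X.ed i).2
    rw [wp_seq]
    have step1 : wp N (.ite (.read aDA (.read aEA (.var xE))) (
        .write aYA (.read aEA (.var xE)) (.plus (.read aYA (.read aEA (.var xE)))
          (.minus (.plus (.var xD) (.const 1)) (.read aDA (.read aEA (.var xE))))) ;;
        .write aDA (.read aEA (.var xE)) (.const 0)) .skip)
        (fun s'' t'' => t'' ≤ t' + 5 ∧ 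
          (∀ a, X.IA a → y' (Sum.inl a) = if s''.arr aDA (X.ia a) = 0 then s''.arr aYA (X.ia a)
            else s''.arr aYA (X.ia a) + (s.var xD + 1 - s''.arr aDA (X.ia a))) ∧
          s''.arr aDA (X.ia (X.ed i).1) = 0 ∧
          ∀ e, X.lo ≤ e → e < i → s''.arr aDA (X.ia (X.ed e).1) = 0) s' (t' + 1) := by
      simp only [wp_seq, wp_write, wp_ite, wp_skip, Expr.val, Op.val, he, hs'.ea i hi1 hi2, hD,
        ne_eq, Function.update_self, Function.update_of_ne, Nat.reduceEqDiff, not_false_eq_true,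
        abs_zero]
      refine ⟨fun h0 => ?_, fun h0 => ⟨by omega, hA', h0, fun e h1 h2 => (hz e h1 h2).1⟩⟩
      rw [if_neg h0] at ha
      rw [← ha]
      refine ⟨hna, by omega, by omega, ?_, trivial, ?_⟩
      · intro a ha'
        by_cases haa : a = (X.ed i).1
        · subst haa; simp
        · simpa [X.ia_inj.eq_iff, haa] using hA' a ha'
      · intro e h1 h2
        simp only [Function.update_apply, (hz e h1 h2).1, ite_self]
    refine wp_conseq hb' step1 ?_
    rintro s1 t1 hb1 hf1 ⟨ht1, hA1, h01, hz1⟩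
    have hs1 := hs'.of_frame hf1 (by decide) (by decide) (by decide) (by decide) (by decide)
      (by decide)
    have he1 : s1.var xE = i := by rw [hf1.1 xE (by decide), he]
    have hD1 : s1.var xD = s.var xD := by rw [hf1.1 xD (by decide), hD]
    have e1 : s1.arr aDB = s'.arr aDB := hf1.2 _ (by decide)
    have e2 : s1.arr aYB = s'.arr aYB := hf1.2 _ (by decide)
    simp only [wp_seq, wp_write, wp_ite, wp_skip, Expr.val, Op.val, he1, hs1.eb i hi1 hi2, hD1,
        ne_eq, Function.update_self, Function.update_of_ne, Nat.reduceEqDiff, not_false_eq_true,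
        abs_zero, e1, e2]
    refine ⟨fun h0 => ?_, fun h0 => ⟨by push_cast; omega, hA1, hB', fun e h1 h2 => ?_⟩⟩
    · rw [if_neg h0] at hbb
      rw [← hbb]
      refine ⟨hnb, by omega, by push_cast; omega, hA1, ?_, ?_⟩
      · intro b hb'
        by_cases hbb : b = (X.ed i).2
        · subst hbb; simp
        · simpa [X.ib_inj.eq_iff, hbb] using hB' b hb'
      · intro e h1 h2
        rcases eq_or_ne e i with rfl | hne
        · simp [h01]
        · refine ⟨hz1 e h1 (by omega), ?_⟩
          simp only [Function.update_apply, (hz e h1 (by omega)).2, ite_self]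
    · rcases eq_or_ne e i with rfl | hne
      · exact ⟨h01, h0⟩
      · exact ⟨hz1 e h1 (by omega), (hz e h1 (by omega)).2⟩
  · rintro s' t' hb' hf ⟨ht, hA', hB', hz⟩
    refine ⟨by push_cast; omega, ?_, ?_⟩
    · rintro a ⟨e, h1, h2, rfl⟩
      rw [hA' _ (Layout.ia_mem h1 h2), if_pos (hz e h1 (by omega)).1]
    · rintro b ⟨e, h1, h2, rfl⟩
      rw [hB' _ (Layout.ib_mem h1 h2), if_pos (hz e h1 (by omega)).2]

end

end RAM

namespace RAM

set_option linter.unusedSectionVars false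

open WGraph

/-! ## Second stage: depth-first search -/

/-- The cells `0, 1, …` of the array contain the elements of the list, the last one first. -/
def Stored (f : ℤ → ℤ) : List ℤ → Prop
  | [] => True
  | e :: l => f l.length = e ∧ Stored f l

theorem Stored.update {f : ℤ → ℤ} {v : ℤ} {k : ℕ} : ∀ {l : List ℤ}, l.length ≤ k → Stored f l →
    Stored (Function.update f k v) l
  | [], _, _ => trivial
  | e :: l, hk, h => by
    simp only [List.length_cons] at hk
    refine ⟨?_, Stored.update (by omega) h.2⟩
    rw [Function.update_of_ne (by omega)]
    exact h.1

theorem Stored.push {f : ℤ → ℤ} {l : List ℤ} {v : ℤ} (h : Stored f l) :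
    Stored (Function.update f l.length v) (v :: l) :=
  ⟨by simp, h.update le_rfl⟩

/-- Run `body` for the elements of the list of length `x` that is stored in the array `a`. -/
def forStored (x a : ℕ) (body : Cmd) : Cmd :=
  .while (.var x) (.assign x (.minus (.var x) (.const 1)) ;; .assign xF (.read a (.var x)) ;; body)

/-- The loop runs downwards from the last cell, which holds the head of the list, so the elements
still to be treated form a suffix. The counter ends at 0 and the array is left intact. -/
theorem wp_forStored {N : ℤ} {x a : ℕ} {body : Cmd} {Q : State → ℕ → Prop}
    (hx : x ∉ body.vars) (hxF : xF ≠ x) (ha : a ∉ body.arrs) (I : List ℤ → State → ℕ → Prop)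
    {L : List ℤ} {s : State} {t : ℕ} (hb : Bdd N s) (hL : (L.length : ℤ) ≤ N)
    (hS : Stored (s.arr a) L) (hlen : s.var x = L.length) (h0 : I L s t)
    (hstep : ∀ f l s' t', (f :: l) <:+ L → Bdd N s' → Frame (forStored x a body) s s' →
      I (f :: l) s' t' → ∀ s1,
      s1 = { s' with var := Function.update (Function.update s'.var x l.length) xF f } →
      Bdd N s1 →
        wp N body (I l) s1 (t' + 3))
    (hQ : ∀ s' t', Bdd N s' → Frame (forStored x a body) s s' → I [] s' t' → Q s' (t' + 1)) :
    wp N (forStored x a body) Q s t := by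
  have key : ∀ (l : List ℤ) (s' : State) (t' : ℕ), l <:+ L → Bdd N s' →
      Frame (forStored x a body) s s' → s'.var x = l.length → I l s' t' →
      wp N (forStored x a body) Q s' t' := by
    intro l
    induction l with
    | nil =>
      intro s' t' _ hb' hf hl hI
      exact wp_while_false (by simpa [Expr.val] using hl) (hQ s' t' hb' hf hI)
    | cons f l ih =>
      intro s' t' hsuf hb' hf hl hI
      have hlenL : l.length + 1 ≤ L.length := by simpa using hsuf.length_le
      have hSa : Stored (s'.arr a) L := by
        rw [hf.2 a (by simpa [forStored, Cmd.arrs] using ha)]; exact hS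
      have hSf : s'.arr a l.length = f := by
        obtain ⟨r, hr⟩ := hsuf
        rw [← hr] at hSa
        clear hr
        induction r with
        | nil => exact hSa.1
        | cons _ r ihr => exact ihr hSa.2
      have hf1 : |f| ≤ N := by rw [← hSf]; exact hb'.2 _ _
      simp only [List.length_cons] at hl
      refine wp_while_true (by simp only [Expr.val, hl]; push_cast; omega) ?_
      have hb1 := (hb'.assign (x := x) (v := l.length) (by rw [abs_le]; omega)).assign
        (x := xF) hf1
      have hx' : s'.var x - 1 = l.length := by omega
      simp only [wp_seq, wp_assign, Expr.val, Op.val, hx', Function.update_self, hSf]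
      refine ⟨by rw [abs_le]; omega, hf1, ?_⟩
      refine wp_conseq hb1 (hstep f l s' t' hsuf hb' hf hI _ rfl hb1) ?_
      intro s2 t2 hb2 hf2 hI2
      refine ih s2 t2 ((List.suffix_cons f l).trans hsuf) hb2 ?_ ?_ hI2
      · refine ⟨fun z hz => ?_, fun z hz => ?_⟩
        · rw [← hf.1 z hz]
          simp only [forStored, Cmd.vars, List.mem_append, List.mem_singleton, not_or] at hz
          rw [hf2.1 z hz.2.2]
          simp [hz.1, hz.2.1]
        · rw [← hf.2 z hz]
          simp only [forStored, Cmd.arrs, List.nil_append] at hz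
          rw [hf2.2 z hz]
      · rw [hf2.1 x hx]
        simp [Function.update_of_ne hxF.symm]
  exact key L s t (List.suffix_refl _) hb (Frame.refl _ _) hlen h0

/-- One step of the depth-first search. -/
def searchStep : Cmd :=
  .assign xF (.read aLH (.var xB)) ;;
  .ite (.var xF) (
    .write aLH (.var xB) (.read aLN (.var xF)) ;;
    .assign xA (.read aEA (.var xF)) ;;
    .ite (.minus (.plus (.read aWt (.var xF)) (.read aYA (.var xA))) (.read aYB (.var xB))) .skip (
      .write aVs (.var xNv) (.var xF) ;;
      .assign xNv (.plus (.var xNv) (.const 1)) ;;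
      .ite (.read aFl (.var xA)) .skip (
        .write aSt (.var xSp) (.var xF) ;;
        .assign xSp (.plus (.var xSp) (.const 1)) ;;
        .assign xG (.read aMA (.var xA)) ;;
        .ite (.var xG) (
          .write aFl (.var xA) (.const 1) ;;
          .write aVs (.var xNv) (.var xG) ;;
          .assign xNv (.plus (.var xNv) (.const 1)) ;;
          .assign xB (.read aEB (.var xG)))
        (.assign xRes (.const 2)))))
  (.ite (.var xSp) (
    .assign xSp (.minus (.var xSp) (.const 1)) ;;
    .assign xB (.read aEB (.read aSt (.var xSp))))
    (.assign xRes (.const 1)))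

/-- The depth-first search. -/
def search : Cmd :=
  .assign xSp (.const 0) ;; .assign xNv (.const 0) ;; .assign xRes (.const 0) ;;
  .while (.equal (.var xRes) (.const 0)) searchStep

section

variable {A B : Type} [DecidableEq A] [DecidableEq B] {X : Layout A B} {N : ℤ} {s : State} {t : ℕ}
  {S : StageState A B} {Y : ℤ} {R : Finset ℤ} {b : B}

namespace Layout

variable (X)

/-- The memory during the second stage: `R` is the set of the edges that are still in the
lists. -/
structure StageMem (S : StageState A B) (Y : ℤ) (s : State) (R : Finset ℤ) : Prop where
  feasible : X.G.Feasible S.M S.y Y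
  mates : X.Mates S.M (s.arr aMA) (s.arr aMB)
  duals : X.Duals S.y (s.arr aYA) (s.arr aYB)
  lists : Lists X.dom (s.arr aLH) (s.arr aLN) X.keyB R
  sub : ∀ e ∈ R, X.lo ≤ e ∧ e ≤ X.hi ∧ X.ed e ∉ S.M ∧ X.ed e ∉ S.deleted
  -- Together with `sub` this is deliberately not an equality: the lists may contain edges of
  -- positive slack, which are discarded when they are met.
  sup : ∀ e, X.lo ≤ e → e ≤ X.hi → X.ed e ∉ S.M → X.G.slack S.M S.y (X.ed e) = 0 →
    X.ed e ∉ S.deleted → e ∈ R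
  -- A matched vertex of A has only one outgoing arc, so one flag per vertex replaces the marking of
  -- matching edges.
  flag : ∀ a, X.IA a → (s.arr aFl (X.ia a) ≠ 0 ↔ ∃ e ∈ S.M, e.1 = a ∧ e ∈ S.deleted)

/-- The list of edge numbers describes a path from `b` whose end is the vertex of `B`. -/
inductive Stack (M vis : Finset (A × B)) (b : B) : List ℤ → B → List (A ⊕ B) → Prop
  | nil : Stack M vis b [] b [Sum.inr b]
  | cons (f g : ℤ) (l : List ℤ) (P : List (A ⊕ B)) : Stack M vis b l (X.ed f).2 P → X.lo ≤ f →
      f ≤ X.hi → X.ed f ∉ M → X.ed f ∈ vis → f ∉ l → X.ed g ∈ M → (X.ed g).1 = (X.ed f).1 →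
      X.ed g ∈ vis → Stack M vis b (f :: l) (X.ed g).2
        (Sum.inr (X.ed g).2 :: Sum.inl (X.ed f).1 :: P)

variable {X}

namespace Stack

variable {M vis : Finset (A × B)} {l : List ℤ} {c : B} {P : List (A ⊕ B)}

theorem mono {vis' : Finset (A × B)} (hv : vis ⊆ vis') (h : X.Stack M vis b l c P) :
    X.Stack M vis' b l c P := by
  induction h with
  | nil => exact .nil
  | cons f g l P _ h1 h2 h3 h4 h5 h6 h7 h8 ih =>
    exact .cons f g l P ih h1 h2 h3 (hv h4) h5 h6 h7 (hv h8)

theorem head (h : X.Stack M vis b l c P) : ∃ P', P = Sum.inr c :: P' := by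
  cases h with
  | nil => exact ⟨_, rfl⟩
  | cons => exact ⟨_, rfl⟩

theorem mem_left (h : X.Stack M vis b l c P) {a : A} (ha : Sum.inl a ∈ P) :
    ∃ e ∈ M, e ∈ vis ∧ e.1 = a := by
  induction h with
  | nil => simp at ha
  | cons f g l P _ h1 h2 h3 h4 h5 h6 h7 h8 ih =>
    simp only [List.mem_cons, reduceCtorEq, Sum.inl.injEq, false_or] at ha
    rcases ha with rfl | ha
    · exact ⟨_, h6, h8, h7⟩
    · exact ih ha

theorem mem_right (h : X.Stack M vis b l c P) {x : B} (hx : Sum.inr x ∈ P) :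
    x = b ∨ ∃ e ∈ M, e ∈ vis ∧ e.2 = x := by
  induction h with
  | nil => simp at hx; exact Or.inl hx
  | cons f g l P _ h1 h2 h3 h4 h5 h6 h7 h8 ih =>
    simp only [List.mem_cons, reduceCtorEq, Sum.inr.injEq, false_or] at hx
    rcases hx with rfl | hx
    · exact Or.inr ⟨_, h6, h8, rfl⟩
    · exact ih hx

theorem mem_list (h : X.Stack M vis b l c P) : ∀ f ∈ l, X.lo ≤ f ∧ f ≤ X.hi ∧ X.ed f ∉ M ∧
    X.ed f ∈ vis := by
  induction h with
  | nil => simp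
  | cons f g l P _ h1 h2 h3 h4 h5 h6 h7 h8 ih =>
    simp only [List.mem_cons, forall_eq_or_imp]
    exact ⟨⟨h1, h2, h3, h4⟩, ih⟩

theorem nodup (h : X.Stack M vis b l c P) : l.Nodup := by
  induction h with
  | nil => simp
  | cons f g l P _ h1 h2 h3 h4 h5 h6 h7 h8 ih => exact List.nodup_cons.2 ⟨h5, ih⟩

theorem root (h : X.Stack M vis b l c P) : c = b ∨ ∃ f ∈ l, (X.ed f).2 = b := by
  induction h with
  | nil => exact Or.inl rfl
  | cons f g l P _ h1 h2 h3 h4 h5 h6 h7 h8 ih =>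
    refine Or.inr ?_
    rcases ih with h | ⟨f', h, h'⟩
    · exact ⟨f, by simp, h⟩
    · exact ⟨f', by simp [h], h'⟩

/-- The stack holds only the unmatched edges; the matched edges of the path are recovered from their
ends in A. -/
theorem mem_pathEdges (hM : X.G.IsMatching M) (h : X.Stack M vis b l c P) (e : A × B) :
    e ∈ pathEdges P ↔ (∃ f ∈ l, X.ed f = e) ∨ (e ∈ M ∧ ∃ f ∈ l, (X.ed f).1 = e.1) := by
  induction h with
  | nil => simp [pathEdges]
  | cons f g l P hs h1 h2 h3 h4 h5 h6 h7 h8 ih =>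
    obtain ⟨P', rfl⟩ := hs.head
    have eq1 : ((X.ed f).1, (X.ed g).2) = X.ed g := by rw [← h7]
    have eq2 : ((X.ed f).1, (X.ed f).2) = X.ed f := rfl
    simp only [pathEdges, edgeBetween, Finset.mem_union, Finset.mem_singleton, eq1, eq2, ih,
      List.mem_cons, exists_eq_or_imp]
    constructor
    · rintro (rfl | rfl | (h | h))
      · exact Or.inr ⟨h6, Or.inl h7.symm⟩
      · exact Or.inl (Or.inl rfl)
      · exact Or.inl (Or.inr h)
      · exact Or.inr ⟨h.1, Or.inr h.2⟩
    · rintro ((h | h) | ⟨h, h' | h'⟩)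
      · exact Or.inr (Or.inl h.symm)
      · exact Or.inr (Or.inr (Or.inl h))
      · exact Or.inl (hM.2 _ h _ h6 (Or.inl (by rw [h7, h'])))
      · exact Or.inr (Or.inr (Or.inr ⟨h, h'⟩))

end Stack

theorem length_le {l : List ℤ} (hl : l.Nodup) (h : ∀ f ∈ l, X.lo ≤ f ∧ f ≤ X.hi) :
    (l.length : ℤ) ≤ X.hi + 1 - X.lo := by
  have h1 : l.toFinset ⊆ Finset.Icc X.lo X.hi := fun f hf => by
    rw [List.mem_toFinset] at hf
    exact Finset.mem_Icc.2 (h f hf)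
  have h2 := Finset.card_le_card h1
  rw [List.toFinset_card_of_nodup hl, Int.card_Icc] at h2
  have := X.lo_le
  omega

/-- The array of visited edges represents the set `vis`. -/
structure Visited (vis : Finset (A × B)) (s : State) (vs : List ℤ) : Prop where
  stored : Stored (s.arr aVs) vs
  length : s.var xNv = vs.length
  nodup : vs.Nodup
  mem : ∀ e, e ∈ vs ↔ X.lo ≤ e ∧ e ≤ X.hi ∧ X.ed e ∈ vis

theorem Visited.length_le {vis : Finset (A × B)} {vs : List ℤ} (h : X.Visited vis s vs) :
    (vs.length : ℤ) ≤ X.hi + 1 - X.lo :=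
  Layout.length_le h.nodup fun f hf => ⟨((h.mem f).1 hf).1, ((h.mem f).1 hf).2.1⟩

variable (X) in
/-- The depth-first search from `b` in progress. -/
structure Searching (S : StageState A B) (Y : ℤ) (b : B) (s : State) (R : Finset ℤ)
    (vis : Finset (A × B)) (vs st : List ℤ) (c : B) (P : List (A ⊕ B)) : Prop where
  mem : X.StageMem { S with deleted := S.deleted ∪ vis } Y s R
  dfs : X.G.DFS S b P vis
  stack : X.Stack S.M vis b st c P
  stored : Stored (s.arr aSt) st
  length : s.var xSp = st.length
  visited : X.Visited vis s vs
  cur : s.var xB = X.ib c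
  cur_mem : X.IB c

variable (X) in
/-- The search from `b` has found an augmenting path. -/
structure Found (S : StageState A B) (Y : ℤ) (b : B) (s : State) (R : Finset ℤ)
    (vis : Finset (A × B)) (vs st : List ℤ) (P : List (A ⊕ B)) : Prop where
  mem : X.StageMem { S with deleted := S.deleted ∪ vis } Y s R
  finds : X.G.DFSFinds S b P vis
  stored : Stored (s.arr aSt) st
  length : s.var xSp = st.length
  visited : X.Visited vis s vs
  nodup : st.Nodup
  mem_list : ∀ f ∈ st, X.lo ≤ f ∧ f ≤ X.hi ∧ X.ed f ∉ S.M ∧ X.ed f ∈ vis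
  root : ∃ f ∈ st, (X.ed f).2 = b
  path : ∀ e, e ∈ pathEdges P ↔
    (∃ f ∈ st, X.ed f = e) ∨ (e ∈ S.M ∧ ∃ f ∈ st, (X.ed f).1 = e.1)

end Layout

end

end RAM

/-! ### One step of the depth-first search -/

namespace RAM

set_option linter.unusedSectionVars false

open WGraph

section

variable {A B : Type} [DecidableEq A] [DecidableEq B] {X : Layout A B} {N : ℤ} {s : State} {t : ℕ}
  {S : StageState A B} {Y : ℤ} {R : Finset ℤ} {b : B}

namespace Layout

theorem Duals.slack_eq {M : Finset (A × B)} {y : A ⊕ B → ℤ} {ya yb : ℤ → ℤ}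
    (hd : X.Duals y ya yb) {e : ℤ} (h1 : X.lo ≤ e) (h2 : e ≤ X.hi) (hM : X.ed e ∉ M) :
    X.G.slack M y (X.ed e) = X.w e + ya (X.ia (X.ed e).1) - yb (X.ib (X.ed e).2) := by
  rw [WGraph.slack, if_neg hM, hd.left _ (ia_mem h1 h2), hd.right _ (ib_mem h1 h2),
    X.weight e h1 h2]

theorem Visited.insert {vis : Finset (A × B)} {s' : State} {vs : List ℤ} {e : ℤ}
    (h : X.Visited vis s vs) (h1 : X.lo ≤ e) (h2 : e ≤ X.hi) (hv : X.ed e ∉ vis)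
    (hs : s'.arr aVs = Function.update (s.arr aVs) (s.var xNv) e)
    (hn : s'.var xNv = s.var xNv + 1) : X.Visited (insert (X.ed e) vis) s' (e :: vs) := by
  refine ⟨?_, ?_, ?_, ?_⟩
  · rw [hs, h.length]; exact h.stored.push
  · rw [hn, h.length]; simp
  · refine List.nodup_cons.2 ⟨fun he => hv ((h.mem e).1 he).2.2, h.nodup⟩
  · intro f
    rw [List.mem_cons, h.mem, Finset.mem_insert]
    constructor
    · rintro (rfl | h)
      · exact ⟨h1, h2, Or.inl rfl⟩
      · exact ⟨h.1, h.2.1, Or.inr h.2.2⟩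
    · rintro ⟨h3, h4, h5 | h5⟩
      · exact Or.inl (X.ed_inj _ _ h3 h4 h1 h2 h5)
      · exact Or.inr ⟨h3, h4, h5⟩

end Layout

/-- A step either consumes a list entry or shrinks the stack or ends the search. An entry holds 40
units, enough for the step and the 10 units of a new stack element; it also accounts for at most two
visited edges, itself and the matching edge behind it. -/
theorem searchStep_spec (hN : 2 * X.hi + 10 ≤ N) (hb : Bdd N s) (hs : X.Static s)
    {vis : Finset (A × B)} {vs st : List ℤ} {c : B} {P : List (A ⊕ B)}
    (h : X.Searching S Y b s R vis vs st c P) (hbf : FreeB S.M b) (h0 : s.var xRes = 0) :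
    wp N searchStep (fun s' t' => ∃ R' vis' vs' st' P',
      (t' : ℤ) + 40 * R'.card + 10 * st'.length + 1 ≤
        t + 40 * R.card + 10 * st.length + 10 * s'.var xRes ∧
      (vs'.length : ℤ) + 2 * R'.card ≤ vs.length + 2 * R.card ∧
      ((s'.var xRes = 0 ∧ ∃ c', X.Searching S Y b s' R' vis' vs' st' c' P') ∨
        (s'.var xRes = 1 ∧ X.StageMem { S with deleted := S.deleted ∪ vis' } Y s' R' ∧
          X.G.DFSFails S b vis') ∨
        (s'.var xRes = 2 ∧ X.Found S Y b s' R' vis' vs' st' P'))) s t := by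
  have hl := X.one_le
  have hle := X.lo_le
  obtain ⟨hmem, hdfs, hst, hsto, hsp, hvis, hcur, hcm⟩ := h
  have hstl := Layout.length_le hst.nodup fun f hf => ⟨(hst.mem_list f hf).1,
    (hst.mem_list f hf).2.1⟩
  have hvl := hvis.length_le
  have hM := hmem.feasible.matching
  have hcd : X.ib c ∈ X.dom := ⟨c, hcm, rfl⟩
  obtain ⟨P₀, rfl⟩ := hst.head
  simp only [searchStep, wp_seq, wp_assign, wp_ite, wp_write, wp_skip, Expr.val, Op.val, hcur,
    ne_eq, Function.update_self, Function.update_of_ne, Nat.reduceEqDiff, not_false_eq_true]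
  refine ⟨hb.2 _ _, fun hf0 => ?_, fun hf0 => ?_⟩
  swap
  · -- the list of the last vertex is exhausted
    have hne := hmem.lists.ne_of_head hcd hf0
    have hdone : ∀ e x, X.G.SearchArc S (Sum.inr c) e x → e ∈ vis := by
      rintro e x ⟨h1, h2, h3⟩
      by_contra hv
      cases h1 with
      | unmatched a _ k1 k2 =>
        obtain ⟨f, f1, f2, f3⟩ := X.ed_surj _ k1
        have : f ∈ R := hmem.sup f f1 f2 (by rw [f3]; exact k2) (by rw [f3]; exact h2)
          (by rw [f3]; simp [h3, hv])
        exact hne f this (by rw [Layout.keyB, f3])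
    refine ⟨fun hs0 => ?_, fun hs0 => ?_⟩
    · rw [hsp] at hs0 ⊢
      cases hst with
      | nil => simp at hs0
      | cons f g l P' hst' f1 f2 f3 f4 f5 g1 g2 g3 =>
        have hl1 : (((f :: l).length : ℕ) : ℤ) - 1 = l.length := by simp
        rw [hl1, hsto.1, hs.eb f f1 f2]
        obtain ⟨P'', rfl⟩ := hst'.head
        -- One step of the program is two of the abstract search: it leaves the exhausted vertex of
        -- B and then the vertex of A below it, whose only arc `g` is visited.
        have hd1 := DFS.pop _ _ _ _ hdfs hdone
        have hd2 := DFS.pop _ _ _ _ hd1 (by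
          rintro e x ⟨h1, -, -⟩
          cases h1 with
          | matched _ b' k1 =>
            rw [hM.2 _ k1 _ g1 (Or.inl g2.symm)]; exact g3)
        simp only [List.length_cons] at hstl
        push_cast at hstl
        refine ⟨by rw [abs_le]; omega, by rw [← hs.eb f f1 f2]; exact hb.2 _ _, R, vis, vs, l, _,
          ?_, le_rfl, Or.inl ⟨by simpa using h0, (X.ed f).2, ?_, hd2, hst', hsto.2, by simp,
          ?_, by simp, Layout.ib_mem f1 f2⟩⟩
        · simp [h0]; omega
        · exact ⟨hmem.feasible, hmem.mates, hmem.duals, hmem.lists, hmem.sub, hmem.sup,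
            hmem.flag⟩
        · exact ⟨hvis.stored, by simpa using hvis.length, hvis.nodup, hvis.mem⟩
    · rw [hsp] at hs0
      cases hst with
      | cons f g l P' => simp only [List.length_cons] at hs0; push_cast at hs0; omega
      | nil =>
        refine ⟨by rw [abs_le]; omega, R, vis, vs, [], [], ?_, le_rfl,
          Or.inr (Or.inl ⟨by simp, ?_, hdfs, hdone⟩)⟩
        · simp; omega
        · exact ⟨hmem.feasible, hmem.mates, hmem.duals, hmem.lists, hmem.sub, hmem.sup,
            hmem.flag⟩
  obtain ⟨hfR, hfk, hlists⟩ := hmem.lists.pop hcd hf0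
  set f := s.arr aLH (X.ib c) with hf
  obtain ⟨f1, f2, f3, f4⟩ := hmem.sub f hfR
  have hfc : (X.ed f).2 = c := X.ib_inj hfk
  have hfv : X.ed f ∉ vis := fun h => f4 (by simp [h])
  have hfd : X.ed f ∉ S.deleted := fun h => f4 (by simp [h])
  have hcard : ((R.erase f).card : ℤ) = R.card - 1 := by
    have := Finset.card_erase_add_one hfR; omega
  have hsl := hmem.duals.slack_eq f1 f2 f3
  rw [hfc] at hsl
  refine ⟨hb.2 _ _, hb.2 _ _, ?_⟩
  rw [hs.ea f f1 f2, hs.wt f f1 f2, ← hsl]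
  refine ⟨fun hk => ?_, fun hk => ?_⟩
  · refine ⟨R.erase f, vis, vs, st, Sum.inr c :: P₀, ?_, ?_,
      Or.inl ⟨by simpa using h0, c, ?_, hdfs, hst, hsto, by simpa using hsp, ?_,
        by simpa using hcur, hcm⟩⟩
    · simp [hcard, h0]; omega
    · rw [hcard]; omega
    · refine ⟨hmem.feasible, hmem.mates, hmem.duals, hlists,
        fun e he => hmem.sub e (Finset.mem_of_mem_erase he), fun e e1 e2 e3 e4 e5 =>
        Finset.mem_erase.2 ⟨?_, hmem.sup e e1 e2 e3 e4 e5⟩, hmem.flag⟩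
      rintro rfl; exact hk e4
    · exact ⟨hvis.stored, by simpa using hvis.length, hvis.nodup, hvis.mem⟩
  -- the edge is admissible
  have harc : X.G.SearchArc S (Sum.inr c) (X.ed f) (Sum.inl (X.ed f).1) := by
    refine ⟨?_, hk, hfd⟩
    have := Arc.unmatched (G := X.G) (M := S.M) (X.ed f).1 (X.ed f).2 (X.ed_mem f f1 f2) f3
    rw [hfc] at this
    convert this using 1
    rw [← hfc]
  have hnv : s.var xNv + 1 ≤ N := by rw [hvis.length]; omega
  have hfa : |f| ≤ N := by rw [abs_le]; omega
  refine ⟨hfa, by rw [abs_le, hvis.length]; omega, ?_⟩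
  have hflag := hmem.flag _ (Layout.ia_mem f1 f2)
  have hsub' : ∀ e ∈ R.erase f, X.lo ≤ e ∧ e ≤ X.hi ∧ X.ed e ∉ S.M ∧
      X.ed e ∉ S.deleted ∪ insert (X.ed f) vis := by
    intro e he
    obtain ⟨e1, e2, e3, e4⟩ := hmem.sub e (Finset.mem_of_mem_erase he)
    refine ⟨e1, e2, e3, ?_⟩
    simp only [Finset.mem_union, Finset.mem_insert, not_or] at e4 ⊢
    exact ⟨e4.1, fun h => (Finset.ne_of_mem_erase he) (X.ed_inj _ _ e1 e2 f1 f2 h), e4.2⟩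
  have hsup' : ∀ e, X.lo ≤ e → e ≤ X.hi → X.ed e ∉ S.M → X.G.slack S.M S.y (X.ed e) = 0 →
      X.ed e ∉ S.deleted ∪ insert (X.ed f) vis → e ∈ R.erase f := by
    intro e e1 e2 e3 e4 e5
    simp only [Finset.mem_union, Finset.mem_insert, not_or] at e5
    exact Finset.mem_erase.2 ⟨fun h => e5.2.1 (by rw [h]), hmem.sup e e1 e2 e3 e4
      (by simp [e5])⟩
  have hflag' : ∀ a, X.IA a → (s.arr aFl (X.ia a) ≠ 0 ↔
      ∃ e ∈ S.M, e.1 = a ∧ e ∈ S.deleted ∪ insert (X.ed f) vis) := by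
    intro a ha
    rw [hmem.flag a ha]
    simp only [Finset.mem_union, Finset.mem_insert]
    constructor
    · rintro ⟨e, e1, e2, e3⟩; exact ⟨e, e1, e2, by tauto⟩
    · rintro ⟨e, e1, e2, e3 | rfl | e3⟩
      · exact ⟨e, e1, e2, Or.inl e3⟩
      · exact absurd e1 f3
      · exact ⟨e, e1, e2, Or.inr e3⟩
  refine ⟨fun hfl => ?_, fun hfl => ?_⟩
  · -- the end of the edge has been visited before
    obtain ⟨g, g1, g2, g3⟩ := hflag.1 hfl
    have hnf : ¬ IsFreeA S.M (Sum.inl (X.ed f).1) := by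
      rintro ⟨a, h1, h2⟩
      cases h1
      exact h2 g g1 g2
    -- The program ignores a flagged vertex. For the abstract search it lies on the path, or it is
    -- entered and left at once, because its only arc is visited or deleted.
    have hd : X.G.DFS S b (Sum.inr c :: P₀) (insert (X.ed f) vis) := by
      by_cases hon : Sum.inl (X.ed f).1 ∈ Sum.inr c :: P₀
      · exact DFS.onPath _ _ _ _ _ hdfs harc hfv hon
      · refine DFS.pop _ _ _ _ (DFS.push _ _ _ _ _ hdfs harc hfv hon hnf) ?_
        rintro e x ⟨h1, -, h3⟩
        cases h1 with
        | matched _ b' k1 =>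
          have hg := hM.2 _ k1 _ g1 (Or.inl g2.symm)
          rw [← hg] at g3
          simp only [Finset.mem_union] at g3
          exact Finset.mem_insert_of_mem (g3.resolve_left h3)
    refine ⟨R.erase f, insert (X.ed f) vis, f :: vs, st, Sum.inr c :: P₀, ?_, ?_,
      Or.inl ⟨by simpa using h0, c, ?_, hd, hst.mono (Finset.subset_insert _ _), hsto,
        by simpa using hsp, hvis.insert f1 f2 hfv (by simp) (by simp), by simpa using hcur, hcm⟩⟩
    · simp [hcard, h0]; omega
    · rw [hcard, List.length_cons]; push_cast; omega
    · exact ⟨hmem.feasible, hmem.mates, hmem.duals, hlists, hsub', hsup', hflag'⟩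
  -- Without the flag the matching edge is neither deleted nor visited. A vertex of A below the end
  -- of the path has a visited matching edge, so this one is not on the path.
  have hnon : ∀ g ∈ S.M, g.1 = (X.ed f).1 → g ∉ S.deleted ∧ g ∉ vis := by
    intro g g1 g2
    have := mt hflag.2 (not_not.2 hfl)
    push Not at this
    have := this g g1 g2
    simpa [not_or] using this
  have hnotP : Sum.inl (X.ed f).1 ∉ Sum.inr c :: P₀ := by
    intro h
    obtain ⟨e, e1, e2, e3⟩ := hst.mem_left h
    exact (hnon e e1 e3).2 e2
  have hfst : f ∉ st := fun h => hfv (hst.mem_list f h).2.2.2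
  refine ⟨hfa, by rw [abs_le, hsp]; omega, hb.2 _ _, ?_⟩
  rcases hmem.mates.left _ (Layout.ia_mem f1 f2) with ⟨hfree, hma⟩ | ⟨g, g1, g2, hg, hge, hma⟩
  · -- the end of the edge is free
    rw [hma]
    refine ⟨fun h => absurd rfl h, fun _ => ⟨by rw [abs_le]; omega, ?_⟩⟩
    have hd : X.G.DFSFinds S b (Sum.inl (X.ed f).1 :: Sum.inr c :: P₀)
        (insert (X.ed f) vis) :=
      ⟨_, _, _, _, _, hdfs, harc, hfv, hnotP, ⟨_, rfl, hfree⟩, rfl, rfl⟩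
    refine ⟨R.erase f, insert (X.ed f) vis, f :: vs, f :: st, _, ?_, ?_,
      Or.inr (Or.inr ⟨by simp, ?_, hd, ?_, ?_, hvis.insert f1 f2 hfv (by simp) (by simp),
        List.nodup_cons.2 ⟨hfst, hst.nodup⟩, ?_, ?_, ?_⟩)⟩
    · simp [hcard]; omega
    · rw [hcard, List.length_cons]; push_cast; omega
    · exact ⟨hmem.feasible, hmem.mates, hmem.duals, hlists, hsub', hsup', hflag'⟩
    · simpa [hsp] using hsto.push
    · simp [hsp]
    · simp only [List.mem_cons, forall_eq_or_imp]
      exact ⟨⟨f1, f2, f3, Finset.mem_insert_self _ _⟩, fun e he =>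
        ⟨(hst.mem_list e he).1, (hst.mem_list e he).2.1, (hst.mem_list e he).2.2.1,
        Finset.mem_insert_of_mem (hst.mem_list e he).2.2.2⟩⟩
    · rcases hst.root with h | ⟨e, e1, e2⟩
      · exact ⟨f, by simp, by rw [hfc, h]⟩
      · exact ⟨e, by simp [e1], e2⟩
    · intro e
      have eq1 : ((X.ed f).1, c) = X.ed f := by rw [← hfc]
      simp only [pathEdges, edgeBetween, Finset.mem_union, Finset.mem_singleton, eq1,
        hst.mem_pathEdges hM, List.mem_cons, exists_eq_or_imp]
      constructor
      · rintro (rfl | h | h)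
        · exact Or.inl (Or.inl rfl)
        · exact Or.inl (Or.inr h)
        · exact Or.inr ⟨h.1, Or.inr h.2⟩
      · rintro ((h | h) | ⟨h, h' | h'⟩)
        · exact Or.inl h.symm
        · exact Or.inr (Or.inl h)
        · exact absurd h'.symm (hfree _ h)
        · exact Or.inr (Or.inr ⟨h, h'⟩)
  -- the search continues along the matching edge
  rw [hma]
  refine ⟨fun _ => ?_, fun h => by omega⟩
  obtain ⟨gd, gv⟩ := hnon _ hg hge
  have hgf : X.ed g ≠ X.ed f := fun h => f3 (h ▸ hg)
  have hgv : X.ed g ∉ insert (X.ed f) vis := by simp [hgf, gv]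
  have hcN : |s.var xNv + 1 + 1| ≤ N := by rw [abs_le, hvis.length]; omega
  rw [hs.eb g g1 g2]
  refine ⟨by rw [abs_one]; omega, by rw [abs_le]; omega, hcN,
    by rw [← hs.eb g g1 g2]; exact hb.2 _ _, ?_⟩
  have hnf : ¬ IsFreeA S.M (Sum.inl (X.ed f).1) := by
    rintro ⟨a, h1, h2⟩
    cases h1
    exact h2 _ hg hge
  have hd1 := DFS.push _ _ _ _ _ hdfs harc hfv hnotP hnf
  have harc2 : X.G.SearchArc S (Sum.inl (X.ed f).1) (X.ed g) (Sum.inr (X.ed g).2) := by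
    refine ⟨?_, by simp [WGraph.slack, hg], gd⟩
    rw [← hge]
    exact Arc.matched _ _ hg
  -- A vertex of B on the path is the free root or was entered by its matching edge, which would
  -- then be visited.
  have hnotP2 : Sum.inr (X.ed g).2 ∉ Sum.inl (X.ed f).1 :: Sum.inr c :: P₀ := by
    intro h
    rw [List.mem_cons] at h
    rcases hst.mem_right (h.resolve_left (by simp)) with h | ⟨e, e1, e2, e3⟩
    · exact hbf _ hg h
    · exact gv (hM.2 _ e1 _ hg (Or.inr e3) ▸ e2)
  have hd2 := DFS.push _ _ _ _ _ hd1 harc2 hgv hnotP2 (by rintro ⟨a, h, -⟩; simp at h)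
  have hst2 : X.Stack S.M (insert (X.ed g) (insert (X.ed f) vis)) b (f :: st) (X.ed g).2
      (Sum.inr (X.ed g).2 :: Sum.inl (X.ed f).1 :: Sum.inr c :: P₀) := by
    refine .cons f g st _ ?_ f1 f2 f3 (by simp) hfst hg hge (by simp)
    rw [hfc]
    exact hst.mono fun e he => by simp [he]
  have hv1 := hvis.insert (s' := { s with
    var := Function.update s.var xNv (s.var xNv + 1)
    arr := Function.update s.arr aVs (Function.update (s.arr aVs) (s.var xNv) f) })
    f1 f2 hfv (by simp) (by simp)
  refine ⟨R.erase f, insert (X.ed g) (insert (X.ed f) vis), g :: f :: vs, f :: st, _, ?_, ?_,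
    Or.inl ⟨by simpa using h0, (X.ed g).2, ?_, hd2, hst2, ?_, by simp [hsp],
      hv1.insert g1 g2 hgv (by simp) (by simp), by simp, Layout.ib_mem g1 g2⟩⟩
  · simp [hcard, h0]; omega
  · rw [hcard, List.length_cons, List.length_cons]; push_cast; omega
  · refine ⟨hmem.feasible, hmem.mates, hmem.duals, hlists, fun e he => ?_,
      fun e e1 e2 e3 e4 e5 => hsup' e e1 e2 e3 e4 ?_, fun a ha => ?_⟩
    · obtain ⟨k1, k2, k3, k4⟩ := hsub' e he
      refine ⟨k1, k2, k3, ?_⟩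
      have : X.ed e ≠ X.ed g := fun h => k3 (h ▸ hg)
      simp only [Finset.mem_union, Finset.mem_insert, not_or] at k4 ⊢
      tauto
    · simp only [Finset.mem_union, Finset.mem_insert, not_or] at e5 ⊢
      tauto
    · simp only [ne_eq, Function.update_self, Function.update_of_ne, Nat.reduceEqDiff,
        not_false_eq_true]
      by_cases haf : a = (X.ed f).1
      · subst haf
        simp only [Function.update_self, one_ne_zero, not_false_eq_true, true_iff]
        exact ⟨_, hg, hge, by simp⟩
      · rw [Function.update_of_ne (X.ia_inj.ne haf)]
        refine (hflag' a ha).trans ?_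
        simp only [Finset.mem_union, Finset.mem_insert]
        constructor
        · rintro ⟨e, e1, e2, e3⟩; exact ⟨e, e1, e2, by tauto⟩
        · rintro ⟨e, e1, e2, e3 | rfl | e3⟩
          · exact ⟨e, e1, e2, Or.inl e3⟩
          · exact absurd (e2.symm.trans hge) haf
          · exact ⟨e, e1, e2, Or.inr e3⟩
  · simpa [hsp] using hsto.push

/-- The second inequality lets the list entries consumed by the search pay later for work
proportional to the number of visited edges. -/
theorem search_spec (hN : 2 * X.hi + 10 ≤ N) (hb : Bdd N s) (hs : X.Static s)
    (hm : X.StageMem S Y s R) (hbf : FreeB S.M b) (hbm : X.IB b) (hcur : s.var xB = X.ib b) :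
    wp N search (fun s' t' => ∃ R' vis vs st P, (t' : ℤ) + 40 * R'.card ≤ t + 40 * R.card + 30 ∧
      (vs.length : ℤ) + 2 * R'.card ≤ 2 * R.card ∧
      ((s'.var xRes = 1 ∧ X.StageMem { S with deleted := S.deleted ∪ vis } Y s' R' ∧
          X.G.DFSFails S b vis) ∨
        (s'.var xRes = 2 ∧ X.Found S Y b s' R' vis vs st P))) s t := by
  have hl := X.one_le
  have hle := X.lo_le
  simp only [search, wp_seq, wp_assign, Expr.val, abs_zero]
  refine ⟨by omega, by omega, by omega, ?_⟩
  have h0N : |(0 : ℤ)| ≤ N := by rw [abs_zero]; omega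
  refine wp_while (((hb.assign h0N).assign h0N).assign h0N) (t + 40 * R.card + 30)
    (fun s' t' => ∃ R' vis vs st P,
      (t' : ℤ) + 40 * R'.card + 10 * st.length ≤ t + 3 + 40 * R.card + 10 * s'.var xRes ∧
      (vs.length : ℤ) + 2 * R'.card ≤ 2 * R.card ∧
      ((s'.var xRes = 0 ∧ ∃ c, X.Searching S Y b s' R' vis vs st c P) ∨
        (s'.var xRes = 1 ∧ X.StageMem { S with deleted := S.deleted ∪ vis } Y s' R' ∧
          X.G.DFSFails S b vis) ∨
        (s'.var xRes = 2 ∧ X.Found S Y b s' R' vis vs st P))) ?_ ?_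
  · refine ⟨R, ∅, [], [], _, by simp; omega, by simp, Or.inl ⟨by simp, b, ?_, .start, .nil,
      trivial, by simp, ⟨trivial, by simp, by simp, by simp⟩, by simpa using hcur, hbm⟩⟩
    rw [Finset.union_empty]
    exact ⟨hm.feasible, hm.mates, hm.duals, hm.lists, hm.sub, hm.sup, hm.flag⟩
  · rintro s' t' hb' hf' ⟨R', vis, vs, st, P, ht, hv, hcase⟩
    refine ⟨by omega, fun hc => ?_, fun hc => ?_⟩
    · replace hc : s'.var xRes = 0 := by
        by_contra h; simp [Expr.val, Op.val, h] at hc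
      obtain ⟨-, c, hc'⟩ : s'.var xRes = 0 ∧ ∃ c, X.Searching S Y b s' R' vis vs st c P := by
        rcases hcase with h | h | h
        · exact h
        · omega
        · omega
      have hs' : X.Static s' := by
        refine Layout.Static.of_frame (p := searchStep) ?_ hf' (by decide) (by decide) (by decide)
          (by decide) (by decide) (by decide)
        exact ⟨hs.ea, hs.eb, hs.wt, hs.pc, by simpa using hs.lo, by simpa using hs.hi⟩
      refine wp_conseq hb' (searchStep_spec hN hb' hs' hc' hbf hc) ?_
      rintro s2 t2 _ _ ⟨R2, vis2, vs2, st2, P2, h1, h2, h3⟩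
      exact ⟨R2, vis2, vs2, st2, P2, by push_cast at h1; omega, by omega, h3⟩
    · replace hc : ¬ s'.var xRes = 0 := by
        intro h; simp [Expr.val, Op.val, h] at hc
      exact ⟨R', vis, vs, st, P, by push_cast; omega, hv, hcase.resolve_left fun h => hc h.1⟩

end

end RAM

namespace RAM

set_option linter.unusedSectionVars false

open WGraph

/-! ## Second stage: augmentation -/

/-- Unmark the pieces of the visited edges. -/
def clearMarks : Cmd :=
  .assign xI (.var xNv) ;; forStored xI aVs (.write aAf (.read aPc (.var xF)) (.const 0))

/-- Mark the pieces that contain edges of the path. -/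
def setMarks : Cmd :=
  .assign xI (.var xSp) ;; forStored xI aSt (
    .ite (.read aWt (.var xF)) .skip (.write aAf (.read aPc (.var xF)) (.const 1)) ;;
    .assign xG (.read aMA (.read aEA (.var xF))) ;;
    .ite (.var xG)
      (.ite (.read aWt (.var xG)) .skip (.write aAf (.read aPc (.var xG)) (.const 1))) .skip)

/-- Replace the matching by its symmetric difference with the path. -/
def flipPath : Cmd :=
  forStored xSp aSt (
    .write aMA (.read aEA (.var xF)) (.var xF) ;;
    .write aMB (.read aEB (.var xF)) (.var xF) ;;
    .write aYB (.read aEB (.var xF)) (.minus (.read aYB (.read aEB (.var xF)))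
      (.plus (.read aWt (.var xF)) (.read aWt (.var xF)))) ;;
    .write aFl (.read aEA (.var xF)) (.const 1))

/-- Restore the visited edges in marked pieces. -/
def revive : Cmd :=
  forStored xNv aVs (
    .ite (.read aWt (.var xF)) .skip (
    .ite (.read aAf (.read aPc (.var xF))) (
      .ite (.equal (.read aMA (.read aEA (.var xF))) (.var xF))
        (.write aFl (.read aEA (.var xF)) (.const 0))
        (.write aLN (.var xF) (.read aLH (.read aEB (.var xF))) ;;
        .write aLH (.read aEB (.var xF)) (.var xF)))
      .skip))

/-- Augment along the path found by the search. -/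
def augmentPath : Cmd := clearMarks ;; setMarks ;; flipPath ;; revive

section

variable {A B : Type} [DecidableEq A] [DecidableEq B] {X : Layout A B} {N : ℤ} {s : State} {t : ℕ}
  {S : StageState A B} {Y : ℤ} {R : Finset ℤ} {b : B} {vis : Finset (A × B)} {vs st : List ℤ}
  {P : List (A ⊕ B)}

namespace Layout

theorem StageMem.of_frame {s' : State} {p : Cmd} (h : X.StageMem S Y s R) (hf : Frame p s s')
    (h1 : aMA ∉ p.arrs) (h2 : aMB ∉ p.arrs) (h3 : aYA ∉ p.arrs) (h4 : aYB ∉ p.arrs)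
    (h5 : aLH ∉ p.arrs) (h6 : aLN ∉ p.arrs) (h7 : aFl ∉ p.arrs) : X.StageMem S Y s' R :=
  ⟨h.feasible, by rw [hf.2 _ h1, hf.2 _ h2]; exact h.mates,
    by rw [hf.2 _ h3, hf.2 _ h4]; exact h.duals,
    by rw [hf.2 _ h5, hf.2 _ h6]; exact h.lists, h.sub, h.sup, by rw [hf.2 _ h7]; exact h.flag⟩

/-- Labels separate components among the edges of weight 0, so affected pieces can be recognised by
the labels of the path edges of weight 0. -/
theorem affected_iff (hP : ∀ e ∈ pathEdges P, e ∈ X.G.E) {e : ℤ} (h1 : X.lo ≤ e) (h2 : e ≤ X.hi)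
    (h0 : X.w e = 0) : X.G.InAffectedPiece P (X.ed e) ↔
      ∃ f, X.lo ≤ f ∧ f ≤ X.hi ∧ X.w f = 0 ∧ X.pc f = X.pc e ∧ X.ed f ∈ pathEdges P := by
  have hc : ∀ f, X.lo ≤ f → f ≤ X.hi → (X.w f = 0 ↔ X.G.c (X.ed f) = 0) := fun f k1 k2 => by
    rw [← X.weight f k1 k2]; omega
  constructor
  · rintro ⟨K, k1, g, k2, k3⟩
    obtain ⟨f, f1, f2, rfl⟩ := X.ed_surj g (hP g k2)
    simp only [pieceEdges, Finset.mem_filter] at k1 k3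
    have h0f := (hc f f1 f2).2 k3.2.1
    exact ⟨f, f1, f2, h0f, (X.piece f e f1 f2 h1 h2 h0f h0).2 (k3.2.2.trans k1.2.2.symm), k2⟩
  · rintro ⟨f, f1, f2, f3, f4, f5⟩
    have := (X.piece f e f1 f2 h1 h2 f3 h0).1 f4
    refine ⟨X.G.zeroGraph.connectedComponentMk (Sum.inl (X.ed e).1), ?_, X.ed f, f5, ?_⟩
    · simp only [pieceEdges, Finset.mem_filter]
      exact ⟨X.ed_mem e h1 h2, (hc e h1 h2).1 h0, trivial⟩
    · simp only [pieceEdges, Finset.mem_filter]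
      exact ⟨X.ed_mem f f1 f2, (hc f f1 f2).1 f3, this⟩

end Layout

/-- Old marks are removed only at the labels of visited edges; no other labels are consulted
afterwards, and clearing all of them would be too expensive. -/
theorem clearMarks_spec (hN : 2 * X.hi + 10 ≤ N) (hb : Bdd N s) (hs : X.Static s)
    (hv : X.Visited vis s vs) :
    wp N clearMarks (fun s' t' => t' ≤ t + 4 * vs.length + 2 ∧
      ∀ e ∈ vs, s'.arr aAf (X.pc e) = 0) s t := by
  have hl := X.one_le
  have hle := X.lo_le
  have hvl := hv.length_le
  simp only [clearMarks, wp_seq, wp_assign, Expr.val]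
  refine ⟨hb.1 _, ?_⟩
  refine wp_forStored (by decide) (by decide) (by decide) (fun l s' t' =>
    t' + 4 * l.length ≤ t + 1 + 4 * vs.length ∧ ∀ e ∈ vs, e ∈ l ∨ s'.arr aAf (X.pc e) = 0)
    (hb.assign (hb.1 _)) (by omega) hv.stored (by simpa using hv.length)
    ⟨le_rfl, fun e he => Or.inl he⟩ ?_ ?_
  · rintro f l s' t' hsuf hb' hf ⟨ht, hI⟩ s1 rfl hb1
    have hfm := (hv.mem f).1 (hsuf.subset (by simp))
    have e1 : s'.arr aPc = s.arr aPc := hf.2 _ (by decide)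
    simp only [wp_write, Expr.val, Function.update_self, e1, hs.pc f hfm.1 hfm.2.1, abs_zero]
    refine ⟨by omega, by simp only [List.length_cons] at ht; omega, fun e he => ?_⟩
    by_cases h : X.pc e = X.pc f
    · right; rw [h]; simp
    · rcases hI e he with h' | h'
      · rcases List.mem_cons.1 h' with rfl | h'
        · exact absurd rfl h
        · exact Or.inl h'
      · right; simpa [h] using h'
  · rintro s' t' _ _ ⟨ht, hI⟩
    simp only [List.length_nil] at ht
    exact ⟨by omega, fun e he => (hI e he).resolve_left (by simp)⟩

/-- This has to happen before the matching changes: the matched edges of the path are found as the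
current mates of the ends in A of the stacked edges. -/
theorem setMarks_spec (hN : 2 * X.hi + 10 ≤ N) (hb : Bdd N s) (hs : X.Static s)
    (h : X.Found S Y b s R vis vs st P) :
    wp N setMarks (fun s' t' => t' ≤ t + 9 * st.length + 2 ∧
      ∀ k, s'.arr aAf k ≠ 0 ↔ s.arr aAf k ≠ 0 ∨
        ∃ f, X.lo ≤ f ∧ f ≤ X.hi ∧ X.w f = 0 ∧ X.pc f = k ∧ X.ed f ∈ pathEdges P) s t := by
  have hl := X.one_le
  have hle := X.lo_le
  have hM := h.mem.feasible.matching
  have hsl := Layout.length_le h.nodup fun f hf => ⟨(h.mem_list f hf).1, (h.mem_list f hf).2.1⟩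
  simp only [setMarks, wp_seq, wp_assign, Expr.val]
  refine ⟨hb.1 _, ?_⟩
  refine wp_forStored (by decide) (by decide) (by decide) (fun l s' t' =>
    t' + 9 * l.length ≤ t + 1 + 9 * st.length ∧ ∀ k, s'.arr aAf k ≠ 0 ↔ s.arr aAf k ≠ 0 ∨
      ∃ e, X.lo ≤ e ∧ e ≤ X.hi ∧ X.w e = 0 ∧ X.pc e = k ∧ ∃ f ∈ st, f ∉ l ∧
        (e = f ∨ (X.ed e ∈ S.M ∧ (X.ed f).1 = (X.ed e).1)))
    (hb.assign (hb.1 _)) (by omega) h.stored (by simpa using h.length) ⟨le_rfl, ?_⟩ ?_ ?_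
  · intro k
    refine ⟨Or.inl, fun h => h.resolve_right ?_⟩
    rintro ⟨e, _, _, _, _, f, h1, h2, _⟩
    exact h2 h1
  · rintro f l s' t' hsuf hb' hf ⟨ht, hI⟩ s1 hs1 hb1
    have hfst : f ∈ st := hsuf.subset (by simp)
    have hfl : f ∉ l := (List.nodup_cons.1 (h.nodup.sublist hsuf.sublist)).1
    obtain ⟨f1, f2, f3, f4⟩ := h.mem_list f hfst
    have e1 : s1.arr aPc = s.arr aPc := by rw [hs1]; exact hf.2 aPc (by decide)
    have e2 : s1.arr aWt = s.arr aWt := by rw [hs1]; exact hf.2 aWt (by decide)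
    have e3 : s1.arr aEA = s.arr aEA := by rw [hs1]; exact hf.2 aEA (by decide)
    have e4 : s1.arr aMA = s.arr aMA := by rw [hs1]; exact hf.2 aMA (by decide)
    have e5 : s1.var xF = f := by rw [hs1]; simp
    have e6 : s1.arr aAf = s'.arr aAf := by rw [hs1]
    simp only [List.length_cons] at ht
    clear hs1
    rw [← e6] at hI
    -- the new marks
    have step : ∀ (a' : ℤ → ℤ) (a'' : ℤ → ℤ),
        (a' = if X.w f = 0 then Function.update (s1.arr aAf) (X.pc f) 1 else s1.arr aAf) →
        (∀ k, a'' k ≠ 0 ↔ a' k ≠ 0 ∨ ∃ e, X.lo ≤ e ∧ e ≤ X.hi ∧ X.w e = 0 ∧ X.pc e = k ∧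
          X.ed e ∈ S.M ∧ (X.ed f).1 = (X.ed e).1) →
        ∀ k, a'' k ≠ 0 ↔ s.arr aAf k ≠ 0 ∨
          ∃ e, X.lo ≤ e ∧ e ≤ X.hi ∧ X.w e = 0 ∧ X.pc e = k ∧ ∃ f ∈ st, f ∉ l ∧
            (e = f ∨ (X.ed e ∈ S.M ∧ (X.ed f).1 = (X.ed e).1)) := by
      intro a' a'' h1 h2 k
      have h3 : a' k ≠ 0 ↔ s1.arr aAf k ≠ 0 ∨ (X.w f = 0 ∧ X.pc f = k) := by
        rw [h1]
        split_ifs with hw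
        · by_cases hk : k = X.pc f
          · simp [hk, hw]
          · simp [hk, Ne.symm hk]
        · simp [hw]
      rw [h2, h3, hI]
      constructor
      · rintro (((h | ⟨e, k1, k2, k3, k4, f', k5, k6, k7⟩) | ⟨h, h'⟩) |
          ⟨e, k1, k2, k3, k4, k5, k6⟩)
        · exact Or.inl h
        · exact Or.inr ⟨e, k1, k2, k3, k4, f', k5, fun h => k6 (List.mem_cons_of_mem _ h), k7⟩
        · exact Or.inr ⟨f, f1, f2, h, h', f, hfst, hfl, Or.inl rfl⟩
        · exact Or.inr ⟨e, k1, k2, k3, k4, f, hfst, hfl, Or.inr ⟨k5, k6⟩⟩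
      · rintro (h | ⟨e, k1, k2, k3, k4, f', k5, k6, k7⟩)
        · exact Or.inl (Or.inl (Or.inl h))
        · by_cases hff : f' = f
          · subst hff
            rcases k7 with rfl | k7
            · exact Or.inl (Or.inr ⟨k3, k4⟩)
            · exact Or.inr ⟨e, k1, k2, k3, k4, k7⟩
          · exact Or.inl (Or.inl (Or.inr ⟨e, k1, k2, k3, k4, f', k5, by simp [hff, k6], k7⟩))
    have step1 : wp N (.ite (.read aWt (.var xF)) .skip
        (.write aAf (.read aPc (.var xF)) (.const 1))) (fun s2 t2 => t2 ≤ t' + 5 ∧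
        s2.arr aAf = if X.w f = 0 then Function.update (s1.arr aAf) (X.pc f) 1
          else s1.arr aAf) s1 (t' + 3) := by
      simp only [wp_ite, wp_skip, wp_write, Expr.val, e5, e1, e2, hs.wt f f1 f2, hs.pc f f1 f2]
      refine ⟨fun hw => ⟨le_rfl, by rw [if_neg hw]⟩, fun hw => ⟨by rw [abs_one]; omega, le_rfl, ?_⟩⟩
      rw [if_pos hw]; simp
    rw [wp_seq]
    refine wp_conseq hb1 step1 ?_
    rintro s2 t2 hb2 hf2 ⟨ht2, ha2⟩
    have g1 : s2.arr aPc = s.arr aPc := by rw [hf2.2 aPc (by decide), e1]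
    have g2 : s2.arr aWt = s.arr aWt := by rw [hf2.2 aWt (by decide), e2]
    have g3 : s2.arr aEA = s.arr aEA := by rw [hf2.2 aEA (by decide), e3]
    have g4 : s2.arr aMA = s.arr aMA := by rw [hf2.2 aMA (by decide), e4]
    have g5 : s2.var xF = f := by rw [hf2.1 xF (by decide), e5]
    simp only [wp_seq, wp_ite, wp_skip, wp_write, wp_assign, Expr.val, g1, g2, g3, g4, g5,
      hs.ea f f1 f2, Function.update_self, abs_one]
    refine ⟨hb.2 _ _, ?_⟩
    rcases h.mem.mates.left _ (Layout.ia_mem f1 f2) with ⟨hfree, hma⟩ | ⟨g, k1, k2, hg, hge, hma⟩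
    · rw [hma]
      refine ⟨fun h => absurd rfl h, fun _ => ⟨by omega, step _ _ ha2 fun k => ?_⟩⟩
      refine ⟨Or.inl, fun h => h.resolve_right ?_⟩
      rintro ⟨e, _, _, _, _, h1, h2⟩
      exact hfree _ h1 h2.symm
    · rw [hma]
      refine ⟨fun _ => ?_, fun h => by omega⟩
      rw [hs.wt g k1 k2, hs.pc g k1 k2]
      have huniq : ∀ e, X.lo ≤ e → e ≤ X.hi → X.ed e ∈ S.M → (X.ed f).1 = (X.ed e).1 → e = g := by
        intro e q1 q2 q3 q4
        exact X.ed_inj _ _ q1 q2 k1 k2 (hM.2 _ q3 _ hg (Or.inl (by rw [hge, q4])))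
      refine ⟨fun hw => ⟨by omega, step _ _ ha2 fun k => ?_⟩,
        fun hw => ⟨by omega, by omega, step _ _ ha2 fun k => ?_⟩⟩
      · refine ⟨Or.inl, fun h => h.resolve_right ?_⟩
        rintro ⟨e, q1, q2, q3, _, q4, q5⟩
        exact hw (huniq e q1 q2 q4 q5 ▸ q3)
      · by_cases hk : k = X.pc g
        · subst hk
          simp only [Function.update_self, ne_eq, one_ne_zero, not_false_eq_true, true_iff]
          exact Or.inr ⟨g, k1, k2, hw, rfl, hg, hge.symm⟩
        · simp only [Function.update_of_ne hk]
          refine ⟨Or.inl, fun h => h.resolve_right ?_⟩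
          rintro ⟨e, q1, q2, q3, q4, q5, q6⟩
          exact hk (huniq e q1 q2 q5 q6 ▸ q4.symm)
  · rintro s' t' _ _ ⟨ht, hI⟩
    simp only [List.length_nil] at ht
    refine ⟨by omega, fun k => (hI k).trans (or_congr_right (exists_congr fun e => ?_))⟩
    constructor
    · rintro ⟨k1, k2, k3, k4, f, k5, -, k6⟩
      refine ⟨k1, k2, k3, k4, (h.path _).2 ?_⟩
      rcases k6 with rfl | ⟨k6, k7⟩
      · exact Or.inl ⟨e, k5, rfl⟩
      · exact Or.inr ⟨k6, f, k5, k7⟩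
    · rintro ⟨k1, k2, k3, k4, k5⟩
      refine ⟨k1, k2, k3, k4, ?_⟩
      rcases (h.path _).1 k5 with ⟨f, f1, f2⟩ | ⟨f1, f, f2, f3⟩
      · exact ⟨f, f1, by simp, Or.inl (X.ed_inj _ _ k1 k2 (h.mem_list f f1).1
          (h.mem_list f f1).2.1 f2.symm)⟩
      · exact ⟨f, f2, by simp, Or.inr ⟨f1, f3⟩⟩

theorem Layout.Found.path_sub (h : X.Found S Y b s R vis vs st P) (e : A × B)
    (he : e ∈ pathEdges P) : e ∈ vis ∧ e ∈ X.G.E := by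
  obtain ⟨a, Z, hfi⟩ := h.finds.inv
  obtain ⟨h1, u, v, h2⟩ := pathEdges_subset hfi.chain e he
  exact ⟨h1, h2.1.mem h.mem.feasible.matching.1⟩

theorem Layout.Found.mem_sdiff (h : X.Found S Y b s R vis vs st P) (e : A × B) :
    e ∈ pathEdges P \ S.M ↔ ∃ f ∈ st, X.ed f = e := by
  rw [Finset.mem_sdiff, h.path]
  constructor
  · rintro ⟨h1 | h1, h2⟩
    · exact h1
    · exact absurd h1.1 h2
  · rintro ⟨f, h1, rfl⟩
    exact ⟨Or.inl ⟨f, h1, rfl⟩, (h.mem_list f h1).2.2.1⟩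

/-- All visited edges are regarded as deleted for the moment. Then the lists remain correct as they
are, since every edge that changes sides is visited, and the new matching edges only need their
flags set. -/
theorem flipPath_spec (hN : 2 * X.hi + 10 ≤ N) (hb : Bdd N s) (hs : X.Static s)
    (h : X.Found S Y b s R vis vs st P) (hbf : FreeB S.M b) (hY : 0 ≤ Y) (hYN : Y ≤ N) :
    wp N flipPath (fun s' t' => t' ≤ t + 7 * st.length + 2 ∧
      X.StageMem ⟨symmDiff S.M (pathEdges P), X.G.augmentDuals S.M S.y P, S.deleted ∪ vis⟩
        Y s' R) s t := by
  have hl := X.one_le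
  have hle := X.lo_le
  have hM := h.mem.feasible.matching
  have hsl := Layout.length_le h.nodup fun f hf => ⟨(h.mem_list f hf).1, (h.mem_list f hf).2.1⟩
  obtain ⟨a₀, Z, hfi⟩ := h.finds.inv
  have hF' := hfi.feasible (vis := vis) ⟨hM, h.mem.feasible.nonneg, h.mem.feasible.tight,
    h.mem.feasible.left_nonneg, h.mem.feasible.left_le, h.mem.feasible.left_free,
    h.mem.feasible.right_le, h.mem.feasible.right_free⟩ hbf
  change X.G.Feasible (symmDiff S.M (pathEdges P)) (X.G.augmentDuals S.M S.y P) Y at hF'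
  obtain ⟨hM', -, hfA, hfB⟩ := hfi.augment hM hbf
  have hmem' : ∀ f ∈ st, X.ed f ∈ symmDiff S.M (pathEdges P) := fun f hf => by
    have := Finset.mem_sdiff.1 ((h.mem_sdiff (X.ed f)).2 ⟨f, hf, rfl⟩)
    exact Finset.mem_symmDiff.2 (Or.inr this)
  -- The stacked edges all belong to the new matching, so their ends are distinct and each memory
  -- cell is changed only once.
  have hinj : ∀ f ∈ st, ∀ g ∈ st, ((X.ed f).1 = (X.ed g).1 ∨ (X.ed f).2 = (X.ed g).2) →
      f = g := fun f hf g hg hfg =>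
    X.ed_inj _ _ (h.mem_list f hf).1 (h.mem_list f hf).2.1 (h.mem_list g hg).1
      (h.mem_list g hg).2.1 (hM'.2 _ (hmem' f hf) _ (hmem' g hg) hfg)
  have hyf : ∀ f ∈ st, X.G.augmentDuals S.M S.y P (Sum.inr (X.ed f).2) =
      s.arr aYB (X.ib (X.ed f).2) - (X.w f + X.w f) := fun f hf => by
    obtain ⟨f1, f2, -, -⟩ := h.mem_list f hf
    rw [augmentDuals_eq S.y hM' ((h.mem_sdiff _).2 ⟨f, hf, rfl⟩),
      h.mem.duals.right _ (Layout.ib_mem f1 f2), X.weight f f1 f2]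
    ring
  refine wp_forStored (by decide) (by decide) (by decide) (fun l s' t' =>
    t' + 7 * l.length ≤ t + 1 + 7 * st.length ∧
    (∀ a, X.IA a → (∃ f ∈ st, f ∉ l ∧ (X.ed f).1 = a ∧ s'.arr aMA (X.ia a) = f ∧
        s'.arr aFl (X.ia a) = 1) ∨
      ((∀ f ∈ st, f ∉ l → (X.ed f).1 ≠ a) ∧ s'.arr aMA (X.ia a) = s.arr aMA (X.ia a) ∧
        s'.arr aFl (X.ia a) = s.arr aFl (X.ia a))) ∧
    (∀ x, X.IB x → (∃ f ∈ st, f ∉ l ∧ (X.ed f).2 = x ∧ s'.arr aMB (X.ib x) = f ∧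
        s'.arr aYB (X.ib x) = X.G.augmentDuals S.M S.y P (Sum.inr x)) ∨
      ((∀ f ∈ st, f ∉ l → (X.ed f).2 ≠ x) ∧ s'.arr aMB (X.ib x) = s.arr aMB (X.ib x) ∧
        s'.arr aYB (X.ib x) = s.arr aYB (X.ib x))) ∧
    (∀ i, (∀ a, X.IA a → X.ia a ≠ i) → s'.arr aMA i = X.oa i) ∧
    ∀ i, (∀ x, X.IB x → X.ib x ≠ i) → s'.arr aMB i = X.ob i)
    hb (by omega) h.stored h.length ⟨by omega, fun a _ => Or.inr ⟨fun f h1 h2 => absurd h1 h2,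
      rfl, rfl⟩, fun a _ => Or.inr ⟨fun f h1 h2 => absurd h1 h2, rfl, rfl⟩,
      h.mem.mates.left_out, h.mem.mates.right_out⟩ ?_ ?_
  · rintro f l s' t' hsuf hb' hf ⟨ht, hIA, hIB, hOA, hOB⟩ s1 hs1 hb1
    have hfst : f ∈ st := hsuf.subset (by simp)
    have hfl : f ∉ l := (List.nodup_cons.1 (h.nodup.sublist hsuf.sublist)).1
    obtain ⟨f1, f2, f3, f4⟩ := h.mem_list f hfst
    have e2 : s1.arr aWt = s.arr aWt := by rw [hs1]; exact hf.2 aWt (by decide)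
    have e3 : s1.arr aEA = s.arr aEA := by rw [hs1]; exact hf.2 aEA (by decide)
    have e4 : s1.arr aEB = s.arr aEB := by rw [hs1]; exact hf.2 aEB (by decide)
    have e5 : s1.var xF = f := by rw [hs1]; simp
    have e6 : s1.arr = s'.arr := by rw [hs1]
    simp only [List.length_cons] at ht
    clear hs1
    rw [← e6] at hIA hIB hOA hOB
    have hyb : s1.arr aYB (X.ib (X.ed f).2) - (X.w f + X.w f) =
        X.G.augmentDuals S.M S.y P (Sum.inr (X.ed f).2) := by
      rw [hyf f hfst]
      rcases hIB _ (Layout.ib_mem f1 f2) with ⟨g, g1, g2, g3, -⟩ | h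
      · rw [hinj g g1 f hfst (Or.inr g3)] at g2
        exact absurd (List.mem_cons_self) g2
      · rw [h.2.2]
    have hyN : |X.G.augmentDuals S.M S.y P (Sum.inr (X.ed f).2)| ≤ N := by
      have := hF'.right_le (X.ed f).2
      have := hF'.right_ge hY (X.ed f).2
      rw [abs_le]; omega
    have hfN : |f| ≤ N := by rw [abs_le]; omega
    simp only [wp_seq, wp_write, Expr.val, Op.val, e2, e3, e4, e5, hs.ea f f1 f2, hs.eb f f1 f2,
      hs.wt f f1 f2, ne_eq, Function.update_self, Function.update_of_ne, Nat.reduceEqDiff,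
      not_false_eq_true, abs_one, hyb]
    refine ⟨hfN, hfN, hyN, by omega, by omega, ?_, ?_, fun i hi => ?_, fun i hi => ?_⟩
    · intro a ha
      by_cases haf : a = (X.ed f).1
      · subst haf
        exact Or.inl ⟨f, hfst, hfl, rfl, by simp, by simp⟩
      · have hne : X.ia a ≠ X.ia (X.ed f).1 := X.ia_inj.ne haf
        rw [Function.update_of_ne hne, Function.update_of_ne hne]
        rcases hIA a ha with ⟨g, g1, g2, g3, g4⟩ | ⟨g1, g2⟩
        · exact Or.inl ⟨g, g1, fun h => g2 (List.mem_cons_of_mem _ h), g3, g4⟩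
        · refine Or.inr ⟨fun g k1 k2 k3 => ?_, g2⟩
          by_cases hgf : g = f
          · subst hgf; exact haf k3.symm
          · exact g1 g k1 (by simp [hgf, k2]) k3
    · intro x hx
      by_cases hxf : x = (X.ed f).2
      · subst hxf
        exact Or.inl ⟨f, hfst, hfl, rfl, by simp, by simp⟩
      · have hne : X.ib x ≠ X.ib (X.ed f).2 := X.ib_inj.ne hxf
        rw [Function.update_of_ne hne, Function.update_of_ne hne]
        rcases hIB x hx with ⟨g, g1, g2, g3, g4⟩ | ⟨g1, g2⟩
        · exact Or.inl ⟨g, g1, fun h => g2 (List.mem_cons_of_mem _ h), g3, g4⟩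
        · refine Or.inr ⟨fun g k1 k2 k3 => ?_, g2⟩
          by_cases hgf : g = f
          · subst hgf; exact hxf k3.symm
          · exact g1 g k1 (by simp [hgf, k2]) k3
    · rw [Function.update_of_ne (Ne.symm (hi _ (Layout.ia_mem f1 f2)))]
      exact hOA i hi
    · rw [Function.update_of_ne (Ne.symm (hi _ (Layout.ib_mem f1 f2)))]
      exact hOB i hi
  · rintro s' t' hb' hf ⟨ht, hIA, hIB, hOA, hOB⟩
    simp only [List.length_nil] at ht
    have hnp : ∀ e ∉ pathEdges P, e ∈ symmDiff S.M (pathEdges P) ↔ e ∈ S.M := fun e he => by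
      rw [Finset.mem_symmDiff]; tauto
    have hout : ∀ a, (∀ f ∈ st, f ∉ ([] : List ℤ) → (X.ed f).1 ≠ a) → ∀ e : A × B, e.1 = a →
        e ∉ pathEdges P := by
      rintro a ha e rfl he
      rcases (h.path e).1 he with ⟨f, f1, rfl⟩ | ⟨-, f, f1, f2⟩
      · exact ha f f1 (by simp) rfl
      · exact ha f f1 (by simp) f2
    refine ⟨by omega, hF', ⟨fun a ha => ?_, fun x hx => ?_, hOA, hOB⟩,
      ⟨fun a ha => ?_, fun x hx => ?_⟩,
      ?_, fun e he => ?_, fun e e1 e2 e3 e4 e5 => ?_, fun a ha => ?_⟩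
    · rcases hIA a ha with ⟨f, f1, -, f2, f3, -⟩ | ⟨f1, f2, -⟩
      · exact Or.inr ⟨f, (h.mem_list f f1).1, (h.mem_list f f1).2.1, hmem' f f1, f2, f3⟩
      · rw [f2]
        rcases h.mem.mates.left a ha with ⟨k1, k2⟩ | ⟨g, g1, g2, g3, g4, g5⟩
        · refine Or.inl ⟨?_, k2⟩
          intro e he hea
          exact k1 e ((hnp e (hout a f1 e hea)).1 he) hea
        · exact Or.inr ⟨g, g1, g2, (hnp _ (hout a f1 _ g4)).2 g3, g4, g5⟩
    · rw [hfB]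
      rcases hIB x hx with ⟨f, f1, -, f2, f3, -⟩ | ⟨f1, f2, -⟩
      · have k1 := (h.mem_list f f1).1
        rw [f3]
        refine ⟨fun k2 => ?_, fun k2 => by omega⟩
        exact absurd f2 (((hfB x).2 k2) _ (hmem' f f1))
      · rw [f2, ← h.mem.mates.right x hx]
        refine ⟨fun k => k.1, fun k => ⟨k, ?_⟩⟩
        rintro rfl
        obtain ⟨g, g1, g2⟩ := h.root
        exact f1 g g1 (by simp) g2
    · rw [hf.2 aYA (by decide)]
      exact h.mem.duals.left a ha
    · rcases hIB x hx with ⟨f, f1, -, f2, -, f3⟩ | ⟨f1, -, f2⟩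
      · exact f3
      · rw [f2, h.mem.duals.right x hx]
        refine (augmentDuals_eq_self _ ?_).symm
        intro e he
        obtain ⟨f, k1, rfl⟩ := (h.mem_sdiff e).1 he
        exact f1 f k1 (by simp)
    · rw [hf.2 aLH (by decide), hf.2 aLN (by decide)]
      exact h.mem.lists
    · obtain ⟨e1, e2, e3, e4⟩ := h.mem.sub e he
      refine ⟨e1, e2, fun k => e3 ((hnp _ fun k' => e4 ?_).1 k), e4⟩
      exact Finset.mem_union_right _ (h.path_sub _ k').1
    · have hnp' : X.ed e ∉ pathEdges P := fun k =>
        e5 (Finset.mem_union_right _ (h.path_sub _ k).1)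
      have hm := (not_congr (hnp _ hnp')).1 e3
      refine h.mem.sup e e1 e2 hm ?_ e5
      -- The dual weights on B only decrease, so an edge off the path with new slack 0 and
      -- nonnegative old slack was admissible before.
      have k1 := h.mem.feasible.nonneg _ (X.ed_mem e e1 e2) hm
      have k2 := augmentDuals_le (G := X.G) S.M S.y P (Sum.inr (X.ed e).2)
      have k3 : X.G.augmentDuals S.M S.y P (Sum.inl (X.ed e).1) = S.y (Sum.inl (X.ed e).1) := rfl
      simp only [WGraph.slack, if_neg e3] at e4
      simp only [WGraph.slack, if_neg hm] at k1 ⊢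
      omega
    · rcases hIA a ha with ⟨f, f1, -, f2, -, f3⟩ | ⟨f1, -, f2⟩
      · rw [f3]
        simp only [ne_eq, one_ne_zero, not_false_eq_true, true_iff]
        exact ⟨_, hmem' f f1, f2, Finset.mem_union_right _ (h.mem_list f f1).2.2.2⟩
      · rw [f2]
        refine (h.mem.flag a ha).trans (exists_congr fun e => ?_)
        constructor
        · rintro ⟨k1, k2, k3⟩; exact ⟨(hnp _ (hout a f1 _ k2)).2 k1, k2, k3⟩
        · rintro ⟨k1, k2, k3⟩; exact ⟨(hnp _ (hout a f1 _ k2)).1 k1, k2, k3⟩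

end

end RAM

/-! ### Restoring the visited edges of affected pieces -/

namespace RAM

set_option linter.unusedSectionVars false

open WGraph

section

variable {A B : Type} [DecidableEq A] [DecidableEq B] {X : Layout A B} {N : ℤ} {s : State} {t : ℕ}
  {S : StageState A B} {Y : ℤ} {R : Finset ℤ} {b : B} {vis : Finset (A × B)} {vs st : List ℤ}
  {P : List (A ⊕ B)}

namespace Layout

theorem StageMem.congr_deleted {D : Finset (A × B)} (h : X.StageMem S Y s R)
    (hD : ∀ e, e ∈ D ↔ e ∈ S.deleted) : X.StageMem { S with deleted := D } Y s R := by
  have : D = S.deleted := Finset.ext hD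
  rw [this]; exact h

/-- Restoring a matching edge. -/
theorem StageMem.restore_matched {s' : State} {D : Finset (A × B)} {f : ℤ}
    (h : X.StageMem S Y s R) (hM : X.ed f ∈ S.M)
    (hD : ∀ e, e ∈ D ↔ e ∈ S.deleted ∧ e ≠ X.ed f)
    (hs : ∀ a, a ≠ aFl → s'.arr a = s.arr a)
    (hfl : s'.arr aFl = Function.update (s.arr aFl) (X.ia (X.ed f).1) 0) :
    X.StageMem { S with deleted := D } Y s' R := by
  refine ⟨h.feasible, ?_, ?_, ?_, fun e he => ?_, fun e e1 e2 e3 e4 e5 => ?_, fun a ha => ?_⟩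
  · rw [hs aMA (by decide), hs aMB (by decide)]; exact h.mates
  · rw [hs aYA (by decide), hs aYB (by decide)]; exact h.duals
  · rw [hs aLH (by decide), hs aLN (by decide)]; exact h.lists
  · obtain ⟨e1, e2, e3, e4⟩ := h.sub e he
    exact ⟨e1, e2, e3, fun k => e4 ((hD _).1 k).1⟩
  · refine h.sup e e1 e2 e3 e4 fun k => e5 ((hD _).2 ⟨k, ?_⟩)
    intro k'; exact e3 (k' ▸ hM)
  · rw [hfl]
    by_cases haf : a = (X.ed f).1
    · subst haf
      simp only [Function.update_self, ne_eq, not_true_eq_false, false_iff]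
      rintro ⟨e, e1, e2, e3⟩
      exact ((hD _).1 e3).2 (h.feasible.matching.2 _ e1 _ hM (Or.inl e2))
    · rw [Function.update_of_ne (X.ia_inj.ne haf), h.flag a ha]
      refine exists_congr fun e => and_congr_right fun _ => and_congr_right fun e2 => ?_
      rw [hD]
      refine ⟨fun k => ⟨k, ?_⟩, fun k => k.1⟩
      rintro rfl; exact haf e2.symm

/-- Restoring an edge outside the matching. -/
theorem StageMem.restore_unmatched {s' : State} {D : Finset (A × B)} {f : ℤ}
    (h : X.StageMem S Y s R) (f1 : X.lo ≤ f) (f2 : f ≤ X.hi) (hM : X.ed f ∉ S.M)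
    (hfd : X.ed f ∈ S.deleted) (hD : ∀ e, e ∈ D ↔ e ∈ S.deleted ∧ e ≠ X.ed f)
    (hs : ∀ a, a ≠ aLH → a ≠ aLN → s'.arr a = s.arr a)
    (hlh : s'.arr aLH = Function.update (s.arr aLH) (X.ib (X.ed f).2) f)
    (hln : s'.arr aLN = Function.update (s.arr aLN) f (s.arr aLH (X.ib (X.ed f).2))) :
    X.StageMem { S with deleted := D } Y s' (insert f R) := by
  have hl := X.one_le
  have hfR : f ∉ R := fun k => (h.sub f k).2.2.2 hfd
  refine ⟨h.feasible, ?_, ?_, ?_, fun e he => ?_, fun e e1 e2 e3 e4 e5 => ?_, fun a ha => ?_⟩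
  · rw [hs aMA (by decide) (by decide), hs aMB (by decide) (by decide)]; exact h.mates
  · rw [hs aYA (by decide) (by decide), hs aYB (by decide) (by decide)]; exact h.duals
  · rw [hlh, hln]
    exact h.lists.push hfR (by omega)
  · rcases Finset.mem_insert.1 he with rfl | he
    · exact ⟨f1, f2, hM, fun k => ((hD _).1 k).2 rfl⟩
    · obtain ⟨e1, e2, e3, e4⟩ := h.sub e he
      exact ⟨e1, e2, e3, fun k => e4 ((hD _).1 k).1⟩
  · by_cases hef : e = f
    · simp [hef]
    · refine Finset.mem_insert_of_mem (h.sup e e1 e2 e3 e4 fun k => e5 ((hD _).2 ⟨k, ?_⟩))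
      intro k'; exact hef (X.ed_inj _ _ e1 e2 f1 f2 k')
  · rw [hs aFl (by decide) (by decide), h.flag a ha]
    refine exists_congr fun e => and_congr_right fun e1 => and_congr_right fun e2 => ?_
    rw [hD]
    refine ⟨fun k => ⟨k, ?_⟩, fun k => k.1⟩
    rintro rfl; exact hM e1

end Layout

/-- Undeleting is a local operation: a matched edge has the flag of its end in A cleared, an
unmatched edge returns to its list. The loop passes through the intermediate sets of deleted edges
one visited edge at a time. -/
theorem revive_spec (hN : 2 * X.hi + 10 ≤ N) (hb : Bdd N s) (hs : X.Static s)
    (h : X.StageMem S Y s R) (hv : X.Visited vis s vs) (hvd : vis ⊆ S.deleted) {D : Finset (A × B)}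
    {aff : A × B → Prop}
    (haff : ∀ e ∈ vs, aff (X.ed e) ↔ X.w e = 0 ∧ s.arr aAf (X.pc e) ≠ 0)
    (hD : ∀ e, e ∈ D ↔ e ∈ S.deleted ∧ ¬ (e ∈ vis ∧ aff e)) (hvE : vis ⊆ X.G.E) :
    wp N revive (fun s' t' => t' ≤ t + 9 * vs.length + 2 ∧ ∃ R',
      X.StageMem { S with deleted := D } Y s' R' ∧
      ∀ e ∈ R', e ∈ R ∨ (e ∈ vs ∧ aff (X.ed e))) s t := by
  have hl := X.one_le
  have hle := X.lo_le
  have hvl := hv.length_le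
  classical
  refine wp_forStored (by decide) (by decide) (by decide) (fun l s' t' =>
    t' + 9 * l.length ≤ t + 1 + 9 * vs.length ∧ ∃ D' R', X.StageMem { S with deleted := D' } Y s' R' ∧
      (∀ e ∈ R', e ∈ R ∨ (e ∈ vs ∧ aff (X.ed e))) ∧
      ∀ e, e ∈ D' ↔ e ∈ S.deleted ∧ ¬ (∃ f ∈ vs, f ∉ l ∧ X.ed f = e ∧ aff e))
    hb (by omega) hv.stored hv.length
    ⟨by omega, S.deleted, R, h, fun e he => Or.inl he, fun e => ⟨fun k => ⟨k, ?_⟩, fun k => k.1⟩⟩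
    ?_ ?_
  · rintro ⟨f, k1, k2, -⟩; exact k2 k1
  · rintro f l s' t' hsuf hb' hf ⟨ht, D', R', hS, hR', hD'⟩ s1 hs1 hb1
    have hfv : f ∈ vs := hsuf.subset (by simp)
    have hfl : f ∉ l := (List.nodup_cons.1 (hv.nodup.sublist hsuf.sublist)).1
    obtain ⟨f1, f2, f3⟩ := (hv.mem f).1 hfv
    have e1 : s1.arr aPc = s.arr aPc := by rw [hs1]; exact hf.2 aPc (by decide)
    have e2 : s1.arr aWt = s.arr aWt := by rw [hs1]; exact hf.2 aWt (by decide)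
    have e3 : s1.arr aEA = s.arr aEA := by rw [hs1]; exact hf.2 aEA (by decide)
    have e4 : s1.arr aEB = s.arr aEB := by rw [hs1]; exact hf.2 aEB (by decide)
    have e7 : s1.arr aAf = s.arr aAf := by rw [hs1]; exact hf.2 aAf (by decide)
    have e5 : s1.var xF = f := by rw [hs1]; simp
    have hS1 : X.StageMem { S with deleted := D' } Y s1 R' := by
      rw [hs1]
      exact ⟨hS.feasible, hS.mates, hS.duals, hS.lists, hS.sub, hS.sup, hS.flag⟩
    simp only [List.length_cons] at ht
    clear hs1
    have hfN : |f| ≤ N := by rw [abs_le]; omega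
    -- the edge stays deleted
    have keep : ¬ aff (X.ed f) → ∀ e, e ∈ D' ↔ e ∈ S.deleted ∧
        ¬ (∃ f ∈ vs, f ∉ l ∧ X.ed f = e ∧ aff e) := by
      intro hna e
      rw [hD']
      refine and_congr_right fun _ => not_congr ⟨?_, ?_⟩
      · rintro ⟨g, g1, g2, g3⟩
        exact ⟨g, g1, fun k => g2 (List.mem_cons_of_mem _ k), g3⟩
      · rintro ⟨g, g1, g2, rfl, g4⟩
        refine ⟨g, g1, ?_, rfl, g4⟩
        rw [List.mem_cons, not_or]
        refine ⟨?_, g2⟩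
        rintro rfl; exact hna g4
    -- the edge is restored
    have drop : aff (X.ed f) → ∀ e, e ∈ D'.erase (X.ed f) ↔ e ∈ S.deleted ∧
        ¬ (∃ f ∈ vs, f ∉ l ∧ X.ed f = e ∧ aff e) := by
      intro ha e
      rw [Finset.mem_erase, hD']
      constructor
      · rintro ⟨h1, h2, h3⟩
        refine ⟨h2, ?_⟩
        rintro ⟨g, g1, g2, rfl, g4⟩
        refine h3 ⟨g, g1, ?_, rfl, g4⟩
        rw [List.mem_cons, not_or]
        refine ⟨?_, g2⟩
        rintro rfl; exact h1 rfl
      · rintro ⟨h2, h3⟩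
        refine ⟨?_, h2, ?_⟩
        · rintro rfl
          exact h3 ⟨f, hfv, hfl, rfl, ha⟩
        · rintro ⟨g, g1, g2, g3⟩
          exact h3 ⟨g, g1, fun k => g2 (List.mem_cons_of_mem _ k), g3⟩
    have hfD : X.ed f ∈ D' := by
      rw [hD']
      refine ⟨hvd f3, ?_⟩
      rintro ⟨g, g1, g2, g3, -⟩
      obtain ⟨k1, k2, -⟩ := (hv.mem g).1 g1
      exact g2 (by rw [X.ed_inj _ _ k1 k2 f1 f2 g3]; simp)
    have hmate := hS1.mates.mem_iff hS1.feasible.matching f1 f2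
    simp only [wp_ite, wp_skip, wp_write, wp_seq, Expr.val, Op.val, e1, e2, e3, e4, e5, e7,
      hs.ea f f1 f2, hs.eb f f1 f2, hs.wt f f1 f2, hs.pc f f1 f2, ne_eq, Function.update_of_ne,
      Nat.reduceEqDiff, not_false_eq_true, abs_zero]
    refine ⟨fun hw => ⟨by omega, D', R', hS1, hR', keep fun k => hw ((haff f hfv).1 k).1⟩,
      fun hw => ⟨fun ha => ?_, fun ha => ⟨by omega, D', R', hS1, hR',
        keep fun k => ((haff f hfv).1 k).2 ha⟩⟩⟩
    have ha' := (haff f hfv).2 ⟨hw, ha⟩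
    refine ⟨fun hm => ?_, fun hm => ?_⟩
    · have hm' : X.ed f ∈ S.M := by
        rw [hmate]; by_contra hc; simp [hc] at hm
      refine ⟨by omega, by omega, D'.erase (X.ed f), R', ?_, hR', drop ha'⟩
      refine hS1.restore_matched hm' (fun e => ?_) (fun a ha => ?_) ?_
      · rw [Finset.mem_erase, and_comm]
      · simp [ha]
      · simp
    · have hm' : X.ed f ∉ S.M := by
        rw [hmate]; intro hc; simp [hc] at hm
      refine ⟨hb1.2 _ _, hfN, by omega, D'.erase (X.ed f), insert f R', ?_, ?_, drop ha'⟩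
      · refine hS1.restore_unmatched f1 f2 hm' hfD (fun e => ?_) (fun a h1 h2 => ?_) ?_ ?_
        · rw [Finset.mem_erase, and_comm]
        · simp [h1, h2]
        · simp
        · simp
      · intro e he
        rcases Finset.mem_insert.1 he with rfl | he
        · exact Or.inr ⟨hfv, ha'⟩
        · exact hR' e he
  · rintro s' t' hb' hf ⟨ht, D', R', hS, hR', hD'⟩
    simp only [List.length_nil] at ht
    refine ⟨by omega, R', hS.congr_deleted fun e => ?_, hR'⟩
    rw [hD, hD']
    refine and_congr_right fun _ => not_congr ⟨?_, ?_⟩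
    · rintro ⟨h1, h2⟩
      obtain ⟨f, f1, f2, rfl⟩ := X.ed_surj e (hvE h1)
      exact ⟨f, (hv.mem f).2 ⟨f1, f2, h1⟩, by simp, rfl, h2⟩
    · rintro ⟨f, f1, -, rfl, f4⟩
      exact ⟨((hv.mem f).1 f1).2.2, f4⟩

/-- Each new list entry is a visited edge in an affected piece, so the lists grow by no more than
the bound in `card_affected_le`. All other work is linear in the number of visited edges, since the
path consists of such edges. -/
theorem augmentPath_spec (hN : 2 * X.hi + 10 ≤ N) (hb : Bdd N s) (hs : X.Static s)
    (h : X.Found S Y b s R vis vs st P) (hbf : FreeB S.M b) (hY : 0 ≤ Y) (hYN : Y ≤ N) {m : ℕ}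
    (hm : ∀ K, (X.G.pieceEdges K).card ≤ m) :
    wp N augmentPath (fun s' t' => t' ≤ t + 30 * vs.length + 8 ∧ ∃ R',
      X.StageMem (X.G.afterAugment S P vis) Y s' R' ∧
      (R'.card : ℤ) ≤ R.card + (Y + 1) * m) s t := by
  classical
  have hst : st.length ≤ vs.length := by
    refine (List.subperm_of_subset h.nodup fun f hf => ?_).length_le
    have := h.mem_list f hf
    exact (h.visited.mem f).2 ⟨this.1, this.2.1, this.2.2.2⟩
  have hvl := h.visited
  obtain ⟨a₀, Z, hfi⟩ := h.finds.inv
  have hvis : ∀ e ∈ vis, e ∉ S.deleted ∧ e ∈ X.G.E := fun e he => by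
    obtain ⟨u, v, h1⟩ := hfi.arc e he
    exact ⟨h1.2.2, h1.1.mem h.mem.feasible.matching.1⟩
  unfold augmentPath
  rw [wp_seq]
  refine wp_conseq hb (clearMarks_spec hN hb hs h.visited) ?_
  rintro s1 t1 hb1 hf1 ⟨ht1, hc1⟩
  have hs1 := hs.of_frame hf1 (by decide) (by decide) (by decide) (by decide) (by decide)
    (by decide)
  have hv1 : X.Visited vis s1 vs := ⟨by rw [hf1.2 aVs (by decide)]; exact hvl.stored,
    by rw [hf1.1 xNv (by decide)]; exact hvl.length, hvl.nodup, hvl.mem⟩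
  have h1 : X.Found S Y b s1 R vis vs st P := 
    ⟨h.mem.of_frame hf1 (by decide) (by decide) (by decide) (by decide) (by decide) (by decide)
      (by decide), h.finds, by rw [hf1.2 aSt (by decide)]; exact h.stored,
      by rw [hf1.1 xSp (by decide)]; exact h.length, hv1, h.nodup, h.mem_list, h.root, h.path⟩
  rw [wp_seq]
  refine wp_conseq hb1 (setMarks_spec hN hb1 hs1 h1) ?_
  rintro s2 t2 hb2 hf2 ⟨ht2, hc2⟩
  have hs2 := hs1.of_frame hf2 (by decide) (by decide) (by decide) (by decide) (by decide)
    (by decide)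
  have hv2 : X.Visited vis s2 vs := ⟨by rw [hf2.2 aVs (by decide)]; exact hv1.stored,
    by rw [hf2.1 xNv (by decide)]; exact hv1.length, hvl.nodup, hvl.mem⟩
  have h2 : X.Found S Y b s2 R vis vs st P := 
    ⟨h1.mem.of_frame hf2 (by decide) (by decide) (by decide) (by decide) (by decide) (by decide)
      (by decide), h.finds, by rw [hf2.2 aSt (by decide)]; exact h1.stored,
      by rw [hf2.1 xSp (by decide)]; exact h1.length, hv2, h.nodup, h.mem_list, h.root, h.path⟩
  rw [wp_seq]
  refine wp_conseq hb2 (flipPath_spec hN hb2 hs2 h2 hbf hY hYN) ?_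
  rintro s3 t3 hb3 hf3 ⟨ht3, hm3⟩
  have hs3 := hs2.of_frame hf3 (by decide) (by decide) (by decide) (by decide) (by decide)
    (by decide)
  have hv3 : X.Visited vis s3 vs := ⟨by rw [hf3.2 aVs (by decide)]; exact hv2.stored,
    by rw [hf3.1 xNv (by decide)]; exact hv2.length, hvl.nodup, hvl.mem⟩
  refine wp_conseq hb3 (revive_spec hN hb3 hs3 hm3 hv3 (D := (X.G.afterAugment S P vis).deleted)
    (aff := X.G.InAffectedPiece P) Finset.subset_union_right ?_ ?_ fun e he => (hvis e he).2) ?_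
  · intro e he
    obtain ⟨e1, e2, e3⟩ := (hvl.mem e).1 he
    rw [hf3.2 aAf (by decide), hc2]
    constructor
    · intro ha
      have hw : X.w e = 0 := by
        obtain ⟨K, k1, -⟩ := ha
        simp only [pieceEdges, Finset.mem_filter] at k1
        rw [← X.weight e e1 e2, k1.2.1]; rfl
      exact ⟨hw, Or.inr ((Layout.affected_iff (fun e he => (h.path_sub e he).2) e1 e2 hw).1 ha)⟩
    · rintro ⟨hw, k | k⟩
      · exact absurd (hc1 e he) k
      · exact (Layout.affected_iff (fun e he => (h.path_sub e he).2) e1 e2 hw).2 k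
  · intro e
    simp only [afterAugment, Finset.mem_union, Finset.mem_filter]
    constructor
    · rintro (k | k)
      · exact ⟨Or.inl k, fun k' => (hvis e k'.1).1 k⟩
      · exact ⟨Or.inr k.1, fun k' => k.2 k'.2⟩
    · rintro ⟨k | k, k'⟩
      · exact Or.inl k
      · exact Or.inr ⟨k, fun k'' => k' ⟨k, k''⟩⟩
  · rintro s4 t4 _ _ ⟨ht4, R', hm4, hR'⟩
    refine ⟨by omega, R', hm4, ?_⟩
    have hcard := hfi.card_affected_le ⟨h.mem.feasible.matching, h.mem.feasible.nonneg,
      h.mem.feasible.tight, h.mem.feasible.left_nonneg, h.mem.feasible.left_le,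
      h.mem.feasible.left_free, h.mem.feasible.right_le, h.mem.feasible.right_free⟩ hbf hm
    have h5 : (R' \ R).card ≤ (X.G.E.filter (X.G.InAffectedPiece P)).card := by
      refine Finset.card_le_card_of_injOn X.ed ?_ ?_
      · intro e he
        rw [Finset.mem_coe, Finset.mem_sdiff] at he
        obtain ⟨k1, k2⟩ := (hR' e he.1).resolve_left he.2
        rw [Finset.mem_coe, Finset.mem_filter]
        exact ⟨(hvis _ ((hvl.mem e).1 k1).2.2).2, k2⟩
      · intro e he f hf hef
        have k1 := hm4.sub e (Finset.mem_sdiff.1 he).1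
        have k2 := hm4.sub f (Finset.mem_sdiff.1 hf).1
        exact X.ed_inj _ _ k1.1 k1.2.1 k2.1 k2.2.1 hef
    have h6 : R'.card ≤ R.card + (R' \ R).card := by
      have := Finset.card_le_card_sdiff_add_card (s := R') (t := R)
      omega
    have h7 : ((R' \ R).card : ℤ) ≤ (Y + 1) * m := by
      refine le_trans ?_ hcard
      convert Int.ofNat_le.2 h5
    omega

end

end RAM

namespace RAM

set_option linter.unusedSectionVars false

open WGraph

/-! ## Second stage -/

/-- Search from all free vertices of `B` that have edges. -/
def stageTwo : Cmd :=
  forEdges (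
    .assign xB (.read aEB (.var xE)) ;;
    .ite (.read aMB (.var xB)) .skip (
    .ite (.read aRt (.var xB)) .skip (
      .write aRt (.var xB) (.const 1) ;; search ;;
      .ite (.equal (.var xRes) (.const 2)) augmentPath .skip)))

section

variable {A B : Type} [DecidableEq A] [DecidableEq B] {X : Layout A B} {N : ℤ} {s : State} {t : ℕ}
  {S : StageState A B} {Y : ℤ} {R : Finset ℤ} {b : B}

/-- The program does not notice free vertices without edges, but the algorithm searches from them
too; these searches fail without visiting anything. -/
theorem _root_.WGraph.SecondStage.of_isolated {G : WGraph A B} {S : StageState A B} {l : List B}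
    (h : ∀ b ∈ l, ∀ e ∈ G.E, e.2 ≠ b) : G.SecondStage l S S := by
  induction l with
  | nil => exact .done S
  | cons b l ih =>
    refine .fails b l S S ∅ ⟨.start, ?_⟩ ?_
    · rintro e x ⟨h1, -, -⟩
      cases h1 with
      | unmatched a _ k1 k2 => exact absurd rfl (h b (by simp) _ k1)
    · rw [Finset.union_empty]
      exact ih fun b' hb' => h b' (List.mem_cons_of_mem _ hb')

/-- Of the 100 units held by a list entry, 40 pay for the search and 60 for the augmentation, which
costs 30 for each of at most two visited edges per entry. Entries that come back are paid by (Y+1)m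
per augmentation. -/
theorem stageTwo_step (hN : 2 * X.hi + 10 ≤ N) (hb : Bdd N s) (hs : X.Static s)
    (h : X.StageMem S Y s R) (hbf : FreeB S.M b) (hbm : X.IB b) (hcur : s.var xB = X.ib b)
    (hY : 0 ≤ Y) (hYN : Y ≤ N) {m : ℕ} (hm : ∀ K, (X.G.pieceEdges K).card ≤ m) :
    wp N (search ;; .ite (.equal (.var xRes) (.const 2)) augmentPath .skip) (fun s' t' => ∃ S' R',
      X.G.SecondStage [b] S S' ∧ X.StageMem S' Y s' R' ∧
      (t' : ℤ) + 100 * R'.card ≤ t + 100 * R.card + 40 +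
        100 * ((S'.M.card - S.M.card) * ((Y + 1) * m))) s t := by
  rw [wp_seq]
  refine wp_conseq hb (search_spec hN hb hs h hbf hbm hcur) ?_
  rintro s1 t1 hb1 hf1 ⟨R1, vis, vs, st, P, ht1, hv1, hcase⟩
  have hs1 := hs.of_frame hf1 (by decide) (by decide) (by decide) (by decide) (by decide)
    (by decide)
  have hpos : 0 ≤ (Y + 1) * m := by positivity
  rcases hcase with ⟨h1, h2, h3⟩ | ⟨h1, h2⟩
  · simp only [wp_ite, wp_skip, Expr.val, Op.val, h1]
    refine ⟨fun h => by simp at h, fun _ => ⟨_, R1, .fails b [] S _ vis h3 (.done _), h2, ?_⟩⟩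
    simp only [sub_self, zero_mul, mul_zero]
    push_cast; omega
  · simp only [wp_ite, wp_skip, Expr.val, Op.val, h1]
    refine ⟨fun _ => ?_, fun h => by simp at h⟩
    refine wp_conseq hb1 (augmentPath_spec hN hb1 hs1 h2 hbf hY hYN hm) ?_
    rintro s2 t2 _ _ ⟨ht2, R2, hm2, hR2⟩
    refine ⟨_, R2, .finds b [] S _ P vis h2.finds (.done _), hm2, ?_⟩
    obtain ⟨a, Z, hfi⟩ := h2.finds.inv
    have hc : (X.G.afterAugment S P vis).M.card = S.M.card + 1 :=
      (hfi.augment h.feasible.matching hbf).2.1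
    rw [hc]
    have : (((S.M.card + 1 : ℕ) : ℤ) - S.M.card) * ((Y + 1) * m) = (Y + 1) * m := by
      push_cast; ring
    rw [this]
    omega

/-- An augmentation covers no free vertex of B other than its root. So a vertex of B that is matched
when its edge is met was matched from the start or has been searched; the marks in `aRt` prevent
repeated searches from a vertex whose search failed. -/
theorem stageTwo_spec [Fintype B] (hN : 2 * X.hi + 10 ≤ N) (hb : Bdd N s) (hs : X.Static s)
    {M : Finset (A × B)} {y : A ⊕ B → ℤ}
    (hm : X.Mates M (s.arr aMA) (s.arr aMB)) (hd : X.Duals y (s.arr aYA) (s.arr aYB))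
    (hF : X.G.Feasible M y Y) (hL : Lists X.dom (s.arr aLH) (s.arr aLN) X.keyB (X.unmatched M))
    (hA : ∀ a, X.IA a → s.arr aFl (X.ia a) = 0) (hB : ∀ b, X.IB b → s.arr aRt (X.ib b) = 0)
    (hY : 0 ≤ Y) (hYN : Y ≤ N) {m : ℕ} (hmK : ∀ K, (X.G.pieceEdges K).card ≤ m) :
    wp N stageTwo (fun s' t' => ∃ bs S', bs.Nodup ∧ (∀ b, b ∈ bs ↔ FreeB M b) ∧
      X.G.SecondStage bs ⟨M, y, ∅⟩ S' ∧ X.Mates S'.M (s'.arr aMA) (s'.arr aMB) ∧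
      X.Duals S'.y (s'.arr aYA) (s'.arr aYB) ∧
      (t' : ℤ) ≤ t + 160 * (X.hi + 1 - X.lo) + 10 +
        100 * ((S'.M.card - M.card) * ((Y + 1) * m))) s t := by
  classical
  have hl := X.one_le
  have hle := X.lo_le
  have hpos : 0 ≤ (Y + 1) * m := by positivity
  have hR0 : ((X.unmatched M).card : ℤ) ≤ X.hi + 1 - X.lo := by
    have := Finset.card_filter_le (Finset.Icc X.lo X.hi) (fun e => X.ed e ∉ M)
    rw [Int.card_Icc] at this
    unfold Layout.unmatched
    omega
  have hfin : ∀ S' bs, X.G.SecondStage bs ⟨M, y, ∅⟩ S' → bs.Nodup → (∀ x ∈ bs, FreeB M x) →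
      (S'.M.card : ℤ) ≤ X.hi + 1 - X.lo := by
    intro S' bs h1 h2 h3
    have h4 := (h1.result hF h2 h3).feasible.matching.1
    have h5 : S'.M.card ≤ (Finset.Icc X.lo X.hi).card := by
      have : S'.M ⊆ (Finset.Icc X.lo X.hi).image X.ed := by
        intro x hx
        obtain ⟨e, e1, e2, rfl⟩ := X.ed_surj x (h4 hx)
        exact Finset.mem_image_of_mem _ (Finset.mem_Icc.2 ⟨e1, e2⟩)
      exact (Finset.card_le_card this).trans Finset.card_image_le
    rw [Int.card_Icc] at h5
    omega
  unfold stageTwo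
  refine wp_forEdges (lo := X.lo) (hi := X.hi) hb
    (t + 160 * (X.hi + 1 - X.lo) + 10 + 100 * ((X.hi + 1 - X.lo) * ((Y + 1) * m))).toNat
    (fun i s' t' => ∃ bs S' R, X.G.SecondStage bs ⟨M, y, ∅⟩ S' ∧ bs.Nodup ∧
      (∀ x ∈ bs, FreeB M x) ∧ X.StageMem S' Y s' R ∧
      (∀ x, X.IB x → (s'.arr aRt (X.ib x) ≠ 0 ↔ x ∈ bs)) ∧ (∀ x ∈ bs, X.IB x) ∧
      (∀ e, X.lo ≤ e → e < i → FreeB M (X.ed e).2 → (X.ed e).2 ∈ bs) ∧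
      (t' : ℤ) + 100 * R.card ≤ t + 100 * (X.unmatched M).card + 1 + 60 * (i - X.lo) +
        100 * ((S'.M.card - M.card) * ((Y + 1) * m))) hs.lo hs.hi (by omega) (by omega)
    (by omega) (by decide) (by decide) ?_ ?_ ?_ ?_
  · refine ⟨[], _, X.unmatched M, .done _, by simp, by simp, ⟨hF, hm, hd, hL, fun e he => ?_,
      fun e e1 e2 e3 _ _ => Layout.mem_unmatched.2 ⟨⟨e1, e2⟩, e3⟩, fun a ha => ?_⟩, fun x hx => ?_,
      by simp, fun e e1 e2 => by omega, ?_⟩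
    · obtain ⟨⟨e1, e2⟩, e3⟩ := Layout.mem_unmatched.1 he
      exact ⟨e1, e2, e3, by simp⟩
    · simp [hA a ha]
    · simp [hB x hx]
    · push_cast; simp; omega
  · rintro i s' t' hi ⟨bs, S', R, h1, h2, h3, h4, -, -, -, ht⟩
    have h6 : ((S'.M.card : ℤ) - M.card) * ((Y + 1) * m) ≤
        (X.hi + 1 - X.lo) * ((Y + 1) * m) := by
      refine mul_le_mul_of_nonneg_right ?_ hpos
      have := hfin S' bs h1 h2 h3
      omega
    omega
  · rintro i s' t' hi1 hi2 hb' hf he ⟨bs, S', R, h1, h2, h3, h4, h5, hbI, h6, ht⟩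
    have hs' := hs.of_frame hf (by decide) (by decide) (by decide) (by decide) (by decide)
      (by decide)
    have hib := Layout.ib_mem (X := X) hi1 hi2
    rw [wp_seq, wp_assign]
    simp only [Expr.val, he, hs'.eb i hi1 hi2]
    have hN1 : |X.ib (X.ed i).2| ≤ N := by rw [← hs'.eb i hi1 hi2]; exact hb'.2 _ _
    refine ⟨hN1, ?_⟩
    simp only [wp_ite, wp_skip, Expr.val, Function.update_self]
    have hm4 := h4.mates.right _ hib
    refine ⟨fun hmb => ?_, fun hmb => ⟨fun hrt => ?_, fun hrt => ?_⟩⟩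
    · refine ⟨bs, S', R, h1, h2, h3, ⟨h4.feasible, h4.mates, h4.duals, h4.lists, h4.sub, h4.sup,
        h4.flag⟩, h5, hbI, fun e e1 e2 e3 => ?_, by push_cast at *; omega⟩
      rcases eq_or_ne e i with rfl | hne
      · by_contra hc
        exact hmb (hm4.1 ((h1.result hF h2 h3).freeB' _ hc e3))
      · exact h6 e e1 (by omega) e3
    · refine ⟨bs, S', R, h1, h2, h3, ⟨h4.feasible, h4.mates, h4.duals, h4.lists, h4.sub, h4.sup,
        h4.flag⟩, h5, hbI, fun e e1 e2 e3 => ?_, by push_cast at *; omega⟩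
      rcases eq_or_ne e i with rfl | hne
      · exact (h5 _ hib).1 hrt
      · exact h6 e e1 (by omega) e3
    · have hnot : (X.ed i).2 ∉ bs := fun h => (h5 _ hib).2 h hrt
      have hfree : FreeB S'.M (X.ed i).2 := hm4.2 hmb
      have hfree0 : FreeB M (X.ed i).2 := (h1.result hF h2 h3).freeB _ hfree
      rw [wp_seq, wp_write]
      simp only [Expr.val, Function.update_self, abs_one]
      refine ⟨by omega, ?_⟩
      have hb1 := (hb'.assign (x := xB) hN1).write (a := aRt) (i := X.ib (X.ed i).2) (v := 1)
        (by rw [abs_one]; omega)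
      refine wp_conseq hb1 (stageTwo_step hN hb1 (b := (X.ed i).2) (S := S') (R := R)
        ⟨hs'.ea, hs'.eb, hs'.wt, hs'.pc, by simpa using hs'.lo, by simpa using hs'.hi⟩
        ⟨h4.feasible, h4.mates, h4.duals, h4.lists, h4.sub, h4.sup, h4.flag⟩
        hfree hib (by simp) hY hYN hmK) ?_
      rintro s2 t2 hb2 hf2 ⟨S2, R2, k1, k2, k3⟩
      refine ⟨bs ++ [(X.ed i).2], S2, R2, h1.append k1, ?_, ?_, ⟨k2.feasible, k2.mates, k2.duals,
        k2.lists, k2.sub, k2.sup, k2.flag⟩, fun x hx => ?_, fun x hx => ?_,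
        fun e e1 e2 e3 => ?_, ?_⟩
      · rw [List.nodup_append]
        refine ⟨h2, by simp, ?_⟩
        rintro x hx z hz rfl
        rw [List.mem_singleton] at hz
        exact hnot (hz ▸ hx)
      · intro x hx
        rcases List.mem_append.1 hx with hx | hx
        · exact h3 x hx
        · rw [List.mem_singleton.1 hx]; exact hfree0
      · rw [hf2.2 aRt (by decide)]
        simp only [Function.update_self, List.mem_append, List.mem_singleton]
        by_cases hxi : x = (X.ed i).2
        · subst hxi; simp
        · rw [Function.update_of_ne (X.ib_inj.ne hxi), h5 x hx]
          simp [hxi]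
      · rcases List.mem_append.1 hx with hx | hx
        · exact hbI x hx
        · rw [List.mem_singleton.1 hx]; exact hib
      · rw [List.mem_append, List.mem_singleton]
        rcases eq_or_ne e i with rfl | hne
        · exact Or.inr rfl
        · exact Or.inl (h6 e e1 (by omega) e3)
      · push_cast at k3 ⊢
        have : ((S2.M.card : ℤ) - M.card) * ((Y + 1) * m) = (S2.M.card - S'.M.card) *
          ((Y + 1) * m) + (S'.M.card - M.card) * ((Y + 1) * m) := by ring
        omega
  · rintro s' t' hb' hf ⟨bs, S', R, h1, h2, h3, h4, h5, hbI, h6, ht⟩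
    -- The order of the searches: first those of the program, then the free vertices without edges.
    refine ⟨bs ++ (Finset.univ.filter fun x => FreeB M x ∧ ¬ X.IB x).toList, S', ?_, fun x => ?_,
      h1.append (.of_isolated ?_), h4.mates, h4.duals, by push_cast; omega⟩
    · rw [List.nodup_append]
      refine ⟨h2, Finset.nodup_toList _, ?_⟩
      rintro x hx z hz rfl
      simp only [Finset.mem_toList, Finset.mem_filter, Finset.mem_univ, true_and] at hz
      exact hz.2 (hbI x hx)
    · simp only [List.mem_append, Finset.mem_toList, Finset.mem_filter, Finset.mem_univ, true_and]
      constructor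
      · rintro (h | h)
        · exact h3 x h
        · exact h.1
      · intro h
        by_cases hx : X.IB x
        · obtain ⟨e, e1, e2, rfl⟩ := hx
          exact Or.inl (h6 e e1 (by omega) h)
        · exact Or.inr ⟨h, hx⟩
    · intro x hx e he
      simp only [Finset.mem_toList, Finset.mem_filter, Finset.mem_univ, true_and] at hx
      rintro rfl
      obtain ⟨f, f1, f2, rfl⟩ := X.ed_surj e he
      exact hx.2 (Layout.ib_mem f1 f2)

end

end RAM

namespace RAM

set_option linter.unusedSectionVars false

open WGraph

/-! ## The phases -/

/-- The phases of the algorithm. -/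
def solve : Cmd :=
  .assign xFd (.const 1) ;;
  .while (.var xFd) (buildLists ;; stageOne ;; .ite (.var xFd) (adjustDuals ;; stageTwo) .skip)

section

variable {A B : Type} [DecidableEq A] [DecidableEq B] {X : Layout A B} {N : ℤ} {s : State} {t : ℕ}
  {M : Finset (A × B)} {y : A ⊕ B → ℤ} {Y : ℤ} {m : ℕ}

/-- A phase is linear in the number of edges except for the edges restored after augmentations. For
these Y + L, the common dual weight after the first stage, is decisive. -/
theorem phase_spec [Fintype B] (hN : 2 * X.hi + 10 ≤ N) (hb : Bdd N s) (hs : X.Static s)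
    (hm : X.Mates M (s.arr aMA) (s.arr aMB)) (hd : X.Duals y (s.arr aYA) (s.arr aYB))
    (hF : X.G.Feasible M y Y) (hY : 0 ≤ Y) (hmK : ∀ K, (X.G.pieceEdges K).card ≤ m) :
    wp N (buildLists ;; stageOne ;; .ite (.var xFd) (adjustDuals ;; stageTwo) .skip)
      (fun s' t' => (s'.var xFd = 0 ∧ X.G.minDist M y = ⊤ ∧ X.Mates M (s'.arr aMA) (s'.arr aMB) ∧
          (t' : ℤ) ≤ t + 500 * (X.hi + 1 - X.lo)) ∨
        (s'.var xFd ≠ 0 ∧ ∃ (L : ℕ) (bs : List B) (S' : StageState A B), X.G.minDist M y = L ∧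
          bs.Nodup ∧ (∀ b, b ∈ bs ↔ FreeB M b) ∧
          X.G.SecondStage bs ⟨M, X.G.updateDuals M y, ∅⟩ S' ∧
          X.Mates S'.M (s'.arr aMA) (s'.arr aMB) ∧ X.Duals S'.y (s'.arr aYA) (s'.arr aYB) ∧
          (t' : ℤ) ≤ t + 550 * (X.hi + 1 - X.lo) +
            100 * ((S'.M.card - M.card) * ((Y + L + 1) * m)))) s t := by
  have hl := X.one_le
  have hle := X.lo_le
  rw [wp_seq]
  refine wp_conseq hb (buildLists_spec (by omega) hb hs hF.matching hm) ?_
  rintro s1 t1 hb1 hf1 ⟨ht1, hL1, hA1, hB1⟩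
  have hs1 := hs.of_frame hf1 (by decide) (by decide) (by decide) (by decide) (by decide)
    (by decide)
  have hm1 : X.Mates M (s1.arr aMA) (s1.arr aMB) := by
    rw [hf1.2 aMA (by decide), hf1.2 aMB (by decide)]; exact hm
  have hd1 : X.Duals y (s1.arr aYA) (s1.arr aYB) := by
    rw [hf1.2 aYA (by decide), hf1.2 aYB (by decide)]; exact hd
  rw [wp_seq]
  refine wp_conseq hb1 (stageOne_spec hN hb1 hs1 hm1 hd1 hF hL1 (fun a ha => (hA1 a ha).1)
    fun b hb => (hB1 b hb).1) ?_
  rintro s2 t2 hb2 hf2 ⟨ht2, hcase⟩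
  have hs2 := hs1.of_frame hf2 (by decide) (by decide) (by decide) (by decide) (by decide)
    (by decide)
  have hm2 : X.Mates M (s2.arr aMA) (s2.arr aMB) := by
    rw [hf2.2 aMA (by decide), hf2.2 aMB (by decide)]; exact hm1
  have hd2 : X.Duals y (s2.arr aYA) (s2.arr aYB) := by
    rw [hf2.2 aYA (by decide), hf2.2 aYB (by decide)]; exact hd1
  rw [wp_ite]
  simp only [Expr.val, wp_skip]
  rcases hcase with ⟨h0, htop⟩ | ⟨h0, L, hL, hmin, hYL, hup1, hup2⟩
  · refine ⟨fun h => absurd h0 h, fun _ => Or.inl ⟨h0, htop, hm2, by push_cast; omega⟩⟩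
  · refine ⟨fun _ => ?_, fun h => by omega⟩
    have hF' := hF.updateDuals hmin
    rw [wp_seq]
    refine wp_conseq hb2 (adjustDuals_spec hN hb2 hs2 hF' (by omega) (by omega) (fun a ha => ?_)
      fun b hb => ?_) ?_
    · rw [hup1 a ha, hd2.left a ha]
    · rw [hup2 b hb, hd2.right b hb]
    rintro s3 t3 hb3 hf3 ⟨ht3, hd3⟩
    have hs3 := hs2.of_frame hf3 (by decide) (by decide) (by decide) (by decide) (by decide)
      (by decide)
    have hm3 : X.Mates M (s3.arr aMA) (s3.arr aMB) := by
      rw [hf3.2 aMA (by decide), hf3.2 aMB (by decide)]; exact hm2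
    have hL3 : Lists X.dom (s3.arr aLH) (s3.arr aLN) X.keyB (X.unmatched M) := by
      rw [hf3.2 aLH (by decide), hf3.2 aLN (by decide), hf2.2 aLH (by decide),
        hf2.2 aLN (by decide)]
      exact hL1
    refine wp_conseq hb3 (stageTwo_spec hN hb3 hs3 hm3 hd3 hF' hL3 (fun a ha => ?_)
      (fun b hb => ?_) (by omega) (by omega) hmK) ?_
    · rw [hf3.2 aFl (by decide), hf2.2 aFl (by decide)]; exact (hA1 a ha).2
    · rw [hf3.2 aRt (by decide), hf2.2 aRt (by decide)]; exact (hB1 b hb).2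
    rintro s4 t4 hb4 hf4 ⟨bs, S', h1, h2, h3, h4, h5, h6⟩
    refine Or.inr ⟨?_, L, bs, S', hmin, h1, h2, h3, h4, h5, ?_⟩
    · rw [hf4.1 xFd (by decide), hf3.1 xFd (by decide), h0]; decide
    · push_cast at ht3; omega

/-- The time spent in the phases. -/
def solveCost (l R w k m : ℕ) : ℕ := 600 * l * (2 * R + 2) + 100 * (m * revisitPotential w k) + 10

/-- Two potentials are spent: `phasePotential` for the linear part of each phase and
`revisitPotential` for restored edges. Both are controlled by the distance k of the current matching
from a maximum one, because weak duality gives k(Y+L) ≤ 2w after each first stage. -/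
theorem solve_spec [Fintype B] (hN : 2 * X.hi + 10 ≤ N) (hb : Bdd N s) (hs : X.Static s)
    (hm : X.Mates M (s.arr aMA) (s.arr aMB)) (hd : X.Duals (fun _ => 0) (s.arr aYA) (s.arr aYB))
    (hF : X.G.Feasible M (fun _ => 0) 0) (hmK : ∀ K, (X.G.pieceEdges K).card ≤ m) {w R k : ℕ}
    (hw : ∀ M', X.G.IsMatching M' → X.G.weight M' ≤ w) (hR : 2 * w < R * R)
    (hk : ∀ M', X.G.IsMatching M' → M'.card ≤ M.card + k) :
    wp N solve (fun s' t' => ∃ M', X.G.Phases M (fun _ => 0) M' ∧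
      X.Mates M' (s'.arr aMA) (s'.arr aMB) ∧
      t' ≤ t + solveCost (X.hi + 1 - X.lo).toNat R w k m) s t := by
  have hl := X.one_le
  have hle := X.lo_le
  obtain ⟨l, hlen⟩ := Int.eq_ofNat_of_zero_le (show 0 ≤ X.hi + 1 - X.lo by omega)
  -- a matching of maximal cardinality
  obtain ⟨N₀, hN₀, hmax⟩ : ∃ N₀, X.G.IsMatching N₀ ∧
      ∀ M', X.G.IsMatching M' → M'.card ≤ N₀.card := by
    obtain ⟨N₀, h1, h2⟩ := Finset.exists_max_image
      (X.G.E.powerset.filter fun M' => ∀ e ∈ M', ∀ f ∈ M', (e.1 = f.1 ∨ e.2 = f.2) → e = f)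
      Finset.card ⟨M, by rw [Finset.mem_filter, Finset.mem_powerset]; exact hF.matching⟩
    rw [Finset.mem_filter, Finset.mem_powerset] at h1
    refine ⟨N₀, h1, fun M' hM' => h2 M' ?_⟩
    rw [Finset.mem_filter, Finset.mem_powerset]; exact hM'
  have hk0 := hk N₀ hN₀
  rw [solve, wp_seq, wp_assign]
  simp only [Expr.val, abs_one]
  refine ⟨by omega, ?_⟩
  have hb1 := hb.assign (x := xFd) (v := 1) (by rw [abs_one]; omega)
  rw [hlen, Int.toNat_natCast]
  refine wp_while hb1 (t + solveCost l R w k m) (fun s' t' => ∃ M' y' Y',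
    X.G.Feasible M' y' Y' ∧ 0 ≤ Y' ∧ (∀ M'', X.G.Phases M' y' M'' →
      X.G.Phases M (fun _ => 0) M'') ∧ X.Mates M' (s'.arr aMA) (s'.arr aMB) ∧
    ((s'.var xFd = 0 ∧ X.G.minDist M' y' = ⊤ ∧ t' + 5 ≤ t + solveCost l R w k m) ∨
      (s'.var xFd ≠ 0 ∧ X.Duals y' (s'.arr aYA) (s'.arr aYB) ∧
      -- The first phase may have ℓ = 0 and leave Y unchanged, so it receives one extra unit; after
      -- a second stage ℓ ≥ 1, and the potential drops by itself.
      ∃ δ : ℕ, (δ = 1 ∨ 1 ≤ X.G.minDist M' y') ∧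
        (t' + 600 * l * (phasePotential R (N₀.card - M'.card) Y' + 1 + δ) +
        100 * (m * revisitPotential w (N₀.card - M'.card)) : ℤ) + 8 ≤
          t + solveCost l R w k m))) ?_ ?_
  · refine ⟨M, _, 0, hF, le_rfl, fun _ h => h, hm, Or.inr ⟨by simp, hd, 1, Or.inl rfl, ?_⟩⟩
    have h1 := phasePotential_le (R := R) (k := N₀.card - M.card)
    have h2 : revisitPotential w (N₀.card - M.card) ≤ revisitPotential w k := by
      unfold revisitPotential
      exact Finset.sum_le_sum_of_subset (Finset.Icc_subset_Icc_right (by omega))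
    unfold solveCost
    have h3 : 600 * l * (phasePotential R (N₀.card - M.card) 0 + 1 + 1) ≤
      600 * l * (2 * R + 2) := Nat.mul_le_mul_left _ (by omega)
    have h4 : m * revisitPotential w (N₀.card - M.card) ≤ m * revisitPotential w k :=
      Nat.mul_le_mul_left _ h2
    zify at h3 h4
    push_cast
    omega
  · rintro s' t' hb' hf' ⟨M', y', Y', hF', hY', hph, hm', hcase⟩
    refine ⟨?_, fun h0 => ?_, fun h0 => ?_⟩
    · rcases hcase with h | ⟨-, -, δ, -, h⟩
      · omega
      · have : (0 : ℤ) ≤ 600 * l * (phasePotential R (N₀.card - M'.card) Y' + 1 + δ) := by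
          positivity
        have : (0 : ℤ) ≤ 100 * (m * revisitPotential w (N₀.card - M'.card)) := by positivity
        omega
    · replace h0 : s'.var xFd ≠ 0 := h0
      obtain ⟨-, hd', δ, hδ, ht'⟩ := hcase.resolve_left fun h => h0 h.1
      have hs' : X.Static s' := by
        refine Layout.Static.of_frame ?_ hf' (by decide) (by decide) (by decide) (by decide)
          (by decide) (by decide)
        exact ⟨hs.ea, hs.eb, hs.wt, hs.pc, by simpa using hs.lo, by simpa using hs.hi⟩
      refine wp_conseq hb' (phase_spec hN hb' hs' hm' hd' hF' hY' hmK) ?_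
      rintro s2 t2 hb2 hf2 (⟨k1, k2, k3, k4⟩ | ⟨k1, L, bs, S', k2, k3, k4, k5, k6, k7, k8⟩)
      · refine ⟨M', y', Y', hF', hY', hph, k3, Or.inl ⟨k1, k2, ?_⟩⟩
        have : (0 : ℤ) ≤ 600 * l * (phasePotential R (N₀.card - M'.card) Y' + δ) := by
          positivity
        have : (0 : ℤ) ≤ 100 * (m * revisitPotential w (N₀.card - M'.card)) := by positivity
        have e1 : (600 * l * (phasePotential R (N₀.card - M'.card) Y' + 1 + δ) : ℤ) =
          600 * l * (phasePotential R (N₀.card - M'.card) Y' + δ) + 600 * l := by ring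
        push_cast at k4
        omega
      · have hF2 := hF'.updateDuals k2
        have hres := k5.result hF2 k3 fun x hx => (k4 x).1 hx
        have hbs : ∀ b, FreeB M' b → b ∈ bs := fun b hb => (k4 b).2 hb
        have hlt := hres.card_lt hbs (updateDuals_minDist hF' k2)
        have hle' := hmax _ hres.feasible.matching
        have hmul := hF2.card_sub_mul_le hN₀
        have hw1 := hw _ hF'.matching
        have hw2 := hw _ hN₀
        have hkY : ((N₀.card - M'.card : ℕ) : ℤ) * (Y' + L) ≤ 2 * w := by
          rw [Nat.cast_sub (by omega)]; omega
        refine ⟨S'.M, S'.y, Y' + L, hres.feasible, by omega, fun M'' h => hph _ ?_, k6,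
          Or.inr ⟨k1, k7, 0, Or.inr (hres.one_le_minDist hbs), ?_⟩⟩
        · exact .phase M' y' bs S' M'' (by rw [k2]; simp) k3 k4 k5 h
        · have hrev := revisitPotential_le (w := w) (k := N₀.card - M'.card)
            (k' := N₀.card - S'.M.card) (by omega) hkY
          have hpp : phasePotential R (N₀.card - S'.M.card) (Y' + L) + 1 ≤
              phasePotential R (N₀.card - M'.card) Y' + δ := by
            rcases hδ with rfl | hδ
            · have := phasePotential_mono (R := R) (k := N₀.card - M'.card)
                (k' := N₀.card - S'.M.card) (Y := Y') (Y' := Y' + L) (by omega) (by omega)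
              omega
            · rw [k2] at hδ
              have hL1 : 1 ≤ L := by exact_mod_cast hδ
              have := phasePotential_lt (k := N₀.card - M'.card)
                (k' := N₀.card - S'.M.card) (Y := Y') (Y' := Y' + L) hR (by omega) (by omega) hkY
              omega
          have e1 : ((N₀.card - M'.card - (N₀.card - S'.M.card) : ℕ) : ℤ) =
              S'.M.card - M'.card := by omega
          rw [e1] at hrev
          have e2 := mul_le_mul_of_nonneg_left hrev (show (0 : ℤ) ≤ 100 * m by positivity)
          have e3 : (600 * l * (phasePotential R (N₀.card - S'.M.card) (Y' + L) + 1 + 0) : ℤ) +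
              600 * l ≤ 600 * l * (phasePotential R (N₀.card - M'.card) Y' + 1 + δ) := by
            have : ((phasePotential R (N₀.card - S'.M.card) (Y' + L) + 1 + 1 : ℕ) : ℤ) ≤
              ((phasePotential R (N₀.card - M'.card) Y' + 1 + δ : ℕ) : ℤ) := by
                exact_mod_cast (by omega)
            have h6 := mul_le_mul_of_nonneg_left this (show (0 : ℤ) ≤ 600 * l by positivity)
            push_cast at h6 ⊢
            linarith
          have e4 : (100 * m : ℤ) * (revisitPotential w (N₀.card - S'.M.card) +
              (S'.M.card - M'.card) * (Y' + L + 1)) =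
              100 * (m * revisitPotential w (N₀.card - S'.M.card)) +
              100 * ((S'.M.card - M'.card) * ((Y' + L + 1) * m)) := by ring
          have e5 : (100 * m : ℤ) * revisitPotential w (N₀.card - M'.card) =
              100 * (m * revisitPotential w (N₀.card - M'.card)) := by ring
          rw [e4, e5] at e2
          push_cast at k8 ⊢
          omega
    · replace h0 : s'.var xFd = 0 := h0
      obtain ⟨-, h1, h2⟩ := hcase.resolve_right fun h => h.1 h0
      exact ⟨M', hph _ (.halt _ _ h1), hm', by omega⟩

end

end RAM

namespace RAM

set_option linter.unusedSectionVars false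

open WGraph

notation "xZ" => (17 : ℕ)
notation "xP" => (18 : ℕ)
notation "xJ" => (19 : ℕ)
notation "xL" => (20 : ℕ)
notation "aHA" => (24 : ℕ)
notation "aTA" => (25 : ℕ)
notation "aHB" => (26 : ℕ)
notation "aTB" => (27 : ℕ)
notation "aEm" => (28 : ℕ)
notation "aSp" => (29 : ℕ)

/-! ## Enumerating the pieces -/

/-- A graph given by the list of its edges, numbered from `1` to `m`. -/
structure Source (A B : Type) where
  G : WGraph A B
  ia : A → ℤ
  ib : B → ℤ
  ed : ℤ → A × B
  m : ℤ
  ia_inj : Function.Injective ia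
  ib_inj : Function.Injective ib
  ed_inj : ∀ e f, 1 ≤ e → e ≤ m → 1 ≤ f → f ≤ m → ed e = ed f → e = f
  ed_mem : ∀ e, 1 ≤ e → e ≤ m → ed e ∈ G.E
  ed_surj : ∀ x ∈ G.E, ∃ e, 1 ≤ e ∧ e ≤ m ∧ ed e = x

namespace Source

variable {A B : Type} [DecidableEq A] [DecidableEq B] (X : Source A B)

/-- The edges of weight `0`. -/
def Zero (e : ℤ) : Prop := 1 ≤ e ∧ e ≤ X.m ∧ X.G.c (X.ed e) = 0

/-- The edges have a common end. -/
def Touch (e f : ℤ) : Prop := (X.ed e).1 = (X.ed f).1 ∨ (X.ed e).2 = (X.ed f).2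

/-- The component of an edge. -/
def comp (e : ℤ) : X.G.zeroGraph.ConnectedComponent :=
  X.G.zeroGraph.connectedComponentMk (Sum.inl (X.ed e).1)

variable {X}

theorem Touch.symm {e f : ℤ} (h : X.Touch e f) : X.Touch f e := h.imp Eq.symm Eq.symm

theorem comp_right {e : ℤ} (h : X.Zero e) :
    X.comp e = X.G.zeroGraph.connectedComponentMk (Sum.inr (X.ed e).2) :=
  SimpleGraph.ConnectedComponent.sound
    (zeroGraph_adj (X.ed_mem e h.1 h.2.1) h.2.2).reachable

theorem Touch.comp {e f : ℤ} (he : X.Zero e) (hf : X.Zero f) (h : X.Touch e f) :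
    X.comp e = X.comp f := by
  rcases h with h | h
  · unfold Source.comp; rw [h]
  · rw [comp_right he, comp_right hf, h]

variable (X)

/-- The first `z` places contain edges of weight `0`, sorted by components. -/
structure Listing (k z : ℤ) (or pc em : ℤ → ℤ) : Prop where
  z_nonneg : 0 ≤ z
  k_nonneg : 0 ≤ k
  zero : ∀ p, 1 ≤ p → p ≤ z → X.Zero (or p)
  pc_pos : ∀ p, 1 ≤ p → p ≤ z → 1 ≤ pc p
  pc_le : ∀ p, 1 ≤ p → p ≤ z → pc p ≤ k
  inj : ∀ p p', 1 ≤ p → p ≤ z → 1 ≤ p' → p' ≤ z → or p = or p' → p = p'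
  em : ∀ e, 1 ≤ e → e ≤ X.m → (em e ≠ 0 ↔ ∃ p, 1 ≤ p ∧ p ≤ z ∧ or p = e)
  mono : ∀ p p', 1 ≤ p → p ≤ p' → p' ≤ z → pc p ≤ pc p'
  comp : ∀ p p', 1 ≤ p → p ≤ z → 1 ≤ p' → p' ≤ z → pc p = pc p' → X.comp (or p) = X.comp (or p')
  adj : ∀ p p', 1 ≤ p → p ≤ z → 1 ≤ p' → p' ≤ z → X.Touch (or p) (or p') → pc p = pc p'

/-- `sp` contains the places of the first edges of the components. -/
def Starts (k z : ℤ) (pc sp : ℤ → ℤ) : Prop :=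
  ∀ i, 1 ≤ i → i ≤ k → 1 ≤ sp i ∧ sp i ≤ z ∧ pc (sp i) = i ∧ ∀ p, 1 ≤ p → p < sp i → pc p < i

variable {X}

section

variable {k z : ℤ} {or pc em sp : ℤ → ℤ}

theorem Listing.le (h : X.Listing k z or pc em) (hm : 0 ≤ X.m) : z ≤ X.m := by
  have h1 : (Finset.Icc 1 z).card ≤ (Finset.Icc 1 X.m).card := by
    refine Finset.card_le_card_of_injOn or (fun p hp => ?_) fun p hp p' hp' hpp => ?_
    · simp only [Finset.coe_Icc, Set.mem_Icc] at hp ⊢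
      exact ⟨(h.zero p hp.1 hp.2).1, (h.zero p hp.1 hp.2).2.1⟩
    · simp only [Finset.coe_Icc, Set.mem_Icc] at hp hp'
      exact h.inj p p' hp.1 hp.2 hp'.1 hp'.2 hpp
  rw [Int.card_Icc, Int.card_Icc] at h1
  omega

/-- An edge not yet listed leaves one of the m numbers unused, so the next place is within range. -/
theorem Listing.lt (h : X.Listing k z or pc em) {e : ℤ} (he : X.Zero e) (h0 : em e = 0) :
    z < X.m := by
  have h1 : (Finset.Icc 1 z).card ≤ ((Finset.Icc 1 X.m).erase e).card := by
    refine Finset.card_le_card_of_injOn or (fun p hp => ?_) fun p hp p' hp' hpp => ?_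
    · simp only [Finset.coe_Icc, Set.mem_Icc, Finset.mem_coe, Finset.mem_erase,
        Finset.mem_Icc] at hp ⊢
      refine ⟨?_, (h.zero p hp.1 hp.2).1, (h.zero p hp.1 hp.2).2.1⟩
      intro hpe
      exact (h.em e he.1 he.2.1).2 ⟨p, hp.1, hp.2, hpe⟩ h0
    · simp only [Finset.coe_Icc, Set.mem_Icc] at hp hp'
      exact h.inj p p' hp.1 hp.2 hp'.1 hp'.2 hpp
  have h2 := he.1
  have h3 := he.2.1
  rw [Finset.card_erase_of_mem (Finset.mem_Icc.2 ⟨h2, h3⟩), Int.card_Icc, Int.card_Icc] at h1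
  omega

/-- By `hc` the components before label k' are closed under touching, so a listed edge that touches
the new one carries the label k'. By `hk` the new edge either touches the current component or opens
a new one. -/
theorem Listing.emit (h : X.Listing k z or pc em) {e k' : ℤ} (he : X.Zero e) (h0 : em e = 0)
    (hk : (k' = k ∧ ∃ p, 1 ≤ p ∧ p ≤ z ∧ pc p = k ∧ X.Touch (or p) e) ∨ k' = k + 1)
    (hc : ∀ p, 1 ≤ p → p ≤ z → pc p < k' → ∀ f, X.Zero f → X.Touch (or p) f → em f ≠ 0) :
    X.Listing k' (z + 1) (Function.update or (z + 1) e) (Function.update pc (z + 1) k')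
      (Function.update em e 1) := by
  have hz := h.z_nonneg
  have hk0 := h.k_nonneg
  have hkk : k ≤ k' := by omega
  have hlt : ∀ p, 1 ≤ p → p ≤ z + 1 → p ≠ z + 1 → p ≤ z := fun p _ _ _ => by omega
  have hk1 : 1 ≤ k' := by
    rcases hk with ⟨rfl, p, h1, h2, h3, -⟩ | rfl
    · rw [← h3]; exact h.pc_pos p h1 h2
    · omega
  have hne : ∀ p, 1 ≤ p → p ≤ z → or p ≠ e := fun p h1 h2 h3 =>
    (h.em e he.1 he.2.1).2 ⟨p, h1, h2, h3⟩ h0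
  have hcomp : ∀ p, 1 ≤ p → p ≤ z → pc p = k' → X.comp (or p) = X.comp e := by
    intro p h1 h2 h3
    rcases hk with ⟨rfl, p', k1, k2, k3, k4⟩ | rfl
    · rw [h.comp p p' h1 h2 k1 k2 (h3.trans k3.symm)]
      exact Touch.comp (h.zero p' k1 k2) he k4
    · have := h.pc_le p h1 h2; omega
  have hadj : ∀ p, 1 ≤ p → p ≤ z → X.Touch (or p) e → pc p = k' := by
    intro p h1 h2 h3
    by_contra hp
    have := h.pc_le p h1 h2
    exact hc p h1 h2 (by omega) e he h3 h0
  refine ⟨by omega, by omega, fun p h1 h2 => ?_, fun p h1 h2 => ?_, fun p h1 h2 => ?_,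
    fun p p' h1 h2 h1' h2' => ?_, fun f h1 h2 => ?_, fun p p' h1 h2 h3 => ?_,
    fun p p' h1 h2 h1' h2' => ?_, fun p p' h1 h2 h1' h2' => ?_⟩
  · by_cases hp : p = z + 1
    · simpa [hp] using he
    · rw [Function.update_of_ne hp]; exact h.zero p h1 (hlt p h1 h2 hp)
  · by_cases hp : p = z + 1
    · simpa [hp] using hk1
    · rw [Function.update_of_ne hp]; exact h.pc_pos p h1 (hlt p h1 h2 hp)
  · by_cases hp : p = z + 1
    · simp [hp]
    · rw [Function.update_of_ne hp]; exact (h.pc_le p h1 (hlt p h1 h2 hp)).trans hkk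
  · by_cases hp : p = z + 1 <;> by_cases hp' : p' = z + 1
    · intro _; omega
    · subst hp
      rw [Function.update_self, Function.update_of_ne hp']
      intro hpp; exact absurd hpp.symm (hne p' h1' (hlt p' h1' h2' hp'))
    · subst hp'
      rw [Function.update_self, Function.update_of_ne hp]
      intro hpp; exact absurd hpp (hne p h1 (hlt p h1 h2 hp))
    · rw [Function.update_of_ne hp, Function.update_of_ne hp']
      exact h.inj p p' h1 (hlt p h1 h2 hp) h1' (hlt p' h1' h2' hp')
  · by_cases hf : f = e
    · subst hf
      simp only [Function.update_self, ne_eq, one_ne_zero, not_false_eq_true, true_iff]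
      exact ⟨z + 1, by omega, le_rfl, by simp⟩
    · rw [Function.update_of_ne hf, h.em f h1 h2]
      constructor
      · rintro ⟨p, k1, k2, k3⟩
        exact ⟨p, k1, by omega, by rwa [Function.update_of_ne (by omega)]⟩
      · rintro ⟨p, k1, k2, k3⟩
        by_cases hp : p = z + 1
        · subst hp; rw [Function.update_self] at k3; exact absurd k3.symm hf
        · rw [Function.update_of_ne hp] at k3
          exact ⟨p, k1, by omega, k3⟩
  · by_cases hp' : p' = z + 1
    · subst hp'
      rw [Function.update_self]
      by_cases hp : p = z + 1
      · simp [hp]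
      · rw [Function.update_of_ne hp]; exact (h.pc_le p h1 (hlt p h1 h2 hp)).trans hkk
    · rw [Function.update_of_ne hp', Function.update_of_ne (by omega)]
      exact h.mono p p' h1 h2 (by omega)
  · by_cases hp : p = z + 1 <;> by_cases hp' : p' = z + 1
    · subst hp; subst hp'; intro _; rfl
    · subst hp
      rw [Function.update_self, Function.update_of_ne hp', Function.update_self,
        Function.update_of_ne hp']
      intro hpp; exact (hcomp p' h1' (hlt p' h1' h2' hp') hpp.symm).symm
    · subst hp'
      rw [Function.update_self, Function.update_of_ne hp, Function.update_self,
        Function.update_of_ne hp]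
      exact hcomp p h1 (hlt p h1 h2 hp)
    · rw [Function.update_of_ne hp, Function.update_of_ne hp', Function.update_of_ne hp,
        Function.update_of_ne hp']
      exact h.comp p p' h1 (hlt p h1 h2 hp) h1' (hlt p' h1' h2' hp')
  · by_cases hp : p = z + 1 <;> by_cases hp' : p' = z + 1
    · subst hp; subst hp'; intro _; rfl
    · subst hp
      rw [Function.update_self, Function.update_of_ne hp', Function.update_self,
        Function.update_of_ne hp']
      intro hpp; exact (hadj p' h1' (hlt p' h1' h2' hp') hpp.symm).symm
    · subst hp'
      rw [Function.update_self, Function.update_of_ne hp, Function.update_self,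
        Function.update_of_ne hp]
      exact hadj p h1 (hlt p h1 h2 hp)
    · rw [Function.update_of_ne hp, Function.update_of_ne hp', Function.update_of_ne hp,
        Function.update_of_ne hp']
      exact h.adj p p' h1 (hlt p h1 h2 hp) h1' (hlt p' h1' h2' hp')

theorem Starts.emit_same (h : Starts k z pc sp) :
    Starts k (z + 1) (Function.update pc (z + 1) k) sp := by
  intro i h1 h2
  obtain ⟨k1, k2, k3, k4⟩ := h i h1 h2
  refine ⟨k1, by omega, by rwa [Function.update_of_ne (by omega)], fun p p1 p2 => ?_⟩
  rw [Function.update_of_ne (by omega)]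
  exact k4 p p1 p2

theorem Starts.emit_new (h : Starts k z pc sp) (hz : 0 ≤ z)
    (hpc : ∀ p, 1 ≤ p → p ≤ z → pc p ≤ k) :
    Starts (k + 1) (z + 1) (Function.update pc (z + 1) (k + 1))
      (Function.update sp (k + 1) (z + 1)) := by
  intro i h1 h2
  by_cases hi : i = k + 1
  · subst hi
    simp only [Function.update_self]
    refine ⟨by omega, le_rfl, trivial, fun p p1 p2 => ?_⟩
    rw [Function.update_of_ne (by omega)]
    have := hpc p p1 (by omega)
    omega
  · rw [Function.update_of_ne hi]
    obtain ⟨k1, k2, k3, k4⟩ := h i h1 (by omega)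
    refine ⟨k1, by omega, by rwa [Function.update_of_ne (by omega)], fun p p1 p2 => ?_⟩
    rw [Function.update_of_ne (by omega)]
    exact k4 p p1 p2

/-- Two edges of a component are joined by a walk of edges of weight 0. Once all these edges are
listed, consecutive ones touch, so the label is constant along the walk. -/
theorem Listing.pc_eq_iff (h : X.Listing k z or pc em)
    (hall : ∀ e, X.Zero e → em e ≠ 0) {p p' : ℤ} (h1 : 1 ≤ p) (h2 : p ≤ z)
    (h1' : 1 ≤ p') (h2' : p' ≤ z) : pc p = pc p' ↔ X.comp (or p) = X.comp (or p') := by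
  refine ⟨h.comp p p' h1 h2 h1' h2', fun hc => ?_⟩
  have key : ∀ u v : A ⊕ B, X.G.zeroGraph.Walk u v → ∀ q q', 1 ≤ q → q ≤ z → 1 ≤ q' → q' ≤ z →
      (Sum.inl (X.ed (or q)).1 = u ∨ Sum.inr (X.ed (or q)).2 = u) →
      (Sum.inl (X.ed (or q')).1 = v ∨ Sum.inr (X.ed (or q')).2 = v) → pc q = pc q' := by
    intro u v w
    induction w with
    | @nil u =>
      intro q q' q1 q2 q1' q2' hu hv
      refine h.adj q q' q1 q2 q1' q2' ?_
      rcases hu with rfl | rfl <;> rcases hv with hv | hv <;> simp at hv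
      · exact Or.inl hv.symm
      · exact Or.inr hv.symm
    | @cons u u' v hadj w ih =>
      intro q q' q1 q2 q1' q2' hu hv
      obtain ⟨e, e1, e2, e3⟩ := hadj
      obtain ⟨f, f1, f2, rfl⟩ := X.ed_surj e e1
      obtain ⟨p, p1, p2, rfl⟩ := (h.em f f1 f2).1 (hall f ⟨f1, f2, e2⟩)
      have hp : pc q = pc p := by
        refine h.adj q p q1 q2 p1 p2 ?_
        rcases e3 with ⟨rfl, -⟩ | ⟨rfl, -⟩ <;> rcases hu with hu | hu <;> simp at hu
        · exact Or.inl hu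
        · exact Or.inr hu
      rw [hp]
      refine ih p q' p1 p2 q1' q2' ?_ hv
      rcases e3 with ⟨-, rfl⟩ | ⟨-, rfl⟩
      · exact Or.inr rfl
      · exact Or.inl rfl
  obtain ⟨w⟩ := SimpleGraph.ConnectedComponent.exact hc
  exact key _ _ w p p' h1 h2 h1' h2' (Or.inl rfl) (Or.inl rfl)

end

end Source

end RAM

/-! ### Enumeration of the pieces: listing an edge and its neighbours -/

namespace RAM

set_option linter.unusedSectionVars false

open WGraph

/-- Put the edge `xF` on the next place, with label `xL`. -/
def emit : Cmd :=
  .assign xZ (.plus (.var xZ) (.const 1)) ;;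
  .write aEA (.var xZ) (.read 0 (.minus (.var xF) (.const 1))) ;;
  .write aEB (.var xZ) (.read 1 (.minus (.var xF) (.const 1))) ;;
  .write aOr (.var xZ) (.var xF) ;;
  .write aPc (.var xZ) (.var xL) ;;
  .write aWt (.var xZ) (.const 1) ;;
  .write aEm (.var xF) (.const 1)

/-- Emit the edges in the list of `xA`. -/
def scanList (h n : ℕ) : Cmd :=
  .while (.read h (.var xA)) (
    .assign xF (.read h (.var xA)) ;;
    .write h (.var xA) (.read n (.var xF)) ;;
    .ite (.read aEm (.var xF)) .skip emit)

/-- Emit everything that is connected with the edges at places from `xJ` on. -/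
def closure : Cmd :=
  .while (.less (.var xJ) (.plus (.var xZ) (.const 1))) (
    .assign xA (.read aEA (.var xJ)) ;; scanList aHA aTA ;;
    .assign xA (.read aEB (.var xJ)) ;; scanList aHB aTB ;;
    .assign xJ (.plus (.var xJ) (.const 1)))

/-- Build the lists of the edges of weight `0` at the vertices. -/
def buildAdj : Cmd :=
  forEdges (.ite (.read 2 (.minus (.var xE) (.const 1))) .skip (
    .write aTA (.var xE) (.read aHA (.read 0 (.minus (.var xE) (.const 1)))) ;;
    .write aHA (.read 0 (.minus (.var xE) (.const 1))) (.var xE) ;;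
    .write aTB (.var xE) (.read aHB (.read 1 (.minus (.var xE) (.const 1)))) ;;
    .write aHB (.read 1 (.minus (.var xE) (.const 1))) (.var xE)))

/-- Enumerate the pieces. -/
def listPieces : Cmd :=
  forEdges (.ite (.read 2 (.minus (.var xE) (.const 1))) .skip (
    .ite (.read aEm (.var xE)) .skip (
      .assign xL (.plus (.var xL) (.const 1)) ;;
      .write aSp (.var xL) (.plus (.var xZ) (.const 1)) ;;
      .assign xF (.var xE) ;; emit ;; closure)))

section

variable {A B : Type} [DecidableEq A] [DecidableEq B] {X : Source A B} {N : ℤ} {s : State} {t : ℕ}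
  {k z : ℤ}

namespace Source

variable (X)

/-- The input. -/
structure Input (s : State) : Prop where
  a : ∀ e, 1 ≤ e → e ≤ X.m → s.arr 0 (e - 1) = X.ia (X.ed e).1
  b : ∀ e, 1 ≤ e → e ≤ X.m → s.arr 1 (e - 1) = X.ib (X.ed e).2
  c : ∀ e, 1 ≤ e → e ≤ X.m → s.arr 2 (e - 1) = X.G.c (X.ed e)

/-- The memory during the enumeration of the pieces. -/
structure BState (s : State) (k z : ℤ) : Prop where
  z_eq : s.var xZ = z
  k_eq : s.var xL = k
  listing : X.Listing k z (s.arr aOr) (s.arr aPc) (s.arr aEm)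
  starts : Starts k z (s.arr aPc) (s.arr aSp)
  ea : ∀ p, 1 ≤ p → p ≤ z → s.arr aEA p = X.ia (X.ed (s.arr aOr p)).1
  eb : ∀ p, 1 ≤ p → p ≤ z → s.arr aEB p = X.ib (X.ed (s.arr aOr p)).2
  wt : ∀ p, 1 ≤ p → p ≤ z → s.arr aWt p = 1
  closed : ∀ p, 1 ≤ p → p ≤ z → s.arr aPc p < k → ∀ f, X.Zero f →
    X.Touch (s.arr aOr p) f → s.arr aEm f ≠ 0

/-- The lists contain the edges that are not yet emitted. -/
structure Side (h n : ℤ → ℤ) (em key : ℤ → ℤ) (D : Set ℤ) (R : Finset ℤ) : Prop where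
  lists : Lists D h n key R
  sub : ∀ e ∈ R, X.Zero e
  sup : ∀ e, X.Zero e → em e = 0 → e ∈ R

/-- More edges have been emitted. -/
structure Ext (k z : ℤ) (s : State) (z' : ℤ) (s' : State) : Prop where
  le : z ≤ z'
  or : ∀ p, 1 ≤ p → p ≤ z → s'.arr aOr p = s.arr aOr p
  pc : ∀ p, 1 ≤ p → p ≤ z → s'.arr aPc p = s.arr aPc p
  pc_new : ∀ p, z < p → p ≤ z' → s'.arr aPc p = k
  em : ∀ e, s.arr aEm e ≠ 0 → s'.arr aEm e ≠ 0

variable {X}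

theorem Input.of_frame {s' : State} {p : Cmd} (h : X.Input s) (hf : Frame p s s')
    (h0 : 0 ∉ p.arrs) (h1 : 1 ∉ p.arrs) (h2 : 2 ∉ p.arrs) : X.Input s' :=
  ⟨by rw [hf.2 _ h0]; exact h.a, by rw [hf.2 _ h1]; exact h.b, by rw [hf.2 _ h2]; exact h.c⟩

theorem Ext.refl (k z : ℤ) (s : State) : Ext k z s z s :=
  ⟨le_rfl, fun _ _ _ => rfl, fun _ _ _ => rfl, fun _ _ _ => by omega, fun _ h => h⟩

theorem Ext.trans {z' z'' : ℤ} {s' s'' : State} (hz : 0 ≤ z) (h : Ext k z s z' s')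
    (h' : Ext k z' s' z'' s'') : Ext k z s z'' s'' := by
  have h1 := h.le
  have h2 := h'.le
  refine ⟨by omega, fun p p1 p2 => ?_, fun p p1 p2 => ?_, fun p p1 p2 => ?_,
    fun e he => h'.em e (h.em e he)⟩
  · rw [h'.or p p1 (by omega), h.or p p1 p2]
  · rw [h'.pc p p1 (by omega), h.pc p p1 p2]
  · by_cases hp : p ≤ z'
    · rw [h'.pc p (by omega) hp, h.pc_new p p1 hp]
    · exact h'.pc_new p (by omega) p2

theorem BState.congr {s' : State} (h : X.BState s k z) (hz : s'.var xZ = s.var xZ)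
    (hl : s'.var xL = s.var xL)
    (ha : ∀ a ∈ [aOr, aPc, aEm, aSp, aEA, aEB, aWt], s'.arr a = s.arr a) : X.BState s' k z := by
  have h1 := ha aOr (by decide)
  have h2 := ha aPc (by decide)
  have h3 := ha aEm (by decide)
  have h4 := ha aSp (by decide)
  have h5 := ha aEA (by decide)
  have h6 := ha aEB (by decide)
  have h7 := ha aWt (by decide)
  exact ⟨by rw [hz]; exact h.z_eq, by rw [hl]; exact h.k_eq, by rw [h1, h2, h3]; exact h.listing,
    by rw [h2, h4]; exact h.starts, by rw [h5, h1]; exact h.ea, by rw [h6, h1]; exact h.eb,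
    by rw [h7]; exact h.wt, by rw [h1, h2, h3]; exact h.closed⟩

theorem Ext.congr {z' : ℤ} {s' s'' : State} (h : Ext k z s z' s')
    (ha : ∀ a ∈ [aOr, aPc, aEm], s''.arr a = s'.arr a) : Ext k z s z' s'' :=
  ⟨h.le, by rw [ha aOr (by decide)]; exact h.or, by rw [ha aPc (by decide)]; exact h.pc,
    by rw [ha aPc (by decide)]; exact h.pc_new, by rw [ha aEm (by decide)]; exact h.em⟩

theorem Side.mono {h n em em' key : ℤ → ℤ} {D : Set ℤ} {R : Finset ℤ}
    (hS : X.Side h n em key D R) (he : ∀ e, em e ≠ 0 → em' e ≠ 0) : X.Side h n em' key D R :=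
  ⟨hS.lists, hS.sub, fun e h1 h2 => hS.sup e h1 (by by_contra h3; exact he e h3 h2)⟩

end Source

open Source

theorem emit_spec (hN : X.m ≤ N) (hb : Bdd N s) (hi : X.Input s) {e k' : ℤ}
    (hF : s.var xF = e) (hZ : s.var xZ = z) (hL : s.var xL = k')
    (hl : X.Listing k z (s.arr aOr) (s.arr aPc) (s.arr aEm)) (he : X.Zero e)
    (h0 : s.arr aEm e = 0)
    (hk : (k' = k ∧ ∃ p, 1 ≤ p ∧ p ≤ z ∧ s.arr aPc p = k ∧ X.Touch (s.arr aOr p) e) ∨ k' = k + 1)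
    (hst : Starts k' (z + 1) (Function.update (s.arr aPc) (z + 1) k') (s.arr aSp))
    (hea : ∀ p, 1 ≤ p → p ≤ z → s.arr aEA p = X.ia (X.ed (s.arr aOr p)).1)
    (heb : ∀ p, 1 ≤ p → p ≤ z → s.arr aEB p = X.ib (X.ed (s.arr aOr p)).2)
    (hwt : ∀ p, 1 ≤ p → p ≤ z → s.arr aWt p = 1)
    (hc : ∀ p, 1 ≤ p → p ≤ z → s.arr aPc p < k' → ∀ f, X.Zero f →
      X.Touch (s.arr aOr p) f → s.arr aEm f ≠ 0) :
    wp N emit (fun s' t' => t' = t + 7 ∧ X.BState s' k' (z + 1) ∧ Ext k' z s (z + 1) s' ∧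
      s'.arr aEm e ≠ 0) s t := by
  have h1 := he.1
  have h2 := he.2.1
  have hz := hl.z_nonneg
  have hlt := hl.lt he h0
  simp only [emit, wp_seq, wp_assign, wp_write, Expr.val, Op.val, hF, hZ, hL, ne_eq,
    Function.update_self, Function.update_of_ne, Nat.reduceEqDiff, not_false_eq_true, abs_one,
    hi.a e h1 h2, hi.b e h1 h2]
  have ha : |X.ia (X.ed e).1| ≤ N := by rw [← hi.a e h1 h2]; exact hb.2 _ _
  have hbb : |X.ib (X.ed e).2| ≤ N := by rw [← hi.b e h1 h2]; exact hb.2 _ _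
  refine ⟨by rw [abs_le]; omega, ha, hbb, by rw [abs_le]; omega, by rw [← hL]; exact hb.1 _,
    by omega, by omega, trivial, ⟨by simp, by simpa using hL, ?_, hst, ?_, ?_, ?_, ?_⟩,
    ⟨by omega, ?_, ?_, ?_, ?_⟩, by simp⟩
  · exact hl.emit he h0 hk hc
  · intro p p1 p2
    by_cases hp : p = z + 1
    · subst hp; simp
    · have := hea p p1 (by omega)
      simpa [hp] using this
  · intro p p1 p2
    by_cases hp : p = z + 1
    · subst hp; simp
    · have := heb p p1 (by omega)
      simpa [hp] using this
  · intro p p1 p2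
    by_cases hp : p = z + 1
    · subst hp; simp
    · have := hwt p p1 (by omega)
      simpa [hp] using this
  · intro p p1 p2
    by_cases hp : p = z + 1
    · subst hp; simp
    · simp only [Function.update_of_ne hp, ne_eq, Function.update_self, Function.update_of_ne,
        Nat.reduceEqDiff, not_false_eq_true]
      intro p3 f f1 f2
      by_cases hf : f = e
      · subst hf; simp
      · rw [Function.update_of_ne hf]; exact hc p p1 (by omega) p3 f f1 f2
  · intro p p1 p2
    simp [show p ≠ z + 1 by omega]
  · intro p p1 p2
    simp [show p ≠ z + 1 by omega]
  · intro p p1 p2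
    simp [show p = z + 1 by omega]
  · intro f hf
    by_cases hfe : f = e
    · subst hfe; simp
    · simpa [hfe] using hf

theorem wp_assoc {p q r : Cmd} {Q : State → ℕ → Prop} :
    wp N (p ;; q ;; r) Q s t ↔ wp N (p ;; q) (wp N r Q) s t := by
  rw [wp_seq, wp_seq]
  have : wp N (q ;; r) Q = wp N q (wp N r Q) := by
    funext s t; exact propext wp_seq
  rw [this]

/-- An entry leaves its list even if the edge was listed through its other end. Hence each of the
two lists pays only once per edge, and exhausting the list of a vertex lists all weight-0 edges
there. -/
theorem scanList_spec (hN : X.m + 2 ≤ N) (hm : 0 ≤ X.m) (hb : Bdd N s) (hi : X.Input s)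
    (hB : X.BState s k z)
    {h n : ℕ} (hh : h ∉ emit.arrs ++ [0, 1, 2, aSp]) (hn : n ∉ emit.arrs) (hhn : n ≠ h)
    {D : Set ℤ} {key : ℤ → ℤ} {R : Finset ℤ}
    (hS : X.Side (s.arr h) (s.arr n) (s.arr aEm) key D R) {j p₀ : ℤ} (hj : s.var xA = j)
    (hD : j ∈ D) (hp1 : 1 ≤ p₀) (hp2 : p₀ ≤ z) (hpk : s.arr aPc p₀ = k)
    (hkey : ∀ e, key e = j → X.Touch (s.arr aOr p₀) e) :
    wp N (scanList h n) (fun s' t' => ∃ z' R', X.BState s' k z' ∧ Ext k z s z' s' ∧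
      X.Side (s'.arr h) (s'.arr n) (s'.arr aEm) key D R' ∧
      (∀ e, X.Zero e → key e = j → s'.arr aEm e ≠ 0) ∧
      t' + 15 * R'.card ≤ t + 15 * R.card + 1) s t := by
  simp only [emit, Cmd.arrs, List.mem_append, List.mem_cons, List.not_mem_nil, or_false,
    not_or, List.nil_append, List.singleton_append] at hh hn
  have hz := hB.listing.z_nonneg
  unfold scanList
  refine wp_while hb (t + 15 * R.card) (fun s' t' => ∃ z' R', X.BState s' k z' ∧ Ext k z s z' s' ∧
    X.Side (s'.arr h) (s'.arr n) (s'.arr aEm) key D R' ∧ t' + 15 * R'.card ≤ t + 15 * R.card)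
    ⟨z, R, hB, .refl _ _ _, hS, le_rfl⟩ ?_
  rintro s' t' hb' hf ⟨z', R', hB', hE', hS', ht'⟩
  have hA : s'.var xA = j := by rw [hf.1 xA (by simp [emit, Cmd.vars]), hj]
  have hi' : X.Input s' := hi.of_frame hf (by simp [emit, Cmd.arrs]; omega)
    (by simp [emit, Cmd.arrs]; omega) (by simp [emit, Cmd.arrs]; omega)
  refine ⟨by omega, fun h0 => ?_, fun h0 => ?_⟩
  · simp only [Expr.val, hA] at h0
    obtain ⟨k1, k2, k3⟩ := hS'.lists.pop hD h0
    have he := hS'.sub _ k1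
    set e := s'.arr h j with hedef
    have hcard := Finset.card_erase_add_one k1
    have hzm := hB'.listing.le hm
    have hN1 : |e| ≤ N := hb'.2 _ _
    have hN2 : |s'.arr n e| ≤ N := hb'.2 _ _
    have step : wp N (.assign xF (.read h (.var xA)) ;; .write h (.var xA) (.read n (.var xF)))
        (fun s1 t1 => t1 = t' + 3 ∧ (∀ a, a ≠ h → s1.arr a = s'.arr a) ∧
          s1.arr h = Function.update (s'.arr h) j (s'.arr n e) ∧
          (∀ x, x ≠ xF → s1.var x = s'.var x) ∧ s1.var xF = e) s' (t' + 1) := by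
      simp only [wp_seq, wp_assign, wp_write, Expr.val, hA, ← hedef, Function.update_self,
        Function.update_of_ne (show xA ≠ xF by decide)]
      exact ⟨hN1, hN2, trivial, fun a ha => Function.update_of_ne ha _ _, trivial,
        fun x hx => Function.update_of_ne hx _ _, trivial⟩
    rw [wp_assoc]
    refine wp_conseq hb' step ?_
    rintro s1 t1 hb1 - ⟨rfl, c1, c2, c3, c4⟩
    rw [wp_ite, wp_skip]
    simp only [Expr.val, c4]
    have hB1 : X.BState s1 k z' := hB'.congr (c3 _ (by decide)) (c3 _ (by decide)) fun a ha =>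
      c1 a (by rintro rfl; simp at ha; omega)
    have hE1 : Ext k z s z' s1 := hE'.congr fun a ha => c1 a (by rintro rfl; simp at ha; omega)
    have hl1 : Lists D (s1.arr h) (s1.arr n) key (R'.erase e) := by
      rw [c1 n hhn, c2]; exact k3
    have hi1 : X.Input s1 := ⟨by rw [c1 0 (by omega)]; exact hi'.a,
      by rw [c1 1 (by omega)]; exact hi'.b, by rw [c1 2 (by omega)]; exact hi'.c⟩
    have hsup : ∀ f, X.Zero f → s1.arr aEm f = 0 → f ∈ R' := fun f f1 f2 =>
      hS'.sup f f1 (by rwa [c1 aEm (by omega)] at f2)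
    refine ⟨fun h1 => ?_, fun h1 => ?_⟩
    · refine ⟨z', R'.erase e, hB1, hE1, ⟨hl1, fun f hf => hS'.sub f (Finset.mem_of_mem_erase hf),
        fun f f1 f2 => Finset.mem_erase.2 ⟨?_, hsup f f1 f2⟩⟩, by omega⟩
      rintro rfl; exact h1 f2
    · have hzz := hE'.le
      refine wp_conseq hb1 (emit_spec (X := X) (e := e) (k := k) (k' := k) (z := z') (by omega)
        hb1 hi1 c4 hB1.z_eq hB1.k_eq hB1.listing he h1
        (Or.inl ⟨rfl, p₀, hp1, by omega, ?_, ?_⟩) hB1.starts.emit_same hB1.ea hB1.eb hB1.wt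
        hB1.closed) ?_
      · rw [hE1.pc p₀ hp1 hp2, hpk]
      · rw [hE1.or p₀ hp1 hp2]; exact hkey _ k2
      · rintro s2 t2 hb2' hf2 ⟨ht2, hB2, hE2, hm2⟩
        refine ⟨z' + 1, R'.erase e, hB2, hE1.trans hz hE2,
          ⟨?_, fun f hf => hS'.sub f (Finset.mem_of_mem_erase hf), ?_⟩, by omega⟩
        · rw [hf2.2 h (by simp [emit, Cmd.arrs]; omega), hf2.2 n (by simp [emit, Cmd.arrs]; omega)]
          exact hl1
        · intro f f1 f2
          refine Finset.mem_erase.2 ⟨?_, hsup f f1 ?_⟩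
          · rintro rfl; exact hm2 f2
          · by_contra h3
            exact hE2.em f h3 f2
  · simp only [Expr.val, hA] at h0
    refine ⟨z', R', hB', hE', hS', fun e he hek => ?_, by omega⟩
    intro h3
    exact hS'.lists.ne_of_head hD h0 e (hS'.sup e he h3) hek

end

end RAM

/-! ### Enumeration of the pieces: closure under adjacency -/

namespace RAM

set_option linter.unusedSectionVars false

open WGraph Source

section

variable {A B : Type} [DecidableEq A] [DecidableEq B] {X : Source A B} {N : ℤ} {s : State} {t : ℕ}
  {k z : ℤ}

namespace Source

variable (X) in
/-- The memory with the lists of edges at the vertices. -/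
structure Adj (s : State) (RA RB : Finset ℤ) : Prop where
  left : X.Side (s.arr aHA) (s.arr aTA) (s.arr aEm) (fun e => X.ia (X.ed e).1) (Set.range X.ia) RA
  right : X.Side (s.arr aHB) (s.arr aTB) (s.arr aEm) (fun e => X.ib (X.ed e).2) (Set.range X.ib) RB

end Source

/-- The places themselves serve as a queue: before place j everything has been expanded, and when j
passes the last place the component is closed under touching. The vertex lists and the places pay
for the time. -/
theorem closure_spec (hN : X.m + 2 ≤ N) (hm : 0 ≤ X.m) (hb : Bdd N s) (hi : X.Input s)
    (hB : X.BState s k z) {RA RB : Finset ℤ} (hS : X.Adj s RA RB) {j₀ : ℤ}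
    (hj : s.var xJ = j₀) (hj1 : 1 ≤ j₀) (hj2 : j₀ ≤ z + 1)
    (hpk : ∀ p, j₀ ≤ p → p ≤ z → s.arr aPc p = k)
    (hcl : ∀ p, 1 ≤ p → p < j₀ → ∀ f, X.Zero f → X.Touch (s.arr aOr p) f → s.arr aEm f ≠ 0) :
    wp N closure (fun s' t' => ∃ z' RA' RB', X.BState s' k z' ∧ Ext k z s z' s' ∧
      X.Adj s' RA' RB' ∧ s'.var xJ = z' + 1 ∧
      (∀ p, 1 ≤ p → p ≤ z' → ∀ f, X.Zero f → X.Touch (s'.arr aOr p) f → s'.arr aEm f ≠ 0) ∧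
      (t' : ℤ) + 15 * (RA'.card + RB'.card) + 10 * (X.m + 1 - s'.var xJ) ≤
        t + 15 * (RA.card + RB.card) + 10 * (X.m + 1 - j₀) + 1) s t := by
  have hz := hB.listing.z_nonneg
  unfold closure
  refine wp_while hb (t + 15 * (RA.card + RB.card) + 10 * (X.m + 1 - j₀)).toNat
    (fun s' t' => ∃ z' RA' RB' j, X.BState s' k z' ∧ Ext k z s z' s' ∧
      X.Adj s' RA' RB' ∧ s'.var xJ = j ∧ j₀ ≤ j ∧ j ≤ z' + 1 ∧
      (∀ p, 1 ≤ p → p < j → ∀ f, X.Zero f → X.Touch (s'.arr aOr p) f → s'.arr aEm f ≠ 0) ∧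
      (t' : ℤ) + 15 * (RA'.card + RB'.card) + 10 * (X.m + 1 - j) ≤
        t + 15 * (RA.card + RB.card) + 10 * (X.m + 1 - j₀))
    ⟨z, RA, RB, j₀, hB, .refl _ _ _, hS, hj, le_rfl, hj2, hcl, le_rfl⟩ ?_
  rintro s' t' hb' hf ⟨z', RA', RB', j, hB', hE', hS', hj', h1, h2, hcl', ht'⟩
  have hzm := hB'.listing.le hm
  refine ⟨by omega, fun h0 => ?_, fun h0 => ?_⟩
  · have hjz : j ≤ z' := by
      by_contra hc
      apply h0
      simp only [Expr.val, Op.val, hj', hB'.z_eq]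
      rw [if_neg (by omega)]
    have hi' : X.Input s' := hi.of_frame hf (by decide) (by decide) (by decide)
    have hea := hB'.ea j (by omega) hjz
    have hpk' : s'.arr aPc j = k := by
      by_cases hjz0 : j ≤ z
      · rw [hE'.pc j (by omega) hjz0]; exact hpk j h1 hjz0
      · exact hE'.pc_new j (by omega) hjz
    rw [wp_seq, wp_assign]
    simp only [Expr.val, hj']
    refine ⟨hb'.2 _ _, ?_⟩
    rw [wp_seq]
    have hb1 := hb'.assign (x := xA) (hb'.2 aEA j)
    refine wp_conseq hb1 (scanList_spec (X := X) (k := k) (z := z') (R := RA')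
      (key := fun e => X.ia (X.ed e).1) (D := Set.range X.ia) (j := X.ia (X.ed (s'.arr aOr j)).1)
      (p₀ := j) hN hm hb1 ⟨hi'.a, hi'.b, hi'.c⟩
      ⟨by simpa using hB'.z_eq, by simpa using hB'.k_eq, hB'.listing, hB'.starts, hB'.ea, hB'.eb,
        hB'.wt, hB'.closed⟩ (by decide) (by decide) (by decide) hS'.left (by simp [hea])
      ⟨_, rfl⟩ (by omega) hjz hpk' (fun e he => Or.inl (X.ia_inj he).symm)) ?_
    rintro s1 t1 hb1' hf1 ⟨z1, R1, hB1, hE1, hS1, hc1, ht1⟩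
    have hj1' : s1.var xJ = j := by rw [hf1.1 xJ (by decide)]; simpa using hj'
    have hi1 : X.Input s1 := ⟨by rw [hf1.2 0 (by decide)]; exact hi'.a,
      by rw [hf1.2 1 (by decide)]; exact hi'.b, by rw [hf1.2 2 (by decide)]; exact hi'.c⟩
    have hor1 : s1.arr aOr j = s'.arr aOr j := hE1.or j (by omega) hjz
    have hz1 := hE1.le
    have heb := hB1.eb j (by omega) (by omega)
    have hpk1 : s1.arr aPc j = k := by rw [hE1.pc j (by omega) hjz]; exact hpk'
    have hSB : X.Side (s1.arr aHB) (s1.arr aTB) (s1.arr aEm) (fun e => X.ib (X.ed e).2)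
        (Set.range X.ib) RB' := by
      rw [hf1.2 aHB (by decide), hf1.2 aTB (by decide)]
      exact hS'.right.mono hE1.em
    rw [wp_seq, wp_assign]
    simp only [Expr.val, hj1']
    refine ⟨hb1'.2 _ _, ?_⟩
    rw [wp_seq]
    have hb2 := hb1'.assign (x := xA) (hb1'.2 aEB j)
    refine wp_conseq hb2 (scanList_spec (X := X) (k := k) (z := z1) (R := RB')
      (key := fun e => X.ib (X.ed e).2) (D := Set.range X.ib) (j := X.ib (X.ed (s1.arr aOr j)).2)
      (p₀ := j) hN hm hb2 ⟨hi1.a, hi1.b, hi1.c⟩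
      ⟨by simpa using hB1.z_eq, by simpa using hB1.k_eq, hB1.listing, hB1.starts, hB1.ea, hB1.eb,
        hB1.wt, hB1.closed⟩ (by decide) (by decide) (by decide) hSB (by simp [heb])
      ⟨_, rfl⟩ (by omega) (by omega) hpk1 (fun e he => Or.inr (X.ib_inj he).symm)) ?_
    rintro s2 t2 hb2' hf2 ⟨z2, R2, hB2, hE2, hS2, hc2, ht2⟩
    have hj2' : s2.var xJ = j := by rw [hf2.1 xJ (by decide)]; simpa using hj1'
    have hz2 := hE2.le
    have hzm2 := hB2.listing.le hm
    have hE12 : Ext k z' s' z2 s2 := Ext.trans (s' := s1) (by omega)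
      ⟨hE1.le, hE1.or, hE1.pc, hE1.pc_new, hE1.em⟩
      ⟨hE2.le, hE2.or, hE2.pc, hE2.pc_new, hE2.em⟩
    simp only [wp_assign, Expr.val, Op.val, hj2']
    refine ⟨by rw [abs_le]; omega, z2, R1, R2, j + 1,
      ⟨by simpa using hB2.z_eq, by simpa using hB2.k_eq, hB2.listing, hB2.starts, hB2.ea, hB2.eb,
        hB2.wt, hB2.closed⟩, hE'.trans hz ⟨hE12.le, hE12.or, hE12.pc, hE12.pc_new, hE12.em⟩,
      ⟨?_, hS2⟩, by simp, by omega, by omega, ?_, ?_⟩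
    · change X.Side (s2.arr aHA) (s2.arr aTA) (s2.arr aEm) _ _ _
      rw [hf2.2 aHA (by decide), hf2.2 aTA (by decide)]
      exact hS1.mono hE2.em
    · intro p p1 p2 f f1 f2
      change X.Touch (s2.arr aOr p) f at f2
      by_cases hpj : p = j
      · subst hpj
        rw [hE12.or p p1 hjz] at f2
        rcases f2 with f2 | f2
        · exact hE2.em f (hc1 f f1 (by rw [f2]))
        · refine hc2 f f1 ?_
          rw [hor1, f2]
      · rw [hE12.or p p1 (by omega)] at f2
        exact hE12.em f (hcl' p p1 (by omega) f f1 f2)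
    · push_cast; omega
  · have hjz : j = z' + 1 := by
      by_contra hc
      simp only [Expr.val, Op.val, hj', hB'.z_eq] at h0
      rw [if_pos (by omega)] at h0
      exact one_ne_zero h0
    subst hjz
    exact ⟨z', RA', RB', hB', hE', hS', hj', fun p p1 p2 => hcl' p p1 (by omega),
      by rw [hj']; push_cast; omega⟩

theorem buildAdj_spec (hN : X.m + 2 ≤ N) (hm : 0 ≤ X.m) (hb : Bdd N s) (hi : X.Input s)
    (hlo : s.var xLo = 1) (hhi : s.var xHi = X.m) (h1 : ∀ j, s.arr aHA j = 0)
    (h2 : ∀ j, s.arr aHB j = 0) :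
    wp N buildAdj (fun s' t' => (t' : ℤ) ≤ t + 7 * X.m + 2 ∧ ∃ RA RB, X.Adj s' RA RB ∧
      (RA.card : ℤ) ≤ X.m ∧ (RB.card : ℤ) ≤ X.m) s t := by
  classical
  unfold buildAdj
  set Z : ℤ → Finset ℤ := fun i => (Finset.Icc 1 X.m).filter fun e => X.G.c (X.ed e) = 0 ∧ e < i
    with hZ
  have hZc : ∀ i, ((Z i).card : ℤ) ≤ X.m := fun i => by
    have := Finset.card_filter_le (Finset.Icc 1 X.m) fun e => X.G.c (X.ed e) = 0 ∧ e < i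
    rw [Int.card_Icc] at this
    simp only [hZ]; omega
  refine wp_forEdges (lo := 1) (hi := X.m) hb (t + 7 * X.m + 2).toNat
    (fun i s' t' => (t' : ℤ) ≤ t + 1 + 7 * (i - 1) ∧
      Lists (Set.range X.ia) (s'.arr aHA) (s'.arr aTA) (fun e => X.ia (X.ed e).1) (Z i) ∧
      Lists (Set.range X.ib) (s'.arr aHB) (s'.arr aTB) (fun e => X.ib (X.ed e).2) (Z i))
    hlo hhi (by omega) (by omega) (by omega) (by decide) (by decide) ?_ ?_ ?_ ?_
  · have hZ1 : Z 1 = ∅ := by ext e; simp [hZ]; omega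
    rw [hZ1]
    exact ⟨by push_cast; omega, .empty fun j _ => h1 j, .empty fun j _ => h2 j⟩
  · rintro i s' t' hi1 ⟨h, -⟩; omega
  · rintro i s' t' hi1 hi2 hb' hf he ⟨ht, hA, hB⟩
    have hi' : X.Input s' := hi.of_frame hf (by decide) (by decide) (by decide)
    have hcz := hi'.c i hi1 hi2
    simp only [wp_ite, wp_seq, wp_write, wp_skip, Expr.val, Op.val, he, hcz, ne_eq,
      Function.update_self, Function.update_of_ne, Nat.reduceEqDiff, not_false_eq_true,
      hi'.a i hi1 hi2, hi'.b i hi1 hi2]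
    refine ⟨fun hc => ?_, fun hc => ?_⟩
    · have hZi : Z (i + 1) = Z i := by
        ext e
        simp only [hZ, Finset.mem_filter]
        refine and_congr_right fun _ => and_congr_right fun e1 => ⟨fun e2 => ?_, fun e2 => by omega⟩
        rcases eq_or_ne e i with rfl | hne
        · exact absurd (by exact_mod_cast e1) hc
        · omega
      rw [hZi]
      exact ⟨by push_cast; omega, hA, hB⟩
    · have hZi : Z (i + 1) = insert i (Z i) := by
        ext e
        simp only [hZ, Finset.mem_filter, Finset.mem_insert, Finset.mem_Icc]
        constructor
        · rintro ⟨e1, e2, e3⟩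
          rcases eq_or_ne e i with rfl | hne
          · exact Or.inl rfl
          · exact Or.inr ⟨e1, e2, by omega⟩
        · rintro (rfl | ⟨e1, e2, e3⟩)
          · exact ⟨⟨hi1, hi2⟩, by exact_mod_cast hc, by omega⟩
          · exact ⟨e1, e2, by omega⟩
      have hni : i ∉ Z i := by simp [hZ]
      rw [hZi]
      refine ⟨hb'.2 _ _, by rw [abs_le]; omega, hb'.2 _ _, by rw [abs_le]; omega,
        by push_cast; omega, hA.push hni (by omega), hB.push hni (by omega)⟩
  · rintro s' t' hb' hf ⟨ht, hA, hB⟩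
    refine ⟨by push_cast; omega, Z (X.m + 1), Z (X.m + 1), ⟨⟨hA, ?_, ?_⟩, ⟨hB, ?_, ?_⟩⟩, hZc _,
      hZc _⟩
    all_goals
      simp only [hZ, Finset.mem_filter, Finset.mem_Icc]
    · exact fun e he => ⟨he.1.1, he.1.2, he.2.1⟩
    · exact fun e he _ => ⟨⟨he.1, he.2.1⟩, he.2.2, by have := he.2.1; omega⟩
    · exact fun e he => ⟨he.1.1, he.1.2, he.2.1⟩
    · exact fun e he _ => ⟨⟨he.1, he.2.1⟩, he.2.2, by have := he.2.1; omega⟩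

/-- Between two components all listed edges are closed under touching, so an edge of weight 0 not
yet listed belongs to a new component. The queue pointer never goes back, which makes the total time
linear. -/
theorem listPieces_spec (hN : X.m + 2 ≤ N) (hm : 0 ≤ X.m) (hb : Bdd N s) (hi : X.Input s)
    (hlo : s.var xLo = 1) (hhi : s.var xHi = X.m) {RA RB : Finset ℤ} (hS : X.Adj s RA RB)
    (hRA : (RA.card : ℤ) ≤ X.m) (hRB : (RB.card : ℤ) ≤ X.m)
    (hZ : s.var xZ = 0) (hL : s.var xL = 0) (hJ : s.var xJ = 1) (h0 : ∀ e, s.arr aEm e = 0) :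
    wp N listPieces (fun s' t' => (t' : ℤ) ≤ t + 70 * X.m + 20 ∧ ∃ k z, X.BState s' k z ∧
      ∀ e, X.Zero e → s'.arr aEm e ≠ 0) s t := by
  unfold listPieces
  refine wp_forEdges (lo := 1) (hi := X.m) hb (t + 70 * X.m + 20).toNat
    (fun i s' t' => ∃ k z RA' RB', X.BState s' k z ∧ X.Adj s' RA' RB' ∧ s'.var xJ = z + 1 ∧
      (∀ p, 1 ≤ p → p ≤ z → ∀ f, X.Zero f → X.Touch (s'.arr aOr p) f → s'.arr aEm f ≠ 0) ∧
      (∀ e, X.Zero e → e < i → s'.arr aEm e ≠ 0) ∧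
      (t' : ℤ) + 15 * (RA'.card + RB'.card) + 10 * (X.m + 1 - s'.var xJ) ≤
        t + 40 * X.m + 1 + 20 * (i - 1))
    hlo hhi (by omega) (by omega) (by omega) (by decide) (by decide) ?_ ?_ ?_ ?_
  · refine ⟨0, 0, RA, RB, ⟨by simpa using hZ, by simpa using hL, ⟨le_rfl, le_rfl, fun p _ _ => by
      omega, fun p _ _ => by omega, fun p _ _ => by omega, fun p p' _ _ => by omega,
      fun e _ _ => ?_, fun p p' _ _ _ => by omega, fun p p' _ _ => by omega,
      fun p p' _ _ => by omega⟩, fun i _ _ => by omega, fun p _ _ => by omega,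
      fun p _ _ => by omega, fun p _ _ => by omega, fun p _ _ => by omega⟩,
      ⟨hS.left, hS.right⟩, by simpa using hJ, fun p _ _ => by omega,
      fun e he he1 => by have := he.1; omega, ?_⟩
    · simp only [h0, ne_eq, not_true_eq_false, false_iff]
      rintro ⟨p, p1, p2, -⟩; omega
    · simp [hJ]; omega
  · rintro i s' t' hi1 ⟨k, z, RA', RB', hB', -, hJ', -, -, ht⟩
    have := hB'.listing.le hm
    omega
  · rintro i s' t' hi1 hi2 hb' hf he ⟨k, z, RA', RB', hB', hS', hJ', hcl, hall, ht⟩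
    have hi' : X.Input s' := hi.of_frame hf (by decide) (by decide) (by decide)
    have hcz := hi'.c i hi1 hi2
    have hz := hB'.listing.z_nonneg
    have hk := hB'.listing.k_nonneg
    simp only [wp_ite, wp_skip, Expr.val, Op.val, he, hcz]
    have hskip : (X.G.c (X.ed i) = 0 → s'.arr aEm i ≠ 0) → ∀ e, X.Zero e → e < i + 1 →
        s'.arr aEm e ≠ 0 := by
      intro h e e1 e2
      rcases eq_or_ne e i with rfl | hne
      · exact h e1.2.2
      · exact hall e e1 (by omega)
    have hfin : (∀ e, X.Zero e → e < i + 1 → s'.arr aEm e ≠ 0) → ∀ t'' : ℕ, t'' ≤ t' + 20 →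
        ∃ k z RA' RB', X.BState { s' with var := Function.update s'.var xE (i + 1) } k z ∧
        X.Adj { s' with var := Function.update s'.var xE (i + 1) } RA' RB' ∧
        (Function.update s'.var xE (i + 1)) xJ = z + 1 ∧
        (∀ p, 1 ≤ p → p ≤ z → ∀ f, X.Zero f → X.Touch (s'.arr aOr p) f → s'.arr aEm f ≠ 0) ∧
        (∀ e, X.Zero e → e < i + 1 → s'.arr aEm e ≠ 0) ∧
        (t'' : ℤ) + 15 * (RA'.card + RB'.card) +
          10 * (X.m + 1 - (Function.update s'.var xE (i + 1)) xJ) ≤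
          t + 40 * X.m + 1 + 20 * (i + 1 - 1) := by
      intro h t'' ht''
      refine ⟨k, z, RA', RB', ⟨by simpa using hB'.z_eq, by simpa using hB'.k_eq, hB'.listing,
        hB'.starts, hB'.ea, hB'.eb, hB'.wt, hB'.closed⟩, ⟨hS'.left, hS'.right⟩,
        by simpa using hJ', hcl, h, ?_⟩
      simp only [ne_eq, Nat.reduceEqDiff, not_false_eq_true, Function.update_of_ne]
      omega
    refine ⟨fun hc => hfin (hskip fun h => absurd (by exact_mod_cast h) hc) _ (by omega),
      fun hc => ⟨fun hem => hfin (hskip fun _ => hem) _ (by omega), fun hem => ?_⟩⟩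
    have hzero : X.Zero i := ⟨hi1, hi2, by exact_mod_cast hc⟩
    have hlt := hB'.listing.lt hzero hem
    -- Different labels have different starting places, so the label stays below the bound for the
    -- memory.
    have hkz : k ≤ z := by
      by_contra hc
      obtain ⟨q1, q2, q3, -⟩ := hB'.starts k (by omega) le_rfl
      have hinj : (Finset.Icc 1 k).card ≤ (Finset.Icc 1 z).card := by
        refine Finset.card_le_card_of_injOn (s'.arr aSp) (fun p hp => ?_)
          fun p hp p' hp' hpp => ?_
        · simp only [Finset.coe_Icc, Set.mem_Icc] at hp ⊢
          obtain ⟨w1, w2, -⟩ := hB'.starts p hp.1 hp.2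
          exact ⟨w1, w2⟩
        · simp only [Finset.coe_Icc, Set.mem_Icc] at hp hp'
          obtain ⟨-, -, w3, -⟩ := hB'.starts p hp.1 hp.2
          obtain ⟨-, -, w3', -⟩ := hB'.starts p' hp'.1 hp'.2
          rw [← w3, ← w3', hpp]
      rw [Int.card_Icc, Int.card_Icc] at hinj
      omega
    simp only [wp_seq, wp_assign, wp_write, Expr.val, Op.val, hB'.k_eq, hB'.z_eq, ne_eq,
      Function.update_self, Function.update_of_ne, Nat.reduceEqDiff, not_false_eq_true, he]
    refine ⟨by rw [abs_le]; omega, by rw [abs_le]; omega, by rw [abs_le]; omega, ?_⟩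
    have hb1 := ((hb'.assign (x := xL) (v := k + 1) (by rw [abs_le]; omega)).write (a := aSp)
      (i := k + 1) (v := z + 1) (by rw [abs_le]; omega)).assign (x := xF) (v := i)
      (by rw [abs_le]; omega)
    refine wp_conseq hb1 (emit_spec (X := X) (e := i) (k := k) (k' := k + 1) (z := z) (by omega)
      hb1 ⟨hi'.a, hi'.b, hi'.c⟩ (by simp) (by simpa using hB'.z_eq) (by simp) hB'.listing hzero
      hem (Or.inr rfl) ?_ hB'.ea hB'.eb hB'.wt (fun p p1 p2 _ => hcl p p1 p2)) ?_
    · simpa using hB'.starts.emit_new hz hB'.listing.pc_le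
    rintro s1 t1 hb1' hf1 ⟨ht1, hB1, hE1, hem1⟩
    have hi1' : X.Input s1 := ⟨by rw [hf1.2 0 (by decide)]; exact hi'.a,
      by rw [hf1.2 1 (by decide)]; exact hi'.b, by rw [hf1.2 2 (by decide)]; exact hi'.c⟩
    have hJ1 : s1.var xJ = z + 1 := by rw [hf1.1 xJ (by decide)]; simpa using hJ'
    have hS1 : X.Adj s1 RA' RB' := by
      refine ⟨?_, ?_⟩
      · rw [hf1.2 aHA (by decide), hf1.2 aTA (by decide)]
        exact hS'.left.mono hE1.em
      · rw [hf1.2 aHB (by decide), hf1.2 aTB (by decide)]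
        exact hS'.right.mono hE1.em
    refine wp_conseq hb1' (closure_spec hN hm hb1' hi1' hB1 hS1 hJ1 (by omega) (by omega)
      (fun p p1 p2 => hE1.pc_new p (by omega) p2) ?_) ?_
    · intro p p1 p2 f f1 f2
      rw [hE1.or p p1 (by omega)] at f2
      exact hE1.em f (hcl p p1 (by omega) f f1 f2)
    rintro s2 t2 hb2 hf2 ⟨z2, RA2, RB2, hB2, hE2, hS2, hJ2, hcl2, ht2⟩
    refine ⟨k + 1, z2, RA2, RB2, ⟨by simpa using hB2.z_eq, by simpa using hB2.k_eq, hB2.listing,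
        hB2.starts, hB2.ea, hB2.eb, hB2.wt, hB2.closed⟩, ⟨hS2.left, hS2.right⟩,
        by simpa using hJ2, hcl2, fun e e1 e2 => ?_, ?_⟩
    · rcases eq_or_ne e i with rfl | hne
      · exact hE2.em _ hem1
      · exact hE2.em _ (hE1.em _ (hall e e1 (by omega)))
    · push_cast at ht2 ht1 ⊢
      omega
  · rintro s' t' hb' hf ⟨k, z, RA', RB', hB', hS', hJ', hcl, hall, ht⟩
    have := hB'.listing.le hm
    refine ⟨by push_cast; omega, k, z, hB', fun e he => hall e he ?_⟩
    have := he.2.1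
    omega

end

end RAM

/-! ### The order of all edges -/

namespace RAM

set_option linter.unusedSectionVars false

open WGraph Source

notation "xQ" => (21 : ℕ)
notation "xR" => (22 : ℕ)

/-- Put the edges of weight `1` on the places after the pieces. -/
def listOnes : Cmd :=
  .assign xL (.const 0) ;;
  forEdges (.ite (.read 2 (.minus (.var xE) (.const 1))) (.assign xF (.var xE) ;; emit) .skip)

section

variable {A B : Type} [DecidableEq A] [DecidableEq B] {X : Source A B} {N : ℤ} {s : State} {t : ℕ}
  {k z : ℤ}

namespace Source

variable (X) in
/-- The edges are sorted by pieces, followed by the edges of weight `1`. -/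
structure Order (k z : ℤ) (or pc sp : ℤ → ℤ) : Prop where
  z_nonneg : 0 ≤ z
  z_le : z ≤ X.m
  k_nonneg : 0 ≤ k
  rng : ∀ p, 1 ≤ p → p ≤ X.m → 1 ≤ or p ∧ or p ≤ X.m
  inj : ∀ p p', 1 ≤ p → p ≤ X.m → 1 ≤ p' → p' ≤ X.m → or p = or p' → p = p'
  surj : ∀ e, 1 ≤ e → e ≤ X.m → ∃ p, 1 ≤ p ∧ p ≤ X.m ∧ or p = e
  zero : ∀ p, 1 ≤ p → p ≤ X.m → (X.G.c (X.ed (or p)) = 0 ↔ p ≤ z)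
  pc_iff : ∀ p p', 1 ≤ p → p ≤ z → 1 ≤ p' → p' ≤ z →
    (pc p = pc p' ↔ X.comp (or p) = X.comp (or p'))
  sp_le_iff : ∀ i p, 1 ≤ i → i ≤ k + 1 → 1 ≤ p → p ≤ z → (sp i ≤ p ↔ i ≤ pc p)
  sp_pos : ∀ i, 1 ≤ i → i ≤ k + 1 → 1 ≤ sp i
  sp_lt : ∀ i, 1 ≤ i → i ≤ k → sp i < sp (i + 1)
  sp_one : sp 1 = 1
  sp_last : sp (k + 1) = z + 1

variable (X) in
/-- The edges in the memory while those of weight `1` before `i` have been placed. -/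
structure Placed (s : State) (z z' i : ℤ) : Prop where
  le : z ≤ z'
  rng : ∀ p, 1 ≤ p → p ≤ z' → 1 ≤ s.arr aOr p ∧ s.arr aOr p ≤ X.m
  inj : ∀ p p', 1 ≤ p → p ≤ z' → 1 ≤ p' → p' ≤ z' → s.arr aOr p = s.arr aOr p' → p = p'
  surj : ∀ e, 1 ≤ e → e ≤ X.m → X.G.c (X.ed e) = 0 ∨ e < i → ∃ p, 1 ≤ p ∧ p ≤ z' ∧ s.arr aOr p = e
  src : ∀ p, 1 ≤ p → p ≤ z' → X.G.c (X.ed (s.arr aOr p)) = 0 ∨ s.arr aOr p < i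
  zero : ∀ p, 1 ≤ p → p ≤ z' → (X.G.c (X.ed (s.arr aOr p)) = 0 ↔ p ≤ z)
  ea : ∀ p, 1 ≤ p → p ≤ z' → s.arr aEA p = X.ia (X.ed (s.arr aOr p)).1
  eb : ∀ p, 1 ≤ p → p ≤ z' → s.arr aEB p = X.ib (X.ed (s.arr aOr p)).2
  wt : ∀ p, 1 ≤ p → p ≤ z' → s.arr aWt p = 1

theorem Placed.le_m {z' i : ℤ} (h : X.Placed s z z' i) (hm : 0 ≤ X.m) : z' ≤ X.m := by
  have h1 : (Finset.Icc 1 z').card ≤ (Finset.Icc 1 X.m).card := by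
    refine Finset.card_le_card_of_injOn (s.arr aOr) (fun p hp => ?_) fun p hp p' hp' hpp => ?_
    · simp only [Finset.coe_Icc, Set.mem_Icc] at hp ⊢
      exact h.rng p hp.1 hp.2
    · simp only [Finset.coe_Icc, Set.mem_Icc] at hp hp'
      exact h.inj p p' hp.1 hp.2 hp'.1 hp'.2 hpp
  rw [Int.card_Icc, Int.card_Icc] at h1
  omega

/-- All m edges have been placed, and without repetitions, so exactly m places are used. -/
theorem Placed.eq_m {z' : ℤ} (h : X.Placed s z z' (X.m + 1)) (hm : 0 ≤ X.m) (hz : 0 ≤ z) :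
    z' = X.m := by
  have h0 := h.le
  have h1 := h.le_m hm
  have h2 : (Finset.Icc 1 X.m).card ≤ ((Finset.Icc 1 z').image (s.arr aOr)).card := by
    refine Finset.card_le_card fun e he => ?_
    rw [Finset.mem_Icc] at he
    obtain ⟨p, p1, p2, p3⟩ := h.surj e he.1 he.2 (Or.inr (by omega))
    exact Finset.mem_image.2 ⟨p, Finset.mem_Icc.2 ⟨p1, p2⟩, p3⟩
  have h3 := h2.trans Finset.card_image_le
  rw [Int.card_Icc, Int.card_Icc] at h3
  omega

/-- Labels are monotone in the place, so comparing a place with the start of component i is the same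
as comparing its label with i. The extra start z+1 after the last component is a sentinel. -/
theorem Order.of_listing {or₀ pc₀ em sp or pc : ℤ → ℤ} (h : X.Listing k z or₀ pc₀ em)
    (hm : 0 ≤ X.m) (hall : ∀ e, X.Zero e → em e ≠ 0) (hst : Starts k z pc₀ sp)
    (hor : ∀ p, 1 ≤ p → p ≤ z → or p = or₀ p) (hpc : ∀ p, 1 ≤ p → p ≤ z → pc p = pc₀ p)
    (hlast : sp (k + 1) = z + 1)
    (hrng : ∀ p, 1 ≤ p → p ≤ X.m → 1 ≤ or p ∧ or p ≤ X.m)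
    (hinj : ∀ p p', 1 ≤ p → p ≤ X.m → 1 ≤ p' → p' ≤ X.m → or p = or p' → p = p')
    (hsurj : ∀ e, 1 ≤ e → e ≤ X.m → ∃ p, 1 ≤ p ∧ p ≤ X.m ∧ or p = e)
    (hzero : ∀ p, 1 ≤ p → p ≤ X.m → (X.G.c (X.ed (or p)) = 0 ↔ p ≤ z)) :
    X.Order k z or pc sp := by
  have hz := h.z_nonneg
  have hk := h.k_nonneg
  have hle : ∀ i p, 1 ≤ i → i ≤ k + 1 → 1 ≤ p → p ≤ z → (sp i ≤ p ↔ i ≤ pc p) := by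
    intro i p i1 i2 p1 p2
    rw [hpc p p1 p2]
    by_cases hi : i = k + 1
    · have := h.pc_le p p1 p2
      subst hi; omega
    · obtain ⟨k1, k2, k3, k4⟩ := hst i i1 (by omega)
      constructor
      · intro hp
        rw [← k3]; exact h.mono _ _ k1 hp p2
      · intro hp
        by_contra hc
        have := k4 p p1 (by omega)
        omega
  have hpos : ∀ i, 1 ≤ i → i ≤ k + 1 → 1 ≤ sp i := by
    intro i i1 i2
    by_cases hi : i = k + 1
    · subst hi; omega
    · exact (hst i i1 (by omega)).1
  refine ⟨hz, h.le hm, hk, hrng, hinj, hsurj, hzero, fun p p' p1 p2 p1' p2' => ?_, hle, hpos,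
    fun i i1 i2 => ?_, ?_, hlast⟩
  · rw [hpc p p1 p2, hpc p' p1' p2', hor p p1 p2, hor p' p1' p2']
    exact h.pc_eq_iff hall p1 p2 p1' p2'
  · obtain ⟨k1, k2, k3, k4⟩ := hst i i1 i2
    by_contra hc
    have := (hle (i + 1) (sp i) (by omega) (by omega) k1 k2).1 (by omega)
    rw [hpc _ k1 k2] at this
    omega
  · have h1 := hpos 1 le_rfl (by omega)
    by_cases hz1 : 1 ≤ z
    · have h2 := h.pc_pos 1 le_rfl hz1
      rw [← hpc 1 le_rfl hz1] at h2
      have := (hle 1 1 le_rfl (by omega) le_rfl hz1).2 h2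
      omega
    · rcases eq_or_ne k 0 with rfl | hk0
      · rw [zero_add] at hlast; omega
      · have := hst 1 le_rfl (by omega)
        omega

end Source

/-- Edges of weight 1 get the label 0, which never matters because labels are compared only for
weight 0. The weight cells of all places contain 1 at this time. -/
theorem listOnes_spec (hN : X.m + 2 ≤ N) (hm : 0 ≤ X.m) (hb : Bdd N s) (hi : X.Input s)
    (hB : X.BState s k z) (hall : ∀ e, X.Zero e → s.arr aEm e ≠ 0)
    (hlo : s.var xLo = 1) (hhi : s.var xHi = X.m) :
    wp N listOnes (fun s' t' => (t' : ℤ) ≤ t + 12 * X.m + 10 ∧ X.Placed s' z X.m (X.m + 1) ∧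
      ∀ p, 1 ≤ p → p ≤ z → s'.arr aOr p = s.arr aOr p ∧ s'.arr aPc p = s.arr aPc p) s t := by
  have hz := hB.listing.z_nonneg
  unfold listOnes
  rw [wp_seq, wp_assign]
  simp only [Expr.val]
  refine ⟨by rw [abs_zero]; omega, ?_⟩
  refine wp_forEdges (lo := 1) (hi := X.m) (hb.assign (by rw [abs_zero]; omega))
    (t + 12 * X.m + 10).toNat
    (fun i s' t' => (t' : ℤ) ≤ t + 2 + 12 * (i - 1) ∧ ∃ z', s'.var xZ = z' ∧ s'.var xL = 0 ∧
      X.Placed s' z z' i ∧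
      ∀ p, 1 ≤ p → p ≤ z → s'.arr aOr p = s.arr aOr p ∧ s'.arr aPc p = s.arr aPc p)
    (by simpa using hlo) (by simpa using hhi) (by omega) (by omega) (by omega) (by decide)
    (by decide) ?_ ?_ ?_ ?_
  · have hl := hB.listing
    refine ⟨by push_cast; omega, z, by simpa using hB.z_eq, by simp, ⟨le_rfl, fun p p1 p2 =>
      ⟨(hl.zero p p1 p2).1, (hl.zero p p1 p2).2.1⟩, hl.inj, fun e e1 e2 e3 => ?_,
      fun p p1 p2 => Or.inl (hl.zero p p1 p2).2.2, fun p p1 p2 => ?_, hB.ea, hB.eb, hB.wt⟩,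
      fun p _ _ => ⟨rfl, rfl⟩⟩
    · exact (hl.em e e1 e2).1 (hall e ⟨e1, e2, e3.resolve_right (by omega)⟩)
    · exact ⟨fun _ => p2, fun _ => (hl.zero p p1 p2).2.2⟩
  · rintro i s' t' hi1 ⟨h, -⟩; omega
  · rintro i s' t' hi1 hi2 hb' hf he ⟨ht, z', hZ, hL, hP, hag⟩
    have hi' : X.Input s' := ⟨by rw [hf.2 0 (by decide)]; exact hi.a,
      by rw [hf.2 1 (by decide)]; exact hi.b, by rw [hf.2 2 (by decide)]; exact hi.c⟩
    have hle := hP.le_m hm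
    have hzz := hP.le
    have hA : |X.ia (X.ed i).1| ≤ N := by rw [← hi'.a i hi1 hi2]; exact hb'.2 _ _
    have hBB : |X.ib (X.ed i).2| ≤ N := by rw [← hi'.b i hi1 hi2]; exact hb'.2 _ _
    simp only [wp_ite, wp_skip, emit, wp_seq, wp_assign, wp_write, Expr.val, Op.val, he, hZ, hL,
      ne_eq, Function.update_self, Function.update_of_ne, Nat.reduceEqDiff, not_false_eq_true,
      hi'.a i hi1 hi2, hi'.b i hi1 hi2, hi'.c i hi1 hi2, abs_one, abs_zero]
    refine ⟨fun hc => ?_, fun hc => ?_⟩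
    · have hc' : X.G.c (X.ed i) ≠ 0 := by exact_mod_cast hc
      refine ⟨by rw [abs_le]; omega, by rw [abs_le]; omega, hA, hBB, by rw [abs_le]; omega,
        by omega, by omega, by omega, by push_cast; omega, z' + 1, rfl, trivial,
        ⟨by omega, ?_, ?_, ?_, ?_, ?_, ?_, ?_, ?_⟩, ?_⟩
      all_goals
        try simp only [ne_eq, Function.update_self, Function.update_of_ne, Nat.reduceEqDiff,
          not_false_eq_true]
      · intro p p1 p2
        by_cases hp : p = z' + 1
        · subst hp; simpa using ⟨hi1, hi2⟩
        · rw [Function.update_of_ne hp]; exact hP.rng p p1 (by omega)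
      · have hne : ∀ p, 1 ≤ p → p ≤ z' → s'.arr aOr p ≠ i := by
          intro p p1 p2 h
          rcases hP.src p p1 p2 with h1 | h1
          · rw [h] at h1; exact hc' h1
          · omega
        intro p p' p1 p2 p1' p2'
        by_cases hp : p = z' + 1 <;> by_cases hp' : p' = z' + 1
        · intro _; omega
        · subst hp
          rw [Function.update_self, Function.update_of_ne hp']
          intro h; exact absurd h.symm (hne p' p1' (by omega))
        · subst hp'
          rw [Function.update_self, Function.update_of_ne hp]
          intro h; exact absurd h (hne p p1 (by omega))
        · rw [Function.update_of_ne hp, Function.update_of_ne hp']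
          exact hP.inj p p' p1 (by omega) p1' (by omega)
      · intro e e1 e2 e3
        by_cases hei : e = i
        · exact ⟨z' + 1, by omega, le_rfl, by simp [hei]⟩
        · obtain ⟨p, p1, p2, p3⟩ := hP.surj e e1 e2 (e3.imp id (by omega))
          exact ⟨p, p1, by omega, by rwa [Function.update_of_ne (by omega)]⟩
      · intro p p1 p2
        by_cases hp : p = z' + 1
        · subst hp; right; simp
        · rw [Function.update_of_ne hp]
          exact (hP.src p p1 (by omega)).imp id (by omega)
      · intro p p1 p2
        by_cases hp : p = z' + 1
        · subst hp; simp [hc']; omega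
        · rw [Function.update_of_ne hp]
          exact hP.zero p p1 (by omega)
      · intro p p1 p2
        by_cases hp : p = z' + 1
        · subst hp; simp
        · rw [Function.update_of_ne hp, Function.update_of_ne hp]
          exact hP.ea p p1 (by omega)
      · intro p p1 p2
        by_cases hp : p = z' + 1
        · subst hp; simp
        · rw [Function.update_of_ne hp, Function.update_of_ne hp]
          exact hP.eb p p1 (by omega)
      · intro p p1 p2
        by_cases hp : p = z' + 1
        · subst hp; simp
        · rw [Function.update_of_ne hp]
          exact hP.wt p p1 (by omega)
      · intro p p1 p2
        rw [Function.update_of_ne (by omega), Function.update_of_ne (by omega)]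
        exact hag p p1 p2
    · have hc' : X.G.c (X.ed i) = 0 := by exact_mod_cast hc
      refine ⟨by push_cast; omega, z', rfl, trivial, ⟨hzz, hP.rng, hP.inj,
        fun e e1 e2 e3 => hP.surj e e1 e2 ?_, fun p p1 p2 =>
          (hP.src p p1 p2).imp id fun h => h.trans (lt_add_one i),
        hP.zero, hP.ea, hP.eb, hP.wt⟩, hag⟩
      by_cases hei : e = i
      · exact Or.inl (hei ▸ hc')
      · exact e3.imp id (by omega)
  · rintro s' t' hb' hf ⟨ht, z', hZ, hL, hP, hag⟩
    obtain rfl := hP.eq_m hm hz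
    exact ⟨by push_cast; omega, hP, hag⟩

end

end RAM

namespace RAM

set_option linter.unusedSectionVars false

open WGraph Source

/-! ## Solving the pieces -/

/-- Set the dual weights to `0`. -/
def zeroDuals : Cmd :=
  forEdges (.write aYA (.read aEA (.var xE)) (.const 0) ;;
    .write aYB (.read aEB (.var xE)) (.const 0))

/-- Find maximum matchings of the pieces. -/
def solvePieces : Cmd :=
  .assign xQ (.const 1) ;;
  .while (.less (.var xQ) (.plus (.var xP) (.const 1))) (
    .assign xLo (.read aSp (.var xQ)) ;;
    .assign xHi (.minus (.read aSp (.plus (.var xQ) (.const 1))) (.const 1)) ;;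
    zeroDuals ;; solve ;; .assign xQ (.plus (.var xQ) (.const 1)))

section

variable {A B : Type} [DecidableEq A] [DecidableEq B] {N : ℤ} {s : State} {t : ℕ}
  {M : Finset (A × B)}

theorem zeroDuals_spec {X : Layout A B} (hN : 2 * X.hi + 10 ≤ N) (hb : Bdd N s) (hs : X.Static s) :
    wp N zeroDuals (fun s' t' => (t' : ℤ) ≤ t + 4 * (X.hi + 1 - X.lo) + 2 ∧
      X.Duals (fun _ => 0) (s'.arr aYA) (s'.arr aYB)) s t := by
  have hl := X.one_le
  have hle := X.lo_le
  refine wp_forEdges hb (t + 4 * (X.hi + 1 - X.lo) + 2).toNat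
    (fun i s' t' => (t' : ℤ) ≤ t + 1 + 4 * (i - X.lo) ∧ ∀ e, X.lo ≤ e → e < i →
      s'.arr aYA (X.ia (X.ed e).1) = 0 ∧ s'.arr aYB (X.ib (X.ed e).2) = 0)
    hs.lo hs.hi (by omega) (by omega) (by omega) (by decide) (by decide) ?_ ?_ ?_ ?_
  · exact ⟨by push_cast; omega, fun e _ _ => by omega⟩
  · rintro i s' t' hi1 ⟨h, -⟩; omega
  · rintro i s' t' hi1 hi2 hb' hf he ⟨ht, h⟩
    have hs' : X.Static s' := hs.of_frame hf (by decide) (by decide) (by decide) (by decide)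
      (by decide) (by decide)
    simp only [wp_seq, wp_write, Expr.val, he, hs'.ea i hi1 hi2, hs'.eb i hi1 hi2, abs_zero,
      ne_eq, Function.update_self, Function.update_of_ne, Nat.reduceEqDiff, not_false_eq_true]
    refine ⟨by omega, by omega, by push_cast; omega, fun e e1 e2 => ?_⟩
    rcases eq_or_ne e i with rfl | hne
    · simp
    · obtain ⟨k1, k2⟩ := h e e1 (by omega)
      simp only [Function.update_apply]
      exact ⟨by split_ifs <;> [rfl; exact k1], by split_ifs <;> [rfl; exact k2]⟩
  · rintro s' t' hb' hf ⟨ht, h⟩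
    refine ⟨by push_cast; omega, ?_, ?_⟩
    · rintro a ⟨e, e1, e2, rfl⟩
      exact (h e e1 (by omega)).1
    · rintro b ⟨e, e1, e2, rfl⟩
      exact (h e e1 (by omega)).2

namespace Source

variable {X : Source A B} {k z : ℤ} {or pc sp : ℤ → ℤ}

variable (X) in
/-- The subgraph formed by the edges at the places from `lo` to `hi`, with unit weights. -/
noncomputable def sub (or : ℤ → ℤ) (lo hi : ℤ) : WGraph A B where
  E := (Finset.Icc lo hi).image fun p => X.ed (or p)
  c _ := 1
  c_zero_or_one _ _ := Or.inr rfl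

theorem mem_sub {lo hi : ℤ} {x : A × B} :
    x ∈ (X.sub or lo hi).E ↔ ∃ p, lo ≤ p ∧ p ≤ hi ∧ X.ed (or p) = x := by
  simp [sub, and_assoc]

/-- The places from `lo` to `hi`, with unit weights, as a layout. -/
noncomputable def Order.subLayout (h : X.Order k z or pc sp) (oa ob : ℤ → ℤ) (lo hi : ℤ) (h1 : 1 ≤ lo)
    (h2 : lo ≤ hi) (h3 : hi ≤ X.m) : Layout A B where
  G := X.sub or lo hi
  ia := X.ia
  ib := X.ib
  ed p := X.ed (or p)
  lo := lo
  hi := hi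
  w _ := 1
  pc := pc
  oa := oa
  ob := ob
  ia_inj := X.ia_inj
  ib_inj := X.ib_inj
  one_le := h1
  lo_le := h2
  ed_inj e f e1 e2 f1 f2 hef := by
    obtain ⟨k1, k2⟩ := h.rng e (by omega) (by omega)
    obtain ⟨k3, k4⟩ := h.rng f (by omega) (by omega)
    exact h.inj e f (by omega) (by omega) (by omega) (by omega) (X.ed_inj _ _ k1 k2 k3 k4 hef)
  ed_mem e e1 e2 := mem_sub.2 ⟨e, e1, e2, rfl⟩
  ed_surj x hx := mem_sub.1 hx
  weight _ _ _ := rfl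
  piece _ _ _ _ _ _ hw := absurd hw one_ne_zero

/-- All places, as a layout. -/
def Order.layout (h : X.Order k z or pc sp) (oa ob : ℤ → ℤ) (hm : 1 ≤ X.m) : Layout A B where
  G := X.G
  ia := X.ia
  ib := X.ib
  ed p := X.ed (or p)
  lo := 1
  hi := X.m
  w p := if p ≤ z then 0 else 1
  pc := pc
  oa := oa
  ob := ob
  ia_inj := X.ia_inj
  ib_inj := X.ib_inj
  one_le := le_rfl
  lo_le := hm
  ed_inj e f e1 e2 f1 f2 hef := by
    obtain ⟨k1, k2⟩ := h.rng e e1 e2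
    obtain ⟨k3, k4⟩ := h.rng f f1 f2
    exact h.inj e f e1 e2 f1 f2 (X.ed_inj _ _ k1 k2 k3 k4 hef)
  ed_mem e e1 e2 := X.ed_mem _ (h.rng e e1 e2).1 (h.rng e e1 e2).2
  ed_surj x hx := by
    obtain ⟨e, e1, e2, rfl⟩ := X.ed_surj x hx
    obtain ⟨p, p1, p2, rfl⟩ := h.surj e e1 e2
    exact ⟨p, p1, p2, rfl⟩
  weight e e1 e2 := by
    have h1 := h.zero e e1 e2
    have h2 := X.G.c_zero_or_one _ (X.ed_mem _ (h.rng e e1 e2).1 (h.rng e e1 e2).2)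
    split_ifs with hz
    · rw [h1.2 hz]; rfl
    · rw [h2.resolve_left fun h0 => hz (h1.1 h0)]; rfl
  piece e f e1 e2 f1 f2 he hf := by
    have he' : e ≤ z := by by_contra hc; rw [if_neg hc] at he; exact one_ne_zero he
    have hf' : f ≤ z := by by_contra hc; rw [if_neg hc] at hf; exact one_ne_zero hf
    exact h.pc_iff e f e1 he' f1 hf'

theorem mem_pieceEdges_iff {x : A × B} {K : X.G.zeroGraph.ConnectedComponent} :
    x ∈ X.G.pieceEdges K ↔ ∃ e, X.Zero e ∧ X.ed e = x ∧ X.comp e = K := by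
  classical
  simp only [pieceEdges, Finset.mem_filter]
  constructor
  · rintro ⟨h1, h2, h3⟩
    obtain ⟨e, e1, e2, rfl⟩ := X.ed_surj x h1
    exact ⟨e, ⟨e1, e2, h2⟩, rfl, h3⟩
  · rintro ⟨e, ⟨e1, e2, h2⟩, rfl, h3⟩
    exact ⟨X.ed_mem e e1 e2, h2, h3⟩

theorem Order.zero_place (h : X.Order k z or pc sp) {p : ℤ} (p1 : 1 ≤ p) (p2 : p ≤ z) :
    X.Zero (or p) := by
  have := h.z_le
  obtain ⟨k1, k2⟩ := h.rng p p1 (by omega)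
  exact ⟨k1, k2, (h.zero p p1 (by omega)).2 p2⟩

theorem Order.exists_place (h : X.Order k z or pc sp) {e : ℤ} (he : X.Zero e) :
    ∃ p, 1 ≤ p ∧ p ≤ z ∧ or p = e := by
  obtain ⟨p, p1, p2, rfl⟩ := h.surj e he.1 he.2.1
  exact ⟨p, p1, (h.zero p p1 p2).1 he.2.2, rfl⟩

theorem Order.sp_le (h : X.Order k z or pc sp) {i : ℤ} (h1 : 1 ≤ i) (h2 : i ≤ k + 1) :
    sp i ≤ z + 1 := by
  rw [← h.sp_last]
  obtain ⟨n, hn⟩ := Int.eq_ofNat_of_zero_le (show 0 ≤ k + 1 - i by omega)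
  induction n generalizing i with
  | zero => rw [show i = k + 1 by omega]
  | succ n ih =>
    have := h.sp_lt i h1 (by omega)
    have := ih (i := i + 1) (by omega) (by omega) (by omega)
    omega

/-- Places between two consecutive starts form a piece. -/
theorem Order.comp_iff (h : X.Order k z or pc sp) {i p q : ℤ} (i1 : 1 ≤ i) (i2 : i ≤ k)
    (p1 : sp i ≤ p) (p2 : p < sp (i + 1)) (q1 : 1 ≤ q) (q2 : q ≤ z) :
    X.comp (or p) = X.comp (or q) ↔ sp i ≤ q ∧ q < sp (i + 1) := by
  have h1 := h.sp_pos i i1 (by omega)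
  have h2 := h.sp_le (i := i + 1) (by omega) (by omega)
  rw [← h.pc_iff p q (by omega) (by omega) q1 q2]
  have a1 := h.sp_le_iff i p i1 (by omega) (by omega) (by omega)
  have a2 := h.sp_le_iff (i + 1) p (by omega) (by omega) (by omega) (by omega)
  have a3 := h.sp_le_iff i q i1 (by omega) q1 q2
  have a4 := h.sp_le_iff (i + 1) q (by omega) (by omega) q1 q2
  omega

variable (X) in
/-- The state of the preprocessing: `M` is a union of maximum matchings of the pieces at places
before `l`. -/
structure Partial (or : ℤ → ℤ) (l : ℤ) (M : Finset (A × B)) : Prop where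
  matching : X.G.IsMatching M
  place : ∀ x ∈ M, ∃ p, 1 ≤ p ∧ p < l ∧ X.ed (or p) = x
  max : ∀ p, 1 ≤ p → p < l → ∀ N, X.G.IsMatching N → N ⊆ X.G.pieceEdges (X.comp (or p)) →
    N.card ≤ (M ∩ X.G.pieceEdges (X.comp (or p))).card

theorem Partial.isPreprocessed (h : X.Order k z or pc sp) (hM : X.Partial or (z + 1) M) :
    X.G.IsPreprocessed M := by
  refine ⟨hM.matching, fun x hx => ?_, fun K N hN hK => ?_⟩
  · obtain ⟨p, p1, p2, rfl⟩ := hM.place x hx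
    exact (h.zero_place p1 (by omega)).2.2
  · rcases N.eq_empty_or_nonempty with rfl | ⟨x, hx⟩
    · simp
    · obtain ⟨e, e1, -, rfl⟩ := mem_pieceEdges_iff.1 (hK hx)
      obtain ⟨p, p1, p2, rfl⟩ := h.exists_place e1
      exact hM.max p p1 (by omega) N hN hK

variable {i : ℤ} {M' : Finset (A × B)} {ma mb ma' mb' : ℤ → ℤ}

/-- An edge at an earlier place that touched this one would belong to the same component, but
components occupy disjoint intervals of places. -/
theorem Partial.disjoint (h : X.Order k z or pc sp) (i1 : 1 ≤ i) (i2 : i ≤ k)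
    (hM : X.Partial or (sp i) M) {x : A × B} (hx : x ∈ M) {p : ℤ} (p1 : sp i ≤ p)
    (p2 : p < sp (i + 1)) : x.1 ≠ (X.ed (or p)).1 ∧ x.2 ≠ (X.ed (or p)).2 := by
  have h1 := h.sp_pos i i1 (by omega)
  have h2 := h.sp_le (i := i + 1) (by omega) (by omega)
  obtain ⟨q, q1, q2, rfl⟩ := hM.place x hx
  have key : ¬ X.Touch (or p) (or q) := by
    intro hT
    have hc := hT.comp (h.zero_place (by omega) (by omega)) (h.zero_place q1 (by omega))
    have := (h.comp_iff i1 i2 p1 p2 q1 (by omega)).1 hc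
    omega
  exact ⟨fun hh => key (Or.inl hh.symm), fun hh => key (Or.inr hh.symm)⟩

/-- The places of one interval are exactly the edges of one piece, so a maximum matching of the
subgraph is one of the piece; the pieces have no common vertices, so the union is a matching. -/
theorem Partial.union (h : X.Order k z or pc sp) (i1 : 1 ≤ i) (i2 : i ≤ k)
    (hM : X.Partial or (sp i) M)
    (hM' : (X.sub or (sp i) (sp (i + 1) - 1)).IsMaximumMatching M') :
    X.Partial or (sp (i + 1)) (M ∪ M') := by
  have h1 := h.sp_pos i i1 (by omega)
  have h2 := h.sp_le (i := i + 1) (by omega) (by omega)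
  have h3 := h.sp_lt i i1 i2
  have hp : ∀ x ∈ M', ∃ p, sp i ≤ p ∧ p < sp (i + 1) ∧ X.ed (or p) = x := fun x hx => by
    obtain ⟨p, p1, p2, p3⟩ := mem_sub.1 (hM'.1.1 hx)
    exact ⟨p, p1, by omega, p3⟩
  refine ⟨⟨Finset.union_subset hM.matching.1 fun x hx => ?_, ?_⟩, fun x hx => ?_,
    fun p p1 p2 L hL hLK => ?_⟩
  · obtain ⟨p, p1, p2, rfl⟩ := hp x hx
    have := h.zero_place (p := p) (by omega) (by omega)
    exact X.ed_mem _ this.1 this.2.1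
  · intro e he f hf hef
    rw [Finset.mem_union] at he hf
    rcases he with he | he <;> rcases hf with hf | hf
    · exact hM.matching.2 e he f hf hef
    · obtain ⟨p, p1, p2, rfl⟩ := hp f hf
      have := hM.disjoint h i1 i2 he p1 p2
      tauto
    · obtain ⟨p, p1, p2, rfl⟩ := hp e he
      have := hM.disjoint h i1 i2 hf p1 p2
      rcases hef with hef | hef
      · exact absurd hef.symm this.1
      · exact absurd hef.symm this.2
    · exact hM'.1.2 e he f hf hef
  · rcases Finset.mem_union.1 hx with hx | hx
    · obtain ⟨p, p1, p2, p3⟩ := hM.place x hx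
      exact ⟨p, p1, by omega, p3⟩
    · obtain ⟨p, p1, p2, p3⟩ := hp x hx
      exact ⟨p, by omega, p2, p3⟩
  · by_cases hpi : p < sp i
    · exact (hM.max p p1 hpi L hL hLK).trans (Finset.card_le_card
        (Finset.inter_subset_inter_right Finset.subset_union_left))
    · have hLE : L ⊆ (X.sub or (sp i) (sp (i + 1) - 1)).E := by
        intro x hx
        obtain ⟨e, e1, e2, e3⟩ := mem_pieceEdges_iff.1 (hLK hx)
        obtain ⟨q, q1, q2, rfl⟩ := h.exists_place e1
        obtain ⟨w1, w2⟩ := (h.comp_iff i1 i2 (by omega) p2 q1 q2).1 e3.symm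
        exact mem_sub.2 ⟨q, w1, by omega, e2⟩
      refine (hM'.2 L ⟨hLE, hL.2⟩).trans (Finset.card_le_card fun x hx => ?_)
      obtain ⟨q, q1, q2, rfl⟩ := hp x hx
      refine Finset.mem_inter.2 ⟨Finset.mem_union_right _ hx, mem_pieceEdges_iff.2
        ⟨or q, h.zero_place (by omega) (by omega), rfl, ?_⟩⟩
      exact ((h.comp_iff i1 i2 (by omega) p2 (by omega) (by omega)).2 ⟨q1, q2⟩).symm

/-- The vertices of the piece are still free, so the current arrays represent the empty matching on
it. Their contents elsewhere are recorded as the outside part of the layout. -/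
theorem Partial.mates_sub (h : X.Order k z or pc sp) (i1 : 1 ≤ i) (i2 : i ≤ k)
    (hM : X.Partial or (sp i) M) {oa ob : ℤ → ℤ} (hm : 1 ≤ X.m)
    (hma : (h.layout oa ob hm).Mates M ma mb) {h1 h2 h3} :
    (h.subLayout ma mb (sp i) (sp (i + 1) - 1) h1 h2 h3).Mates ∅ ma mb := by
  have hfree : ∀ {p}, sp i ≤ p → p ≤ sp (i + 1) - 1 → FreeA M (X.ed (or p)).1 ∧
      FreeB M (X.ed (or p)).2 := fun {p} p1 p2 =>
    ⟨fun x hx => (hM.disjoint h i1 i2 hx p1 (by omega)).1,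
      fun x hx => (hM.disjoint h i1 i2 hx p1 (by omega)).2⟩
  refine ⟨?_, ?_, fun _ _ => rfl, fun _ _ => rfl⟩
  · rintro a ⟨p, p1, p2, rfl⟩
    refine Or.inl ⟨fun x hx => absurd hx (Finset.notMem_empty x), ?_⟩
    rcases hma.left (X.ed (or p)).1 ⟨p, h1.trans p1, p2.trans h3, rfl⟩ with h4 | ⟨g, -, -, g3, g4, -⟩
    · exact h4.2
    · exact absurd g4 ((hfree p1 p2).1 _ g3)
  · rintro b ⟨p, p1, p2, rfl⟩
    refine iff_of_true (fun x hx => absurd hx (Finset.notMem_empty x)) ?_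
    exact (hma.right (X.ed (or p)).2 ⟨p, h1.trans p1, p2.trans h3, rfl⟩).1 (hfree p1 p2).2

/-- Since the outside part is preserved while the piece is solved, the earlier mates survive and the
two matchings can be read off from the same arrays. -/
theorem Partial.mates_union (h : X.Order k z or pc sp) (i1 : 1 ≤ i) (i2 : i ≤ k)
    (hM : X.Partial or (sp i) M) {oa ob : ℤ → ℤ} (hm : 1 ≤ X.m)
    (hma : (h.layout oa ob hm).Mates M ma mb) {h1 h2 h3}
    (hM' : M' ⊆ (X.sub or (sp i) (sp (i + 1) - 1)).E)
    (hma' : (h.subLayout ma mb (sp i) (sp (i + 1) - 1) h1 h2 h3).Mates M' ma' mb') :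
    (h.layout oa ob hm).Mates (M ∪ M') ma' mb' := by
  set H := h.subLayout ma mb (sp i) (sp (i + 1) - 1) h1 h2 h3 with hH
  have hsubA : ∀ a, H.IA a → (h.layout oa ob hm).IA a := fun a ⟨p, p1, p2, p3⟩ =>
    ⟨p, h1.trans p1, p2.trans h3, p3⟩
  have hsubB : ∀ b, H.IB b → (h.layout oa ob hm).IB b := fun a ⟨p, p1, p2, p3⟩ =>
    ⟨p, h1.trans p1, p2.trans h3, p3⟩
  refine ⟨fun a ha => ?_, fun b hb => ?_, fun j hj => ?_, fun j hj => ?_⟩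
  · by_cases hHa : H.IA a
    · rcases hma'.left a hHa with ⟨k1, k2⟩ | ⟨g, g1, g2, g3, g4, g5⟩
      · refine Or.inl ⟨fun x hx => ?_, k2⟩
        rcases Finset.mem_union.1 hx with hx | hx
        · obtain ⟨p, p1, p2, rfl⟩ := hHa
          exact (hM.disjoint h i1 i2 hx p1 (Int.lt_of_le_sub_one p2)).1
        · exact k1 x hx
      · exact Or.inr ⟨g, h1.trans g1, g2.trans h3, Finset.mem_union_right _ g3, g4, g5⟩
    · have hout : ma' (X.ia a) = ma (X.ia a) := hma'.left_out _ fun a' ha' hc => by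
        rw [X.ia_inj hc] at ha'; exact hHa ha'
      rcases hma.left a ha with ⟨k1, k2⟩ | ⟨g, g1, g2, g3, g4, g5⟩
      · refine Or.inl ⟨fun x hx => ?_, hout.trans k2⟩
        rcases Finset.mem_union.1 hx with hx | hx
        · exact k1 x hx
        · rintro rfl
          obtain ⟨p, p1, p2, rfl⟩ := mem_sub.1 (hM' hx)
          exact hHa ⟨p, p1, p2, rfl⟩
      · exact Or.inr ⟨g, g1, g2, Finset.mem_union_left _ g3, g4, hout.trans g5⟩
  · have hun : FreeB (M ∪ M') b ↔ FreeB M b ∧ FreeB M' b := by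
      simp only [FreeB, Finset.mem_union, or_imp, forall_and]
    rw [hun]
    by_cases hHb : H.IB b
    · refine Iff.trans (and_iff_right ?_) (hma'.right b hHb)
      obtain ⟨p, p1, p2, rfl⟩ := hHb
      exact fun x hx => (hM.disjoint h i1 i2 hx p1 (Int.lt_of_le_sub_one p2)).2
    · have hout : mb' (X.ib b) = mb (X.ib b) := hma'.right_out _ fun b' hb' hc => by
        rw [X.ib_inj hc] at hb'; exact hHb hb'
      change _ ↔ mb' (X.ib b) = 0
      rw [hout, and_iff_left]
      · exact hma.right b hb
      · rintro x hx rfl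
        obtain ⟨p, p1, p2, rfl⟩ := mem_sub.1 (hM' hx)
        exact hHb ⟨p, p1, p2, rfl⟩
  · rw [hma'.left_out j fun a ha => hj a (hsubA a ha)]
    exact hma.left_out j hj
  · rw [hma'.right_out j fun b hb => hj b (hsubB b hb)]
    exact hma.right_out j hj

variable (X) in
/-- The edges in the memory are sorted. -/
structure Cells (or pc sp : ℤ → ℤ) (s : State) : Prop where
  ea : ∀ p, 1 ≤ p → p ≤ X.m → s.arr aEA p = X.ia (X.ed (or p)).1
  eb : ∀ p, 1 ≤ p → p ≤ X.m → s.arr aEB p = X.ib (X.ed (or p)).2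
  wt : ∀ p, 1 ≤ p → p ≤ X.m → s.arr aWt p = 1
  or : s.arr aOr = or
  pc : s.arr aPc = pc
  sp : s.arr aSp = sp

theorem Cells.congr {s' : State} (h : X.Cells or pc sp s)
    (ha : ∀ a ∈ [aEA, aEB, aWt, aOr, aPc, aSp], s'.arr a = s.arr a) : X.Cells or pc sp s' :=
  ⟨by rw [ha aEA (by decide)]; exact h.ea, by rw [ha aEB (by decide)]; exact h.eb,
    by rw [ha aWt (by decide)]; exact h.wt, by rw [ha aOr (by decide)]; exact h.or,
    by rw [ha aPc (by decide)]; exact h.pc, by rw [ha aSp (by decide)]; exact h.sp⟩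

end Source

variable {X : Source A B} {k z : ℤ} {or pc sp : ℤ → ℤ}

/-- With unit weights the subgraph has no pieces, so `solve_spec` applies with m = 0, and the weight
of a matching is its cardinality, at most S. This gives O(√S) linear phases per piece, and the
lengths of the intervals add up to z. -/
theorem solvePieces_spec [Fintype B] (hN : 2 * X.m + 10 ≤ N) (hm : 1 ≤ X.m) (hb : Bdd N s)
    (h : X.Order k z or pc sp) (hkm : k ≤ X.m) (hc : X.Cells or pc sp s) (hP : s.var xP = k)
    {oa ob : ℤ → ℤ} (hma : (h.layout oa ob hm).Mates ∅ (s.arr aMA) (s.arr aMB)) {S R : ℕ}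
    (hS : ∀ K L, X.G.IsMatching L → L ⊆ X.G.pieceEdges K → L.card ≤ S) (hR : 2 * S < R * R) :
    wp N solvePieces (fun s' t' => ∃ M, X.Partial or (z + 1) M ∧
      (h.layout oa ob hm).Mates M (s'.arr aMA) (s'.arr aMB) ∧
      (t' : ℤ) ≤ t + 2 + (600 * (2 * R + 2) + 30) * z) s t := by
  have hz := h.z_nonneg
  have hzm := h.z_le
  have hk := h.k_nonneg
  rw [solvePieces, wp_seq, wp_assign]
  simp only [Expr.val, abs_one]
  refine ⟨by omega, ?_⟩
  have hcz : (0 : ℤ) ≤ 600 * (2 * R + 2) + 30 := by positivity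
  refine wp_while (hb.assign (by rw [abs_one]; omega))
    (t + 1 + (600 * (2 * R + 2) + 30) * z).toNat
    (fun s' t' => ∃ i M, s'.var xQ = i ∧ 1 ≤ i ∧ i ≤ k + 1 ∧ X.Partial or (sp i) M ∧
      (h.layout oa ob hm).Mates M (s'.arr aMA) (s'.arr aMB) ∧
      (t' : ℤ) ≤ t + 1 + (600 * (2 * R + 2) + 30) * (sp i - 1))
    ⟨1, ∅, by simp, le_rfl, by omega, ?_, hma, by rw [h.sp_one]; push_cast; omega⟩ ?_
  · rw [h.sp_one]
    exact ⟨⟨by simp, by simp⟩, by simp, fun p p1 p2 => by omega⟩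
  rintro s' t' hb' hf ⟨i, M, hi, i1, i2, hM, hma', ht'⟩
  have hsz := h.sp_le i1 i2
  have hP' : s'.var xP = k := by rw [hf.1 xP (by decide)]; simpa using hP
  refine ⟨?_, fun h0 => ?_, fun h0 => ?_⟩
  · have := mul_le_mul_of_nonneg_left (show sp i - 1 ≤ z by omega) hcz
    omega
  · have hik : i ≤ k := by
      by_contra hc'
      apply h0
      simp only [Expr.val, Op.val, hi, hP']
      rw [if_neg (by omega)]
    have h1 := h.sp_pos i i1 (by omega)
    have h2 := h.sp_lt i i1 hik
    have h3 := h.sp_le (i := i + 1) (by omega) (by omega)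
    have hc' : X.Cells or pc sp s' := hc.congr fun a ha =>
      hf.2 a (by revert a; decide)
    simp only [wp_seq, wp_assign, Expr.val, Op.val, hi, hc'.sp, ne_eq,
      Function.update_of_ne, Nat.reduceEqDiff, not_false_eq_true]
    refine ⟨by rw [abs_le]; omega, by rw [abs_le]; omega, ?_⟩
    set s1 : State := ⟨Function.update (Function.update s'.var xLo (sp i)) xHi (sp (i + 1) - 1),
      s'.arr⟩ with hs1
    have hb1 : Bdd N s1 := (hb'.assign (x := xLo) (v := sp i) (by rw [abs_le]; omega)).assign
      (by rw [abs_le]; omega)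
    set H := h.subLayout (s'.arr aMA) (s'.arr aMB) (sp i) (sp (i + 1) - 1) h1 (by omega)
      (by omega) with hH
    have hHm : H.hi ≤ X.m := by
      change sp (i + 1) - 1 ≤ X.m
      omega
    have hst1 : H.Static s1 := ⟨fun e e1 e2 => hc'.ea e (h1.trans e1) (e2.trans hHm),
      fun e e1 e2 => hc'.eb e (h1.trans e1) (e2.trans hHm),
      fun e e1 e2 => hc'.wt e (h1.trans e1) (e2.trans hHm),
      fun e _ _ => congrFun hc'.pc e, by simp [hs1, hH, Order.subLayout],
      by simp [hs1, hH, Order.subLayout]⟩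
    have hNH : 2 * H.hi + 10 ≤ N := by omega
    refine wp_conseq hb1 (zeroDuals_spec hNH hb1 hst1) ?_
    rintro s2 t2 hb2 hf2 ⟨ht2, hd2⟩
    have hst2 := hst1.of_frame hf2 (by decide) (by decide) (by decide) (by decide) (by decide)
      (by decide)
    have hm2 : H.Mates ∅ (s2.arr aMA) (s2.arr aMB) := by
      rw [hf2.2 aMA (by decide), hf2.2 aMB (by decide)]
      exact hM.mates_sub h i1 hik hm hma'
    have hF : H.G.Feasible ∅ (fun _ => 0) 0 := feasible_zero ⟨by simp, by simp⟩ (by simp)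
    have hcard : ∀ L, H.G.IsMatching L → L.card ≤ S := by
      intro L hL
      have hLp : ∀ x ∈ L, ∃ p, sp i ≤ p ∧ p < sp (i + 1) ∧ X.ed (or p) = x := fun x hx => by
        obtain ⟨p, p1, p2, p3⟩ := mem_sub.1 (hL.1 hx)
        exact ⟨p, p1, by omega, p3⟩
      refine hS (X.comp (or (sp i))) L ⟨fun x hx => ?_, hL.2⟩ fun x hx => ?_
      · obtain ⟨p, p1, p2, rfl⟩ := hLp x hx
        have := h.zero_place (p := p) (by omega) (by omega)
        exact X.ed_mem _ this.1 this.2.1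
      · obtain ⟨p, p1, p2, rfl⟩ := hLp x hx
        exact mem_pieceEdges_iff.2 ⟨or p, h.zero_place (by omega) (by omega), rfl,
          ((h.comp_iff i1 hik le_rfl h2 (by omega) (by omega)).2 ⟨p1, p2⟩).symm⟩
    -- Unit weights turn the weight bound of `solve_spec` into the bound S on cardinalities.
    have hwt : ∀ L, H.G.weight L = L.card := fun L => by
      simp [WGraph.weight, hH, Order.subLayout, Source.sub]
    rw [wp_seq]
    refine wp_conseq hb2 (solve_spec (m := 0) (w := S) (R := R) (k := S) hNH hb2 hst2 hm2 hd2 hF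
      (fun K => ?_) (fun L hL => by rw [hwt]; exact hcard L hL) hR
      fun L hL => by simpa using hcard L hL) ?_
    · rw [Nat.le_zero, Finset.card_eq_zero]
      refine Finset.eq_empty_of_forall_notMem fun x hx => ?_
      unfold pieceEdges at hx
      simp only [Finset.mem_filter] at hx
      exact one_ne_zero hx.2.1
    rintro s3 t3 hb3 hf3 ⟨M', hph, hm3, ht3⟩
    have hmax := hph.isMaximum hF
    have hQ3 : s3.var xQ = i := by
      rw [hf3.1 xQ (by decide), hf2.1 xQ (by decide)]; simpa [hs1] using hi
    simp only [wp_assign, Expr.val, Op.val, hQ3]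
    refine ⟨by rw [abs_le]; omega, i + 1, M ∪ M', by simp, by omega, by omega,
      hM.union h i1 hik hmax, hM.mates_union h i1 hik hm hma' hmax.1.1 hm3, ?_⟩
    have hlen : H.hi + 1 - H.lo = sp (i + 1) - sp i := by
      change sp (i + 1) - 1 + 1 - sp i = _
      ring
    rw [hlen] at ht2 ht3
    obtain ⟨l, hl⟩ := Int.eq_ofNat_of_zero_le (show 0 ≤ sp (i + 1) - sp i by omega)
    rw [hl] at ht2 ht3
    simp only [solveCost, Int.toNat_natCast, zero_mul, mul_zero, add_zero] at ht3
    have e1 : (600 * (2 * R + 2) + 30 : ℤ) * (sp (i + 1) - 1) =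
        (600 * (2 * R + 2) + 30) * (sp i - 1) + (600 * l * (2 * R + 2) + 30 * l) := by
      rw [show sp (i + 1) = sp i + l by omega]; ring
    zify at ht3
    push_cast at ht2 ⊢
    omega
  · have hik : i = k + 1 := by
      by_contra hc'
      simp only [Expr.val, Op.val, hi, hP'] at h0
      rw [if_pos (by omega)] at h0
      exact one_ne_zero h0
    subst hik
    rw [h.sp_last] at hM ht'
    exact ⟨M, hM, hma', by rw [add_sub_cancel_right] at ht'; push_cast; omega⟩

end

end RAM

namespace RAM

set_option linter.unusedSectionVars false

open WGraph Source

/-! ## The program -/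

/-- Sort the edges by pieces. -/
def prepare : Cmd :=
  .assign xLo (.const 1) ;; .assign xHi (.var 2) ;; .assign xJ (.const 1) ;;
  buildAdj ;; listPieces ;;
  .assign xP (.var xL) ;; .assign xR (.var xZ) ;;
  .write aSp (.plus (.var xP) (.const 1)) (.plus (.var xR) (.const 1)) ;; listOnes

/-- Set the weights of the edges in the pieces to `0`. -/
def clearWeights : Cmd := forEdges (.write aWt (.var xE) (.const 0))

/-- Mark the matched edges. -/
def writeOutput : Cmd :=
  forEdges (.ite (.equal (.read aMA (.read aEA (.var xE))) (.var xE))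
    (.write 3 (.minus (.read aOr (.var xE)) (.const 1)) (.const 1)) .skip)

/-- The preprocessing and the phases. -/
def solveAll : Cmd :=
  solvePieces ;; .assign xLo (.const 1) ;; .assign xHi (.var xR) ;; clearWeights ;;
  .assign xHi (.var 2) ;; zeroDuals ;; solve ;; writeOutput

/-- The whole program. -/
def program : Cmd := .ite (.var 2) (prepare ;; solveAll) .skip

section

variable {A B : Type} [DecidableEq A] [DecidableEq B] {X : Source A B} {N : ℤ} {s : State} {t : ℕ}
  {k z : ℤ} {or pc sp : ℤ → ℤ}

theorem Source.Order.le_sp (h : X.Order k z or pc sp) {i : ℤ} (h1 : 1 ≤ i) (h2 : i ≤ k + 1) :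
    i ≤ sp i := by
  obtain ⟨n, hn⟩ := Int.eq_ofNat_of_zero_le (show 0 ≤ i - 1 by omega)
  induction n generalizing i with
  | zero => rw [show i = 1 by omega, h.sp_one]
  | succ n ih =>
    have := h.sp_lt (i - 1) (by omega) (by omega)
    have := ih (i := i - 1) (by omega) (by omega) (by omega)
    rw [sub_add_cancel] at *
    omega

theorem prepare_spec (hN : X.m + 2 ≤ N) (hm : 1 ≤ X.m) (hb : Bdd N s) (hi : X.Input s)
    (hm2 : s.var 2 = X.m) (hv : ∀ x, 3 ≤ x → s.var x = 0) (ha : ∀ a, 3 ≤ a → s.arr a = fun _ => 0) :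
    wp N prepare (fun s' t' => ∃ k z, X.Order k z (s'.arr aOr) (s'.arr aPc) (s'.arr aSp) ∧
      X.Cells (s'.arr aOr) (s'.arr aPc) (s'.arr aSp) s' ∧ s'.var xP = k ∧ s'.var xR = z ∧
      (t' : ℤ) ≤ t + 89 * X.m + 50) s t := by
  simp only [prepare, wp_seq, wp_assign, Expr.val, abs_one, hm2, ne_eq,
    Function.update_of_ne, Nat.reduceEqDiff, not_false_eq_true]
  refine ⟨by omega, by rw [abs_le]; omega, by omega, ?_⟩
  set s1 : State := ⟨Function.update (Function.update (Function.update s.var xLo 1) xHi X.m) xJ 1,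
    s.arr⟩ with hs1
  have hb1 : Bdd N s1 := ((hb.assign (x := xLo) (v := 1) (by rw [abs_one]; omega)).assign
    (x := xHi) (v := X.m) (by rw [abs_le]; omega)).assign (by rw [abs_one]; omega)
  refine wp_conseq hb1 (buildAdj_spec (X := X) hN (by omega) hb1 ⟨hi.a, hi.b, hi.c⟩
    (by simp [hs1]) (by simp [hs1]) (fun j => congrFun (ha aHA (by decide)) j)
    fun j => congrFun (ha aHB (by decide)) j) ?_
  rintro s2 t2 hb2 hf2 ⟨ht2, RA, RB, hA2, hRA, hRB⟩
  have hi2 : X.Input s2 := ⟨by rw [hf2.2 0 (by decide)]; exact hi.a,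
    by rw [hf2.2 1 (by decide)]; exact hi.b, by rw [hf2.2 2 (by decide)]; exact hi.c⟩
  have hlo2 : s2.var xLo = 1 := by rw [hf2.1 xLo (by decide)]; simp [hs1]
  have hhi2 : s2.var xHi = X.m := by rw [hf2.1 xHi (by decide)]; simp [hs1]
  rw [wp_seq]
  refine wp_conseq hb2 (listPieces_spec hN (by omega) hb2 hi2 hlo2 hhi2 hA2 hRA hRB ?_ ?_ ?_ ?_) ?_
  · rw [hf2.1 xZ (by decide)]; simpa [hs1] using hv xZ (by decide)
  · rw [hf2.1 xL (by decide)]; simpa [hs1] using hv xL (by decide)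
  · rw [hf2.1 xJ (by decide)]; simp [hs1]
  · intro e
    rw [hf2.2 aEm (by decide)]; exact congrFun (ha aEm (by decide)) e
  rintro s3 t3 hb3 hf3 ⟨ht3, k, z, hB3, hall⟩
  have hi3 : X.Input s3 := hi2.of_frame hf3 (by decide) (by decide) (by decide)
  have hlo3 : s3.var xLo = 1 := by rw [hf3.1 xLo (by decide), hlo2]
  have hhi3 : s3.var xHi = X.m := by rw [hf3.1 xHi (by decide), hhi2]
  have hz := hB3.listing.z_nonneg
  have hzm := hB3.listing.le (by omega)
  simp only [wp_seq, wp_assign, wp_write, Expr.val, Op.val, hB3.k_eq, hB3.z_eq, ne_eq,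
    Function.update_self, Function.update_of_ne, Nat.reduceEqDiff, not_false_eq_true]
  have hkN : |k| ≤ N := by rw [← hB3.k_eq]; exact hb3.1 _
  refine ⟨hkN, by rw [abs_le]; omega, by rw [abs_le]; omega, ?_⟩
  set s4 : State := ⟨Function.update (Function.update s3.var xP k) xR z,
    Function.update s3.arr aSp (Function.update (s3.arr aSp) (k + 1) (z + 1))⟩ with hs4
  have hb4 : Bdd N s4 := ((hb3.assign (x := xP) (v := k) hkN).assign (x := xR) (v := z)
    (by rw [abs_le]; omega)).write (a := aSp) (by rw [abs_le]; omega)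
  have hst : Starts k z (s3.arr aPc) (Function.update (s3.arr aSp) (k + 1) (z + 1)) := by
    intro i i1 i2
    rw [Function.update_of_ne (by omega)]
    exact hB3.starts i i1 i2
  refine wp_conseq hb4 (listOnes_spec (X := X) (k := k) (z := z) hN (by omega) hb4
    ⟨hi3.a, hi3.b, hi3.c⟩ ⟨by simpa [hs4] using hB3.z_eq, by simpa [hs4] using hB3.k_eq,
      hB3.listing, by simpa [hs4] using hst, hB3.ea, hB3.eb, hB3.wt, hB3.closed⟩ hall
    (by simpa [hs4] using hlo3) (by simpa [hs4] using hhi3)) ?_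
  rintro s5 t5 hb5 hf5 ⟨ht5, hP, hag⟩
  refine ⟨k, z, ?_, ⟨hP.ea, hP.eb, hP.wt, rfl, rfl, rfl⟩, ?_, ?_, by push_cast at ht5 ht3 ht2; omega⟩
  · have hsp : s5.arr aSp = Function.update (s3.arr aSp) (k + 1) (z + 1) := by
      rw [hf5.2 aSp (by decide)]; simp [hs4]
    refine .of_listing hB3.listing (by omega) hall (by rw [hsp]; exact hst)
      (fun p p1 p2 => (hag p p1 p2).1) (fun p p1 p2 => (hag p p1 p2).2) (by rw [hsp]; simp)
      hP.rng hP.inj (fun e e1 e2 => hP.surj e e1 e2 (Or.inr (by omega))) hP.zero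
  · rw [hf5.1 xP (by decide)]; simp [hs4]
  · rw [hf5.1 xR (by decide)]; simp [hs4]

theorem clearWeights_spec (hz : 0 ≤ z) (hN : z + 2 ≤ N) (hb : Bdd N s) (hlo : s.var xLo = 1)
    (hhi : s.var xHi = z) :
    wp N clearWeights (fun s' t' => (t' : ℤ) ≤ t + 3 * z + 2 ∧
      ∀ p, s'.arr aWt p = if 1 ≤ p ∧ p ≤ z then 0 else s.arr aWt p) s t := by
  refine wp_forEdges hb (t + 3 * z + 2).toNat (fun i s' t' => (t' : ℤ) ≤ t + 1 + 3 * (i - 1) ∧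
      ∀ p, s'.arr aWt p = if 1 ≤ p ∧ p < i then 0 else s.arr aWt p)
    hlo hhi (by omega) (by omega) (by omega) (by decide) (by decide) ?_ ?_ ?_ ?_
  · exact ⟨by push_cast; omega, fun p => by rw [if_neg (by omega)]⟩
  · rintro i s' t' hi1 ⟨h, -⟩; omega
  · rintro i s' t' hi1 hi2 hb' hf he ⟨ht, h⟩
    simp only [wp_write, Expr.val, he, abs_zero]
    refine ⟨by omega, by push_cast; omega, fun p => ?_⟩
    rw [Function.update_self]
    by_cases hp : p = i
    · subst hp
      rw [Function.update_self, if_pos (by omega)]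
    · rw [Function.update_of_ne hp, h p]
      exact if_congr (by omega) rfl rfl
  · rintro s' t' hb' hf ⟨ht, h⟩
    refine ⟨by push_cast; omega, fun p => ?_⟩
    rw [h p]
    exact if_congr (by omega) rfl rfl

/-- Places are translated back to input positions, which start at 0, whence the cell `or p - 1`.
Distinct places mark distinct cells, because `or` is injective. -/
theorem writeOutput_spec (hN : 2 * X.m + 10 ≤ N) (hm : 1 ≤ X.m) (hb : Bdd N s)
    (h : X.Order k z or pc sp) {oa ob : ℤ → ℤ} (hs : (h.layout oa ob hm).Static s)
    (hor : s.arr aOr = or) {M : Finset (A × B)} (hM : X.G.IsMatching M)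
    (hma : (h.layout oa ob hm).Mates M (s.arr aMA) (s.arr aMB)) (h3 : s.arr 3 = fun _ => 0) :
    wp N writeOutput (fun s' t' => (t' : ℤ) ≤ t + 4 * X.m + 2 ∧
      ∀ e, 1 ≤ e → e ≤ X.m → (s'.arr 3 (e - 1) = 1 ↔ X.ed e ∈ M)) s t := by
  refine wp_forEdges hb (t + 4 * X.m + 2).toNat (fun i s' t' => (t' : ℤ) ≤ t + 1 + 4 * (i - 1) ∧
      ∀ p, 1 ≤ p → p ≤ X.m → (s'.arr 3 (or p - 1) = 1 ↔ X.ed (or p) ∈ M ∧ p < i))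
    (lo := 1) (hi := X.m) hs.lo hs.hi (by omega) (by omega) (by omega) (by decide) (by decide)
    ?_ ?_ ?_ ?_
  · refine ⟨by push_cast; omega, fun p p1 p2 => ?_⟩
    simp only [h3, zero_ne_one, false_iff]
    omega
  · rintro i s' t' hi1 ⟨h, -⟩; omega
  · rintro i s' t' hi1 hi2 hb' hf he ⟨ht, hI⟩
    have hs' := hs.of_frame hf (by decide) (by decide) (by decide) (by decide)
      (by decide) (by decide)
    have hea := hs'.ea i hi1 hi2
    have hMA : s'.arr aMA = s.arr aMA := hf.2 aMA (by decide)
    have hOr : s'.arr aOr = or := by rw [hf.2 aOr (by decide), hor]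
    have hmem : X.ed (or i) ∈ M ↔ s.arr aMA (X.ia (X.ed (or i)).1) = i :=
      hma.mem_iff hM (e := i) hi1 hi2
    change s'.arr aEA i = X.ia (X.ed (or i)).1 at hea
    simp only [wp_ite, wp_skip, wp_write, Expr.val, Op.val, he, hea, hMA, hOr, abs_one]
    refine ⟨fun hc => ⟨by omega, by push_cast; omega, fun p p1 p2 => ?_⟩,
      fun hc => ⟨by push_cast; omega, fun p p1 p2 => ?_⟩⟩
    · have hi' : X.ed (or i) ∈ M := hmem.2 (by by_contra hne; rw [if_neg hne] at hc; exact hc rfl)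
      rw [Function.update_self]
      by_cases hp : p = i
      · subst hp
        rw [Function.update_self]
        exact iff_of_true rfl ⟨hi', by omega⟩
      · rw [Function.update_of_ne, hI p p1 p2]
        · exact and_congr_right fun _ => by omega
        · intro hh
          exact hp (h.inj p i p1 p2 hi1 hi2 (by omega))
    · have hi' : X.ed (or i) ∉ M := fun hh => by
        rw [if_pos (hmem.1 hh)] at hc; exact one_ne_zero hc
      rw [hI p p1 p2]
      refine and_congr_right fun hpM => ?_
      have : p ≠ i := fun hpi => hi' (hpi ▸ hpM)
      omega
  · rintro s' t' hb' hf ⟨ht, hI⟩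
    refine ⟨by push_cast; omega, fun e e1 e2 => ?_⟩
    obtain ⟨p, p1, p2, rfl⟩ := h.surj e e1 e2
    rw [hI p p1 p2, and_iff_left (by omega)]

/-- The same `solve` is used twice: with unit weights inside the pieces, and, after the weights of
the first z places have been reset to 0, on the whole graph starting from the matching just found.
-/
theorem solveAll_spec [Fintype B] (hN : 2 * X.m + 10 ≤ N) (hm : 1 ≤ X.m) (hb : Bdd N s)
    (h : X.Order k z or pc sp) (hc : X.Cells or pc sp s) (hP : s.var xP = k) (hR : s.var xR = z)
    (hm2 : s.var 2 = X.m) (h3 : s.arr 3 = fun _ => 0) (hMA : s.arr aMA = fun _ => 0)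
    (hMB : s.arr aMB = fun _ => 0) {S R₀ w R l m : ℕ}
    (hS : ∀ K L, X.G.IsMatching L → L ⊆ X.G.pieceEdges K → L.card ≤ S) (hR₀ : 2 * S < R₀ * R₀)
    (hmK : ∀ K, (X.G.pieceEdges K).card ≤ m)
    (hw : ∀ M', X.G.IsMatching M' → X.G.weight M' ≤ w) (hRw : 2 * w < R * R)
    (hl : ∀ M₀, X.G.IsPreprocessed M₀ → ∀ M', X.G.IsMatching M' → M'.card ≤ M₀.card + l) :
    wp N solveAll (fun s' t' => (∃ M, X.G.TwoStageResult M ∧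
        ∀ e, 1 ≤ e → e ≤ X.m → (s'.arr 3 (e - 1) = 1 ↔ X.ed e ∈ M)) ∧
      (t' : ℤ) ≤ t + (600 * (2 * R₀ + 2) + 50) * X.m + 30 + solveCost X.m.toNat R w l m) s t := by
  have hz := h.z_nonneg
  have hzm := h.z_le
  have hk := h.k_nonneg
  have hkm : k ≤ X.m := by
    have h1 := h.le_sp (i := k + 1) (by omega) le_rfl
    rw [h.sp_last] at h1
    omega
  set Y := h.layout (fun _ => 0) (fun _ => 0) hm with hY
  have hma : Y.Mates ∅ (s.arr aMA) (s.arr aMB) := by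
    rw [hMA, hMB]
    exact ⟨fun a _ => Or.inl ⟨fun x hx => absurd hx (Finset.notMem_empty x), rfl⟩,
      fun b _ => iff_of_true (fun x hx => absurd hx (Finset.notMem_empty x)) rfl,
      fun _ _ => rfl, fun _ _ => rfl⟩
  rw [solveAll, wp_seq]
  refine wp_conseq hb (solvePieces_spec hN hm hb h hkm hc hP hma hS hR₀) ?_
  rintro s1 t1 hb1 hf1 ⟨M₀, hM₀, hm1, ht1⟩
  have hc1 : X.Cells or pc sp s1 := hc.congr fun a ha => hf1.2 a (by revert a; decide)
  have hpre := hM₀.isPreprocessed h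
  have hR1 : s1.var xR = z := by rw [hf1.1 xR (by decide), hR]
  have hm21 : s1.var 2 = X.m := by rw [hf1.1 2 (by decide), hm2]
  simp only [wp_seq, wp_assign, Expr.val, abs_one, hR1, ne_eq,
    Function.update_of_ne, Nat.reduceEqDiff, not_false_eq_true]
  refine ⟨by omega, by rw [abs_le]; omega, ?_⟩
  set s2 : State := ⟨Function.update (Function.update s1.var xLo 1) xHi z, s1.arr⟩ with hs2
  have hb2 : Bdd N s2 := (hb1.assign (x := xLo) (v := 1) (by rw [abs_one]; omega)).assign
    (x := xHi) (v := z) (by rw [abs_le]; omega)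
  refine wp_conseq hb2 (clearWeights_spec hz (by omega) hb2 (by simp [hs2]) (by simp [hs2])) ?_
  rintro s3 t3 hb3 hf3 ⟨ht3, hw3⟩
  have hm23 : s3.var 2 = X.m := by rw [hf3.1 2 (by decide)]; simpa [hs2] using hm21
  rw [wp_seq, wp_assign]
  simp only [Expr.val, hm23]
  refine ⟨by rw [abs_le]; omega, ?_⟩
  set s4 : State := ⟨Function.update s3.var xHi X.m, s3.arr⟩ with hs4
  have hb4 : Bdd N s4 := hb3.assign (by rw [abs_le]; omega)
  have hst4 : Y.Static s4 := by
    refine ⟨fun p p1 p2 => ?_, fun p p1 p2 => ?_, fun p p1 p2 => ?_, fun p p1 p2 => ?_, ?_, ?_⟩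
    · change s3.arr aEA p = _
      rw [hf3.2 aEA (by decide)]; exact hc1.ea p p1 p2
    · change s3.arr aEB p = _
      rw [hf3.2 aEB (by decide)]; exact hc1.eb p p1 p2
    · change s3.arr aWt p = if p ≤ z then 0 else 1
      have := hc1.wt p p1 p2
      rw [hw3 p]
      change (if 1 ≤ p ∧ p ≤ z then 0 else s1.arr aWt p) = _
      rw [this]
      exact if_congr (and_iff_right p1) rfl rfl
    · change s3.arr aPc p = _
      rw [hf3.2 aPc (by decide)]; exact congrFun hc1.pc p
    · have : s3.var xLo = 1 := by rw [hf3.1 xLo (by decide)]; simp [hs2]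
      simpa [hs4, hY, Order.layout] using this
    · simp [hs4, hY, Order.layout]
  have hm4 : Y.Mates M₀ (s4.arr aMA) (s4.arr aMB) := by
    change Y.Mates M₀ (s3.arr aMA) (s3.arr aMB)
    rw [hf3.2 aMA (by decide), hf3.2 aMB (by decide)]
    exact hm1
  have hNY : 2 * Y.hi + 10 ≤ N := hN
  rw [wp_seq]
  refine wp_conseq hb4 (zeroDuals_spec hNY hb4 hst4) ?_
  rintro s5 t5 hb5 hf5 ⟨ht5, hd5⟩
  have hst5 := hst4.of_frame hf5 (by decide) (by decide) (by decide) (by decide) (by decide)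
    (by decide)
  have hm5 : Y.Mates M₀ (s5.arr aMA) (s5.arr aMB) := by
    rw [hf5.2 aMA (by decide), hf5.2 aMB (by decide)]; exact hm4
  have hF : Y.G.Feasible M₀ (fun _ => 0) 0 := feasible_zero hpre.1 hpre.2.1
  rw [wp_seq]
  refine wp_conseq hb5 (solve_spec hNY hb5 hst5 hm5 hd5 hF hmK hw hRw (hl M₀ hpre)) ?_
  rintro s6 t6 hb6 hf6 ⟨M, hph, hm6, ht6⟩
  have hst6 := hst5.of_frame hf6 (by decide) (by decide) (by decide) (by decide) (by decide)
    (by decide)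
  have hor6 : s6.arr aOr = or := by
    rw [hf6.2 aOr (by decide), hf5.2 aOr (by decide)]
    change s3.arr aOr = _
    rw [hf3.2 aOr (by decide)]
    exact hc1.or
  have h36 : s6.arr 3 = fun _ => 0 := by
    rw [hf6.2 3 (by decide), hf5.2 3 (by decide)]
    change s3.arr 3 = _
    rw [hf3.2 3 (by decide)]
    change s1.arr 3 = _
    rw [hf1.2 3 (by decide), h3]
  refine wp_conseq hb6 (writeOutput_spec hN hm hb6 h hst6 hor6 (hph.isMaximum hF).1 hm6 h36) ?_
  rintro s7 t7 - - ⟨ht7, hout⟩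
  refine ⟨⟨M, ⟨M₀, hpre, hph⟩, hout⟩, ?_⟩
  have hYl : Y.hi + 1 - Y.lo = X.m := by
    change X.m + 1 - 1 = X.m
    ring
  rw [hYl] at ht5 ht6
  have e1 : (600 * (2 * R₀ + 2) + 30 : ℤ) * z ≤ (600 * (2 * R₀ + 2) + 30) * X.m :=
    mul_le_mul_of_nonneg_left hzm (by positivity)
  have e2 : (600 * (2 * R₀ + 2) + 50 : ℤ) * X.m = (600 * (2 * R₀ + 2) + 30) * X.m + 20 * X.m := by
    ring
  zify at ht6
  push_cast at ht5 ht3 ⊢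
  omega

end

end RAM

namespace RAM

set_option linter.unusedSectionVars false

open WGraph Source

/-! ## The bound for the running time -/

section

variable {A B : Type} [DecidableEq A] [DecidableEq B] (G : WGraph A B)

/-- Piece by piece the weight-0 edges of M are at most as many as the edges of M₀; every other edge
of M adds 1 to its weight. -/
theorem _root_.WGraph.IsPreprocessed.card_le {G : WGraph A B} {M₀ M : Finset (A × B)}
    (h : G.IsPreprocessed M₀) (hM : G.IsMatching M) : M.card ≤ M₀.card + G.weight M := by
  classical
  set f : A × B → G.zeroGraph.ConnectedComponent := fun e =>
    G.zeroGraph.connectedComponentMk (Sum.inl e.1) with hf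
  set Z := M.filter fun e => G.c e = 0 with hZ
  have h1 : M.card = Z.card + (M.filter fun e => G.c e ≠ 0).card :=
    (Finset.card_filter_add_card_filter_not _).symm
  have h2 : (M.filter fun e => G.c e ≠ 0).card ≤ G.weight M := by
    rw [Finset.card_eq_sum_ones, WGraph.weight]
    refine (Finset.sum_le_sum fun e he => ?_).trans
      (Finset.sum_le_sum_of_subset (Finset.filter_subset _ _))
    exact Nat.one_le_iff_ne_zero.2 (Finset.mem_filter.1 he).2
  have h3 : Z.card ≤ M₀.card := by
    rw [Finset.card_eq_sum_card_fiberwise (f := f) (t := G.E.image f) (s := Z)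
        (fun e he => Finset.mem_coe.2 (Finset.mem_image_of_mem f
          (hM.1 (Finset.mem_filter.1 (Finset.mem_coe.1 he)).1))),
      Finset.card_eq_sum_card_fiberwise (f := f) (t := G.E.image f) (s := M₀)
        (fun e he => Finset.mem_coe.2 (Finset.mem_image_of_mem f (h.1.1 (Finset.mem_coe.1 he))))]
    refine Finset.sum_le_sum fun K _ => ?_
    have hsub : (Z.filter fun e => f e = K) ⊆ M :=
      (Finset.filter_subset _ _).trans (Finset.filter_subset _ _)
    refine (h.2.2 K _ ⟨hsub.trans hM.1, fun e he g hg => hM.2 e (hsub he) g (hsub hg)⟩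
      fun e he => ?_).trans (Finset.card_le_card fun e he => ?_)
    · simp only [hZ, Finset.mem_filter] at he
      simp only [pieceEdges, Finset.mem_filter]
      exact ⟨hM.1 he.1.1, he.1.2, he.2⟩
    · simp only [pieceEdges, Finset.mem_inter, Finset.mem_filter] at he ⊢
      exact ⟨he.1, he.2.2.2⟩
  omega

/-- The edges have distinct ends in A, and all these ends lie in the component. -/
theorem _root_.WGraph.card_le_ncard_supp [Finite A] [Finite B] {G : WGraph A B}
    {K : G.zeroGraph.ConnectedComponent} {M : Finset (A × B)} (hM : G.IsMatching M)
    (hK : M ⊆ G.pieceEdges K) : M.card ≤ K.supp.ncard := by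
  have hinj : Set.InjOn (fun e : A × B => (Sum.inl e.1 : A ⊕ B)) M := fun e he f hf hef =>
    hM.2 e he f hf (Or.inl (Sum.inl.inj hef))
  rw [← Finset.card_image_of_injOn hinj, ← Set.ncard_coe_finset]
  refine Set.ncard_le_ncard (fun v hv => ?_) (Set.toFinite _)
  obtain ⟨e, he, rfl⟩ := Finset.mem_image.1 (Finset.mem_coe.1 hv)
  have := hK he
  simp only [pieceEdges, Finset.mem_filter] at this
  exact this.2.2

/-- The maximum is attained by a piece, unless it is the default value 0, so any bound valid for all
pieces passes to S. -/
theorem _root_.WGraph.exists_max_piece [Finite A] [Finite B] {G : WGraph A B} (v : A ⊕ B)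
    (g : G.zeroGraph.ConnectedComponent → ℕ) : ∃ S, (∀ K, (G.pieceEdges K).Nonempty → g K ≤ S) ∧
      (S = 0 ∨ ∃ K, (G.pieceEdges K).Nonempty ∧ g K = S) := by
  classical
  have : Nonempty G.zeroGraph.ConnectedComponent := ⟨G.zeroGraph.connectedComponentMk v⟩
  obtain ⟨K, hK⟩ := Finite.exists_max fun K => if (G.pieceEdges K).Nonempty then g K else 0
  refine ⟨if (G.pieceEdges K).Nonempty then g K else 0, fun K' hK' => ?_, ?_⟩
  · have := hK K'
    rwa [if_pos hK'] at this
  · by_cases h : (G.pieceEdges K).Nonempty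
    · exact Or.inr ⟨K, h, by rw [if_pos h]⟩
    · exact Or.inl (by rw [if_neg h])

theorem _root_.WGraph.exists_max_weight (G : WGraph A B) :
    ∃ M, G.IsMatching M ∧ ∀ M', G.IsMatching M' → G.weight M' ≤ G.weight M := by
  obtain ⟨M, h1, h2⟩ := Finset.exists_max_image
    (G.E.powerset.filter fun M' => ∀ e ∈ M', ∀ f ∈ M', (e.1 = f.1 ∨ e.2 = f.2) → e = f)
    G.weight ⟨∅, by simp⟩
  rw [Finset.mem_filter, Finset.mem_powerset] at h1
  refine ⟨M, h1, fun M' hM' => h2 M' ?_⟩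
  rw [Finset.mem_filter, Finset.mem_powerset]; exact hM'

/-- The sum is at most w + 2wH(w) ≤ 3w + 2w log w. Since log n ≥ log 2 > 0.69, the term 3w is at
most 5w log n. -/
theorem revisitPotential_le_log {w n : ℕ} (hw : w ≤ n) (hn : 2 ≤ n) :
    (revisitPotential w w : ℝ) ≤ 7 * w * Real.log n := by
  have hlog : (0.69 : ℝ) ≤ Real.log n := by
    have h1 := Real.log_two_gt_d9
    have h2 := Real.log_le_log two_pos (show (2 : ℝ) ≤ n by exact_mod_cast hn)
    linarith
  rcases Nat.eq_zero_or_pos w with rfl | hw0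
  · simp [revisitPotential]
  have h1 : (revisitPotential w w : ℝ) ≤ w + 2 * w * (1 + Real.log w) := by
    have h2 := harmonic_le_one_add_log w
    have h3 : (revisitPotential w w : ℝ) ≤ ∑ j ∈ Finset.Icc 1 w, (1 + 2 * w * (j : ℝ)⁻¹) := by
      unfold revisitPotential
      push_cast
      refine Finset.sum_le_sum fun j _ => add_le_add le_rfl ?_
      refine (Nat.cast_div_le (α := ℝ)).trans ?_
      push_cast
      rw [div_eq_mul_inv]
    refine h3.trans ?_
    rw [Finset.sum_add_distrib, ← Finset.mul_sum]
    have h4 : ∑ j ∈ Finset.Icc 1 w, (j : ℝ)⁻¹ = (harmonic w : ℝ) := by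
      rw [harmonic_eq_sum_Icc]; push_cast; rfl
    rw [h4]
    simp only [Finset.sum_const, Nat.card_Icc, add_tsub_cancel_right, nsmul_eq_mul, mul_one]
    have : (0 : ℝ) ≤ 2 * w := by positivity
    nlinarith
  have h2 : Real.log w ≤ Real.log n :=
    Real.log_le_log (by exact_mod_cast hw0) (by exact_mod_cast hw)
  have h3 : (0 : ℝ) < w := by exact_mod_cast hw0
  refine h1.trans ?_
  nlinarith

/-- N is polynomial in n, so its length is O(log n). The number 20 bounds the sizes and constants of
all expressions in the program. -/
theorem stepCost_le_log {n N : ℕ} (hn : 2 ≤ n) (hN : N ≤ 8 * n ^ 2) (hN0 : N ≠ 0) :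
    (stepCost 20 N : ℝ) ≤ 2000 * Real.log n := by
  have hlog : (0.69 : ℝ) ≤ Real.log n := by
    have h1 := Real.log_two_gt_d9
    have h2 := Real.log_le_log two_pos (show (2 : ℝ) ≤ n by exact_mod_cast hn)
    linarith
  have hs : 2 ^ (N.size - 1) ≤ N := by
    rw [← Nat.lt_size]
    have : 0 < N.size := Nat.size_pos.2 (Nat.pos_of_ne_zero hN0)
    omega
  have hs2 : ((2 : ℝ) ^ (N.size - 1)) ≤ 8 * (n : ℝ) ^ 2 := by exact_mod_cast hs.trans hN
  have hs3 := Real.log_le_log (by positivity) hs2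
  have hn0 : (n : ℝ) ≠ 0 := by positivity
  rw [Real.log_pow, Real.log_mul (by norm_num) (by positivity), Real.log_pow,
    show (8 : ℝ) = 2 ^ 3 by norm_num, Real.log_pow] at hs3
  push_cast at hs3
  have h2 := Real.log_two_gt_d9
  have h2' := Real.log_two_lt_d9
  have h4 : (N.size : ℝ) ≤ (N.size - 1 : ℕ) + 1 := by exact_mod_cast (by omega)
  have h5 : ((N.size - 1 : ℕ) : ℝ) ≤ 3 + 3 * Real.log n := by
    by_contra hc
    push Not at hc
    have := mul_lt_mul_of_pos_right hc (show 0 < Real.log 2 by linarith)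
    nlinarith
  unfold stepCost
  push_cast
  nlinarith

theorem sqrt_two_mul_le {S : ℕ} {x : ℝ} (h : (S : ℝ) ≤ x) :
    ((Nat.sqrt (2 * S) + 1 : ℕ) : ℝ) ≤ 2 * √x + 1 := by
  have h1 : (Nat.sqrt (2 * S) : ℝ) ≤ √(4 * x) := by
    refine Real.le_sqrt_of_sq_le ?_
    have : Nat.sqrt (2 * S) ^ 2 ≤ 2 * S := Nat.sqrt_le' _
    have : ((Nat.sqrt (2 * S) : ℝ)) ^ 2 ≤ 2 * S := by exact_mod_cast this
    have : (0 : ℝ) ≤ S := by positivity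
    linarith
  rw [Real.sqrt_mul (by norm_num), show (4 : ℝ) = 2 ^ 2 by norm_num,
    Real.sqrt_sq (by norm_num)] at h1
  push_cast
  linarith

/-- The number of steps of the program. -/
def stepBound (m S e w : ℕ) : ℕ :=
  2 + (89 * m + 50) + ((600 * (2 * (Nat.sqrt (2 * S) + 1) + 2) + 50) * m + 30) +
    solveCost m (Nat.sqrt (2 * w) + 1) w w e

/-- Contributions proportional to m alone have to be absorbed by the main term. This is possible
because w₀ or S is at least 1, which makes √w + √(cr) at least 1. -/
theorem stepBound_le {m S e w₀ n : ℕ} {w r c : ℝ} (hc : 1 ≤ c) (hm : 1 ≤ m) (hn : 2 ≤ n)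
    (hw : (w₀ : ℝ) ≤ w) (hwn : w₀ ≤ n) (hr : 0 ≤ r) (hS : (S : ℝ) ≤ c * r)
    (he : (e : ℝ) ≤ c * (m * r / n)) (h1 : 1 ≤ w₀ ∨ 1 ≤ S) :
    (stepBound m S e w₀ : ℝ) ≤ 40000 * c * (m * (√w + √r + w * r / n)) * Real.log n := by
  have hlog : (0.69 : ℝ) ≤ Real.log n := by
    have h1 := Real.log_two_gt_d9
    have h2 := Real.log_le_log two_pos (show (2 : ℝ) ≤ n by exact_mod_cast hn)
    linarith
  have hm' : (1 : ℝ) ≤ m := by exact_mod_cast hm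
  have hw0 : (0 : ℝ) ≤ w := le_trans (by positivity) hw
  have e1 := sqrt_two_mul_le hS
  have e2 := sqrt_two_mul_le hw
  have e3 : √(c * r) ≤ c * √r := by
    rw [Real.sqrt_mul (by linarith)]
    refine mul_le_mul_of_nonneg_right ?_ (Real.sqrt_nonneg r)
    exact Real.sqrt_le_iff.2 ⟨by linarith, by nlinarith⟩
  have e4 : 1 ≤ √w + √(c * r) := by
    rcases h1 with h1 | h1
    · have : 1 ≤ √w := Real.one_le_sqrt.2 (le_trans (by exact_mod_cast h1) hw)
      linarith [Real.sqrt_nonneg (c * r)]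
    · have : 1 ≤ √(c * r) := Real.one_le_sqrt.2 (le_trans (by exact_mod_cast h1) hS)
      linarith [Real.sqrt_nonneg w]
  have e5 : √w ≤ c * √w := le_mul_of_one_le_left (Real.sqrt_nonneg w) hc
  have e6 := revisitPotential_le_log hwn hn
  set Q := c * (√w + √r) with hQ
  have hQ1 : 1 ≤ Q := by rw [hQ, mul_add]; linarith
  have e7 : (e : ℝ) * revisitPotential w₀ w₀ ≤ 7 * c * (m * (w * r / n)) * Real.log n := by
    have k1 : (e : ℝ) * revisitPotential w₀ w₀ ≤ c * (m * r / n) * (7 * w * Real.log n) := by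
      refine mul_le_mul he (e6.trans ?_) (by positivity) (by positivity)
      refine mul_le_mul_of_nonneg_right ?_ (by linarith)
      linarith
    refine k1.trans (le_of_eq ?_)
    ring
  have e8 : (stepBound m S e w₀ : ℝ) ≤ 10000 * (m * Q) + 100 * (e * revisitPotential w₀ w₀) := by
    unfold stepBound solveCost
    push_cast at e1 e2 ⊢
    have k1 : (Nat.sqrt (2 * S) : ℝ) + Nat.sqrt (2 * w₀) ≤ 2 * Q := by
      rw [hQ, mul_add]; linarith
    have k2 := mul_le_mul_of_nonneg_left k1 (show (0 : ℝ) ≤ 1200 * m by positivity)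
    have k3 := mul_le_mul_of_nonneg_left hQ1 (show (0 : ℝ) ≤ 7000 * m by positivity)
    nlinarith
  have hP : 0 ≤ c * (m * (w * r / n)) := by positivity
  have hmQ : 0 ≤ m * Q := by positivity
  have e9 : 40000 * c * (m * (√w + √r + w * r / n)) * Real.log n =
      40000 * (m * Q) * Real.log n + 40000 * (c * (m * (w * r / n))) * Real.log n := by
    rw [hQ]; ring
  rw [e9]
  have k1 : m * Q * 0.69 ≤ m * Q * Real.log n := mul_le_mul_of_nonneg_left hlog hmQ
  have k2 : 0 ≤ c * (m * (w * r / n)) * Real.log n := mul_nonneg hP (by linarith)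
  nlinarith

end

end RAM

/-! ### Input, output and the run of the whole program -/

namespace RAM

set_option linter.unusedSectionVars false

open WGraph Source

section

variable {p q : ℕ} {G : WGraph (Fin p) (Fin q)} {L : List (Fin p × Fin q)}

/-- The graph given by the input. -/
def source (hnd : L.Nodup) (hL : L.toFinset = G.E) (x₀ : Fin p × Fin q) :
    Source (Fin p) (Fin q) where
  G := G
  ia a := ((a : ℕ) : ℤ)
  ib b := ((b : ℕ) : ℤ)
  ed e := L.getD (e - 1).toNat x₀
  m := L.length
  ia_inj a b h := Fin.ext (Int.ofNat_inj.1 h)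
  ib_inj a b h := Fin.ext (Int.ofNat_inj.1 h)
  ed_inj e f e1 e2 f1 f2 h := by
    rw [List.getD_eq_getElem _ _ (by omega), List.getD_eq_getElem _ _ (by omega)] at h
    have := (hnd.getElem_inj_iff).1 h
    omega
  ed_mem e e1 e2 := by
    rw [List.getD_eq_getElem _ _ (by omega), ← hL, List.mem_toFinset]
    exact List.getElem_mem _
  ed_surj x hx := by
    rw [← hL, List.mem_toFinset] at hx
    obtain ⟨i, hi, rfl⟩ := List.getElem_of_mem hx
    refine ⟨i + 1, by omega, by omega, ?_⟩
    rw [List.getD_eq_getElem _ _ (by omega)]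
    simp

theorem source_input (hnd : L.Nodup) (hL : L.toFinset = G.E) (x₀ : Fin p × Fin q) :
    (source hnd hL x₀).Input (inputState G L) := by
  have key : ∀ e : ℤ, 1 ≤ e → e ≤ L.length →
      L[(e - 1).toNat]? = some ((source hnd hL x₀).ed e) := fun e e1 e2 => by
    change _ = some (L.getD (e - 1).toNat x₀)
    rw [List.getD_eq_getElem _ _ (by omega), List.getElem?_eq_getElem (by omega)]
  refine ⟨fun e e1 e2 => ?_, fun e e1 e2 => ?_, fun e e1 e2 => ?_⟩ <;>
    simp only [inputState, if_pos (show 0 ≤ e - 1 by omega), key e e1 e2] <;> rfl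

theorem bdd_inputState (hL : L.toFinset = G.E) {N : ℤ} (hN : p + q + L.length + 1 ≤ N) :
    Bdd N (inputState G L) := by
  refine ⟨fun x => ?_, fun a i => ?_⟩
  · simp only [inputState]
    split_ifs <;> rw [abs_le] <;> omega
  · by_cases h : 0 ≤ i
    · cases he : L[i.toNat]? with
      | none =>
        simp only [inputState, if_pos h, he, abs_zero]; omega
      | some e =>
        have hc := G.c_zero_or_one e (by rw [← hL, List.mem_toFinset]; exact List.mem_of_getElem? he)
        have := e.1.2
        have := e.2.2
        simp only [inputState, if_pos h, he]
        split_ifs <;> rw [abs_le] <;> omega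
    · simp only [inputState, if_neg h, abs_zero]; omega

theorem outputEdges_eq (hnd : L.Nodup) (hL : L.toFinset = G.E) {x₀ : Fin p × Fin q} {s : State}
    {M : Finset (Fin p × Fin q)} (hM : M ⊆ G.E)
    (h : ∀ e, 1 ≤ e → e ≤ (source hnd hL x₀).m →
      (s.arr 3 (e - 1) = 1 ↔ (source hnd hL x₀).ed e ∈ M)) : outputEdges L s = M := by
  have key : ∀ i : Fin L.length, s.arr 3 ((i : ℕ) : ℤ) = 1 ↔ L[i] ∈ M := fun i => by
    have h1 := h ((i : ℕ) + 1) (by omega) (by change _ ≤ ((L.length : ℕ) : ℤ); omega)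
    rw [add_sub_cancel_right] at h1
    rw [h1]
    change L.getD (((i : ℕ) : ℤ) + 1 - 1).toNat x₀ ∈ M ↔ _
    rw [List.getD_eq_getElem _ _ (by omega)]
    simp
  ext x
  simp only [outputEdges, Finset.mem_image, Finset.mem_filter, Finset.mem_univ, true_and, key]
  constructor
  · rintro ⟨i, h1, rfl⟩; exact h1
  · intro hx
    have hxL : x ∈ L := by rw [← List.mem_toFinset, hL]; exact hM hx
    obtain ⟨i, hi, rfl⟩ := List.getElem_of_mem hxL
    exact ⟨⟨i, hi⟩, hx, rfl⟩

theorem _root_.WGraph.TwoStageResult.of_edgeless (h : G.E = ∅) : G.TwoStageResult ∅ := by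
  refine ⟨∅, ⟨⟨by simp, by simp⟩, by simp, fun K M hM _ => ?_⟩, .halt _ _ ?_⟩
  · have := hM.1
    rw [h, Finset.subset_empty] at this
    simp [this]
  · simp only [minDist, WGraph.dist, iInf_eq_top]
    intro a _ d hd
    cases hd with
    | step u _ e d k _ harc _ =>
      cases harc with
      | unmatched a b h1 h2 => rw [h] at h1; exact absurd h1 (Finset.notMem_empty _)

/-- The bound n on stored numbers covers vertex numbers and twice the number of edges, which
dominates buckets and dual weights. The quantities S, e and w occur only in the analysis, not in the
program. -/
theorem program_exec (hnd : L.Nodup) (hL : L.toFinset = G.E) (hne : L ≠ []) {S e w : ℕ}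
    (hS : ∀ K, (G.pieceEdges K).Nonempty → K.supp.ncard ≤ S)
    (he : ∀ K, (G.pieceEdges K).card ≤ e) (hw : ∀ M, G.IsMatching M → G.weight M ≤ w) :
    ∃ t s, Exec program (inputState G L) t s ∧ G.TwoStageResult (outputEdges L s) ∧
      t ≤ stepBound L.length S e w * stepCost 20 (p + q + 2 * L.length + 20) := by
  obtain ⟨x₀, hx₀⟩ := List.exists_mem_of_ne_nil L hne
  have hlen : 1 ≤ L.length := List.length_pos_of_mem hx₀
  set X := source hnd hL x₀ with hX
  set n : ℕ := p + q + 2 * L.length + 20 with hn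
  have hXm : X.m = L.length := rfl
  have hb : Bdd (n : ℤ) (inputState G L) := bdd_inputState hL (by rw [hn]; push_cast; omega)
  have hv2 : (inputState G L).var 2 = X.m := by simp [inputState, hXm]
  have ha3 : ∀ a, 3 ≤ a → (inputState G L).arr a = fun _ => 0 := by
    intro a ha
    funext i
    by_cases h : 0 ≤ i
    · cases hi : L[i.toNat]? with
      | none => simp only [inputState, if_pos h, hi]
      | some e =>
        simp only [inputState, if_pos h, hi]
        rw [if_neg (by omega), if_neg (by omega), if_neg (by omega)]
    · simp only [inputState, if_neg h]
  have hrun : wp (n : ℤ) program (fun s' t' => (∃ M, G.TwoStageResult M ∧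
      ∀ e, 1 ≤ e → e ≤ X.m → (s'.arr 3 (e - 1) = 1 ↔ X.ed e ∈ M)) ∧
      t' ≤ stepBound L.length S e w) (inputState G L) 0 := by
    rw [program, wp_ite]
    simp only [Expr.val, hv2]
    refine ⟨fun _ => ?_, fun h0 => by omega⟩
    rw [wp_seq]
    refine wp_conseq hb (prepare_spec (X := X) (by omega) (by omega) hb (source_input hnd hL x₀)
      hv2 (fun x hx => ?_) ha3) ?_
    · simp only [inputState]
      rw [if_neg (by omega), if_neg (by omega), if_neg (by omega)]
    rintro s1 t1 hb1 hf1 ⟨k, z, hO, hC, hP, hR, ht1⟩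
    -- `Nat.sqrt (2 * S) + 1` is the least number whose square exceeds 2S, likewise for w. The
    -- number l of augmentations after the preprocessing is at most w by `IsPreprocessed.card_le`.
    refine wp_conseq hb1 (solveAll_spec (S := S) (R₀ := Nat.sqrt (2 * S) + 1) (w := w)
      (R := Nat.sqrt (2 * w) + 1) (l := w) (m := e) (by omega) (by omega) hb1 hO hC hP hR
      (by rw [hf1.1 2 (by decide), hv2]) (by rw [hf1.2 3 (by decide)]; exact ha3 3 le_rfl)
      (by rw [hf1.2 aMA (by decide)]; exact ha3 aMA (by decide))
      (by rw [hf1.2 aMB (by decide)]; exact ha3 aMB (by decide))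
      (fun K M hM hK => ?_) (Nat.lt_succ_sqrt _) he hw (Nat.lt_succ_sqrt _)
      fun M₀ hM₀ M hM => (hM₀.card_le hM).trans (Nat.add_le_add_left (hw M hM) _)) ?_
    · rcases M.eq_empty_or_nonempty with rfl | ⟨x, hx⟩
      · simp
      · exact (card_le_ncard_supp hM hK).trans (hS K ⟨x, hK hx⟩)
    rintro s2 t2 - - ⟨hres, ht2⟩
    refine ⟨hres, ?_⟩
    rw [hXm] at ht1 ht2
    rw [Int.toNat_natCast] at ht2
    unfold stepBound
    zify
    push_cast at ht1 ht2 ⊢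
    linarith
  obtain ⟨k, s, hr, ⟨M, hM, hout⟩, hk⟩ := hrun
  obtain ⟨t, ht, htk⟩ := hr.exec (K := 20) (by omega) (by omega) (by decide) hb
  rw [zero_add] at hk
  refine ⟨t, s, ht, ?_, htk.trans (Nat.mul_le_mul_right _ hk)⟩
  rw [outputEdges_eq hnd hL hM.isMaximum.1.1 hout]
  exact hM

theorem program_exec_nil : ∃ t s, Exec program (inputState G []) t s ∧
    outputEdges ([] : List (Fin p × Fin q)) s = ∅ := by
  refine ⟨_, _, .iteFalse _ _ _ _ _ _ ?_ (.skip _), ?_⟩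
  · simp [Expr.val, inputState]
  · simp [outputEdges]

end

end RAM

/-! ### The main theorem -/

theorem mainTheorem1 :
    (∀ (p q : ℕ) (G : WGraph (Fin p) (Fin q)) (M : Finset (Fin p × Fin q)),
        G.TwoStageResult M → G.IsMaximumMatching M) ∧
    ∃ (prog : RAM.Cmd) (k : ℕ), ∀ c : ℝ, ∃ C : ℝ,
      ∀ (p q : ℕ) (G : WGraph (Fin p) (Fin q)) (L : List (Fin p × Fin q)),
        L.Nodup → L.toFinset = G.E →
        ∃ (t : ℕ) (s : RAM.State),
          RAM.Exec prog (RAM.inputState G L) t s ∧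
          G.TwoStageResult (RAM.outputEdges L s) ∧
          G.IsMaximumMatching (RAM.outputEdges L s) ∧
          ∀ (n m : ℕ) (w r : ℝ), n = p + q → m = G.E.card → 0 < m → 0 ≤ r →
            (∀ M, G.IsMatching M → (G.weight M : ℝ) ≤ w) →
            (∀ K : G.zeroGraph.ConnectedComponent, (G.pieceEdges K).Nonempty →
              (K.supp.ncard : ℝ) ≤ c * r ∧ ((G.pieceEdges K).card : ℝ) ≤ c * (m * r / n)) →
            (t : ℝ) ≤ C * (m * (√w + √r + w * r / n)) * (Real.log n) ^ k := by
  -- One logarithm comes from the harmonic sum and one from the bit lengths; the constant is the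
  -- product 40000 · 2000. Replacing c by |c| + 1 allows values of c below 1.
  refine ⟨fun p q G M h => h.isMaximum, RAM.program, 2, fun c => ⟨80000000 * (|c| + 1),
    fun p q G L hnd hL => ?_⟩⟩
  rcases eq_or_ne L [] with rfl | hne
  · have hE : G.E = ∅ := hL.symm
    obtain ⟨t, s, h1, h2⟩ := RAM.program_exec_nil (G := G)
    have h3 := WGraph.TwoStageResult.of_edgeless hE
    refine ⟨t, s, h1, by rwa [h2], by rw [h2]; exact h3.isMaximum, ?_⟩
    rintro n m w r - rfl hm
    simp [hE] at hm
  obtain ⟨x, hx⟩ := List.exists_mem_of_ne_nil L hne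
  have hxE : x ∈ G.E := by rw [← hL, List.mem_toFinset]; exact hx
  -- The run is analysed with the exact maxima over pieces and matchings, which depend only on the
  -- graph; the given bounds w and r enter only when these are compared with them.
  obtain ⟨S, hS, hS'⟩ := WGraph.exists_max_piece (G := G) (Sum.inl x.1) fun K => K.supp.ncard
  obtain ⟨e, he, he'⟩ := WGraph.exists_max_piece (G := G) (Sum.inl x.1)
    fun K => (G.pieceEdges K).card
  obtain ⟨M₀, hM₀, hw⟩ := G.exists_max_weight
  obtain ⟨t, s, h1, h2, h3⟩ := RAM.program_exec hnd hL hne hS (fun K => by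
    rcases (G.pieceEdges K).eq_empty_or_nonempty with h | h
    · simp [h]
    · exact he K h) hw
  refine ⟨t, s, h1, h2, h2.isMaximum, ?_⟩
  intro n m w r hn hm hm0 hr hwr hK
  have hlen : L.length = m := by rw [hm, ← hL, List.toFinset_card_of_nodup hnd]
  have hp := x.1.2
  have hq := x.2.2
  have hn2 : 2 ≤ n := by omega
  have hmn : m ≤ n ^ 2 := by
    have h4 : m ≤ p * q := by
      rw [hm]
      refine (Finset.card_le_univ G.E).trans ?_
      simp
    rw [hn]
    nlinarith
  have hcr : c * r ≤ (|c| + 1) * r := mul_le_mul_of_nonneg_right (by linarith [le_abs_self c]) hr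
  have hSr : (S : ℝ) ≤ (|c| + 1) * r := by
    rcases hS' with rfl | ⟨K, hK1, rfl⟩
    · rw [Nat.cast_zero]; positivity
    · exact ((hK K hK1).1).trans hcr
  have her : (e : ℝ) ≤ (|c| + 1) * (m * r / n) := by
    rcases he' with rfl | ⟨K, hK1, rfl⟩
    · rw [Nat.cast_zero]; positivity
    · refine ((hK K hK1).2).trans ?_
      exact mul_le_mul_of_nonneg_right (by linarith [le_abs_self c]) (by positivity)
  -- The given w may be arbitrarily large; the harmonic sum over the true maximum weight is what
  -- yields log n.
  have hwn : G.weight M₀ ≤ n := by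
    have h4 : G.weight M₀ ≤ M₀.card := by
      rw [Finset.card_eq_sum_ones]
      refine Finset.sum_le_sum fun f hf => ?_
      rcases G.c_zero_or_one f (hM₀.1 hf) with h | h <;> omega
    have h5 : M₀.card ≤ p := by
      rw [← Finset.card_image_of_injOn (f := Prod.fst) fun f hf g hg hfg =>
        hM₀.2 f hf g hg (Or.inl hfg)]
      simpa using Finset.card_le_univ (M₀.image Prod.fst)
    omega
  -- Any single edge has weight 1, or has weight 0 and lies in a piece.
  have h1' : 1 ≤ G.weight M₀ ∨ 1 ≤ S := by
    have hxm : G.IsMatching {x} := ⟨by simpa using hxE, by simp⟩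
    rcases G.c_zero_or_one x hxE with h | h
    · right
      have hxK : {x} ⊆ G.pieceEdges (G.zeroGraph.connectedComponentMk (Sum.inl x.1)) := by
        simp [WGraph.pieceEdges, hxE, h]
      have h6 := WGraph.card_le_ncard_supp hxm hxK
      rw [Finset.card_singleton] at h6
      exact h6.trans (hS _ ⟨x, by simpa using hxK⟩)
    · left
      have := hw {x} hxm
      simpa [WGraph.weight, h] using this
  have hc1 : 1 ≤ |c| + 1 := by linarith [abs_nonneg c]
  rw [hlen] at h3
  have b1 := RAM.stepBound_le hc1 hm0 hn2 (hwr M₀ hM₀) hwn hr hSr her h1'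
  -- The memory bound p + q + 2m + 20 is at most 8n² because m ≤ n² and n ≥ 2.
  have b2 := RAM.stepCost_le_log (N := p + q + 2 * m + 20) hn2 (by nlinarith) (by omega)
  have hlog : 0 ≤ Real.log n := Real.log_natCast_nonneg n
  have hw0 : 0 ≤ w := le_trans (by positivity) (hwr M₀ hM₀)
  calc (t : ℝ) ≤ RAM.stepBound m S e (G.weight M₀) * RAM.stepCost 20 (p + q + 2 * m + 20) := by
        exact_mod_cast h3
    _ ≤ (40000 * (|c| + 1) * (m * (√w + √r + w * r / n)) * Real.log n) * (2000 * Real.log n) :=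
        mul_le_mul b1 b2 (by positivity) (by positivity)
    _ = _ := by ring
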